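/- Let $k$ be a field. All dg-categories are over $k$ and cohomologically graded; a small dg-category $\mathbf Q$ has its dg-category $\mathrm C_{dg}(\mathbf Q)$ of right dg-modules, its homotopy category $H^0(\mathbf Q)$ and its derived category $D(\mathbf Q)$. **Conventions.** A small dg-category $\mathbf A$ is *pretriangulated* if it is non-empty and the Yoneda embedding of $\mathbf A$ into $\mathrm{pretr}(\mathbf A)$, the closure of the representable dg-modules under shifts and cones of closed degree $0$ morphisms, is a quasi-equivalence; then $H^0(\mathbf A)$ is triangulated. A t-structure on $\mathbf A$ is a t-structure $(H^0(\mathbf A)_{\le n},H^0(\mathbf A)_{\ge n})_n$ on $H^0(\mathbf A)$, with heart $H^0(\mathbf A)^\heartsuit$ and cohomology functor $H^0_t$. It is *non-degenerate* if $\bigcap_n H^0(\mathbf A)_{\le n}=0=\bigcap_n H^0(\mathbf A)_{\ge n}$. Let $\mathbf A^-\subseteq\mathbf A$ be the full dg-subcategory of the objects lying in some $H^0(\mathbf A)_{\le n}$; the t-structure is *right bounded* if $H^0(\mathbf A^-)\to H^0(\mathbf A)$ is an equivalence. $\mathbf A$ is *closed under countable coproducts* if every countable family in $H^0(\mathbf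 A)_{\le 0}$ has a coproduct in $H^0(\mathbf A)$, lying in $H^0(\mathbf A)_{\le 0}$. An object $S$ is the *derived projective* of a projective object $P$ of the heart if $H^0(\mathbf A)(S,-)\cong H^0(\mathbf A)^\heartsuit(P,H^0_t(-))$; $\mathbf A$ has *enough derived projectives* if the heart has enough projectives and every projective of the heart has a derived projective. $\mathrm{DGProj}(\mathbf A)\subseteq\mathbf A$ is the full dg-subcategory of all derived projectives. For a small dg-category $\mathbf Q$, let $\mathrm{hproj}(\mathbf Q)\subseteq \mathrm C_{dg}(\mathbf Q)$ be the full dg-subcategory of h-projective dg-modules, with the standard t-structure ($M$ is in $\le n$, resp. $\ge n$, if $H^i(M)=0$ for all $i>n$, resp. $i<n$). Let $\mathrm{hproj}^-(\mathbf Q)^{\mathrm{hfp}}$ be its full dg-subcategory of those $M$ such that $H^i(M)=0$ for $i\gg0$ and each $H^i(M)$ is a finitely presented right $H^0(\mathbf Q)$-module. Let $\mathrm{Tw}^-(\mathbf Q)$ be the dg-category of bounded above one-sided twisted complexes: its objects are pairs $(\bigoplus_{i\in\mathbb Z}A_i[-i],q)$, where each $A_i$ is a finite (possibly empty) direct sum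 of objects of $\mathbf Q$ (taken in $\mathrm C_{dg}(\mathbf Q)$), $A_i=0$ for $i\gg0$, and $q$ is a degree $1$ endomorphism with $dq+q^2=0$ and components $q_i^j=0$ for $j\le i$. A degree $p$ morphism $(\bigoplus A_i[-i],q)\to(\bigoplus B_i[-i],q')$ is a degree $p$ morphism $f$ of the underlying dg-modules such that $f$ and $Df=df+q'f-(-1)^pfq$ are both one-sided, where a degree $p$ morphism $g$ is *one-sided* if $g_i^j=0$ whenever $i-j+p>0$; the differential is $D$. The totalisation dg-functor $\mathrm{Tot}\colon\mathrm{Tw}^-(\mathbf Q)\to\mathrm C_{dg}(\mathbf Q)$ sends $(M,q)$ to $M$ with differential $d_M+q$. A *quasi-functor* $\mathbf A\to\mathbf B$ is a dg-bimodule $T$, contravariant in $\mathbf B$ and covariant in $\mathbf A$, such that for every $A\in\mathbf A$ the dg-module $T(-,A)$ is isomorphic in $D(\mathbf B)$ to a representable dg-module $\mathbf B(-,B)$; we say that $T$ sends $A$ to $B$. It defines a morphism $\mathbf A\to\mathbf B$ in the localization $\mathrm{Hqe}$ of the category of dg-categories at the quasi-equivalences. **Theorem.** Let $\mathbf A$ be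 a small pretriangulated dg-category with a non-degenerate right bounded t-structure, with enough derived projectives and closed under countable coproducts. Let $\mathbf Q=\mathrm{DGProj}(\mathbf A)$, with inclusion $j\colon\mathbf Q\to\mathbf A$. Then: 1. The bimodule $T(M,A)=\mathrm C_{dg}(\mathbf Q)(M,\mathbf A(j(-),A))$ is a quasi-functor $\mathbf A^-\to\mathrm{hproj}(\mathbf Q)$, and it is t-exact: if it sends $A$ to $M$ and $A$ lies in $H^0(\mathbf A)_{\le n}$ (resp. $H^0(\mathbf A)_{\ge n}$), then $H^i(M)=0$ for all $i>n$ (resp. $i<n$). 2. Restricting $M$ to $\mathrm{hproj}^-(\mathbf Q)^{\mathrm{hfp}}$, $T$ is a quasi-functor $\mathbf A^-\to\mathrm{hproj}^-(\mathbf Q)^{\mathrm{hfp}}$, and it induces an isomorphism in $\mathrm{Hqe}$. 3. $\mathrm{Tot}$ takes values in $\mathrm{hproj}^-(\mathbf Q)^{\mathrm{hfp}}$ and induces a quasi-equivalence $\mathrm{Tw}^-(\mathbf Q)\to\mathrm{hproj}^-(\mathbf Q)^{\mathrm{hfp}}$. 4. Consequently the bimodule $(Y,A)\mapsto\mathrm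 C_{dg}(\mathbf Q)(\mathrm{Tot}\,Y,\mathbf A(j(-),A))$ is a quasi-functor $\mathbf A^-\to\mathrm{Tw}^-(\mathbf Q)$, and it induces an isomorphism in $\mathrm{Hqe}$. -/

import Mathlib

open CategoryTheory CategoryTheory.Limits Opposite
open CochainComplex.HomComplex (Cochain δ)

universe v u u₁ u₂ u₃

noncomputable section

namespace DG

/-- A `k`-linear dg-category with objects `A`.  Composition is written in diagrammatic order:
`comp p q r h f g` is `g ∘ f` for `f` of degree `p` and `g` of degree `q`. The graded Leibniz rule
`d (g ∘ f) = dg ∘ f + (-1)^|g| g ∘ df` is the usual one. -/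
class DGCategory (k : Type v) [CommRing k] (A : Type u) where
  hom : A → A → CochainComplex (ModuleCat.{v} k) ℤ
  one (X : A) : (hom X X).X 0
  comp {X Y Z : A} (p q r : ℤ) (h : p + q = r) :
    (hom X Y).X p →ₗ[k] (hom Y Z).X q →ₗ[k] (hom X Z).X r
  d_one (X : A) : ((hom X X).d 0 1).hom (one X) = 0
  one_comp {X Y : A} (p : ℤ) (f : (hom X Y).X p) : comp 0 p p (zero_add p) (one X) f = f
  comp_one {X Y : A} (p : ℤ) (f : (hom X Y).X p) : comp p 0 p (add_zero p) f (one Y) = f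
  assoc {W X Y Z : A} (p q r pq qr s : ℤ) (hpq : p + q = pq) (hqr : q + r = qr)
    (hs : pq + r = s) (hs' : p + qr = s)
    (f : (hom W X).X p) (g : (hom X Y).X q) (h : (hom Y Z).X r) :
    comp pq r s hs (comp p q pq hpq f g) h = comp p qr s hs' f (comp q r qr hqr g h)
  leibniz {X Y Z : A} (p q r p' q' r' : ℤ) (h : p + q = r) (hp : p + 1 = p') (hq : q + 1 = q')
    (hr : r + 1 = r') (f : (hom X Y).X p) (g : (hom Y Z).X q) :
    ((hom X Z).d r r').hom (comp p q r h f g) =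
      comp p q' r' (by lia) f (((hom Y Z).d q q').hom g) +
        q.negOnePow • comp p' q r' (by lia) (((hom X Y).d p p').hom f) g

open DGCategory

/-- The homotopy category `H⁰(A)` of a dg-category (its objects; see the instance below). -/
structure H0 (k : Type v) [CommRing k] (A : Type u) where
  of ::
  obj : A

section H0

variable (k : Type v) [CommRing k] {A : Type u} [DGCategory k A]

/-- Closed morphisms of degree `0`. -/
abbrev Z0 (X Y : A) : Submodule k ((hom (k := k) X Y).X 0) :=
  LinearMap.ker ((hom (k := k) X Y).d 0 1).hom

/-- The exact morphisms among the closed morphisms of degree `0`. -/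
abbrev B0 (X Y : A) : Submodule k (Z0 k X Y) :=
  (LinearMap.range ((hom (k := k) X Y).d (-1) 0).hom).comap (Z0 k X Y).subtype

variable {k}

lemma Z0_d {X Y : A} (f : Z0 k X Y) : ((hom (k := k) X Y).d 0 1).hom f.1 = 0 := f.2

/-- Composition of closed morphisms of degree `0`. -/
def Z0.comp {X Y Z : A} (f : Z0 k X Y) (g : Z0 k Y Z) : Z0 k X Z :=
  ⟨DGCategory.comp 0 0 0 (add_zero 0) f.1 g.1, by
    rw [LinearMap.mem_ker, leibniz 0 0 0 1 1 1 rfl rfl rfl rfl, Z0_d, Z0_d]; simp⟩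

/-- The identity as a closed morphism of degree `0`. -/
def Z0.one (X : A) : Z0 k X X := ⟨DGCategory.one X, d_one X⟩

lemma B0_comp_left {X Y Z : A} (f : Z0 k X Y) (g : Z0 k Y Z) (hf : f ∈ B0 k X Y) :
    Z0.comp f g ∈ B0 k X Z := by
  obtain ⟨s, hs⟩ := hf
  refine ⟨DGCategory.comp (-1) 0 (-1) (by lia) s g.1, ?_⟩
  rw [leibniz (-1) 0 (-1) 0 1 0 rfl rfl rfl rfl, Z0_d, hs]
  simp [Z0.comp]

lemma B0_comp_right {X Y Z : A} (f : Z0 k X Y) (g : Z0 k Y Z) (hg : g ∈ B0 k Y Z) :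
    Z0.comp f g ∈ B0 k X Z := by
  obtain ⟨s, hs⟩ := hg
  refine ⟨DGCategory.comp 0 (-1) (-1) (by lia) f.1 s, ?_⟩
  rw [leibniz 0 (-1) (-1) 1 0 0 rfl rfl rfl rfl, Z0_d, hs]
  simp [Z0.comp]

/-- Composition of closed morphisms of degree `0`, as a bilinear map. -/
def Z0.compLin (X Y Z : A) : Z0 k X Y →ₗ[k] Z0 k Y Z →ₗ[k] Z0 k X Z :=
  LinearMap.mk₂ k (fun f g => Z0.comp f g)
    (fun _ _ _ => Subtype.ext (by simp [Z0.comp])) (fun _ _ _ => Subtype.ext (by simp [Z0.comp]))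
    (fun _ _ _ => Subtype.ext (by simp [Z0.comp])) (fun _ _ _ => Subtype.ext (by simp [Z0.comp]))

/-- Composition of homotopy classes, as a bilinear map. -/
def H0.compLin (X Y Z : A) :
    (Z0 k X Y ⧸ B0 k X Y) →ₗ[k] (Z0 k Y Z ⧸ B0 k Y Z) →ₗ[k] (Z0 k X Z ⧸ B0 k X Z) :=
  Submodule.liftQ _
    { toFun := fun f => Submodule.mapQ _ _ (Z0.compLin X Y Z f) (fun g hg => B0_comp_right f g hg)
      map_add' := fun f f' => by
        apply Submodule.linearMap_qext; ext g; simp; rfl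
      map_smul' := fun c f => by
        apply Submodule.linearMap_qext; ext g; simp; rfl }
    (fun f hf => by
      rw [LinearMap.mem_ker]
      apply Submodule.linearMap_qext
      ext g
      exact (Submodule.Quotient.mk_eq_zero _).2 (B0_comp_left f g hf))

instance : Category (H0 k A) where
  Hom X Y := Z0 k X.obj Y.obj ⧸ B0 k X.obj Y.obj
  id X := Submodule.Quotient.mk (Z0.one X.obj)
  comp f g := H0.compLin _ _ _ f g
  id_comp f := by
    induction f using Submodule.Quotient.induction_on with | _ f
    exact congrArg _ (Subtype.ext (one_comp 0 f.1))
  comp_id f := by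
    induction f using Submodule.Quotient.induction_on with | _ f
    exact congrArg _ (Subtype.ext (comp_one 0 f.1))
  assoc f g h := by
    induction f using Submodule.Quotient.induction_on with | _ f
    induction g using Submodule.Quotient.induction_on with | _ g
    induction h using Submodule.Quotient.induction_on with | _ h
    exact congrArg _ (Subtype.ext (DGCategory.assoc 0 0 0 0 0 0 rfl rfl rfl rfl f.1 g.1 h.1))

instance : Preadditive (H0 k A) where
  homGroup X Y := inferInstanceAs (AddCommGroup (Z0 k X.obj Y.obj ⧸ B0 k X.obj Y.obj))
  add_comp X Y Z f f' g := (H0.compLin (k := k) X.obj Y.obj Z.obj).map_add₂ f f' g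
  comp_add X Y Z f g g' := (H0.compLin (k := k) X.obj Y.obj Z.obj f).map_add g g'

instance : Linear k (H0 k A) where
  homModule X Y := inferInstanceAs (Module k (Z0 k X.obj Y.obj ⧸ B0 k X.obj Y.obj))
  smul_comp X Y Z c f g := (H0.compLin (k := k) X.obj Y.obj Z.obj).map_smul₂ c f g
  comp_smul X Y Z f c g := (H0.compLin (k := k) X.obj Y.obj Z.obj f).map_smul c g

/-- The class in `H⁰(A)` of a closed morphism of degree `0`. -/
def H0.cls {X Y : A} (f : Z0 k X Y) : (H0.of X : H0 k A) ⟶ H0.of Y := Submodule.Quotient.mk f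

end H0

section Functors

/-- A dg-functor. -/
structure DGFunctor (k : Type v) [CommRing k] (A : Type u₁) [DGCategory k A] (B : Type u₂)
    [DGCategory k B] where
  obj : A → B
  map (X Y : A) : hom (k := k) X Y ⟶ hom (obj X) (obj Y)
  map_one (X : A) : ((map X X).f 0).hom (one X) = one (obj X)
  map_comp {X Y Z : A} (p q r : ℤ) (h : p + q = r) (f : (hom X Y).X p) (g : (hom Y Z).X q) :
    ((map X Z).f r).hom (comp p q r h f g) =
      comp p q r h (((map X Y).f p).hom f) (((map Y Z).f q).hom g)

variable {k : Type v} [CommRing k] {A : Type u₁} [DGCategory k A] {B : Type u₂} [DGCategory k B]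
  {C : Type u₃} [DGCategory k C]

variable (k A) in
/-- The identity dg-functor. -/
def DGFunctor.id : DGFunctor k A A where
  obj X := X
  map _ _ := 𝟙 _
  map_one _ := rfl
  map_comp _ _ _ _ _ _ := rfl

/-- Composition of dg-functors (first `F`, then `G`). -/
def DGFunctor.comp (F : DGFunctor k A B) (G : DGFunctor k B C) : DGFunctor k A C where
  obj X := G.obj (F.obj X)
  map X Y := F.map X Y ≫ G.map _ _
  map_one X := by simp [F.map_one, G.map_one]
  map_comp p q r h f g := by simp [F.map_comp, G.map_comp]

/-- A quasi-equivalence: quasi-isomorphisms on hom-complexes, essentially surjective on `H⁰`. -/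
structure DGFunctor.IsQuasiEquivalence (F : DGFunctor k A B) : Prop where
  quasiIso (X Y : A) : QuasiIso (F.map X Y)
  essSurj (Y : B) : ∃ X : A, Nonempty ((H0.of (F.obj X) : H0 k B) ≅ H0.of Y)

/-- The full dg-subcategory of `A` on the objects satisfying `P`. -/
instance fullSub (P : A → Prop) : DGCategory k (Subtype P) where
  hom X Y := hom X.1 Y.1
  one X := one X.1
  comp := DGCategory.comp
  d_one X := d_one X.1
  one_comp := one_comp
  comp_one := comp_one
  assoc := DGCategory.assoc
  leibniz := leibniz

variable (k) in
/-- The inclusion of a full dg-subcategory. -/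
def incl (P : A → Prop) : DGFunctor k (Subtype P) A where
  obj X := X.1
  map _ _ := 𝟙 _
  map_one _ := rfl
  map_comp _ _ _ _ _ _ := rfl

/-- A dg-functor with values in a full dg-subcategory. -/
def DGFunctor.codRestrict (F : DGFunctor k A B) (P : B → Prop) (h : ∀ X, P (F.obj X)) :
    DGFunctor k A (Subtype P) where
  obj X := ⟨F.obj X, h X⟩
  map X Y := F.map X Y
  map_one := F.map_one
  map_comp := F.map_comp

/-- The same dg-category, with its type of objects lifted to a larger universe. -/
instance uliftDG : DGCategory k (ULift.{u₂} A) where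
  hom X Y := hom X.down Y.down
  one X := one X.down
  comp := DGCategory.comp
  d_one X := d_one X.down
  one_comp := one_comp
  comp_one := comp_one
  assoc := DGCategory.assoc
  leibniz := leibniz

/-- A dg-functor, with the objects of its target lifted to a larger universe. -/
def DGFunctor.ulift (F : DGFunctor k A B) : DGFunctor k A (ULift.{u₃} B) where
  obj X := ULift.up (F.obj X)
  map X Y := F.map X Y
  map_one := F.map_one
  map_comp := F.map_comp

/-- Bundled dg-categories. -/
structure DGCat (k : Type v) [CommRing k] where
  of ::
  carrier : Type u
  [str : DGCategory k carrier]

attribute [instance] DGCat.str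

instance (k : Type v) [CommRing k] : Category (DGCat.{v, u} k) where
  Hom A B := DGFunctor k A.carrier B.carrier
  id A := DGFunctor.id k A.carrier
  comp F G := F.comp G
  id_comp F := by simp [DGFunctor.comp, DGFunctor.id]
  comp_id F := by simp [DGFunctor.comp, DGFunctor.id]
  assoc F G H := by simp [DGFunctor.comp]

/-- The class of quasi-equivalences. -/
def quasiEquivalences (k : Type v) [CommRing k] : MorphismProperty (DGCat.{v, u} k) :=
  fun _ _ F => DGFunctor.IsQuasiEquivalence F

/-- The homotopy category of dg-categories: the localization of the category of dg-categories
at the quasi-equivalences. -/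
abbrev Hqe (k : Type v) [CommRing k] := (quasiEquivalences.{v, u} k).Localization

/-- The localization functor. -/
abbrev toHqe (k : Type v) [CommRing k] : DGCat.{v, u} k ⥤ Hqe.{v, u} k :=
  (quasiEquivalences.{v, u} k).Q

end Functors

section Modules

/-- A right dg-module over `A`, i.e. a dg-functor from `Aᵒᵖ` to complexes of `k`-modules, written
through its right action `x · f`. -/
structure DGModule (k : Type v) [CommRing k] (A : Type u) [DGCategory k A] where
  obj : A → CochainComplex (ModuleCat.{v} k) ℤ
  act {X Y : A} (p q r : ℤ) (h : p + q = r) :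
    (obj Y).X p →ₗ[k] (hom (k := k) X Y).X q →ₗ[k] (obj X).X r
  act_one {Y : A} (p : ℤ) (x : (obj Y).X p) : act p 0 p (add_zero p) x (one Y) = x
  act_act {X Y Z : A} (p q r pq rq s : ℤ) (hpq : p + q = pq) (hrq : r + q = rq) (hs : pq + r = s)
    (hs' : p + rq = s) (x : (obj Z).X p) (g : (hom (k := k) Y Z).X q) (f : (hom (k := k) X Y).X r) :
    act pq r s hs (act p q pq hpq x g) f = act p rq s hs' x (comp r q rq hrq f g)
  leibniz {X Y : A} (p q r p' q' r' : ℤ) (h : p + q = r) (hp : p + 1 = p') (hq : q + 1 = q')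
    (hr : r + 1 = r') (x : (obj Y).X p) (f : (hom (k := k) X Y).X q) :
    ((obj X).d r r').hom (act p q r h x f) =
      act p' q r' (by lia) (((obj Y).d p p').hom x) f +
        p.negOnePow • act p q' r' (by lia) x (((hom X Y).d q q').hom f)

namespace DGModule

section

variable {k : Type v} [CommRing k] {A : Type u} [DGCategory k A]

/-- Morphisms of degree `n` of dg-modules: families of maps `M(X)ᵖ → N(X)ᵖ⁺ⁿ` that commute with
the right actions. -/
def homSub (M N : DGModule k A) (n : ℤ) : Submodule k (∀ X, Cochain (M.obj X) (N.obj X) n) where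
  carrier := {φ | ∀ (X Y : A) (p q r p' r' : ℤ) (h : p + q = r) (hp : p + n = p') (hr : r + n = r')
    (x : (M.obj Y).X p) (f : (hom (k := k) X Y).X q),
      ((φ X).v r r' hr).hom (M.act p q r h x f) =
        N.act p' q r' (by lia) (((φ Y).v p p' hp).hom x) f}
  add_mem' := by
    intro a b ha hb X Y p q r p' r' h hp hr x f
    simp [ha X Y p q r p' r' h hp hr, hb X Y p q r p' r' h hp hr]
  zero_mem' := by
    intro X Y p q r p' r' h hp hr x f
    simp
  smul_mem' := by
    intro c a ha X Y p q r p' r' h hp hr x f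
    simp [ha X Y p q r p' r' h hp hr]

lemma δ_mem (M N : DGModule k A) (n m : ℤ) (φ : ∀ X, Cochain (M.obj X) (N.obj X) n)
    (hφ : φ ∈ homSub M N n) : (fun X => δ n m (φ X)) ∈ homSub M N m := by
  by_cases hnm : n + 1 = m
  · intro X Y p q r p' r' h hp hr x f
    dsimp only
    rw [CochainComplex.HomComplex.δ_v n m hnm _ r r' hr (r' - 1) (r + 1) rfl rfl,
      CochainComplex.HomComplex.δ_v n m hnm _ p p' hp (p' - 1) (p + 1) rfl rfl]
    simp only [ModuleCat.hom_add, ModuleCat.hom_comp, LinearMap.add_apply, LinearMap.comp_apply,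
      ModuleCat.hom_smul, LinearMap.smul_apply, map_add, Units.smul_def]
    rw [hφ X Y p q r (p' - 1) (r' - 1) h (by lia) (by lia) x f,
      N.leibniz (p' - 1) q (r' - 1) p' (q + 1) r' (by lia) (by lia) rfl (by lia),
      M.leibniz p q r (p + 1) (q + 1) (r + 1) h rfl rfl rfl]
    simp only [map_add, Units.smul_def, map_zsmul, LinearMap.smul_apply]
    rw [hφ X Y (p + 1) q (r + 1) p' r' (by lia) (by lia) (by lia),
      hφ X Y p (q + 1) (r + 1) (p' - 1) r' (by lia) (by lia) (by lia)]
    have e : ((p' - 1).negOnePow : ℤ) = -((m.negOnePow : ℤ) * (p.negOnePow : ℤ)) := by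
      rw [← hp, Int.negOnePow_sub, Int.negOnePow_add]
      simp [mul_comm]
    rw [e, smul_add, smul_smul, neg_smul]
    abel
  · have : (fun X => δ n m (φ X)) = 0 := by
      funext X; exact CochainComplex.HomComplex.δ_shape n m hnm _
    rw [this]; exact Submodule.zero_mem _

end

variable {k : Type v} [CommRing k] {A : Type v} [DGCategory k A]

/-- The complex of morphisms of dg-modules. -/
def homComplex (M N : DGModule k A) : CochainComplex (ModuleCat.{v} k) ℤ where
  X n := ModuleCat.of k (homSub M N n)
  d n m := ModuleCat.ofHom
    { toFun := fun φ => ⟨fun X => δ n m (φ.1 X), δ_mem M N n m φ.1 φ.2⟩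
      map_add' := fun φ ψ => Subtype.ext (funext fun X => by simp)
      map_smul' := fun c φ => Subtype.ext (funext fun X => by simp) }
  shape n m hnm := by
    refine ModuleCat.hom_ext (LinearMap.ext fun (φ : homSub M N n) => ?_)
    exact Subtype.ext (funext fun X => CochainComplex.HomComplex.δ_shape n m hnm (φ.1 X))
  d_comp_d' n₀ n₁ n₂ _ _ := by
    refine ModuleCat.hom_ext (LinearMap.ext fun (φ : homSub M N n₀) => ?_)
    exact Subtype.ext (funext fun X => CochainComplex.HomComplex.δ_δ n₀ n₁ n₂ (φ.1 X))

/-- The dg-category of right dg-modules over `A`. -/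
instance : DGCategory k (DGModule k A) where
  hom := homComplex
  one M := ⟨fun X => Cochain.ofHom (𝟙 _), by
    intro X Y p q r p' r' h hp hr x f
    obtain rfl : p' = p := by lia
    obtain rfl : r' = r := by lia
    simp⟩
  comp {M N L} p q r h := LinearMap.mk₂ k
    (fun φ ψ => ⟨fun X => (φ.1 X).comp (ψ.1 X) h, by
      intro X Y a b c a' c' h' ha hc x f
      rw [Cochain.comp_v _ _ h c (c + p) c' rfl (by lia),
        Cochain.comp_v _ _ h a (a + p) a' rfl (by lia)]
      simp only [ModuleCat.hom_comp, LinearMap.comp_apply]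
      rw [φ.2 X Y a b c (a + p) (c + p) h' rfl rfl,
        ψ.2 X Y (a + p) b (c + p) a' c' (by lia) (by lia) (by lia)]⟩)
    (fun φ φ' ψ => Subtype.ext (funext fun X => Cochain.add_comp (φ.1 X) (φ'.1 X) (ψ.1 X) h))
    (fun c φ ψ => Subtype.ext (funext fun X => Cochain.smul_comp c (φ.1 X) (ψ.1 X) h))
    (fun φ ψ ψ' => Subtype.ext (funext fun X => Cochain.comp_add (φ.1 X) (ψ.1 X) (ψ'.1 X) h))
    (fun c φ ψ => Subtype.ext (funext fun X => Cochain.comp_smul (φ.1 X) c (ψ.1 X) h))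
  d_one M := Subtype.ext (funext fun X => CochainComplex.HomComplex.δ_ofHom _)
  one_comp p f := Subtype.ext (funext fun X => Cochain.id_comp _)
  comp_one p f := Subtype.ext (funext fun X => Cochain.comp_id _)
  assoc p q r pq qr s hpq hqr hs hs' f g h :=
    Subtype.ext (funext fun X => Cochain.comp_assoc _ _ _ hpq hqr (by lia))
  leibniz p q r p' q' r' h hp hq hr f g :=
    Subtype.ext (funext fun X =>
      CochainComplex.HomComplex.δ_comp (f.1 X) (g.1 X) h p' q' r' hr hp hq)

/-- The morphism of complexes `x ↦ x · f` given by a closed morphism `f` of degree `0`. -/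
def actHom (M : DGModule k A) {X Y : A} (f : Z0 k X Y) : M.obj Y ⟶ M.obj X where
  f p := ModuleCat.ofHom ((M.act p 0 p (add_zero p)).flip f.1)
  comm' p p' hp := by
    ext x
    have := M.leibniz p 0 p p' 1 p' (add_zero p) hp rfl hp x f.1
    rw [Z0_d] at this
    simpa using this

lemma homologyMap_actHom_eq (M : DGModule k A) {X Y : A} (f g : Z0 k X Y) (h : f - g ∈ B0 k X Y)
    (i : ℤ) : HomologicalComplex.homologyMap (M.actHom f) i =
      HomologicalComplex.homologyMap (M.actHom g) i := by
  obtain ⟨s, hs⟩ := h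
  refine Homotopy.homologyMap_eq ((CochainComplex.HomComplex.Cochain.equivHomotopy _ _).symm
    ⟨Cochain.mk fun p q hpq => ModuleCat.ofHom (p.negOnePow • (M.act p (-1) q hpq).flip s), ?_⟩) i
  ext p x
  have hl := M.leibniz p (-1) (p - 1) (p + 1) 0 p (by lia) rfl rfl (by lia) x s
  rw [hs] at hl
  rw [Cochain.add_v, CochainComplex.HomComplex.δ_v (-1) 0 rfl _ p p (add_zero p) (p - 1) (p + 1)
    rfl rfl]
  simp only [Cochain.ofHom_v, actHom, Cochain.mk_v, Int.negOnePow_zero, one_smul,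
    ModuleCat.hom_add, ModuleCat.hom_comp, ModuleCat.hom_ofHom, LinearMap.add_apply,
    LinearMap.comp_apply, LinearMap.smul_apply, LinearMap.flip_apply, Units.smul_def, map_zsmul, hl,
    Int.negOnePow_succ]
  simp [smul_smul, ← Units.val_mul]

/-- The cohomology `Hⁱ(M)` of a dg-module as a right module over `H⁰(A)`. -/
def cohomology (M : DGModule k A) (i : ℤ) : (H0 k A)ᵒᵖ ⥤ ModuleCat.{v} k where
  obj X := (M.obj X.unop.obj).homology i
  map f := Quotient.lift (fun g => HomologicalComplex.homologyMap (M.actHom g) i)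
    (fun g g' h => homologyMap_actHom_eq M g g' ((Submodule.quotientRel_def _).1 h) i) f.unop
  map_id X := by
    refine Eq.trans ?_ (HomologicalComplex.homologyMap_id _ i)
    refine congrArg (fun φ => HomologicalComplex.homologyMap φ i) ?_
    ext p x
    exact M.act_one p x
  map_comp {X Y Z} f g := by
    obtain ⟨f', hf⟩ := Submodule.Quotient.mk_surjective _ f.unop
    obtain ⟨g', hg⟩ := Submodule.Quotient.mk_surjective _ g.unop
    obtain rfl : f = Quiver.Hom.op (Submodule.Quotient.mk f') := Quiver.Hom.unop_inj hf.symm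
    obtain rfl : g = Quiver.Hom.op (Submodule.Quotient.mk g') := Quiver.Hom.unop_inj hg.symm
    refine Eq.trans ?_ (HomologicalComplex.homologyMap_comp (M.actHom f') (M.actHom g') i)
    refine congrArg (fun φ => HomologicalComplex.homologyMap φ i) ?_
    ext p x
    exact (M.act_act p 0 0 p 0 p (add_zero p) rfl (add_zero p) (add_zero p) x f'.1 g'.1).symm

/-- Acyclic dg-modules. -/
def IsAcyclic (M : DGModule k A) : Prop := ∀ X, (M.obj X).Acyclic

/-- h-projective dg-modules: every morphism to an acyclic dg-module is null-homotopic. -/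
def IsHProjective (M : DGModule k A) : Prop :=
  ∀ N : DGModule k A, N.IsAcyclic → ∀ f : (H0.of M : H0 k (DGModule k A)) ⟶ H0.of N, f = 0

end DGModule

/-- A finitely presented right module over a `k`-linear category `C`: a cokernel of a morphism
between finite direct sums of representable modules. -/
def IsFinitelyPresented {k : Type v} [CommRing k] {C : Type v} [Category.{v} C] [Preadditive C]
    [Linear k C] (M : Cᵒᵖ ⥤ ModuleCat.{v} k) : Prop :=
  ∃ (m n : ℕ) (C' : Fin m → C) (C₀ : Fin n → C)
    (f : (∐ fun j => (linearYoneda k C).obj (C' j)) ⟶ ∐ fun i => (linearYoneda k C).obj (C₀ i))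
    (g : (∐ fun i => (linearYoneda k C).obj (C₀ i)) ⟶ M) (w : f ≫ g = 0),
      (ShortComplex.mk f g w).Exact ∧ Epi g

/-- Homotopically finitely presented dg-modules. -/
def DGModule.IsHfp {k : Type v} [CommRing k] {A : Type v} [DGCategory k A] (M : DGModule k A) :
    Prop :=
  ∀ i : ℤ, IsFinitelyPresented (M.cohomology i)

end Modules

section Yoneda

/-- The effect of a dg-functor on closed morphisms of degree `0`. -/
def DGFunctor.mapZ0 {k : Type v} [CommRing k] {A : Type u₁} [DGCategory k A] {B : Type u₂}
    [DGCategory k B] (F : DGFunctor k A B) {X Y : A} (f : Z0 k X Y) :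
    Z0 k (F.obj X) (F.obj Y) :=
  ⟨((F.map X Y).f 0).hom f.1, by
    have := ConcreteCategory.congr_hom ((F.map X Y).comm 0 1) f.1
    simp only [ConcreteCategory.comp_apply] at this
    refine Eq.trans this ?_
    exact (congrArg _ f.2).trans (map_zero _)⟩

variable {k : Type v} [CommRing k] {Q : Type v} [DGCategory k Q] {A : Type u} [DGCategory k A]

/-- The dg-module `A(j(-), X)` over `Q`, for a dg-functor `j : Q → A` and an object `X` of `A`. -/
def restrictedRep (j : DGFunctor k Q A) (X : A) : DGModule k Q where
  obj W := hom (j.obj W) X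
  act {V W} p q r h := (LinearMap.comp (comp q p r (by lia)) ((j.map V W).f q).hom).flip
  act_one p x := by
    simp [j.map_one, one_comp]
  act_act p q r pq rq s hpq hrq hs hs' x g f := by
    simp [j.map_comp, DGCategory.assoc r q p rq pq s hrq (by lia) (by lia) (by lia)]
  leibniz {V W} p q r p' q' r' h hp hq hr x f := by
    have := ConcreteCategory.congr_hom ((j.map V W).comm q q') f
    simp only [ConcreteCategory.comp_apply] at this
    simp [DGCategory.leibniz q p r q' p' r' (by lia) hq hp hr, this]

/-- The restricted Yoneda dg-functor `X ↦ A(j(-), X)` from `A` to dg-modules over `Q`. -/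
def restrictedYoneda (j : DGFunctor k Q A) : DGFunctor k A (DGModule k Q) where
  obj X := restrictedRep j X
  map X Y :=
    { f := fun n => ModuleCat.ofHom
        { toFun := fun f => ⟨fun W => Cochain.mk fun p q h =>
              ModuleCat.ofHom ((comp p n q h).flip f), by
            intro V W p q r p' r' h hp hr x g
            exact DGCategory.assoc q p n r p' r' _ _ _ _ _ x f⟩
          map_add' := fun f g => Subtype.ext (funext fun W => by
            ext p q h x; exact map_add (comp p n q h x) f g)
          map_smul' := fun c f => Subtype.ext (funext fun W => by
            ext p q h x; exact map_smul (comp p n q h x) c f) }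
      comm' := fun n m hnm => by
        ext f
        refine Subtype.ext (funext fun W => ?_)
        ext p q h x
        have hnm' : n + 1 = m := hnm
        have hl := DGCategory.leibniz p n (q - 1) (p + 1) m q
          (by lia) rfl hnm' (by lia) x f
        refine Eq.trans (ConcreteCategory.congr_hom (CochainComplex.HomComplex.δ_v n m hnm _ p q h
          (q - 1) (p + 1) rfl rfl) x) ?_
        have hm : m.negOnePow = -n.negOnePow := by
          rw [← hnm', Int.negOnePow_succ]
        refine Eq.trans (congrArg₂ (· + ·) hl (congrArg₂ (· • ·) hm rfl)) ?_
        refine Eq.trans (congrArg _ (Units.neg_smul _ _)) ?_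
        exact add_neg_cancel_right _ _ }
  map_one X := Subtype.ext (funext fun W => by
    ext p x
    exact (comp_one p x).trans (ConcreteCategory.congr_hom (Cochain.ofHom_v (𝟙 _) p) x).symm)
  map_comp p q r h f g := Subtype.ext (funext fun W => by
    ext a b hab x
    refine Eq.trans ?_ (ConcreteCategory.congr_hom (Cochain.comp_v _ _ h a (a + p) b rfl (by lia))
      x).symm
    exact (DGCategory.assoc a p q (a + p) r b rfl h (by lia) hab x f g).symm)

variable (k Q) in
/-- The Yoneda embedding. -/
def yonedaDG : DGFunctor k Q (DGModule k Q) := restrictedYoneda (DGFunctor.id k Q)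

end Yoneda

section Triangles

variable (k : Type v) [CommRing k] {A : Type u} [DGCategory k A]

/-- `Y` is a strict shift `X[n]`: there are mutually inverse closed morphisms `X → Y` of degree
`-n` and `Y → X` of degree `n`. -/
def IsShift (n : ℤ) (X Y : A) : Prop :=
  ∃ (a : (hom (k := k) X Y).X (-n)) (b : (hom (k := k) Y X).X n),
    ((hom X Y).d (-n) (-n + 1)).hom a = 0 ∧ ((hom Y X).d n (n + 1)).hom b = 0 ∧
    comp (-n) n 0 (neg_add_cancel n) a b = one X ∧ comp n (-n) 0 (add_neg_cancel n) b a = one Y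

/-- `Y` is isomorphic to the shift `X[n]` in the homotopy category: as in `IsShift`, with the
compositions homotopic to the identities. -/
def IsHoShift (n : ℤ) (X Y : A) : Prop :=
  ∃ (a : (hom (k := k) X Y).X (-n)) (b : (hom (k := k) Y X).X n),
    ((hom X Y).d (-n) (-n + 1)).hom a = 0 ∧ ((hom Y X).d n (n + 1)).hom b = 0 ∧
    (∃ s, comp (-n) n 0 (neg_add_cancel n) a b - one X = ((hom X X).d (-1) 0).hom s) ∧
    (∃ s, comp n (-n) 0 (add_neg_cancel n) b a - one Y = ((hom Y Y).d (-1) 0).hom s)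

variable {k}

/-- The structure of a (strict) cone of the closed morphism `f : X → Y` of degree `0` on `C`.
The degree `-1` map `i : X → C` and the degree `1` map `p : C → X` correspond to degree `0` maps
`X[1] → C` and `C → X[1]`; together with `j` and `s` they exhibit `C` as `X[1] ⊕ Y` in the
underlying graded category. -/
structure ConeData {X Y : A} (f : Z0 k X Y) (C : A) where
  i : (hom (k := k) X C).X (-1)
  j : Z0 k Y C
  p : (hom (k := k) C X).X 1
  s : (hom (k := k) C Y).X 0
  d_i : ((hom X C).d (-1) 0).hom i = comp 0 0 0 (add_zero 0) f.1 j.1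
  d_p : ((hom C X).d 1 2).hom p = 0
  d_s : ((hom C Y).d 0 1).hom s = -comp 1 0 1 (add_zero 1) p f.1
  i_p : comp (-1) 1 0 (by lia) i p = one X
  j_s : comp 0 0 0 (add_zero 0) j.1 s = one Y
  j_p : comp 0 1 1 (zero_add 1) j.1 p = 0
  i_s : comp (-1) 0 (-1) (add_zero (-1)) i s = 0
  p_i_add_s_j : comp 1 (-1) 0 (by lia) p i + comp 0 0 0 (add_zero 0) s j.1 = one C

end Triangles

section Pretriangulated

variable (k : Type v) [CommRing k] {A : Type v} [DGCategory k A]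

/-- The objects of the pretriangulated hull `pretr(A)`: the smallest class of dg-modules that
contains the representable ones and is closed under shifts and under cones of closed morphisms of
degree `0`. -/
inductive IsPretr : DGModule k A → Prop
  | yoneda (X : A) : IsPretr ((yonedaDG k A).obj X)
  | shift (n : ℤ) (M N : DGModule k A) : IsPretr M → IsShift k n M N → IsPretr N
  | cone (M N C : DGModule k A) (f : Z0 k M N) : IsPretr M → IsPretr N → ConeData f C → IsPretr C

variable (A) in
/-- Pretriangulated dg-categories: the Yoneda embedding `A → pretr(A)` is a quasi-equivalence. The
dg-category is required to have an object, so that `H⁰(A)` has a zero object. -/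
structure IsPretriangulated : Prop where
  nonempty : Nonempty A
  quasiEquivalence : ((yonedaDG k A).codRestrict (IsPretr k) IsPretr.yoneda).IsQuasiEquivalence

variable {k}

/-- The sequence `X → Y → Z` in `H⁰(A)` given by `f` and `g` extends to a distinguished triangle:
its image under the Yoneda embedding is isomorphic, in the homotopy category of dg-modules, to
the sequence `A(-,X) → A(-,Y) → cone(f)`. -/
def IsDistinguished {X Y Z : A} (f : Z0 k X Y) (g : Z0 k Y Z) : Prop :=
  ∃ (C : DGModule k A) (c : ConeData ((yonedaDG k A).mapZ0 f) C)
    (w : Z0 k C ((yonedaDG k A).obj Z)),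
    IsIso (H0.cls w) ∧ H0.cls (Z0.comp c.j w) = H0.cls ((yonedaDG k A).mapZ0 g)

variable (k A) in
/-- A t-structure on (the triangulated category `H⁰(A)` of) a pretriangulated dg-category. Here
`le n` and `ge n` are the classes of objects `H⁰(A)_{≤ n}` and `H⁰(A)_{≥ n}`. -/
structure TStructure where
  le (n : ℤ) : ObjectProperty (H0 k A)
  ge (n : ℤ) : ObjectProperty (H0 k A)
  le_isClosedUnderIsomorphisms (n : ℤ) : (le n).IsClosedUnderIsomorphisms
  ge_isClosedUnderIsomorphisms (n : ℤ) : (ge n).IsClosedUnderIsomorphisms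
  le_shift (n a n' : ℤ) (h : a + n' = n) (X Y : A) (hXY : IsHoShift k a X Y)
    (hX : le n (H0.of X)) : le n' (H0.of Y)
  ge_shift (n a n' : ℤ) (h : a + n' = n) (X Y : A) (hXY : IsHoShift k a X Y)
    (hX : ge n (H0.of X)) : ge n' (H0.of Y)
  zero ⦃X Y : H0 k A⦄ (f : X ⟶ Y) (hX : le 0 X) (hY : ge 1 Y) : f = 0
  le_zero_le : le 0 ≤ le 1
  ge_one_le : ge 1 ≤ ge 0
  exists_triangle (Y : A) : ∃ (X Z : A) (f : Z0 k X Y) (g : Z0 k Y Z),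
    le 0 (H0.of X) ∧ ge 1 (H0.of Z) ∧ IsDistinguished f g

namespace TStructure

variable (t : TStructure k A)

/-- The t-structure is non-degenerate. -/
structure NonDegenerate : Prop where
  left (X : H0 k A) : (∀ n, t.le n X) → IsZero X
  right (X : H0 k A) : (∀ n, t.ge n X) → IsZero X

/-- The objects of `H⁰(A)⁻` (and of `A⁻`): those lying in `H⁰(A)_{≤ n}` for some `n`. -/
def minus (X : A) : Prop := ∃ n, t.le n (H0.of X)

/-- The t-structure is right bounded (bounded from above): the inclusion of `H⁰(A)⁻` in `H⁰(A)`
is an equivalence. -/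
def RightBounded : Prop :=
  (ObjectProperty.ι (fun X : H0 k A => t.minus X.obj)).IsEquivalence

/-- The t-structure is closed under countable coproducts: countable families in `H⁰(A)_{≤ 0}` have
a coproduct in `H⁰(A)`, which lies in `H⁰(A)_{≤ 0}`. -/
def ClosedUnderCountableCoproducts : Prop :=
  ∀ X : ℕ → H0 k A, (∀ n, t.le 0 (X n)) →
    ∃ c : Cofan X, Nonempty (IsColimit c) ∧ t.le 0 c.pt

/-- The heart of the t-structure. -/
def heart : ObjectProperty (H0 k A) := t.le 0 ⊓ t.ge 0

/-- The truncation functors of the t-structure, in degree `0`: a left adjoint `τ_{≥ 0}` of the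
inclusion of `H⁰(A)_{≥ 0}` and a right adjoint `τ_{≤ 0}` of the inclusion of `H⁰(A)_{≤ 0}`.
They are unique up to isomorphism. -/
structure Truncation where
  τge : H0 k A ⥤ (t.ge 0).FullSubcategory
  adjGE : τge ⊣ (t.ge 0).ι
  τle : H0 k A ⥤ (t.le 0).FullSubcategory
  adjLE : (t.le 0).ι ⊣ τle

/-- The cohomology functor `H⁰ = τ_{≤ 0} τ_{≥ 0}` of the t-structure, seen with values in `H⁰(A)`
(its values lie in the heart). -/
def Truncation.cohomology {t : TStructure k A} (τ : t.Truncation) : H0 k A ⥤ H0 k A :=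
  τ.τge ⋙ (t.ge 0).ι ⋙ τ.τle ⋙ (t.le 0).ι

/-- `S` is the derived projective associated with the object `P` of the heart:
the functor `X ↦ Hom(P, H⁰(X))` is corepresented by `S`. -/
def IsDerivedProjectiveOf (S : H0 k A) (P : t.heart.FullSubcategory) : Prop :=
  ∃ τ : t.Truncation,
    Nonempty (coyoneda.obj (op S) ≅ τ.cohomology ⋙ coyoneda.obj (op P.obj))

/-- The t-structure has enough derived projectives: every projective object of the heart has an
associated derived projective, and the heart has enough projectives. -/
structure HasEnoughDerivedProjectives : Prop where
  hasDerivedProjectives (P : t.heart.FullSubcategory) (hP : Projective P) :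
    ∃ S, t.IsDerivedProjectiveOf S P
  enoughProjectives : EnoughProjectives t.heart.FullSubcategory

/-- The objects of `DGProj(A)`: the derived projectives. -/
def dgProj (X : A) : Prop :=
  ∃ P : t.heart.FullSubcategory, Projective P ∧ t.IsDerivedProjectiveOf (H0.of X) P

end TStructure

end Pretriangulated

section Bimodules

/-- An `A`-`B`-dg-bimodule `T`, contravariant in `B` and covariant in `A`, written through the left
action of `A` and the right action of `B`. -/
structure DGBimodule (k : Type v) [CommRing k] (A : Type u₁) [DGCategory k A] (B : Type u₂)
    [DGCategory k B] where
  obj : B → A → CochainComplex (ModuleCat.{v} k) ℤ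
  actL {b : B} {a a' : A} (p q r : ℤ) (h : p + q = r) :
    (hom (k := k) a a').X p →ₗ[k] (obj b a).X q →ₗ[k] (obj b a').X r
  actR {b' b : B} {a : A} (p q r : ℤ) (h : p + q = r) :
    (obj b a).X p →ₗ[k] (hom (k := k) b' b).X q →ₗ[k] (obj b' a).X r
  one_actL {b : B} {a : A} (p : ℤ) (x : (obj b a).X p) : actL 0 p p (zero_add p) (one a) x = x
  actR_one {b : B} {a : A} (p : ℤ) (x : (obj b a).X p) : actR p 0 p (add_zero p) x (one b) = x
  actL_actL {b : B} {a a' a'' : A} (p q r pq qp s : ℤ) (hpq : p + q = pq) (hqp : q + r = qp)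
    (hs : pq + r = s) (hs' : p + qp = s)
    (g : (hom (k := k) a' a'').X p) (f : (hom (k := k) a a').X q) (x : (obj b a).X r) :
    actL p qp s hs' g (actL q r qp hqp f x) = actL pq r s hs (comp q p pq (by lia) f g) x
  actR_actR {b'' b' b : B} {a : A} (p q r pq qr s : ℤ) (hpq : p + q = pq) (hqr : q + r = qr)
    (hs : pq + r = s) (hs' : p + qr = s)
    (x : (obj b a).X p) (g : (hom (k := k) b' b).X q) (f : (hom (k := k) b'' b').X r) :
    actR pq r s hs (actR p q pq hpq x g) f = actR p qr s hs' x (comp r q qr (by lia) f g)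
  actL_actR {b' b : B} {a a' : A} (p q r pq qr s : ℤ) (hpq : p + q = pq) (hqr : q + r = qr)
    (hs : pq + r = s) (hs' : p + qr = s)
    (f : (hom (k := k) a a').X p) (x : (obj b a).X q) (g : (hom (k := k) b' b).X r) :
    actR pq r s hs (actL p q pq hpq f x) g = actL p qr s hs' f (actR q r qr hqr x g)
  leibnizL {b : B} {a a' : A} (p q r p' q' r' : ℤ) (h : p + q = r) (hp : p + 1 = p')
    (hq : q + 1 = q') (hr : r + 1 = r') (f : (hom (k := k) a a').X p) (x : (obj b a).X q) :
    ((obj b a').d r r').hom (actL p q r h f x) =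
      actL p' q r' (by lia) (((hom a a').d p p').hom f) x +
        p.negOnePow • actL p q' r' (by lia) f (((obj b a).d q q').hom x)
  leibnizR {b' b : B} {a : A} (p q r p' q' r' : ℤ) (h : p + q = r) (hp : p + 1 = p')
    (hq : q + 1 = q') (hr : r + 1 = r') (x : (obj b a).X p) (f : (hom (k := k) b' b).X q) :
    ((obj b' a).d r r').hom (actR p q r h x f) =
      actR p' q r' (by lia) (((obj b a).d p p').hom x) f +
        p.negOnePow • actR p q' r' (by lia) x (((hom b' b).d q q').hom f)

namespace DGBimodule

variable {k : Type v} [CommRing k] {A : Type u₁} [DGCategory k A] {B : Type u₂} [DGCategory k B]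
  {C : Type u₃} [DGCategory k C]

/-- The bimodule `(b, a) ↦ C(F b, N a)` for dg-functors `N : A → C` and `F : B → C`. -/
def ofFunctors (N : DGFunctor k A C) (F : DGFunctor k B C) : DGBimodule k A B where
  obj b a := hom (F.obj b) (N.obj a)
  actL {b a a'} p q r h := (LinearMap.comp (comp q p r (by lia)).flip ((N.map a a').f p).hom)
  actR {b' b a} p q r h := (LinearMap.comp (comp q p r (by lia)) ((F.map b' b).f q).hom).flip
  one_actL p x := by simp [N.map_one, comp_one]
  actR_one p x := by simp [F.map_one, one_comp]
  actL_actL p q r pq qp s hpq hqp hs hs' g f x := by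
    simp [N.map_comp, DGCategory.assoc r q p qp pq s (by lia) (by lia) (by lia) (by lia)]
  actR_actR p q r pq qr s hpq hqr hs hs' x g f := by
    simp [F.map_comp, DGCategory.assoc r q p qr pq s (by lia) (by lia) (by lia) (by lia)]
  actL_actR p q r pq qr s hpq hqr hs hs' f x g := by
    simp [DGCategory.assoc r q p qr pq s (by lia) (by lia) (by lia) (by lia)]
  leibnizL {b a a'} p q r p' q' r' h hp hq hr f x := by
    have := ConcreteCategory.congr_hom ((N.map a a').comm p p') f
    simp only [ConcreteCategory.comp_apply] at this
    simp [DGCategory.leibniz q p r q' p' r' (by lia) hq hp hr, this]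
  leibnizR {b' b a} p q r p' q' r' h hp hq hr x f := by
    have := ConcreteCategory.congr_hom ((F.map b' b).comm q q') f
    simp only [ConcreteCategory.comp_apply] at this
    simp [DGCategory.leibniz q p r q' p' r' (by lia) hq hp hr, this]

variable (T : DGBimodule k A B)

/-- The morphism of complexes `B(b', b) → T(b', a)`, `g ↦ x · g`, given by a closed element `x` of
degree `0` of `T(b, a)`. -/
def evalHom {b : B} {a : A} (x : (T.obj b a).X 0) (hx : ((T.obj b a).d 0 1).hom x = 0) (b' : B) :
    hom (k := k) b' b ⟶ T.obj b' a where
  f p := ModuleCat.ofHom (T.actR 0 p p (zero_add p) x)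
  comm' p p' hp := by
    ext g
    have := T.leibnizR 0 p p 1 p' p' (zero_add p) rfl hp hp x g
    rw [hx] at this
    simpa using this

/-- A closed element of degree `0` of `T(b, a)` such that the induced morphism of dg-modules
`B(-, b) → T(-, a)` is a quasi-isomorphism. As `B(-, b)` is h-projective, such elements up to
boundaries are the same as isomorphisms `B(-, b) ≅ T(-, a)` in the derived category of `B`. -/
structure Representation (b : B) (a : A) where
  x : (T.obj b a).X 0
  closed : ((T.obj b a).d 0 1).hom x = 0
  quasiIso (b' : B) : QuasiIso (T.evalHom x closed b')

/-- `T` is a quasi-functor `A → B`: each `T(-, a)` is quasi-representable. -/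
def IsQuasiFunctor : Prop := ∀ a : A, ∃ b : B, Nonempty (T.Representation b a)

/-- The objects of the graph of a quasi-functor. -/
structure Graph where
  a : A
  b : B
  rep : T.Representation b a

namespace Graph

variable {T}

/-- The hom-complexes of the graph: the homotopy fibres of
`A(a, a') ⊕ B(b, b') → T(b, a')`, `(f, g) ↦ f x - x' g`. -/
def homComplex (E E' : T.Graph) : CochainComplex (ModuleCat.{v} k) ℤ where
  X n := ModuleCat.of k
    ((hom (k := k) E.a E'.a).X n × (hom (k := k) E.b E'.b).X n × (T.obj E.b E'.a).X (n - 1))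
  d n m := if h : n + 1 = m then ModuleCat.ofHom
    (LinearMap.prod (((hom E.a E'.a).d n m).hom ∘ₗ LinearMap.fst _ _ _)
      (LinearMap.prod (((hom E.b E'.b).d n m).hom ∘ₗ LinearMap.fst _ _ _ ∘ₗ LinearMap.snd _ _ _)
        ((T.actL n 0 (m - 1) (by lia)).flip E.rep.x ∘ₗ LinearMap.fst _ _ _ -
          T.actR 0 n (m - 1) (by lia) E'.rep.x ∘ₗ LinearMap.fst _ _ _ ∘ₗ LinearMap.snd _ _ _ -
          ((T.obj E.b E'.a).d (n - 1) (m - 1)).hom ∘ₗ LinearMap.snd _ _ _ ∘ₗ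
            LinearMap.snd _ _ _))) else 0
  shape n m h := dif_neg h
  d_comp_d' n m l hnm hml := by
    have hnm' : n + 1 = m := hnm
    have hml' : m + 1 = l := hml
    rw [dif_pos hnm', dif_pos hml']
    refine ModuleCat.hom_ext (LinearMap.ext fun z => ?_)
    obtain ⟨f, g, s⟩ := z
    have h1 := ConcreteCategory.congr_hom ((hom (k := k) E.a E'.a).d_comp_d n m l) f
    have h2 := ConcreteCategory.congr_hom ((hom (k := k) E.b E'.b).d_comp_d n m l) g
    have h3 := ConcreteCategory.congr_hom ((T.obj E.b E'.a).d_comp_d (n - 1) (m - 1) (l - 1)) s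
    have h4 := T.leibnizL n 0 (m - 1) m 1 (l - 1) (by lia) hnm' rfl (by lia) f E.rep.x
    have h5 := T.leibnizR 0 n (m - 1) 1 m (l - 1) (by lia) rfl hnm' (by lia) E'.rep.x g
    rw [E.rep.closed] at h4
    rw [E'.rep.closed] at h5
    simp only [ConcreteCategory.comp_apply] at h1 h2 h3
    refine Prod.ext h1 (Prod.ext h2 ?_)
    simp_all

lemma homComplex_d {E E' : T.Graph} (n m : ℤ) (h : n + 1 = m) (f : (hom (k := k) E.a E'.a).X n)
    (g : (hom (k := k) E.b E'.b).X n) (s : (T.obj E.b E'.a).X (n - 1)) :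
    ((homComplex E E').d n m).hom (f, g, s) =
      (((hom E.a E'.a).d n m).hom f, ((hom E.b E'.b).d n m).hom g,
        T.actL n 0 (m - 1) (by lia) f E.rep.x - T.actR 0 n (m - 1) (by lia) E'.rep.x g -
          ((T.obj E.b E'.a).d (n - 1) (m - 1)).hom s) := by
  simp only [homComplex, dif_pos h]
  rfl

lemma assoc_aux {E₀ E₁ E₂ E₃ : T.Graph} (p q r pq qr s : ℤ) (hpq : p + q = pq) (hqr : q + r = qr)
    (hs : pq + r = s) (hs' : p + qr = s)
    (g : (hom (k := k) E₀.b E₁.b).X p) (f' : (hom (k := k) E₁.a E₂.a).X q)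
    (x : (T.obj E₀.b E₁.a).X (p - 1))
    (g' : (hom (k := k) E₁.b E₂.b).X q) (f'' : (hom (k := k) E₂.a E₃.a).X r)
    (x' : (T.obj E₁.b E₂.a).X (q - 1)) (x'' : (T.obj E₂.b E₃.a).X (r - 1)) :
    r.negOnePow • T.actL r (pq - 1) (s - 1) (by lia) f''
          (q.negOnePow • T.actL q (p - 1) (pq - 1) (by lia) f' x +
            T.actR (q - 1) p (pq - 1) (by lia) x' g) +
        T.actR (r - 1) pq (s - 1) (by lia) x'' (comp p q pq hpq g g') =
      qr.negOnePow • T.actL qr (p - 1) (s - 1) (by lia) (comp q r qr hqr f' f'') x +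
        T.actR (qr - 1) p (s - 1) (by lia) (r.negOnePow • T.actL r (q - 1) (qr - 1) (by lia) f'' x' +
          T.actR (r - 1) q (qr - 1) (by lia) x'' g') g := by
  have h1 := T.actL_actL r q (p - 1) qr (pq - 1) (s - 1) (by lia) (by lia) (by lia) (by lia)
    f'' f' x
  have h2 := T.actL_actR r (q - 1) p (qr - 1) (pq - 1) (s - 1) (by lia) (by lia) (by lia)
    (by lia) f'' x' g
  have h3 := T.actR_actR (r - 1) q p (qr - 1) pq (s - 1) (by lia) (by lia) (by lia) (by lia)
    x'' g' g
  have e : (qr.negOnePow : ℤ) = (r.negOnePow : ℤ) * (q.negOnePow : ℤ) := by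
    rw [← hqr, Int.negOnePow_add]; simp [mul_comm]
  simp only [map_add, Units.smul_def, map_zsmul, LinearMap.add_apply, LinearMap.smul_apply, h1, h2,
    h3, smul_add, smul_smul, e]
  abel

lemma leibniz_aux {E E' E'' : T.Graph} (p q r p' q' r' : ℤ) (h : p + q = r) (hp : p + 1 = p')
    (hq : q + 1 = q') (hr : r + 1 = r')
    (f : (hom (k := k) E.a E'.a).X p) (g : (hom (k := k) E.b E'.b).X p)
    (s : (T.obj E.b E'.a).X (p - 1))
    (f' : (hom (k := k) E'.a E''.a).X q) (g' : (hom (k := k) E'.b E''.b).X q)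
    (s' : (T.obj E'.b E''.a).X (q - 1)) :
    T.actL r 0 (r' - 1) (by lia) (comp p q r h f f') E.rep.x -
          T.actR 0 r (r' - 1) (by lia) E''.rep.x (comp p q r h g g') -
        ((T.obj E.b E''.a).d (r - 1) (r' - 1)).hom
          (q.negOnePow • T.actL q (p - 1) (r - 1) (by lia) f' s +
            T.actR (q - 1) p (r - 1) (by lia) s' g) =
      (q'.negOnePow • T.actL q' (p - 1) (r' - 1) (by lia) (((hom E'.a E''.a).d q q').hom f') s +
        T.actR (q' - 1) p (r' - 1) (by lia) (T.actL q 0 (q' - 1) (by lia) f' E'.rep.x -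
          T.actR 0 q (q' - 1) (by lia) E''.rep.x g' -
          ((T.obj E'.b E''.a).d (q - 1) (q' - 1)).hom s') g) +
      q.negOnePow • (q.negOnePow • T.actL q (p' - 1) (r' - 1) (by lia) f'
          (T.actL p 0 (p' - 1) (by lia) f E.rep.x - T.actR 0 p (p' - 1) (by lia) E'.rep.x g -
            ((T.obj E.b E'.a).d (p - 1) (p' - 1)).hom s) +
        T.actR (q - 1) p' (r' - 1) (by lia) s' (((hom E.b E'.b).d p p').hom g)) := by
  have h1 := T.actL_actL q p 0 r (p' - 1) (r' - 1) (by lia) (by lia) (by lia) (by lia)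
    f' f E.rep.x
  have h2 := T.actR_actR 0 q p (q' - 1) r (r' - 1) (by lia) (by lia) (by lia) (by lia)
    E''.rep.x g' g
  have h3 := T.actL_actR q 0 p (q' - 1) (p' - 1) (r' - 1) (by lia) (by lia) (by lia) (by lia)
    f' E'.rep.x g
  have h4 := T.leibnizL q (p - 1) (r - 1) q' (p' - 1) (r' - 1) (by lia) hq (by lia) (by lia) f' s
  have h5 := T.leibnizR (q - 1) p (r - 1) (q' - 1) p' (r' - 1) (by lia) (by lia) hp (by lia) s' g
  have e : (q'.negOnePow : ℤ) = -(q.negOnePow : ℤ) := by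
    rw [← hq, Int.negOnePow_succ]; simp
  have e' : ((q - 1).negOnePow : ℤ) = -(q.negOnePow : ℤ) := by
    rw [Int.negOnePow_sub]; simp
  have e'' : (q.negOnePow : ℤ) * (q.negOnePow : ℤ) = 1 := by
    rw [← Units.val_mul]; simp
  simp only [map_add, map_sub, Units.smul_def, map_zsmul, LinearMap.sub_apply, h1, h2, h3, h4, h5,
    smul_add, smul_sub, smul_smul, e, e', e'', neg_smul, one_smul]
  abel

/-- Composition in the graph. -/
def compLin {E E' E'' : T.Graph} (p q r : ℤ) (h : p + q = r) :
    (homComplex E E').X p →ₗ[k] (homComplex E' E'').X q →ₗ[k] (homComplex E E'').X r :=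
  LinearMap.mk₂ k
    (fun F G => ⟨comp p q r h F.1 G.1, comp p q r h F.2.1 G.2.1,
      q.negOnePow • T.actL q (p - 1) (r - 1) (by lia) G.1 F.2.2 +
        T.actR (q - 1) p (r - 1) (by lia) G.2.2 F.2.1⟩)
    (fun F F' G => Prod.ext (LinearMap.map_add₂ _ _ _ _) (Prod.ext (LinearMap.map_add₂ _ _ _ _) (by
      obtain ⟨f, g, s⟩ := F
      obtain ⟨f', g', s'⟩ := F'
      refine (congrArg₂ (· + ·) (congrArg _ (map_add _ s s')) (map_add _ g g')).trans ?_
      rw [smul_add]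
      exact add_add_add_comm _ _ _ _)))
    (fun c F G => Prod.ext (LinearMap.map_smul₂ _ _ _ _) (Prod.ext (LinearMap.map_smul₂ _ _ _ _) (by
      obtain ⟨f, g, s⟩ := F
      refine (congrArg₂ (· + ·) (congrArg _ (map_smul _ c s)) (map_smul _ c g)).trans ?_
      rw [smul_comm]
      exact (smul_add _ _ _).symm)))
    (fun F G G' => Prod.ext (map_add _ _ _) (Prod.ext (map_add _ _ _) (by
      obtain ⟨f, g, s⟩ := G
      obtain ⟨f', g', s'⟩ := G'
      refine (congrArg₂ (· + ·) (congrArg _ (LinearMap.map_add₂ _ f f' _))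
        (LinearMap.map_add₂ _ s s' _)).trans ?_
      rw [smul_add]
      exact add_add_add_comm _ _ _ _)))
    (fun c F G => Prod.ext (map_smul _ _ _) (Prod.ext (map_smul _ _ _) (by
      obtain ⟨f, g, s⟩ := G
      refine (congrArg₂ (· + ·) (congrArg _ (LinearMap.map_smul₂ _ c f _))
        (LinearMap.map_smul₂ _ c s _)).trans ?_
      rw [smul_comm]
      exact (smul_add _ _ _).symm)))

instance : DGCategory k T.Graph where
  hom := homComplex
  one E := ⟨one E.a, one E.b, 0⟩
  comp p q r h := compLin p q r h
  d_one E := by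
    refine (homComplex_d 0 1 rfl _ _ _).trans (Prod.ext (d_one _) (Prod.ext (d_one _) ?_))
    have h1 := T.one_actL 0 E.rep.x
    have h2 := T.actR_one 0 E.rep.x
    simp_all
    rfl
  one_comp p F := by
    obtain ⟨f, g, s⟩ := F
    refine Prod.ext (one_comp p f) (Prod.ext (one_comp p g) ?_)
    refine (congrArg₂ (· + ·) (congrArg _ (map_zero _)) (T.actR_one (p - 1) s)).trans ?_
    simp
  comp_one p F := by
    obtain ⟨f, g, s⟩ := F
    refine Prod.ext (comp_one p f) (Prod.ext (comp_one p g) ?_)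
    refine (congrArg₂ (· + ·) (congrArg _ (T.one_actL (p - 1) s)) (LinearMap.map_zero₂ _ _)).trans ?_
    simp
  assoc p q r pq qr s hpq hqr hs hs' F G H := by
    obtain ⟨f, g, x⟩ := F
    obtain ⟨f', g', x'⟩ := G
    obtain ⟨f'', g'', x''⟩ := H
    refine Prod.ext (DGCategory.assoc p q r pq qr s hpq hqr hs hs' f f' f'')
      (Prod.ext (DGCategory.assoc p q r pq qr s hpq hqr hs hs' g g' g'') ?_)
    exact assoc_aux p q r pq qr s hpq hqr hs hs' g f' x g' f'' x' x''
  leibniz {E E' E''} p q r p' q' r' h hp hq hr F G := by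
    obtain ⟨f, g, s⟩ := F
    obtain ⟨f', g', s'⟩ := G
    rw [homComplex_d p p' hp f g s, homComplex_d q q' hq f' g' s']
    refine (homComplex_d r r' hr _ _ _).trans ?_
    refine Prod.ext (DGCategory.leibniz p q r p' q' r' h hp hq hr f f')
      (Prod.ext (DGCategory.leibniz p q r p' q' r' h hp hq hr g g') ?_)
    exact leibniz_aux p q r p' q' r' h hp hq hr f g s f' g' s'

variable (T)

/-- The projection of the graph of `T : A → B` to `A`. It is a quasi-equivalence if `T` is a
quasi-functor. -/
def fst : DGFunctor k T.Graph A where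
  obj E := E.a
  map E E' :=
    { f := fun n => ModuleCat.ofHom (LinearMap.fst _ _ _)
      comm' := fun n m h => by
        refine ModuleCat.hom_ext (LinearMap.ext fun z => ?_)
        exact (congrArg Prod.fst (homComplex_d n m h z.1 z.2.1 z.2.2)).symm }
  map_one E := rfl
  map_comp p q r h f g := rfl

/-- The projection of the graph of `T : A → B` to `B`. -/
def snd : DGFunctor k T.Graph B where
  obj E := E.b
  map E E' :=
    { f := fun n => ModuleCat.ofHom (LinearMap.fst _ _ _ ∘ₗ LinearMap.snd _ _ _)
      comm' := fun n m h => by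
        refine ModuleCat.hom_ext (LinearMap.ext fun z => ?_)
        exact (congrArg (fun w => w.2.1) (homComplex_d n m h z.1 z.2.1 z.2.2)).symm }
  map_one E := rfl
  map_comp p q r h f g := rfl

end Graph

/-- The quasi-functor `T : A → B` induces an isomorphism in `Hqe`. The morphism of `Hqe` given by
`T` is the composition of the inverse of the quasi-equivalence `Graph.fst : T.Graph → A` with
`Graph.snd : T.Graph → B`. (The objects are lifted to a common universe.) -/
def InducesIsoInHqe : Prop :=
  ∃ e : (toHqe k).obj (DGCat.of (ULift.{max u₂ v} A)) ≅
      (toHqe k).obj (DGCat.of (ULift.{max u₁ v} B)),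
    (toHqe k).map (X := DGCat.of T.Graph) (Y := DGCat.of (ULift.{max u₂ v} A))
        (Graph.fst T).ulift ≫ e.hom =
      (toHqe k).map (X := DGCat.of T.Graph) (Y := DGCat.of (ULift.{max u₁ v} B))
        (Graph.snd T).ulift

end DGBimodule

end Bimodules

section TwistedComplexes

variable {k : Type v} [CommRing k] {Q : Type v} [DGCategory k Q]

/-- The data of a bounded above graded object `⊕ A_i[-i]`, where each `A_i` is a finite direct
sum of objects of `Q` (possibly empty), and `A_i = 0` for `i` large. -/
structure GradedObj (Q : Type v) where
  n : ℤ → ℕ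
  obj (i : ℤ) : Fin (n i) → Q
  bounded : ∃ N : ℤ, ∀ i, N < i → n i = 0

namespace GradedObj

/-- The index set of all the summands of `⊕ A_i[-i]`. -/
abbrev Idx (G : GradedObj Q) : Type := Σ i : ℤ, Fin (G.n i)

/-- The object of `Q` in the summand with index `a`. -/
abbrev ob (G : GradedObj Q) (a : G.Idx) : Q := G.obj a.1 a.2

variable (k) in
/-- The degree `m` part of the value at `W` of the dg-module `⊕ A_i[-i]`. -/
abbrev Elt (G : GradedObj Q) (W : Q) (m : ℤ) : Type v :=
  Π₀ a : G.Idx, (hom (k := k) W (G.ob a)).X (m - a.1)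

variable (k) in
/-- The value at `W` of the dg-module `⊕ A_i[-i]`. The differential of `M[-i]` is `(-1)^i d_M`. -/
def cplx (G : GradedObj Q) (W : Q) : CochainComplex (ModuleCat.{v} k) ℤ where
  X m := ModuleCat.of k (G.Elt k W m)
  d m m' := ModuleCat.ofHom (DFinsupp.mapRange.linearMap fun a =>
    a.1.negOnePow • ((hom (k := k) W (G.ob a)).d (m - a.1) (m' - a.1)).hom)
  shape m m' h := by
    have h' : ¬ m + 1 = m' := h
    refine ModuleCat.hom_ext (LinearMap.ext fun x => DFinsupp.ext fun a => ?_)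
    have := (hom (k := k) W (G.ob a)).shape (m - a.1) (m' - a.1) (fun e => h' (by
      have e' : m - a.1 + 1 = m' - a.1 := e
      lia))
    simp [this]
  d_comp_d' m m' m'' h h' := by
    refine ModuleCat.hom_ext (LinearMap.ext fun x => DFinsupp.ext fun a => ?_)
    have := ConcreteCategory.congr_hom ((hom (k := k) W (G.ob a)).d_comp_d (m - a.1) (m' - a.1)
      (m'' - a.1)) (x a)
    simp only [ConcreteCategory.comp_apply] at this
    simp [Units.smul_def, this]

lemma cplx_d_apply (G : GradedObj Q) (W : Q) (m m' : ℤ) (x : G.Elt k W m) (a : G.Idx) :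
    (show G.Elt k W m' from ((G.cplx k W).d m m').hom x) a =
      a.1.negOnePow • ((hom (k := k) W (G.ob a)).d (m - a.1) (m' - a.1)).hom (x a) := rfl

/-- The right action of `Q` on `⊕ A_i[-i]`. -/
def actLin (G : GradedObj Q) {V W : Q} (p q r : ℤ) (h : p + q = r) :
    G.Elt k W p →ₗ[k] (hom (k := k) V W).X q →ₗ[k] G.Elt k V r :=
  LinearMap.mk₂ k
    (fun x f => DFinsupp.mapRange.linearMap
      (fun a : G.Idx => (comp q (p - a.1) (r - a.1) (by lia) f)) x)
    (fun x x' f => map_add _ x x')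
    (fun c x f => map_smul _ c x)
    (fun x f f' => DFinsupp.ext fun a => by simp)
    (fun c x f => DFinsupp.ext fun a => by simp)

lemma actLin_apply (G : GradedObj Q) {V W : Q} (p q r : ℤ) (h : p + q = r) (x : G.Elt k W p)
    (f : (hom (k := k) V W).X q) (a : G.Idx) :
    G.actLin p q r h x f a = comp q (p - a.1) (r - a.1) (by lia) f (x a) := rfl

lemma actLin_leibniz (G : GradedObj Q) {V W : Q} (p q r p' q' r' : ℤ) (h : p + q = r)
    (hp : p + 1 = p') (hq : q + 1 = q') (hr : r + 1 = r') (x : G.Elt k W p)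
    (f : (hom (k := k) V W).X q) :
    (show G.Elt k V r' from ((G.cplx k V).d r r').hom (G.actLin p q r h x f)) =
      G.actLin p' q r' (by lia) (show G.Elt k W p' from ((G.cplx k W).d p p').hom x) f +
        p.negOnePow • G.actLin p q' r' (by lia) x (((hom V W).d q q').hom f) := by
  refine DFinsupp.ext fun a => ?_
  have hl := DGCategory.leibniz q (p - a.1) (r - a.1) q' (p' - a.1) (r' - a.1) (by lia) hq
    (by lia) (by lia) f (x a)
  have e : (p.negOnePow : ℤ) = (a.1.negOnePow : ℤ) * ((p - a.1).negOnePow : ℤ) := by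
    rw [← Units.val_mul, ← Int.negOnePow_add, add_sub_cancel]
  rw [cplx_d_apply, actLin_apply, hl, Units.smul_def p.negOnePow, DFinsupp.add_apply,
    DFinsupp.smul_apply, actLin_apply, actLin_apply, cplx_d_apply, e]
  simp only [Units.smul_def, map_zsmul, smul_add, smul_smul]

variable (k) in
/-- The dg-module `⊕ A_i[-i]`, where `A_i` is identified with the dg-module it represents. -/
def toModule (G : GradedObj Q) : DGModule k Q where
  obj W := G.cplx k W
  act p q r h := G.actLin p q r h
  act_one p x := DFinsupp.ext fun a => (actLin_apply G _ _ _ _ _ _ a).trans (one_comp _ _)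
  act_act p q r pq rq s hpq hrq hs hs' x g f := DFinsupp.ext fun a =>
    (DGCategory.assoc r q (p - a.1) rq (pq - a.1) (s - a.1) hrq (by lia) (by lia) (by lia)
      f g _).symm
  leibniz p q r p' q' r' h hp hq hr x f := G.actLin_leibniz p q r p' q' r' h hp hq hr x f

/-- A family of maps between the graded pieces of `⊕ A_i[-i]` and `⊕ B_j[-j]` of degree `p` is
one-sided if its components `A_i[-i] → B_j[-j]` vanish whenever `i - j + p > 0`. -/
def OneSided (G G' : GradedObj Q) (p : ℤ)
    (φ : ∀ (W : Q) (m m' : ℤ), m + p = m' → (G.Elt k W m →ₗ[k] G'.Elt k W m')) : Prop :=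
  ∀ (a : G.Idx) (b : G'.Idx), 0 < a.1 - b.1 + p →
    ∀ (W : Q) (m m' : ℤ) (h : m + p = m') (x : (hom (k := k) W (G.ob a)).X (m - a.1)),
      φ W m m' h (DFinsupp.single a x) b = 0

end GradedObj

/-- The complex `M(W)` with differential `d + q`, where `q` is an endomorphism of `M` of degree `1`
with `dq + q² = 0`. -/
def DGModule.twistCplx (M : DGModule k Q) (q : (hom (k := k) M M).X 1)
    (hq : ((hom M M).d 1 2).hom q + comp 1 1 2 rfl q q = 0) (W : Q) :
    CochainComplex (ModuleCat.{v} k) ℤ where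
  X := (M.obj W).X
  d := fun i j => (M.obj W).d i j + if h : i + 1 = j then (q.1 W).v i j h else 0
  shape := fun i j h => by
    have h' : ¬ i + 1 = j := h
    rw [dif_neg h', (M.obj W).shape i j h, add_zero]
  d_comp_d' := fun i j l hij hjl => by
    have hij' : i + 1 = j := hij
    have hjl' : j + 1 = l := hjl
    have h0 : δ 1 2 (q.1 W) + (q.1 W).comp (q.1 W) (show (1 : ℤ) + 1 = 2 from rfl) = 0 :=
      congrFun (congrArg Subtype.val hq) W
    have h1 := Cochain.congr_v h0 i l (by lia)
    rw [Cochain.add_v, CochainComplex.HomComplex.δ_v 1 2 rfl _ i l (by lia) j j (by lia) hij',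
      Cochain.comp_v _ _ (show (1 : ℤ) + 1 = 2 from rfl) i j l hij' hjl', Cochain.zero_v,
      show (2 : ℤ).negOnePow = 1 from rfl, one_smul] at h1
    rw [dif_pos hij', dif_pos hjl', Preadditive.comp_add, Preadditive.add_comp,
      Preadditive.add_comp, HomologicalComplex.d_comp_d, zero_add, ← h1]
    abel

lemma DGModule.twistCplx_d_apply (M : DGModule k Q) (q : (hom (k := k) M M).X 1)
    (hq : ((hom M M).d 1 2).hom q + comp 1 1 2 rfl q q = 0) (W : Q) (i j : ℤ) (h : i + 1 = j)
    (x : (M.obj W).X i) :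
    (show (M.obj W).X j from ((M.twistCplx q hq W).d i j).hom x) =
      ((M.obj W).d i j).hom x + ((q.1 W).v i j h).hom x := by
  have e : (M.twistCplx q hq W).d i j = (M.obj W).d i j + (q.1 W).v i j h :=
    congrArg ((M.obj W).d i j + ·) (dif_pos h)
  rw [e]
  rfl

/-- The totalisation of a Maurer-Cartan element: the dg-module `M` with differential `d + q`. -/
def DGModule.twist (M : DGModule k Q) (q : (hom (k := k) M M).X 1)
    (hq : ((hom M M).d 1 2).hom q + comp 1 1 2 rfl q q = 0) : DGModule k Q where
  obj W := M.twistCplx q hq W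
  act := M.act
  act_one := M.act_one
  act_act := M.act_act
  leibniz {V W} p n r p' n' r' h hp hn hr x f := by
    have h1 := M.leibniz p n r p' n' r' h hp hn hr x f
    have h2 := q.2 V W p n r p' r' h hp hr x f
    refine (M.twistCplx_d_apply q hq V r r' hr _).trans ?_
    refine (congrArg₂ (· + ·) h1 h2).trans ?_
    refine Eq.trans ?_ (congrArg (fun y => M.act p' n r' (by lia) y f + p.negOnePow •
      M.act p n' r' (by lia) x (((hom V W).d n n').hom f))
      (M.twistCplx_d_apply q hq W p p' hp x).symm)
    refine Eq.trans ?_ (congrArg (· + _) (LinearMap.map_add₂ _ _ _ _).symm)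
    exact add_right_comm _ _ _

variable (k Q) in
/-- Bounded above one-sided twisted complexes `(⊕ A_i[-i], q)`: `q` is an endomorphism of degree `1`
with `dq + q² = 0`, and its components `q_i^j : A_i[-i] → A_j[-j]` vanish if `j ≤ i`. -/
structure TwMinus where
  gr : GradedObj Q
  q : (hom (k := k) (gr.toModule k) (gr.toModule k)).X 1
  mc : ((hom _ _).d 1 2).hom q + comp 1 1 2 rfl q q = 0
  oneSided : GradedObj.OneSided (k := k) gr gr 1 fun W m m' h => ((q.1 W).v m m' h).hom

namespace TwMinus

/-- The totalisation of a twisted complex. -/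
def tot (X : TwMinus k Q) : DGModule k Q := (X.gr.toModule k).twist X.q X.mc

/-- One-sidedness of a morphism of degree `p` between twisted complexes. The underlying graded module
of `tot X` is that of `⊕ A_i[-i]`. -/
def IsOneSided {X Y : TwMinus k Q} {p : ℤ} (φ : (hom (k := k) X.tot Y.tot).X p) : Prop :=
  GradedObj.OneSided (k := k) X.gr Y.gr p fun W m m' h => ((φ.1 W).v m m' h).hom

lemma IsOneSided.add {X Y : TwMinus k Q} {p : ℤ} {φ ψ : (hom (k := k) X.tot Y.tot).X p}
    (hφ : IsOneSided φ) (hψ : IsOneSided ψ) : IsOneSided (φ + ψ) := fun a b hab W m m' h x =>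
  (congrArg₂ (· + ·) (hφ a b hab W m m' h x) (hψ a b hab W m m' h x)).trans (add_zero 0)

lemma IsOneSided.smul {X Y : TwMinus k Q} {p : ℤ} {φ : (hom (k := k) X.tot Y.tot).X p}
    (hφ : IsOneSided φ) (c : k) : IsOneSided (c • φ) := fun a b hab W m m' h x =>
  (congrArg (c • ·) (hφ a b hab W m m' h x)).trans (smul_zero c)

lemma IsOneSided.zero {X Y : TwMinus k Q} {p : ℤ} :
    IsOneSided (0 : (hom (k := k) X.tot Y.tot).X p) := fun _ _ _ _ _ _ _ _ => rfl

/-- The morphisms of degree `p` of twisted complexes: the one-sided morphisms whose differential is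
also one-sided. A morphism of degree `p` of dg-modules from `tot X` to `tot Y` is the same thing as a
morphism `f` of degree `p` between the underlying `⊕ A_i[-i]` and `⊕ B_j[-j]`, and its differential
is `df + q' f - (-1)^p f q`. -/
def homSub (X Y : TwMinus k Q) (p : ℤ) : Submodule k ((hom (k := k) X.tot Y.tot).X p) where
  carrier := {φ | IsOneSided φ ∧
    IsOneSided (X := X) (Y := Y) (((hom (k := k) X.tot Y.tot).d p (p + 1)).hom φ)}
  add_mem' := by
    rintro φ ψ ⟨h1, h2⟩ ⟨h3, h4⟩
    exact ⟨h1.add h3, by rw [map_add]; exact h2.add h4⟩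
  zero_mem' := ⟨IsOneSided.zero, by rw [map_zero]; exact IsOneSided.zero⟩
  smul_mem' := by
    rintro c φ ⟨h1, h2⟩
    exact ⟨h1.smul c, by rw [map_smul]; exact h2.smul c⟩

lemma d_mem {X Y : TwMinus k Q} (p p' : ℤ) (φ : (hom (k := k) X.tot Y.tot).X p)
    (hφ : φ ∈ homSub X Y p) :
    ((hom (k := k) X.tot Y.tot).d p p').hom φ ∈ homSub X Y p' := by
  by_cases h : p + 1 = p'
  · subst h
    refine ⟨hφ.2, ?_⟩
    have := ConcreteCategory.congr_hom
      ((hom (k := k) X.tot Y.tot).d_comp_d p (p + 1) (p + 1 + 1)) φ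
    rw [ConcreteCategory.comp_apply] at this
    have e : ((hom (k := k) X.tot Y.tot).d (p + 1) (p + 1 + 1)).hom
      (((hom (k := k) X.tot Y.tot).d p (p + 1)).hom φ) = 0 := this
    rw [e]
    exact IsOneSided.zero
  · rw [(hom (k := k) X.tot Y.tot).shape p p' h]
    exact Submodule.zero_mem _

/-- The complex of morphisms of twisted complexes. -/
def homComplex (X Y : TwMinus k Q) : CochainComplex (ModuleCat.{v} k) ℤ where
  X p := ModuleCat.of k (homSub X Y p)
  d p p' := ModuleCat.ofHom
    (LinearMap.restrict ((hom (k := k) X.tot Y.tot).d p p').hom (fun φ hφ => d_mem p p' φ hφ))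
  shape p p' h := by
    refine ModuleCat.hom_ext (LinearMap.ext fun (φ : homSub X Y p) => Subtype.ext ?_)
    exact ConcreteCategory.congr_hom ((hom (k := k) X.tot Y.tot).shape p p' h) φ.1
  d_comp_d' p p' p'' h h' := by
    refine ModuleCat.hom_ext (LinearMap.ext fun (φ : homSub X Y p) => Subtype.ext ?_)
    exact ConcreteCategory.congr_hom ((hom (k := k) X.tot Y.tot).d_comp_d p p' p'') φ.1

lemma IsOneSided.apply_eq_zero {Y Z : TwMinus k Q} {q : ℤ} {ψ : (hom (k := k) Y.tot Z.tot).X q}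
    (hψ : IsOneSided ψ) (W : Q) (m m' : ℤ) (h : m + q = m') (N : ℤ) (y : Y.gr.Elt k W m)
    (hy : ∀ b : Y.gr.Idx, b.1 < N → y b = 0) (c : Z.gr.Idx) (hc : c.1 < N + q) :
    (show Z.gr.Elt k W m' from ((ψ.1 W).v m m' h).hom y) c = 0 := by
  classical
  let L : Y.gr.Elt k W m →ₗ[k] (hom (k := k) W (Z.gr.ob c)).X (m' - c.1) :=
    (DFinsupp.lapply c).comp
      (show Y.gr.Elt k W m →ₗ[k] Z.gr.Elt k W m' from ((ψ.1 W).v m m' h).hom)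
  change L y = 0
  rw [← DFinsupp.sum_single (f := y), DFinsupp.sum, map_sum]
  refine Finset.sum_eq_zero fun b _ => ?_
  by_cases hb : b.1 < N
  · rw [hy b hb, DFinsupp.single_zero, map_zero]
  · exact hψ b c (by lia) W m m' h (y b)

lemma IsOneSided.comp {X Y Z : TwMinus k Q} {p q r : ℤ} (h : p + q = r)
    {φ : (hom (k := k) X.tot Y.tot).X p} {ψ : (hom (k := k) Y.tot Z.tot).X q}
    (hφ : IsOneSided φ) (hψ : IsOneSided ψ) :
    IsOneSided (X := X) (Y := Z) (DGCategory.comp p q r h φ ψ) := by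
  intro a c hac W m m' hm x
  have e := Cochain.comp_v (φ.1 W) (ψ.1 W) h m (m + p) m' rfl (by lia)
  refine Eq.trans (congrArg (fun z : Z.gr.Elt k W m' => z c)
    (ConcreteCategory.congr_hom e (DFinsupp.single a x))) ?_
  exact hψ.apply_eq_zero W (m + p) m' (by lia) (a.1 + p)
    (((φ.1 W).v m (m + p) rfl).hom (DFinsupp.single a x))
    (fun b hb => hφ a b (by lia) W m (m + p) rfl x) c (by lia)

lemma comp_mem {X Y Z : TwMinus k Q} (p q r : ℤ) (h : p + q = r) (φ : homSub X Y p)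
    (ψ : homSub Y Z q) : DGCategory.comp p q r h φ.1 ψ.1 ∈ homSub X Z r := by
  refine ⟨φ.2.1.comp h ψ.2.1, ?_⟩
  rw [DGCategory.leibniz p q r (p + 1) (q + 1) (r + 1) h rfl rfl rfl]
  refine (φ.2.1.comp (by lia) ψ.2.2).add ?_
  have := ((φ.2.2).comp (r := r + 1) (by lia) ψ.2.1).smul ((q.negOnePow : ℤ) : k)
  rwa [Int.cast_smul_eq_zsmul] at this

lemma one_mem (X : TwMinus k Q) : (one X.tot : (hom (k := k) X.tot X.tot).X 0) ∈ homSub X X 0 := by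
  refine ⟨fun a b hab W m m' h x => ?_, ?_⟩
  · obtain rfl : m' = m := by lia
    refine Eq.trans (congrArg (fun z : X.gr.Elt k W m' => z b)
      (ConcreteCategory.congr_hom (Cochain.ofHom_v (𝟙 (X.tot.obj W)) m') (DFinsupp.single a x))) ?_
    exact DFinsupp.single_eq_of_ne (by rintro rfl; simp at hab)
  · have := d_one (k := k) X.tot
    have e : ((hom (k := k) X.tot X.tot).d 0 (0 + 1)).hom (one X.tot) = 0 := this
    rw [e]
    exact IsOneSided.zero

/-- The dg-category of bounded above one-sided twisted complexes. -/
instance : DGCategory k (TwMinus k Q) where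
  hom := homComplex
  one X := ⟨one X.tot, one_mem X⟩
  comp p q r h := LinearMap.mk₂ k
    (fun φ ψ => ⟨DGCategory.comp p q r h φ.1 ψ.1, comp_mem p q r h φ ψ⟩)
    (fun _ _ _ => Subtype.ext (LinearMap.map_add₂ _ _ _ _))
    (fun _ _ _ => Subtype.ext (LinearMap.map_smul₂ _ _ _ _))
    (fun _ _ _ => Subtype.ext (map_add _ _ _))
    (fun _ _ _ => Subtype.ext (map_smul _ _ _))
  d_one X := Subtype.ext (d_one (k := k) X.tot)
  one_comp p f := Subtype.ext (one_comp p f.1)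
  comp_one p f := Subtype.ext (comp_one p f.1)
  assoc p q r pq qr s hpq hqr hs hs' f g h :=
    Subtype.ext (DGCategory.assoc p q r pq qr s hpq hqr hs hs' f.1 g.1 h.1)
  leibniz p q r p' q' r' h hp hq hr f g :=
    Subtype.ext (DGCategory.leibniz p q r p' q' r' h hp hq hr f.1 g.1)

variable (k Q) in
/-- The totalisation dg-functor. -/
def Tot : DGFunctor k (TwMinus k Q) (DGModule k Q) where
  obj X := X.tot
  map X Y :=
    { f := fun p => ModuleCat.ofHom (Y := (hom (k := k) X.tot Y.tot).X p) (homSub X Y p).subtype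
      comm' := fun _ _ _ => rfl }
  map_one _ := rfl
  map_comp _ _ _ _ _ _ := rfl

end TwMinus

end TwistedComplexes

section Comparison

variable {k : Type v} [CommRing k]

namespace DGModule

variable {Q : Type v} [DGCategory k Q]

/-- The aisle `≤ n` of the standard t-structure: `Hⁱ(M) = 0` for `i > n`. -/
def StdLE (n : ℤ) (M : DGModule k Q) : Prop := ∀ i, n < i → ∀ W, (M.obj W).ExactAt i

/-- The co-aisle `≥ n` of the standard t-structure: `Hⁱ(M) = 0` for `i < n`. -/
def StdGE (n : ℤ) (M : DGModule k Q) : Prop := ∀ i, i < n → ∀ W, (M.obj W).ExactAt i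

/-- The objects of `hproj⁻(Q)^hfp`: the homotopically finitely presented h-projective dg-modules
whose cohomology is bounded above. -/
structure IsHProjMinusHfp (M : DGModule k Q) : Prop where
  hproj : M.IsHProjective
  hfp : M.IsHfp
  bounded : ∃ n, M.StdLE n

end DGModule

namespace TStructure

variable {A : Type v} [DGCategory k A] (t : TStructure k A)

/-- The dg-category `A⁻`. -/
abbrev Minus := Subtype t.minus

/-- The dg-category `DGProj(A)` of derived projectives. -/
abbrev DGProj := Subtype t.dgProj

/-- The dg-functor `X ↦ A(j(-), X)` from `A⁻` to dg-modules over `Q = DGProj(A)`, where `j` is the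
inclusion of `Q` in `A`. -/
def comparison : DGFunctor k t.Minus (DGModule k t.DGProj) :=
  (incl k t.minus).comp (restrictedYoneda (incl k t.dgProj))

/-- The bimodule `(M, X) ↦ C_dg(Q)(M, A(j(-), X))`, where `M` runs through the
dg-modules over `Q` satisfying `P`. -/
def comparisonBimodule (P : DGModule k t.DGProj → Prop) : DGBimodule k t.Minus (Subtype P) :=
  DGBimodule.ofFunctors t.comparison (incl k P)

/-- The bimodule `(Y, X) ↦ C_dg(Q)(Tot Y, A(j(-), X))`, where `Y` runs through the bounded above
one-sided twisted complexes over `Q`. -/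
def comparisonBimoduleTw : DGBimodule k t.Minus (TwMinus k t.DGProj) :=
  DGBimodule.ofFunctors t.comparison (TwMinus.Tot k t.DGProj)

/-- t-exactness of a quasi-functor from `A⁻` to h-projective dg-modules over `Q`: it maps
`H⁰(A⁻)_{≤ n}` and `H⁰(A⁻)_{≥ n}` to the aisle and to the co-aisle of the standard t-structure.
The objects that the quasi-functor assigns to `X` are the `M` that quasi-represent `T(-, X)`. -/
def IsTExact {Q : Type v} [DGCategory k Q]
    (T : DGBimodule k t.Minus {M : DGModule k Q // M.IsHProjective}) : Prop :=
  ∀ (n : ℤ) (X : t.Minus) (M : {M : DGModule k Q // M.IsHProjective}),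
    Nonempty (T.Representation M X) →
      (t.le n (H0.of X.1) → M.1.StdLE n) ∧ (t.ge n (H0.of X.1) → M.1.StdGE n)

end TStructure

end Comparison

end DG

end

set_option autoImplicit false

noncomputable section

namespace DG

section Complexes

variable {k : Type u} [CommRing k]

/-- The cycle given by a cocycle. -/
def toCycle (K : CochainComplex (ModuleCat.{v} k) ℤ) (i : ℤ) :
    LinearMap.ker (K.d i (i + 1)).hom →ₗ[k] K.cycles i :=
  (K.liftCycles (ModuleCat.ofHom (LinearMap.ker (K.d i (i + 1)).hom).subtype)
    (i + 1) (by simp) (by ext x; exact x.2)).hom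

lemma iCycles_toCycle (K : CochainComplex (ModuleCat.{v} k) ℤ) (i : ℤ)
    (x : LinearMap.ker (K.d i (i + 1)).hom) : (K.iCycles i).hom (toCycle K i x) = x.1 :=
  ConcreteCategory.congr_hom (K.liftCycles_i
    (ModuleCat.ofHom (LinearMap.ker (K.d i (i + 1)).hom).subtype)
    (i + 1) (by simp) (by ext x; exact x.2)) x

/-- The class in cohomology of a cocycle. -/
def cohClass (K : CochainComplex (ModuleCat.{v} k) ℤ) (i : ℤ) :
    LinearMap.ker (K.d i (i + 1)).hom →ₗ[k] K.homology i :=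
  (K.homologyπ i).hom ∘ₗ toCycle K i

variable {K L : CochainComplex (ModuleCat.{v} k) ℤ}

lemma cohClass_surjective (i : ℤ) : Function.Surjective (cohClass K i) := by
  intro y
  obtain ⟨z, rfl⟩ := (ModuleCat.epi_iff_surjective (K.homologyπ i)).1 inferInstance y
  refine ⟨⟨(K.iCycles i).hom z, ?_⟩, ?_⟩
  · exact ConcreteCategory.congr_hom (K.iCycles_d i (i + 1)) z
  · refine congrArg (K.homologyπ i).hom ?_
    refine (ModuleCat.mono_iff_injective (K.iCycles i)).1 inferInstance ?_
    exact iCycles_toCycle K i _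

lemma cohClass_eq_zero_iff {i j : ℤ} (h : j + 1 = i) (x : LinearMap.ker (K.d i (i + 1)).hom) :
    cohClass K i x = 0 ↔ ∃ y, (K.d j i).hom y = x.1 := by
  obtain rfl : j = i - 1 := by omega
  have hex : (ShortComplex.mk (K.toCycles (i - 1) i) (K.homologyπ i) (by simp)).Exact :=
    ShortComplex.exact_of_g_is_cokernel _ (K.homologyIsCokernel (i - 1) i (by simp))
  constructor
  · intro hx
    obtain ⟨y, hy⟩ := (ShortComplex.moduleCat_exact_iff _).1 hex _ hx
    refine ⟨y, ?_⟩
    rw [← iCycles_toCycle K i x]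
    refine Eq.trans ?_ (congrArg (K.iCycles i).hom hy)
    exact (ConcreteCategory.congr_hom (K.toCycles_i (i - 1) i) y).symm
  · rintro ⟨y, hy⟩
    have e : (K.toCycles (i - 1) i).hom y =
        toCycle K i x := by
      refine (ModuleCat.mono_iff_injective (K.iCycles i)).1 inferInstance ?_
      refine Eq.trans ?_ (iCycles_toCycle K i x).symm
      exact (ConcreteCategory.congr_hom (K.toCycles_i (i - 1) i) y).trans hy
    refine (congrArg (K.homologyπ i).hom e).symm.trans ?_
    exact ConcreteCategory.congr_hom (K.toCycles_comp_homologyπ (i - 1) i) y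

/-- A morphism of complexes commutes with the differentials, on elements. -/
lemma hom_d_apply (φ : K ⟶ L) (i j : ℤ) (x : K.X i) :
    (L.d i j).hom ((φ.f i).hom x) = (φ.f j).hom ((K.d i j).hom x) :=
  ConcreteCategory.congr_hom (φ.comm i j) x

lemma d_d_apply (K : CochainComplex (ModuleCat.{v} k) ℤ) (i j l : ℤ) (x : K.X i) :
    (K.d j l).hom ((K.d i j).hom x) = 0 :=
  ConcreteCategory.congr_hom (K.d_comp_d i j l) x

lemma homologyMap_cohClass (φ : K ⟶ L) (i : ℤ) (x : LinearMap.ker (K.d i (i + 1)).hom) :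
    (HomologicalComplex.homologyMap φ i).hom (cohClass K i x) =
      cohClass L i ⟨(φ.f i).hom x.1, by
        rw [LinearMap.mem_ker, hom_d_apply, x.2, map_zero]⟩ := by
  refine Eq.trans (ConcreteCategory.congr_hom (HomologicalComplex.homologyπ_naturality φ i) _) ?_
  refine congrArg (L.homologyπ i).hom ?_
  refine (ModuleCat.mono_iff_injective (L.iCycles i)).1 inferInstance ?_
  refine Eq.trans (ConcreteCategory.congr_hom (HomologicalComplex.cyclesMap_i φ i) _) ?_
  refine Eq.trans (congrArg (φ.f i).hom (iCycles_toCycle K i x)) ?_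
  exact (iCycles_toCycle L i ⟨(φ.f i).hom x.1, by
        rw [LinearMap.mem_ker, hom_d_apply, x.2, map_zero]⟩).symm

lemma exactAt_iff {i j l : ℤ} (h : j + 1 = i) (h' : i + 1 = l) :
    K.ExactAt i ↔ ∀ x : K.X i, (K.d i l).hom x = 0 → ∃ y, (K.d j i).hom y = x := by
  obtain rfl : j = i - 1 := by omega
  subst h'
  rw [K.exactAt_iff' (i - 1) i (i + 1) (by simp) (by simp), ShortComplex.moduleCat_exact_iff]
  rfl

/-- The vanishing of the cohomology in degree `n` of the cone of a morphism of complexes. -/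
def ConeExactAt (φ : K ⟶ L) (n : ℤ) : Prop :=
  ∀ (m n' n'' : ℤ) (_ : m + 1 = n) (_ : n + 1 = n') (_ : n' + 1 = n'') (x : K.X n') (z : L.X n),
    (K.d n' n'').hom x = 0 → (φ.f n').hom x = (L.d n n').hom z →
      ∃ (x' : K.X n) (z' : L.X m), (K.d n n').hom x' = x ∧ z = (φ.f n).hom x' + (L.d m n).hom z'

lemma coneExactAt_iff (φ : K ⟶ L) (n : ℤ) : ConeExactAt φ n ↔
    (∀ x : K.X (n + 1), (K.d (n + 1) (n + 2)).hom x = 0 →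
      ∀ z : L.X n, (φ.f (n + 1)).hom x = (L.d n (n + 1)).hom z → ∃ x', (K.d n (n + 1)).hom x' = x) ∧
    (∀ z : L.X n, (L.d n (n + 1)).hom z = 0 → ∃ (x' : K.X n) (z' : L.X (n - 1)),
      (K.d n (n + 1)).hom x' = 0 ∧ z = (φ.f n).hom x' + (L.d (n - 1) n).hom z') := by
  constructor
  · intro H
    refine ⟨fun x hx z hz => ?_, fun z hz => ?_⟩
    · obtain ⟨x', z', h, -⟩ := H (n - 1) (n + 1) (n + 2) (by omega) rfl (by omega) x z hx hz
      exact ⟨x', h⟩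
    · obtain ⟨x', z', h, h'⟩ := H (n - 1) (n + 1) (n + 2) (by omega) rfl (by omega) 0 z
        (map_zero _) (by rw [hz, map_zero])
      exact ⟨x', z', h, h'⟩
  · rintro ⟨h1, h2⟩ m n' n'' hm rfl hn'' x z hx hz
    obtain rfl : m = n - 1 := by omega
    obtain rfl : n'' = n + 2 := by omega
    obtain ⟨x', hx'⟩ := h1 x hx z hz
    obtain ⟨y, z', hy, hz'⟩ := h2 (z - (φ.f n).hom x') (by
      rw [map_sub, hom_d_apply, hx', hz, sub_self])
    refine ⟨x' + y, z', by rw [map_add, hx', hy, add_zero], ?_⟩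
    rw [map_add, add_assoc, ← hz']
    abel

lemma quasiIsoAt_iff_injective_surjective (φ : K ⟶ L) (i : ℤ) : QuasiIsoAt φ i ↔
    Function.Injective (HomologicalComplex.homologyMap φ i).hom ∧
      Function.Surjective (HomologicalComplex.homologyMap φ i).hom := by
  rw [quasiIsoAt_iff_isIso_homologyMap, ConcreteCategory.isIso_iff_bijective]
  rfl

lemma injective_homologyMap_iff (φ : K ⟶ L) {i j l : ℤ} (hj : j + 1 = i) (hl : i + 1 = l) :
    Function.Injective (HomologicalComplex.homologyMap φ i).hom ↔
    ∀ x : K.X i, (K.d i l).hom x = 0 → ∀ z : L.X j, (φ.f i).hom x = (L.d j i).hom z →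
      ∃ x', (K.d j i).hom x' = x := by
  subst hl
  rw [injective_iff_map_eq_zero]
  constructor
  · intro H x hx z hz
    refine (cohClass_eq_zero_iff hj ⟨x, hx⟩).1 (H _ ?_)
    rw [homologyMap_cohClass]
    exact (cohClass_eq_zero_iff hj _).2 ⟨z, hz.symm⟩
  · intro H y hy
    obtain ⟨x, rfl⟩ := cohClass_surjective i y
    rw [homologyMap_cohClass] at hy
    obtain ⟨z, hz⟩ := (cohClass_eq_zero_iff hj _).1 hy
    exact (cohClass_eq_zero_iff hj x).2 (H x.1 x.2 z hz.symm)

lemma surjective_homologyMap_iff (φ : K ⟶ L) {i j l : ℤ} (hj : j + 1 = i) (hl : i + 1 = l) :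
    Function.Surjective (HomologicalComplex.homologyMap φ i).hom ↔
    ∀ z : L.X i, (L.d i l).hom z = 0 → ∃ (x' : K.X i) (z' : L.X j),
      (K.d i l).hom x' = 0 ∧ z = (φ.f i).hom x' + (L.d j i).hom z' := by
  subst hl
  constructor
  · intro H z hz
    obtain ⟨y, hy⟩ := H (cohClass L i ⟨z, hz⟩)
    obtain ⟨x, rfl⟩ := cohClass_surjective i y
    rw [homologyMap_cohClass, ← sub_eq_zero, ← map_sub] at hy
    obtain ⟨z', hz'⟩ := (cohClass_eq_zero_iff hj _).1 hy
    refine ⟨x.1, -z', x.2, ?_⟩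
    rw [map_neg, hz']
    simp
  · intro H y
    obtain ⟨z, rfl⟩ := cohClass_surjective i y
    obtain ⟨x, z', hx, hz⟩ := H z.1 z.2
    refine ⟨cohClass K i ⟨x, hx⟩, ?_⟩
    rw [homologyMap_cohClass, ← sub_eq_zero, ← map_sub]
    refine (cohClass_eq_zero_iff hj _).2 ⟨-z', ?_⟩
    rw [map_neg]
    simp [hz]

lemma quasiIso_iff_coneExactAt (φ : K ⟶ L) : QuasiIso φ ↔ ∀ n, ConeExactAt φ n := by
  simp only [quasiIso_iff, quasiIsoAt_iff_injective_surjective, coneExactAt_iff]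
  constructor
  · exact fun H n => ⟨(injective_homologyMap_iff φ rfl (by omega)).1 (H (n + 1)).1,
      (surjective_homologyMap_iff φ (by omega) rfl).1 (H n).2⟩
  · refine fun H n => ⟨(injective_homologyMap_iff φ (j := n - 1) (l := n + 1) (by omega) rfl).2 ?_,
      (surjective_homologyMap_iff φ (by omega) rfl).2 (H n).2⟩
    have := (H (n - 1)).1
    rw [show n - 1 + 1 = n by omega, show n - 1 + 2 = n + 1 by omega] at this
    exact this

lemma ConeExactAt.of_homotopic {φ ψ : K ⟶ L} {n : ℤ} (hφ : ConeExactAt φ n)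
    (s : ∀ p q : ℤ, q + 1 = p → (K.X p →ₗ[k] L.X q))
    (hs : ∀ (p q r : ℤ) (h : p + 1 = q) (h' : r + 1 = p) (x : K.X p), (φ.f p).hom x - (ψ.f p).hom x =
      (L.d r p).hom (s p r h' x) + s q p h ((K.d p q).hom x)) : ConeExactAt ψ n := by
  intro m n' n'' hm hn' hn'' x z hx hz
  have h1 := hs n' n'' n hn'' hn' x
  rw [hx, map_zero, add_zero, sub_eq_iff_eq_add, hz, ← map_add] at h1
  obtain ⟨x', z', h2, h3⟩ := hφ m n' n'' hm hn' hn'' x _ hx h1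
  refine ⟨x', z' + s n m hm x', h2, ?_⟩
  have h4 := hs n n' m hn' hm x'
  rw [h2] at h4
  rw [map_add, ← add_assoc, add_right_comm, ← sub_eq_iff_eq_add']
  rw [sub_eq_iff_eq_add] at h4
  rw [h4] at h3
  rw [← sub_eq_zero] at h3 ⊢
  rw [← h3]
  abel

/-- The middle morphism of a morphism of (shifted) degreewise short exact sequences is a
quasi-isomorphism if the outer ones are. -/
lemma quasiIso_of_extension {K₁ K₂ L₁ L₂ : CochainComplex (ModuleCat.{v} k) ℤ}
    {φ : K ⟶ L} {φ₁ : K₁ ⟶ L₁} {φ₂ : K₂ ⟶ L₂} (h₁ : QuasiIso φ₁) (h₂ : QuasiIso φ₂)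
    (e₁ e₂ : ℤ) (ε : ℤˣ)
    (i : ∀ n m : ℤ, m = n + e₁ → (K₁.X m →ₗ[k] K.X n))
    (i' : ∀ n m : ℤ, m = n + e₁ → (L₁.X m →ₗ[k] L.X n))
    (π : ∀ n m : ℤ, m = n + e₂ → (K.X n →ₗ[k] K₂.X m))
    (π' : ∀ n m : ℤ, m = n + e₂ → (L.X n →ₗ[k] L₂.X m))
    (hi : ∀ n m h n' m' h', ∀ x, (K.d n n').hom (i n m h x) = i n' m' h' ((K₁.d m m').hom x))
    (hi' : ∀ n m h n' m' h', ∀ x, (L.d n n').hom (i' n m h x) = i' n' m' h' ((L₁.d m m').hom x))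
    (hπ : ∀ n m h n' m' h', ∀ x, π n' m' h' ((K.d n n').hom x) = ε • (K₂.d m m').hom (π n m h x))
    (hπ' : ∀ n m h n' m' h', ∀ x, π' n' m' h' ((L.d n n').hom x) = ε • (L₂.d m m').hom (π' n m h x))
    (exK : ∀ n m h l h', ∀ x, π n m h x = 0 → ∃ y, i n l h' y = x)
    (exL : ∀ n m h l h', ∀ x, π' n m h x = 0 → ∃ y, i' n l h' y = x)
    (injK : ∀ n l h', ∀ y, i n l h' y = 0 → y = 0)
    (injL : ∀ n l h', ∀ y, i' n l h' y = 0 → y = 0)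
    (surK : ∀ n m h, Function.Surjective (π n m h))
    (surL : ∀ n m h, Function.Surjective (π' n m h))
    (cmi : ∀ n l h', ∀ y, (φ.f n).hom (i n l h' y) = i' n l h' ((φ₁.f l).hom y))
    (cmπ : ∀ n m h, ∀ x, π' n m h ((φ.f n).hom x) = (φ₂.f m).hom (π n m h x)) : QuasiIso φ := by
  rw [quasiIso_iff_coneExactAt] at h₁ h₂ ⊢
  intro n m n' n'' hm hn' hn'' x z hx hz
  have εε : ∀ {M : Type v} [AddCommGroup M] (y : M), ε • ε • y = y := fun y => by
    rw [smul_smul, Int.units_mul_self, one_smul]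
  obtain ⟨α, γ, hα, hγ⟩ := h₂ (n + e₂) (m + e₂) (n' + e₂) (n'' + e₂) (by omega) (by omega) (by omega)
    (π n' _ rfl x) (ε • π' n _ rfl z) (by
      have := hπ n' _ rfl n'' _ rfl x
      rw [hx, map_zero] at this
      rw [← εε ((K₂.d _ _).hom _), ← this, smul_zero]) (by
      rw [← cmπ, hz, hπ' n _ rfl n' _ rfl z, Units.smul_def, Units.smul_def, map_zsmul])
  obtain ⟨a, ha⟩ := surK n _ rfl (ε • α)
  obtain ⟨c, hc⟩ := surL m _ rfl γ
  obtain ⟨b, hb⟩ := exK n' _ rfl _ rfl (x - (K.d n n').hom a) (by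
    rw [map_sub, hπ n _ rfl n' _ rfl, ha, Units.smul_def, Units.smul_def, map_zsmul,
      ← Units.smul_def, ← Units.smul_def, εε, hα, sub_self])
  obtain ⟨t, ht⟩ := exL n _ rfl _ rfl (z - (φ.f n).hom a - (L.d m n).hom c) (by
    rw [map_sub, map_sub, cmπ, hπ' m _ rfl n _ rfl, ha, hc, Units.smul_def, Units.smul_def,
      map_zsmul, ← Units.smul_def, ← Units.smul_def, ← εε (π' n _ rfl z), hγ, smul_add]
    abel)
  have hbx : (K₁.d (n' + e₁) (n'' + e₁)).hom b = 0 := by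
    refine injK n'' _ rfl _ ?_
    rw [← hi n' _ rfl n'' _ rfl, hb, map_sub, hx, d_d_apply, sub_zero]
  obtain ⟨b', t', hb', ht'⟩ := h₁ (n + e₁) (m + e₁) (n' + e₁) (n'' + e₁) (by omega) (by omega) (by omega)
    b t hbx (by
      rw [← sub_eq_zero]
      refine injL n' _ rfl _ ?_
      rw [map_sub, ← cmi, ← hi' n _ rfl n' _ rfl, hb, ht]
      simp only [map_sub, d_d_apply, hz, hom_d_apply, sub_zero, sub_self])
  refine ⟨a + i n _ rfl b', c + i' m _ rfl t', ?_, ?_⟩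
  · rw [map_add, hi n _ rfl n' _ rfl, hb', hb]; abel
  · rw [map_add, map_add, cmi, hi' m _ rfl n _ rfl]
    rw [ht', map_add, sub_sub, eq_sub_iff_add_eq] at ht
    rw [← ht]
    abel

lemma quasiIso_of_injective_surjective (φ : K ⟶ L)
    (h₁ : ∀ (i j l : ℤ), j + 1 = i → i + 1 = l → ∀ (x : K.X i), (K.d i l).hom x = 0 →
      ∀ z : L.X j, (φ.f i).hom x = (L.d j i).hom z → ∃ x', (K.d j i).hom x' = x)
    (h₂ : ∀ (i j l : ℤ), j + 1 = i → i + 1 = l → ∀ z : L.X i, (L.d i l).hom z = 0 →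
      ∃ (x' : K.X i) (z' : L.X j), (K.d i l).hom x' = 0 ∧ z = (φ.f i).hom x' + (L.d j i).hom z') :
    QuasiIso φ := by
  simp only [quasiIso_iff, quasiIsoAt_iff_injective_surjective]
  exact fun i => ⟨(injective_homologyMap_iff φ (by omega) rfl).2 (h₁ i (i - 1) (i + 1) (by omega) rfl),
    (surjective_homologyMap_iff φ (by omega) rfl).2 (h₂ i (i - 1) (i + 1) (by omega) rfl)⟩

lemma exists_of_quasiIso (φ : K ⟶ L) (hφ : QuasiIso φ) {i j l : ℤ} (hj : j + 1 = i) (hl : i + 1 = l)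
    (z : L.X i) (hz : (L.d i l).hom z = 0) :
    ∃ (x' : K.X i) (z' : L.X j), (K.d i l).hom x' = 0 ∧ z = (φ.f i).hom x' + (L.d j i).hom z' := by
  simp only [quasiIso_iff, quasiIsoAt_iff_injective_surjective] at hφ
  exact (surjective_homologyMap_iff φ hj hl).1 (hφ i).2 z hz

lemma boundary_of_quasiIso (φ : K ⟶ L) (hφ : QuasiIso φ) {i j l : ℤ} (hj : j + 1 = i)
    (hl : i + 1 = l) (x : K.X i) (hx : (K.d i l).hom x = 0) (z : L.X j)
    (hz : (φ.f i).hom x = (L.d j i).hom z) : ∃ x', (K.d j i).hom x' = x := by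
  simp only [quasiIso_iff, quasiIsoAt_iff_injective_surjective] at hφ
  exact (injective_homologyMap_iff φ hj hl).1 (hφ i).1 x hx z hz

/-- A morphism of complexes with an inverse up to homotopy. -/
lemma quasiIso_of_homotopyInverse (φ : K ⟶ L) (ψ : L ⟶ K)
    (h₁ : ∀ (i j l : ℤ), j + 1 = i → i + 1 = l → ∀ x : K.X i, (K.d i l).hom x = 0 →
      ∃ y, (ψ.f i).hom ((φ.f i).hom x) - x = (K.d j i).hom y)
    (h₂ : ∀ (i j l : ℤ), j + 1 = i → i + 1 = l → ∀ z : L.X i, (L.d i l).hom z = 0 →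
      ∃ y, (φ.f i).hom ((ψ.f i).hom z) - z = (L.d j i).hom y) : QuasiIso φ := by
  refine quasiIso_of_injective_surjective φ (fun i j l hj hl x hx z hz => ?_)
    (fun i j l hj hl z hz => ?_)
  · obtain ⟨y, hy⟩ := h₁ i j l hj hl x hx
    refine ⟨(ψ.f j).hom z - y, ?_⟩
    rw [map_sub, ← hy, hom_d_apply, hz]
    abel
  · obtain ⟨y, hy⟩ := h₂ i j l hj hl z hz
    refine ⟨(ψ.f i).hom z, -y, ?_, ?_⟩
    · rw [hom_d_apply, hz, map_zero]
    · rw [map_neg, ← hy]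
      abel

lemma quasiIso_of_bijective (φ : K ⟶ L) (h : ∀ i, Function.Bijective (φ.f i).hom) : QuasiIso φ := by
  refine quasiIso_of_injective_surjective φ (fun i j l hj hl x hx z hz => ?_)
    (fun i j l hj hl z hz => ?_)
  · obtain ⟨x', rfl⟩ := (h j).2 z
    refine ⟨x', (h i).1 ?_⟩
    rw [hz, hom_d_apply]
  · obtain ⟨x', rfl⟩ := (h i).2 z
    refine ⟨x', 0, (h l).1 ?_, by simp⟩
    rw [← hom_d_apply, hz, map_zero]

end Complexes

end DG

namespace DG

open DGCategory

section Basic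

variable {k : Type v} [CommRing k] {A : Type u} [DGCategory k A]

/-- Precomposition with a closed morphism of degree `0`. -/
def precomp {X Y : A} (f : Z0 k X Y) (Z : A) : hom (k := k) Y Z ⟶ hom X Z where
  f p := ModuleCat.ofHom (comp 0 p p (zero_add p) f.1)
  comm' p q h := by
    ext g
    have := leibniz 0 p p 1 q q (zero_add p) rfl h h f.1 g
    rw [Z0_d] at this
    simpa using this

/-- Postcomposition with a closed morphism of degree `0`. -/
def postcomp (V : A) {X Y : A} (f : Z0 k X Y) : hom (k := k) V X ⟶ hom V Y where
  f p := ModuleCat.ofHom ((comp p 0 p (add_zero p)).flip f.1)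
  comm' p q h := by
    ext g
    have := leibniz p 0 p q 1 q (add_zero p) h rfl h g f.1
    rw [Z0_d] at this
    simpa using this

lemma precomp_apply {X Y : A} (f : Z0 k X Y) (Z : A) (p : ℤ) (g : (hom (k := k) Y Z).X p) :
    ((precomp f Z).f p).hom g = comp 0 p p (zero_add p) f.1 g := rfl

lemma postcomp_apply (V : A) {X Y : A} (f : Z0 k X Y) (p : ℤ) (g : (hom (k := k) V X).X p) :
    ((postcomp V f).f p).hom g = comp p 0 p (add_zero p) g f.1 := rfl

lemma cls_surjective {X Y : A} (f : (H0.of X : H0 k A) ⟶ H0.of Y) : ∃ g : Z0 k X Y, H0.cls g = f :=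
  Submodule.Quotient.mk_surjective _ f

lemma cls_eq_iff {X Y : A} (f g : Z0 k X Y) :
    H0.cls f = H0.cls g ↔ ∃ s, ((hom X Y).d (-1) 0).hom s = f.1 - g.1 :=
  Submodule.Quotient.eq _

lemma cls_eq_zero_iff {X Y : A} (f : Z0 k X Y) :
    H0.cls f = 0 ↔ ∃ s, ((hom X Y).d (-1) 0).hom s = f.1 :=
  Submodule.Quotient.mk_eq_zero _

lemma cls_comp {X Y Z : A} (f : Z0 k X Y) (g : Z0 k Y Z) :
    H0.cls (Z0.comp f g) = H0.cls f ≫ H0.cls g := rfl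

lemma cls_one (X : A) : H0.cls (Z0.one X : Z0 k X X) = 𝟙 _ := rfl

lemma cls_add {X Y : A} (f g : Z0 k X Y) : H0.cls (f + g) = H0.cls f + H0.cls g := rfl

/-- Composition with a closed morphism of degree `0` is compatible with differentials. -/
lemma d_comp_closed_left {X Y Z : A} (f : Z0 k X Y) (p q : ℤ)
    (g : (hom (k := k) Y Z).X p) :
    ((hom X Z).d p q).hom (comp 0 p p (zero_add p) f.1 g) =
      comp 0 q q (zero_add q) f.1 (((hom Y Z).d p q).hom g) :=
  hom_d_apply (precomp f Z) p q g

lemma d_comp_closed_right {V X Y : A} (f : Z0 k X Y) (p q : ℤ)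
    (g : (hom (k := k) V X).X p) :
    ((hom V Y).d p q).hom (comp p 0 p (add_zero p) g f.1) =
      comp q 0 q (add_zero q) (((hom V X).d p q).hom g) f.1 :=
  hom_d_apply (postcomp V f) p q g

/-- `comp s g` for `g` closed of arbitrary degree. -/
lemma d_comp_of_right_closed {X Y Z : A} {p q r p' r' : ℤ} (h : p + q = r) (hp : p + 1 = p')
    (hr : r + 1 = r') (s : (hom (k := k) X Y).X p) (g : (hom (k := k) Y Z).X q)
    {q' : ℤ} (hq : q + 1 = q')
    (hg : ((hom Y Z).d q q').hom g = 0) :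
    ((hom X Z).d r r').hom (comp p q r h s g) =
      q.negOnePow • comp p' q r' (by lia) (((hom X Y).d p p').hom s) g := by
  rw [leibniz p q r p' q' r' h hp hq hr, hg, map_zero, zero_add]

lemma d_comp_of_left_closed {X Y Z : A} {p q r q' r' : ℤ} (h : p + q = r) (hq : q + 1 = q')
    (hr : r + 1 = r') (f : (hom (k := k) X Y).X p) (t : (hom (k := k) Y Z).X q)
    {p' : ℤ} (hp : p + 1 = p')
    (hf : ((hom X Y).d p p').hom f = 0) :
    ((hom X Z).d r r').hom (comp p q r h f t) =
      comp p q' r' (by lia) f (((hom Y Z).d q q').hom t) := by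
  rw [leibniz p q r p' q' r' h hp hq hr, hf, map_zero, LinearMap.zero_apply, smul_zero, add_zero]

lemma exists_homotopyInverse {X Y : A} (f : Z0 k X Y) [IsIso (H0.cls f)] :
    ∃ g : Z0 k Y X, (∃ s, ((hom X X).d (-1) 0).hom s = (Z0.comp f g).1 - one X) ∧
      ∃ t, ((hom Y Y).d (-1) 0).hom t = (Z0.comp g f).1 - one Y := by
  obtain ⟨g, hg⟩ := cls_surjective (inv (H0.cls f))
  refine ⟨g, (cls_eq_iff (Z0.comp f g) (Z0.one X)).1 ?_, (cls_eq_iff (Z0.comp g f) (Z0.one Y)).1 ?_⟩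
  · rw [cls_comp, hg, IsIso.hom_inv_id, cls_one]
  · rw [cls_comp, hg, IsIso.inv_hom_id, cls_one]

lemma comp_closed_sub_boundary {X Y : A} (f : Z0 k X X)
    (s : (hom (k := k) X X).X (-1)) (hs : ((hom X X).d (-1) 0).hom s = f.1 - one X) {i j l : ℤ}
    (hj : j + 1 = i) (hl : i + 1 = l) (x : (hom (k := k) X Y).X i) (hx : ((hom X Y).d i l).hom x = 0) :
    ∃ y, comp 0 i i (zero_add i) f.1 x - x = ((hom X Y).d j i).hom y := by
  refine ⟨i.negOnePow • comp (-1) i j (by lia) s x, ?_⟩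
  rw [Units.smul_def, map_zsmul, d_comp_of_right_closed (p' := 0) (by lia) rfl hj s x hl hx, hs,
    map_sub, LinearMap.sub_apply, one_comp, Units.smul_def, smul_smul, ← Units.val_mul]
  simp

lemma comp_closed_sub_boundary' {X Y : A} (f : Z0 k Y Y)
    (s : (hom (k := k) Y Y).X (-1)) (hs : ((hom Y Y).d (-1) 0).hom s = f.1 - one Y) {i j l : ℤ}
    (hj : j + 1 = i) (hl : i + 1 = l) (x : (hom (k := k) X Y).X i) (hx : ((hom X Y).d i l).hom x = 0) :
    ∃ y, comp i 0 i (add_zero i) x f.1 - x = ((hom X Y).d j i).hom y := by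
  refine ⟨comp i (-1) j (by lia) x s, ?_⟩
  rw [d_comp_of_left_closed (q' := 0) (by lia) rfl hj x s hl hx, hs, map_sub, comp_one]

lemma quasiIso_precomp {X Y : A} (f : Z0 k X Y) [IsIso (H0.cls f)] (Z : A) :
    QuasiIso (precomp f Z) := by
  obtain ⟨g, ⟨s, hs⟩, t, ht⟩ := exists_homotopyInverse f
  refine quasiIso_of_homotopyInverse _ (precomp g Z) (fun i j l hj hl x hx => ?_)
    (fun i j l hj hl x hx => ?_)
  · obtain ⟨y, hy⟩ := comp_closed_sub_boundary (Z0.comp g f) t ht hj hl x hx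
    refine ⟨y, ?_⟩
    rw [← hy, precomp_apply, precomp_apply]
    exact congrArg (· - x) (DGCategory.assoc 0 0 i 0 i i rfl (by lia) (by lia) (by lia) _ _ _).symm
  · obtain ⟨y, hy⟩ := comp_closed_sub_boundary (Z0.comp f g) s hs hj hl x hx
    refine ⟨y, ?_⟩
    rw [← hy, precomp_apply, precomp_apply]
    exact congrArg (· - x) (DGCategory.assoc 0 0 i 0 i i rfl (by lia) (by lia) (by lia) _ _ _).symm

lemma quasiIso_postcomp (V : A) {X Y : A} (f : Z0 k X Y) [IsIso (H0.cls f)] :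
    QuasiIso (postcomp V f) := by
  obtain ⟨g, ⟨s, hs⟩, t, ht⟩ := exists_homotopyInverse f
  refine quasiIso_of_homotopyInverse _ (postcomp V g) (fun i j l hj hl x hx => ?_)
    (fun i j l hj hl x hx => ?_)
  · obtain ⟨y, hy⟩ := comp_closed_sub_boundary' (Z0.comp f g) s hs hj hl x hx
    refine ⟨y, ?_⟩
    rw [← hy, postcomp_apply, postcomp_apply]
    exact congrArg (· - x) (DGCategory.assoc i 0 0 i 0 i (by lia) (by lia) (by lia) (by lia) _ _ _)
  · obtain ⟨y, hy⟩ := comp_closed_sub_boundary' (Z0.comp g f) t ht hj hl x hx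
    refine ⟨y, ?_⟩
    rw [← hy, postcomp_apply, postcomp_apply]
    exact congrArg (· - x) (DGCategory.assoc i 0 0 i 0 i (by lia) (by lia) (by lia) (by lia) _ _ _)

/-- The Yoneda lemma in the homotopy category. -/
lemma isIso_cls_of_quasiIso_postcomp {X Y : A} (f : Z0 k X Y)
    (h : ∀ V, QuasiIso (postcomp V f)) : IsIso (H0.cls f) := by
  obtain ⟨g, s, hg, hs⟩ := exists_of_quasiIso _ (h Y) (i := 0) (j := -1) rfl (l := 1) rfl (one Y) (d_one Y)
  rw [postcomp_apply] at hs
  have h1 : H0.cls (⟨g, hg⟩ : Z0 k Y X) ≫ H0.cls f = 𝟙 _ := by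
    rw [← cls_comp, ← cls_one, cls_eq_iff]
    refine ⟨-s, ?_⟩
    rw [map_neg]
    change _ = comp 0 0 0 _ g f.1 - one Y
    rw [hs]; abel
  refine ⟨⟨H0.cls ⟨g, hg⟩, ?_, h1⟩⟩
  have h2 : (H0.cls f ≫ H0.cls (⟨g, hg⟩ : Z0 k Y X) - 𝟙 _) ≫ H0.cls f = 0 := by
    rw [Preadditive.sub_comp, Category.assoc, h1]; simp
  obtain ⟨r, hr⟩ := cls_surjective (H0.cls f ≫ H0.cls (⟨g, hg⟩ : Z0 k Y X) - 𝟙 _)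
  rw [← hr, ← cls_comp, cls_eq_zero_iff] at h2
  obtain ⟨t, ht⟩ := h2
  obtain ⟨r', hr'⟩ := boundary_of_quasiIso _ (h X) (i := 0) (j := -1) (l := 1) rfl rfl r.1 r.2 t
    (by rw [ht]; rfl)
  rw [← sub_eq_zero, ← hr, cls_eq_zero_iff]
  exact ⟨r', hr'⟩

lemma coneExactAt_postcomp_of_cls_eq {V X Y : A} {f g : Z0 k X Y} (h : H0.cls f = H0.cls g) {n : ℤ}
    (hf : ConeExactAt (postcomp V f) n) : ConeExactAt (postcomp V g) n := by
  obtain ⟨s, hs⟩ := (cls_eq_iff f g).1 h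
  refine hf.of_homotopic (fun p q hpq => (comp p (-1) q (by lia)).flip s) ?_
  intro p q r h h' x
  rw [postcomp_apply, postcomp_apply, ← map_sub, ← hs]
  rw [LinearMap.flip_apply, LinearMap.flip_apply,
    leibniz p (-1) r q 0 p (by lia) h rfl h' x s]
  simp

lemma quasiIso_postcomp_of_cls_eq {V X Y : A} {f g : Z0 k X Y} (h : H0.cls f = H0.cls g)
    (hf : QuasiIso (postcomp V f)) : QuasiIso (postcomp V g) :=
  (quasiIso_iff_coneExactAt _).2 fun n =>
    coneExactAt_postcomp_of_cls_eq h ((quasiIso_iff_coneExactAt _).1 hf n)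

end Basic

namespace DGBimodule

variable {k : Type v} [CommRing k] {A : Type u₁} [DGCategory k A] {B : Type u₂} [DGCategory k B]
  (T : DGBimodule k A B)

/-- The morphism of complexes `A(a, a') → T(b, a')`, `f ↦ f · x`, given by a closed element `x` of
degree `0` of `T(b, a)`. -/
def evalHomLeft {b : B} {a : A} (x : (T.obj b a).X 0) (hx : ((T.obj b a).d 0 1).hom x = 0) (a' : A) :
    hom (k := k) a a' ⟶ T.obj b a' where
  f p := ModuleCat.ofHom ((T.actL p 0 p (add_zero p)).flip x)
  comm' p p' hp := by
    ext g
    have := T.leibnizL p 0 p p' 1 p' (add_zero p) hp rfl hp g x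
    rw [hx] at this
    simpa using this

lemma Graph.fst_isQuasiEquivalence (hT : T.IsQuasiFunctor) :
    (Graph.fst T).IsQuasiEquivalence where
  quasiIso E E' := by
    rw [quasiIso_iff_coneExactAt]
    rintro n m n' n'' hm hn' hn'' ⟨f, g, s⟩ (z : (hom (k := k) E.a E'.a).X n) hx hz
    obtain rfl : n = n' - 1 := by lia
    obtain rfl : m = n' - 1 - 1 := by lia
    have hx' := (Graph.homComplex_d n' n'' hn'' f g s).symm.trans hx
    have h2 : ((hom E.b E'.b).d n' n'').hom g = 0 := congrArg (fun w => w.2.1) hx'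
    have h3 : T.actL n' 0 (n'' - 1) (by lia) f E.rep.x - T.actR 0 n' (n'' - 1) (by lia) E'.rep.x g -
      ((T.obj E.b E'.a).d (n' - 1) (n'' - 1)).hom s = 0 := congrArg (fun w => w.2.2) hx'
    obtain rfl : n'' = n' + 1 := hn''.symm
    have h3' : T.actL n' 0 n' (by lia) f E.rep.x - T.actR 0 n' n' (by lia) E'.rep.x g -
      ((T.obj E.b E'.a).d (n' - 1) n').hom s = 0 := by
      have e : n' + 1 - 1 = n' := by lia
      rw! [e] at h3
      exact h3
    change f = ((hom E.a E'.a).d (n' - 1) n').hom z at hz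
    have h4 := T.leibnizL (n' - 1) 0 (n' - 1) n' 1 n' (by lia) (by lia) rfl (by lia) z E.rep.x
    rw [E.rep.closed, map_zero, smul_zero, add_zero] at h4
    obtain ⟨g', t, h5, h6⟩ := (quasiIso_iff_coneExactAt _).1 (E'.rep.quasiIso E.b) (n' - 1)
      (n' - 1 - 1) n' (n' + 1) hm hn' rfl g
      (T.actL (n' - 1) 0 (n' - 1) (by lia) z E.rep.x - s) h2 (by
        rw [map_sub, h4, ← sub_eq_zero, ← neg_eq_zero, ← h3', hz]
        change -(T.actR 0 n' n' _ E'.rep.x g - _) = _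
        abel)
    refine ⟨(z, g', t), 0, ?_, ?_⟩
    · refine (Graph.homComplex_d (n' - 1) n' hn' z g' t).trans
        (Prod.ext hz.symm (Prod.ext h5 ?_))
      change _ = T.actR 0 (n' - 1) (n' - 1) _ E'.rep.x g' + _ at h6
      change _ - T.actR 0 (n' - 1) (n' - 1) _ E'.rep.x g' - _ = s
      rw [sub_eq_iff_eq_add] at h6
      rw [h6]
      abel
    · rw [map_zero, add_zero]
      rfl
  essSurj a := by
    obtain ⟨b, ⟨r⟩⟩ := hT a
    exact ⟨⟨a, b, r⟩, ⟨Iso.refl _⟩⟩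

/-- The projection of the graph to the target of a quasi-functor is a quasi-equivalence if the
quasi-functor is quasi-fully faithful and quasi-essentially surjective. -/
lemma Graph.snd_isQuasiEquivalence
    (hf : ∀ (E : T.Graph) (a' : A), QuasiIso (T.evalHomLeft E.rep.x E.rep.closed a'))
    (hs : ∀ b : B, ∃ E : T.Graph, Nonempty ((H0.of E.b : H0 k B) ≅ H0.of b)) :
    (Graph.snd T).IsQuasiEquivalence where
  quasiIso E E' := by
    rw [quasiIso_iff_coneExactAt]
    rintro n m n' n'' hm hn' hn'' ⟨f, g, s⟩ (z : (hom (k := k) E.b E'.b).X n) hx hz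
    obtain rfl : n = n' - 1 := by lia
    obtain rfl : m = n' - 1 - 1 := by lia
    have hx' := (Graph.homComplex_d n' n'' hn'' f g s).symm.trans hx
    have h2 : ((hom E.a E'.a).d n' n'').hom f = 0 := congrArg (fun w => w.1) hx'
    have h3 : T.actL n' 0 (n'' - 1) (by lia) f E.rep.x - T.actR 0 n' (n'' - 1) (by lia) E'.rep.x g -
      ((T.obj E.b E'.a).d (n' - 1) (n'' - 1)).hom s = 0 := congrArg (fun w => w.2.2) hx'
    obtain rfl : n'' = n' + 1 := hn''.symm
    have h3' : T.actL n' 0 n' (by lia) f E.rep.x - T.actR 0 n' n' (by lia) E'.rep.x g -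
      ((T.obj E.b E'.a).d (n' - 1) n').hom s = 0 := by
      have e : n' + 1 - 1 = n' := by lia
      rw! [e] at h3
      exact h3
    change g = ((hom E.b E'.b).d (n' - 1) n').hom z at hz
    have h4 := T.leibnizR 0 (n' - 1) (n' - 1) 1 n' n' (by lia) rfl (by lia) (by lia) E'.rep.x z
    rw [E'.rep.closed, map_zero, LinearMap.zero_apply, zero_add, Int.negOnePow_zero, one_smul] at h4
    obtain ⟨f', t, h5, h6⟩ := (quasiIso_iff_coneExactAt _).1 (hf E E'.a) (n' - 1)
      (n' - 1 - 1) n' (n' + 1) hm hn' rfl f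
      (T.actR 0 (n' - 1) (n' - 1) (by lia) E'.rep.x z + s) h2 (by
        rw [map_add, h4, ← sub_eq_zero, ← h3', hz]
        change T.actL n' 0 n' _ f E.rep.x - _ = _
        abel)
    refine ⟨(f', z, -t), 0, ?_, ?_⟩
    · refine (Graph.homComplex_d (n' - 1) n' hn' f' z (-t)).trans
        (Prod.ext h5 (Prod.ext hz.symm ?_))
      change _ = T.actL (n' - 1) 0 (n' - 1) _ f' E.rep.x + _ at h6
      change T.actL (n' - 1) 0 (n' - 1) _ f' E.rep.x - _ - _ = s
      rw [← eq_sub_iff_add_eq'] at h6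
      rw [h6, map_neg]
      abel
    · rw [map_zero, add_zero]
      rfl
  essSurj b := hs b

lemma isQuasiEquivalence_ulift {F : DGFunctor k A B} (hF : F.IsQuasiEquivalence) :
    (F.ulift : DGFunctor k A (ULift.{u₃} B)).IsQuasiEquivalence where
  quasiIso X Y := hF.quasiIso X Y
  essSurj Y := by
    obtain ⟨X, ⟨e⟩⟩ := hF.essSurj Y.down
    exact ⟨X, ⟨⟨e.hom, e.inv, e.hom_inv_id, e.inv_hom_id⟩⟩⟩

lemma inducesIsoInHqe (h₁ : (Graph.fst T).IsQuasiEquivalence)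
    (h₂ : (Graph.snd T).IsQuasiEquivalence) : T.InducesIsoInHqe := by
  have i₁ := (quasiEquivalences k).Q_inverts
    (X := DGCat.of T.Graph) (Y := DGCat.of (ULift.{max u₂ v} A)) (Graph.fst T).ulift
    (isQuasiEquivalence_ulift h₁)
  have i₂ := (quasiEquivalences k).Q_inverts
    (X := DGCat.of T.Graph) (Y := DGCat.of (ULift.{max u₁ v} B)) (Graph.snd T).ulift
    (isQuasiEquivalence_ulift h₂)
  refine ⟨(@asIso _ _ _ _ _ i₁).symm ≪≫ @asIso _ _ _ _ _ i₂, ?_⟩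
  rw [Iso.trans_hom, Iso.symm_hom]
  exact (@asIso _ _ _ _ _ i₁).hom_inv_id_assoc _

end DGBimodule

end DG

namespace DG

open DGCategory

/-- Transport along an equality of degrees. -/
def castX {k : Type u} [CommRing k] (K : CochainComplex (ModuleCat.{v} k) ℤ) {p q : ℤ} (h : p = q) :
    K.X p →ₗ[k] K.X q := (K.XIsoOfEq h).hom.hom

@[simp]
lemma castX_rfl {k : Type u} [CommRing k] (K : CochainComplex (ModuleCat.{v} k) ℤ) {p : ℤ}
    (h : p = p) (x : K.X p) : castX K h x = x := by
  simp [castX]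

namespace DGModule

variable {k : Type v} [CommRing k] {A : Type v} [DGCategory k A] {M N L : DGModule k A}

/-- The values of a morphism of dg-modules. -/
def ap {n : ℤ} (φ : (hom (k := k) M N).X n) (W : A) (p q : ℤ) (h : p + n = q) :
    (M.obj W).X p →ₗ[k] (N.obj W).X q := ((φ.1 W).v p q h).hom

lemma hom_ext' {n : ℤ} {φ ψ : (hom (k := k) M N).X n}
    (h : ∀ W p q hpq x, ap φ W p q hpq x = ap ψ W p q hpq x) : φ = ψ := by
  refine Subtype.ext (funext fun W => ?_)
  ext p q hpq x
  exact h W p q hpq x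

/-- A morphism of dg-modules from its values. -/
def homMk (n : ℤ) (F : ∀ (W : A) (p q : ℤ), p + n = q → ((M.obj W).X p →ₗ[k] (N.obj W).X q))
    (hF : ∀ (V W : A) (p q r p' r' : ℤ) (h : p + q = r) (hp : p + n = p') (hr : r + n = r')
      (x : (M.obj W).X p) (f : (hom (k := k) V W).X q),
      F V r r' hr (M.act p q r h x f) = N.act p' q r' (by omega) (F W p p' hp x) f) :
    (hom (k := k) M N).X n :=
  ⟨fun W => Cochain.mk fun p q h => ModuleCat.ofHom (F W p q h), fun V W p q r p' r' h hp hr x f =>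
    hF V W p q r p' r' h hp hr x f⟩

lemma ap_homMk (n : ℤ) (F : ∀ (W : A) (p q : ℤ), p + n = q → ((M.obj W).X p →ₗ[k] (N.obj W).X q)) (hF)
    (W : A) (p q : ℤ) (h : p + n = q) : ap (homMk (M := M) (N := N) n F hF) W p q h = F W p q h := rfl

lemma ap_act {n : ℤ} (φ : (hom (k := k) M N).X n) {V W : A} (p q r p' r' : ℤ) (h : p + q = r)
    (hp : p + n = p') (hr : r + n = r') (x : (M.obj W).X p) (f : (hom (k := k) V W).X q) :
    ap φ V r r' hr (M.act p q r h x f) = N.act p' q r' (by omega) (ap φ W p p' hp x) f :=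
  φ.2 V W p q r p' r' h hp hr x f

@[simp] lemma ap_zero {n : ℤ} (W : A) (p q : ℤ) (h : p + n = q) :
    ap (0 : (hom (k := k) M N).X n) W p q h = 0 := rfl

@[simp] lemma ap_add {n : ℤ} (φ ψ : (hom (k := k) M N).X n) (W : A) (p q : ℤ) (h : p + n = q) :
    ap (φ + ψ) W p q h = ap φ W p q h + ap ψ W p q h := rfl

@[simp] lemma ap_sub {n : ℤ} (φ ψ : (hom (k := k) M N).X n) (W : A) (p q : ℤ) (h : p + n = q) :
    ap (φ - ψ) W p q h = ap φ W p q h - ap ψ W p q h := rfl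

@[simp] lemma ap_neg {n : ℤ} (φ : (hom (k := k) M N).X n) (W : A) (p q : ℤ) (h : p + n = q) :
    ap (-φ) W p q h = - ap φ W p q h := rfl

@[simp] lemma ap_units_smul {n : ℤ} (ε : ℤˣ) (φ : (hom (k := k) M N).X n) (W : A) (p q : ℤ)
    (h : p + n = q) : ap (ε • φ) W p q h = ε • ap φ W p q h := by
  rcases Int.units_eq_one_or ε with rfl | rfl
  · simp
  · simp [Units.neg_smul]

lemma ap_one (W : A) (p q : ℤ) (h : p + 0 = q) (x : (M.obj W).X p) :
    ap (one M : (hom (k := k) M M).X 0) W p q h x = castX _ (by omega) x := by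
  obtain rfl : p = q := by omega
  rw [castX_rfl]
  exact ConcreteCategory.congr_hom (Cochain.ofHom_v (𝟙 (M.obj W)) p) x

lemma ap_comp {a b c : ℤ} (h : a + b = c) (φ : (hom (k := k) M N).X a) (ψ : (hom (k := k) N L).X b)
    (W : A) (p q r : ℤ) (hpr : p + c = r) (hpq : p + a = q) (x : (M.obj W).X p) :
    ap (comp a b c h φ ψ) W p r hpr x = ap ψ W q r (by omega) (ap φ W p q hpq x) :=
  ConcreteCategory.congr_hom (Cochain.comp_v (φ.1 W) (ψ.1 W) h p q r hpq (by omega)) x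

lemma ap_d {n m : ℤ} (hnm : n + 1 = m) (φ : (hom (k := k) M N).X n) (W : A) (p q q' p' : ℤ)
    (h : p + m = q) (hq : q' + 1 = q) (hp : p + 1 = p') (x : (M.obj W).X p) :
    ap (((hom M N).d n m).hom φ) W p q h x = ((N.obj W).d q' q).hom (ap φ W p q' (by omega) x) -
      n.negOnePow • ap φ W p' q (by omega) (((M.obj W).d p p').hom x) := by
  refine Eq.trans (ConcreteCategory.congr_hom (CochainComplex.HomComplex.δ_v n m hnm (φ.1 W) p q h
    q' p' (by omega) hp) x) ?_
  subst hnm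
  rw [Int.negOnePow_succ, Units.neg_smul, ← sub_eq_add_neg]
  rfl

lemma closed_iff {n m : ℤ} (hnm : n + 1 = m) (φ : (hom (k := k) M N).X n) :
    ((hom M N).d n m).hom φ = 0 ↔ ∀ (W : A) (p q p' q' : ℤ) (h : p + n = q) (hp : p + 1 = p')
      (hq : q + 1 = q') (x : (M.obj W).X p), ((N.obj W).d q q').hom (ap φ W p q h x) =
        n.negOnePow • ap φ W p' q' (by omega) (((M.obj W).d p p').hom x) := by
  constructor
  · intro h0 W p q p' q' h hp hq x
    have := ap_d hnm φ W p q' q p' (by omega) hq hp x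
    rwa [h0, ap_zero, LinearMap.zero_apply, eq_comm, sub_eq_zero] at this
  · intro H
    refine hom_ext' fun W p q h x => ?_
    rw [ap_d hnm φ W p q (q - 1) (p + 1) h (by omega) rfl, H W p (q - 1) (p + 1) q (by omega) rfl (by omega),
      sub_self]
    rfl

/-- The morphism of complexes given by a closed morphism of degree `0`. -/
def app (w : Z0 k M N) (W : A) : M.obj W ⟶ N.obj W where
  f p := ModuleCat.ofHom (ap w.1 W p p (add_zero p))
  comm' p q h := by
    ext x
    have := (closed_iff rfl w.1).1 w.2 W p p q q (add_zero p) h h x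
    simpa using this

lemma app_apply (w : Z0 k M N) (W : A) (p : ℤ) (x : (M.obj W).X p) :
    ((app w W).f p).hom x = ap w.1 W p p (add_zero p) x := rfl

lemma app_comp (w : Z0 k M N) (w' : Z0 k N L) (W : A) :
    app (Z0.comp w w') W = app w W ≫ app w' W := by
  ext p x
  exact ap_comp (add_zero 0) w.1 w'.1 W p p p (add_zero p) (add_zero p) x

/-- The action is compatible with the differential for closed elements of the category. -/
lemma d_act_closed (M : DGModule k A) {X Y : A} (p q r p' q' r' : ℤ) (h : p + q = r) (hp : p + 1 = p')
    (hq : q + 1 = q') (hr : r + 1 = r') (x : (M.obj Y).X p) (f : (hom (k := k) X Y).X q)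
    (hf : ((hom X Y).d q q').hom f = 0) :
    ((M.obj X).d r r').hom (M.act p q r h x f) =
      M.act p' q r' (by omega) (((M.obj Y).d p p').hom x) f := by
  rw [M.leibniz p q r p' q' r' h hp hq hr, hf, map_zero, smul_zero, add_zero]

section Shift

/-- The shift `M[-e]` of a dg-module. -/
def shiftMod (M : DGModule k A) (e : ℤ) : DGModule k A where
  obj W :=
    { X := fun m => (M.obj W).X (m - e)
      d := fun m m' => e.negOnePow • (M.obj W).d (m - e) (m' - e)
      shape := fun m m' h => by
        rw [(M.obj W).shape, smul_zero]
        intro h'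
        have h'' : m - e + 1 = m' - e := h'
        exact h (show m + 1 = m' by omega)
      d_comp_d' := fun i j l _ _ => by simp }
  act p q r h := M.act (p - e) q (r - e) (by omega)
  act_one p x := M.act_one (p - e) x
  act_act p q r pq rq s hpq hrq hs hs' x g f :=
    M.act_act (p - e) q r (pq - e) rq (s - e) (by omega) hrq (by omega) (by omega) x g f
  leibniz {X Y} p q r p' q' r' h hp hq hr x f := by
    have := M.leibniz (p - e) q (r - e) (p' - e) q' (r' - e) (by omega) (by omega) hq (by omega) x f
    have e1 : (p.negOnePow : ℤ) = (e.negOnePow : ℤ) * ((p - e).negOnePow : ℤ) := by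
      rw [← Units.val_mul, ← Int.negOnePow_add, add_sub_cancel]
    change e.negOnePow • ((M.obj X).d (r - e) (r' - e)).hom _ =
      M.act (p' - e) q (r' - e) _ (e.negOnePow • ((M.obj Y).d (p - e) (p' - e)).hom x) f + _
    rw [this]
    simp only [Units.smul_def, map_zsmul, LinearMap.smul_apply, smul_add, smul_smul, e1]

/-- The identification of the components of `M[-e]`. -/
def shiftEquiv (M : DGModule k A) (e : ℤ) (W : A) {p m : ℤ} (h : p = m - e) :
    (M.obj W).X p ≃ₗ[k] ((shiftMod M e).obj W).X m where
  toLinearMap := castX (M.obj W) h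
  invFun := castX (M.obj W) h.symm
  left_inv x := by subst h; exact (castX_rfl _ _ _).trans (castX_rfl _ _ _)
  right_inv x := by subst h; exact (castX_rfl _ _ _).trans (castX_rfl _ _ _)

lemma shiftEquiv_d (M : DGModule k A) (e : ℤ) (W : A) {p m p' m' : ℤ} (h : p = m - e) (h' : p' = m' - e)
    (x : (M.obj W).X p) : (((shiftMod M e).obj W).d m m').hom (shiftEquiv M e W h x) =
      e.negOnePow • shiftEquiv M e W h' (((M.obj W).d p p').hom x) := by
  subst h h'
  change e.negOnePow • ((M.obj W).d (m - e) (m' - e)).hom (castX (M.obj W) rfl x) =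
    e.negOnePow • castX (M.obj W) rfl (((M.obj W).d (m - e) (m' - e)).hom x)
  rw [castX_rfl, castX_rfl]

lemma shiftEquiv_act (M : DGModule k A) (e : ℤ) {V W : A} {p m p' m' : ℤ} (h : p = m - e)
    (h' : p' = m' - e) (q : ℤ) (hq : p + q = p') (x : (M.obj W).X p) (f : (hom (k := k) V W).X q) :
    shiftEquiv M e V h' (M.act p q p' hq x f) =
      (shiftMod M e).act m q m' (by omega) (shiftEquiv M e W h x) f := by
  subst h h'
  change castX (M.obj V) rfl (M.act (m - e) q (m' - e) _ x f) =
    M.act (m - e) q (m' - e) _ (castX (M.obj W) rfl x) f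
  rw [castX_rfl, castX_rfl]

variable (M) in
/-- The closed invertible morphism `M → M[-e]` of degree `e`. -/
def toShift (e : ℤ) : (hom (k := k) M (shiftMod M e)).X e :=
  homMk e (fun W p q h => (shiftEquiv M e W (show p = q - e by omega)).toLinearMap)
    (fun V W p q r p' r' h hp hr x f => shiftEquiv_act M e _ _ q h x f)

variable (M) in
/-- The closed invertible morphism `M[-e] → M` of degree `-e`. -/
def ofShift (e : ℤ) : (hom (k := k) (shiftMod M e) M).X (-e) :=
  homMk (-e) (fun W p q h => (shiftEquiv M e W (show q = p - e by omega)).symm.toLinearMap)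
    (fun V W p q r p' r' h hp hr x f => by
      obtain ⟨x, rfl⟩ := (shiftEquiv M e W (show p' = p - e by omega)).surjective x
      refine (LinearEquiv.symm_apply_eq _).2 ?_
      rw [LinearEquiv.coe_coe, LinearEquiv.symm_apply_apply]
      exact (shiftEquiv_act M e _ _ q (by omega) x f).symm)

lemma ap_toShift (e : ℤ) (W : A) (p q : ℤ) (h : p + e = q) (x : (M.obj W).X p) :
    ap (toShift M e) W p q h x = shiftEquiv M e W (show p = q - e by omega) x := rfl

lemma ap_ofShift (e : ℤ) (W : A) (p q : ℤ) (h : p + -e = q) (x : ((shiftMod M e).obj W).X p) :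
    ap (ofShift M e) W p q h x = (shiftEquiv M e W (show q = p - e by omega)).symm x := rfl

lemma d_toShift (e e' : ℤ) (h : e + 1 = e') :
    ((hom M (shiftMod M e)).d e e').hom (toShift M e) = 0 := by
  refine (closed_iff h _).2 fun W p q p' q' h hp hq x => ?_
  rw [ap_toShift, ap_toShift]
  exact shiftEquiv_d M e W (by omega) (by omega) x

lemma d_ofShift (e e' : ℤ) (h : -e + 1 = e') :
    ((hom (shiftMod M e) M).d (-e) e').hom (ofShift M e) = 0 := by
  refine (closed_iff h _).2 fun W p q p' q' h hp hq x => ?_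
  obtain ⟨x, rfl⟩ := (shiftEquiv M e W (show q = p - e by omega)).surjective x
  rw [ap_ofShift, ap_ofShift, LinearEquiv.symm_apply_apply,
    shiftEquiv_d M e W (p := q) (p' := q') (by omega) (by omega), Units.smul_def, Units.smul_def, map_zsmul,
    LinearEquiv.symm_apply_apply, smul_smul, ← Units.val_mul, ← Int.negOnePow_add]
  simp

lemma toShift_ofShift (e : ℤ) (h : e + -e = 0) :
    comp e (-e) 0 h (toShift M e) (ofShift M e) = one M := by
  refine hom_ext' fun W p q h x => ?_
  obtain rfl : p = q := by omega
  rw [ap_comp _ _ _ W p (p + e) p h rfl, ap_one, ap_toShift, ap_ofShift, LinearEquiv.symm_apply_apply,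
    castX_rfl]

lemma ofShift_toShift (e : ℤ) (h : -e + e = 0) :
    comp (-e) e 0 h (ofShift M e) (toShift M e) = one (shiftMod M e) := by
  refine hom_ext' fun W p q h x => ?_
  obtain rfl : p = q := by omega
  rw [ap_comp _ _ _ W p (p - e) p h (by omega), ap_one, ap_toShift, ap_ofShift,
    LinearEquiv.apply_symm_apply, castX_rfl]

end Shift

section Attach

variable (e : ℤ) {r₀ : ℤ} (f : (hom (k := k) M N).X r₀)
  (hf : e + 1 = r₀ ∧ ((hom M N).d r₀ (r₀ + 1)).hom f = 0)

/-- The extension of `M[-e]` by `N` given by a closed morphism `M → N` of degree `e + 1`;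
for `e = -1` this is the cone. -/
def attachMod : DGModule k A where
  obj W :=
    { X := fun m => ModuleCat.of k ((N.obj W).X m × (M.obj W).X (m - e))
      d := fun m m' => if h : m + 1 = m' then ModuleCat.ofHom
        (LinearMap.prod (((N.obj W).d m m').hom ∘ₗ LinearMap.fst _ _ _ +
            ap f W (m - e) m' (by have := hf.1; omega) ∘ₗ LinearMap.snd _ _ _)
          (e.negOnePow • ((M.obj W).d (m - e) (m' - e)).hom ∘ₗ LinearMap.snd _ _ _)) else 0
      shape := fun m m' h => dif_neg h
      d_comp_d' := fun i j l hij hjl => by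
        have hij' : i + 1 = j := hij
        have hjl' : j + 1 = l := hjl
        rw [dif_pos hij', dif_pos hjl']
        refine ModuleCat.hom_ext (LinearMap.ext fun z => ?_)
        obtain ⟨y, x⟩ := z
        have h1 := (closed_iff rfl f).1 hf.2 W (i - e) j (j - e) l (by have := hf.1; omega) (by have := hf.1; omega) hjl' x
        refine Prod.ext ?_ ?_
        · change ((N.obj W).d j l).hom (((N.obj W).d i j).hom y + ap f W (i - e) j _ x) +
            ap f W (j - e) l _ (e.negOnePow • ((M.obj W).d (i - e) (j - e)).hom x) = 0
          rw [map_add, d_d_apply, h1,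
            show r₀.negOnePow = -e.negOnePow by rw [← hf.1, Int.negOnePow_succ]]
          simp [Units.smul_def]
        · change e.negOnePow • ((M.obj W).d (j - e) (l - e)).hom
            (e.negOnePow • ((M.obj W).d (i - e) (j - e)).hom x) = 0
          simp [Units.smul_def, d_d_apply] }
  act p q r h := LinearMap.mk₂ k
    (fun x g => (N.act p q r h x.1 g, M.act (p - e) q (r - e) (by have := hf.1; omega) x.2 g))
    (fun x x' g => Prod.ext (LinearMap.map_add₂ _ _ _ _) (LinearMap.map_add₂ _ _ _ _))
    (fun c x g => Prod.ext (LinearMap.map_smul₂ _ _ _ _) (LinearMap.map_smul₂ _ _ _ _))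
    (fun x g g' => Prod.ext (map_add _ _ _) (map_add _ _ _))
    (fun c x g => Prod.ext (map_smul _ _ _) (map_smul _ _ _))
  act_one p x := Prod.ext (N.act_one p x.1) (M.act_one (p - e) x.2)
  act_act p q r pq rq s hpq hrq hs hs' x g f := Prod.ext
    (N.act_act p q r pq rq s hpq hrq hs hs' x.1 g f)
    (M.act_act (p - e) q r (pq - e) rq (s - e) (by have := hf.1; omega) hrq (by have := hf.1; omega) (by have := hf.1; omega) x.2 g f)
  leibniz {X Y} p q r p' q' r' h hp hq hr x g := by
    obtain ⟨y, x⟩ := x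
    have h1 := N.leibniz p q r p' q' r' h hp hq hr y g
    have h2 := M.leibniz (p - e) q (r - e) (p' - e) q' (r' - e) (by have := hf.1; omega) (by have := hf.1; omega) hq (by have := hf.1; omega) x g
    have h3 := ap_act f (p - e) q (r - e) p' r' (by have := hf.1; omega) (by have := hf.1; omega) (by have := hf.1; omega) x g
    have e1 : (p.negOnePow : ℤ) = (e.negOnePow : ℤ) * ((p - e).negOnePow : ℤ) := by
      rw [← Units.val_mul, ← Int.negOnePow_add, add_sub_cancel]
    simp only [dif_pos hr, dif_pos hp]
    refine Prod.ext ?_ ?_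
    · change ((N.obj X).d r r').hom (N.act p q r h y g) +
          ap f X (r - e) r' _ (M.act (p - e) q (r - e) _ x g) =
        N.act p' q r' _ (((N.obj Y).d p p').hom y + ap f Y (p - e) p' _ x) g +
          p.negOnePow • N.act p q' r' _ y (((hom X Y).d q q').hom g)
      rw [h1, h3, map_add, LinearMap.add_apply]
      abel
    · change e.negOnePow • ((M.obj X).d (r - e) (r' - e)).hom (M.act (p - e) q (r - e) _ x g) =
        M.act (p' - e) q (r' - e) _ (e.negOnePow • ((M.obj Y).d (p - e) (p' - e)).hom x) g +
          p.negOnePow • M.act (p - e) q' (r' - e) _ x (((hom X Y).d q q').hom g)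
      rw [h2]
      simp only [Units.smul_def, map_zsmul, LinearMap.smul_apply, smul_add, smul_smul, e1]

/-- The inclusion of the components of `N` in those of the extension. -/
def attachι (W : A) (m : ℤ) : (N.obj W).X m →ₗ[k] ((attachMod e f hf).obj W).X m :=
  LinearMap.inl k ((N.obj W).X m) ((M.obj W).X (m - e))

/-- The inclusion of the components of `M[-e]` in those of the extension. -/
def attachκ (W : A) (m : ℤ) : (M.obj W).X (m - e) →ₗ[k] ((attachMod e f hf).obj W).X m :=
  LinearMap.inr k ((N.obj W).X m) ((M.obj W).X (m - e))

/-- The projection of the components of the extension to those of `N`. -/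
def attachFst (W : A) (m : ℤ) : ((attachMod e f hf).obj W).X m →ₗ[k] (N.obj W).X m :=
  LinearMap.fst k ((N.obj W).X m) ((M.obj W).X (m - e))

/-- The projection of the components of the extension to those of `M[-e]`. -/
def attachSnd (W : A) (m : ℤ) : ((attachMod e f hf).obj W).X m →ₗ[k] (M.obj W).X (m - e) :=
  LinearMap.snd k ((N.obj W).X m) ((M.obj W).X (m - e))

@[simp] lemma attachFst_ι (W : A) (m : ℤ) (y) : attachFst e f hf W m (attachι e f hf W m y) = y := rfl
@[simp] lemma attachFst_κ (W : A) (m : ℤ) (x) : attachFst e f hf W m (attachκ e f hf W m x) = 0 := rfl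
@[simp] lemma attachSnd_ι (W : A) (m : ℤ) (y) : attachSnd e f hf W m (attachι e f hf W m y) = 0 := rfl
@[simp] lemma attachSnd_κ (W : A) (m : ℤ) (x) : attachSnd e f hf W m (attachκ e f hf W m x) = x := rfl

lemma attach_decomp (W : A) (m : ℤ) (z : ((attachMod e f hf).obj W).X m) :
    z = attachι e f hf W m (attachFst e f hf W m z) + attachκ e f hf W m (attachSnd e f hf W m z) :=
  Prod.ext (add_zero _).symm (zero_add _).symm

lemma attach_ext (W : A) (m : ℤ) {z z' : ((attachMod e f hf).obj W).X m}
    (h₁ : attachFst e f hf W m z = attachFst e f hf W m z')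
    (h₂ : attachSnd e f hf W m z = attachSnd e f hf W m z') : z = z' := Prod.ext h₁ h₂

lemma attachMod_d_eq (W : A) (m m' : ℤ) (h : m + 1 = m') : ((attachMod e f hf).obj W).d m m' =
    ModuleCat.ofHom (LinearMap.prod (((N.obj W).d m m').hom ∘ₗ LinearMap.fst _ _ _ +
            ap f W (m - e) m' (by have := hf.1; omega) ∘ₗ LinearMap.snd _ _ _)
          (e.negOnePow • ((M.obj W).d (m - e) (m' - e)).hom ∘ₗ LinearMap.snd _ _ _)) :=
  dif_pos h

lemma attach_d_ι (W : A) (m m' : ℤ) (h : m + 1 = m') (y : (N.obj W).X m) :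
    (((attachMod e f hf).obj W).d m m').hom (attachι e f hf W m y) =
      attachι e f hf W m' (((N.obj W).d m m').hom y) := by
  rw [attachMod_d_eq e f hf W m m' h]
  refine Prod.ext ?_ ?_
  · change ((N.obj W).d m m').hom y + ap f W (m - e) m' _ 0 = ((N.obj W).d m m').hom y
    rw [map_zero, add_zero]
  · change e.negOnePow • ((M.obj W).d (m - e) (m' - e)).hom 0 = 0
    rw [map_zero, smul_zero]

lemma attach_d_κ (W : A) (m m' : ℤ) (h : m + 1 = m') (x : (M.obj W).X (m - e)) :
    (((attachMod e f hf).obj W).d m m').hom (attachκ e f hf W m x) =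
      attachι e f hf W m' (ap f W (m - e) m' (by have := hf.1; omega) x) +
        e.negOnePow • attachκ e f hf W m' (((M.obj W).d (m - e) (m' - e)).hom x) := by
  rw [attachMod_d_eq e f hf W m m' h]
  refine Prod.ext ?_ ?_
  · change ((N.obj W).d m m').hom 0 + ap f W (m - e) m' _ x = _ + e.negOnePow • (0 : (N.obj W).X m')
    rw [map_zero, zero_add, smul_zero, add_zero]
    rfl
  · change _ = (0 : (M.obj W).X (m' - e)) + _
    rw [zero_add]
    rfl

lemma attachSnd_d (W : A) (m m' : ℤ) (h : m + 1 = m') (z : ((attachMod e f hf).obj W).X m) :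
    attachSnd e f hf W m' ((((attachMod e f hf).obj W).d m m').hom z) =
      e.negOnePow • ((M.obj W).d (m - e) (m' - e)).hom (attachSnd e f hf W m z) := by
  rw [attachMod_d_eq e f hf W m m' h]
  rfl

lemma attachFst_d (W : A) (m m' : ℤ) (h : m + 1 = m') (z : ((attachMod e f hf).obj W).X m) :
    attachFst e f hf W m' ((((attachMod e f hf).obj W).d m m').hom z) =
      ((N.obj W).d m m').hom (attachFst e f hf W m z) +
        ap f W (m - e) m' (by have := hf.1; omega) (attachSnd e f hf W m z) := by
  rw [attachMod_d_eq e f hf W m m' h]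
  rfl

lemma attach_act_ι {V W : A} (p q r : ℤ) (h : p + q = r) (y : (N.obj W).X p)
    (g : (hom (k := k) V W).X q) : (attachMod e f hf).act p q r h (attachι e f hf W p y) g =
      attachι e f hf V r (N.act p q r h y g) := Prod.ext rfl (LinearMap.map_zero₂ _ _)

lemma attach_act_κ {V W : A} (p q r : ℤ) (h : p + q = r) (x : (M.obj W).X (p - e))
    (g : (hom (k := k) V W).X q) : (attachMod e f hf).act p q r h (attachκ e f hf W p x) g =
      attachκ e f hf V r (M.act (p - e) q (r - e) (by have := hf.1; omega) x g) :=
  Prod.ext (LinearMap.map_zero₂ _ _) rfl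

lemma attachFst_act {V W : A} (p q r : ℤ) (h : p + q = r) (z : ((attachMod e f hf).obj W).X p)
    (g : (hom (k := k) V W).X q) : attachFst e f hf V r ((attachMod e f hf).act p q r h z g) =
      N.act p q r h (attachFst e f hf W p z) g := rfl

lemma attachSnd_act {V W : A} (p q r : ℤ) (h : p + q = r) (z : ((attachMod e f hf).obj W).X p)
    (g : (hom (k := k) V W).X q) : attachSnd e f hf V r ((attachMod e f hf).act p q r h z g) =
      M.act (p - e) q (r - e) (by have := hf.1; omega) (attachSnd e f hf W p z) g := rfl

/-- The inclusion of `N` in the extension. -/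
def attachInl : Z0 k N (attachMod e f hf) :=
  ⟨homMk 0 (fun W p q h => attachι e f hf W q ∘ₗ castX (N.obj W) (show p = q by have := hf.1; omega))
    (fun V W p q r p' r' h hp hr x g => by
      obtain rfl : p = p' := by omega
      obtain rfl : r = r' := by omega
      rw [LinearMap.comp_apply, LinearMap.comp_apply, castX_rfl, castX_rfl, attach_act_ι]),
  (closed_iff rfl _).2 fun W p q p' q' h hp hq x => by
    obtain rfl : p = q := by omega
    obtain rfl : p' = q' := by omega
    rw [ap_homMk, ap_homMk, LinearMap.comp_apply, LinearMap.comp_apply, castX_rfl, castX_rfl,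
      attach_d_ι _ _ _ _ _ _ hp, Int.negOnePow_zero, one_smul]⟩

lemma ap_attachInl (W : A) (p : ℤ) (x : (N.obj W).X p) :
    ap (attachInl e f hf).1 W p p (add_zero p) x = attachι e f hf W p x := by
  change attachι e f hf W p (castX (N.obj W) rfl x) = _
  rw [castX_rfl]

/-- The inclusion of `M`, of degree `e`, in the extension. -/
def attachInr : (hom (k := k) M (attachMod e f hf)).X e :=
  homMk e (fun W p q h => attachκ e f hf W q ∘ₗ castX (M.obj W) (show p = q - e by have := hf.1; omega))
    (fun V W p q r p' r' h hp hr x g => by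
      obtain rfl : p = p' - e := by omega
      obtain rfl : r = r' - e := by omega
      rw [LinearMap.comp_apply, LinearMap.comp_apply, castX_rfl, castX_rfl, attach_act_κ])

lemma ap_attachInr' (W : A) (q : ℤ) (x : (M.obj W).X (q - e)) :
    ap (attachInr e f hf) W (q - e) q (by have := hf.1; omega) x = attachκ e f hf W q x := by
  change attachκ e f hf W q (castX (M.obj W) rfl x) = _
  rw [castX_rfl]

variable {e f hf}

/-- The morphism on the extension with given components on `N` and `M`. -/
def attachDesc {n m : ℤ} (α : (hom (k := k) N L).X n) (β : (hom (k := k) M L).X m) (hm : n + e = m) :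
    (hom (k := k) (attachMod e f hf) L).X n :=
  homMk n (fun W p q h => ap α W p q h ∘ₗ attachFst e f hf W p +
      ap β W (p - e) q (by have := hf.1; omega) ∘ₗ attachSnd e f hf W p)
    (fun V W p q r p' r' h hp hr x g => by
      simp only [LinearMap.add_apply, LinearMap.comp_apply, attachFst_act, attachSnd_act]
      rw [ap_act α p q r p' r' h hp hr, ap_act β (p - e) q (r - e) p' r' (by have := hf.1; omega) (by have := hf.1; omega) (by have := hf.1; omega),
        map_add, LinearMap.add_apply])

lemma ap_attachDesc {n m : ℤ} (α : (hom (k := k) N L).X n) (β : (hom (k := k) M L).X m)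
    (hm : n + e = m) (W : A) (p q : ℤ) (h : p + n = q) (z : ((attachMod e f hf).obj W).X p) :
    ap (attachDesc (hf := hf) α β hm) W p q h z =
      ap α W p q h (attachFst e f hf W p z) + ap β W (p - e) q (by have := hf.1; omega) (attachSnd e f hf W p z) := rfl

lemma d_attachDesc {n m n' m' : ℤ} (α : (hom (k := k) N L).X n) (β : (hom (k := k) M L).X m)
    (hm : n + e = m) (hn' : n + 1 = n') (hm' : m + 1 = m') :
    ((hom (attachMod e f hf) L).d n n').hom (attachDesc (hf := hf) α β hm) =
      attachDesc (hf := hf) (((hom N L).d n n').hom α) (((hom M L).d m m').hom β -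
        n.negOnePow • comp r₀ n m' (by have := hf.1; omega) f α) (by have := hf.1; omega) := by
  refine hom_ext' fun W p q h z => ?_
  rw [ap_d hn' _ W p q (q - 1) (p + 1) h (by have := hf.1; omega) rfl, ap_attachDesc, ap_attachDesc, ap_attachDesc,
    attachFst_d _ _ _ _ _ _ rfl, attachSnd_d _ _ _ _ _ _ rfl,
    ap_d hn' _ W p q (q - 1) (p + 1) h (by have := hf.1; omega) rfl, ap_sub, LinearMap.sub_apply,
    ap_d hm' _ W (p - e) q (q - 1) (p + 1 - e) (by have := hf.1; omega) (by have := hf.1; omega) (by have := hf.1; omega),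
    ap_units_smul, LinearMap.smul_apply,
    ap_comp _ f α W (p - e) (p + 1) q (by have := hf.1; omega) (by have := hf.1; omega)]
  have e1 : (m.negOnePow : ℤ) = (n.negOnePow : ℤ) * (e.negOnePow : ℤ) := by
    rw [← Units.val_mul, ← Int.negOnePow_add, hm]
  simp only [map_add, Units.smul_def, smul_add, map_zsmul, smul_smul, e1]
  abel

lemma attachDesc_eta {n m : ℤ} (φ : (hom (k := k) (attachMod e f hf) L).X n) (hm : n + e = m) :
    attachDesc (hf := hf) (comp 0 n n (zero_add n) (attachInl e f hf).1 φ)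
      (comp e n m (by have := hf.1; omega) (attachInr e f hf) φ) hm = φ := by
  refine hom_ext' fun W p q h z => ?_
  rw [ap_attachDesc, ap_comp _ _ _ W p p q h (add_zero p),
    ap_comp _ _ _ W (p - e) p q (by have := hf.1; omega) (by have := hf.1; omega),
    ap_attachInl, ap_attachInr', ← map_add, ← attach_decomp]

lemma attachInl_attachDesc {n m : ℤ} (α : (hom (k := k) N L).X n) (β : (hom (k := k) M L).X m)
    (hm : n + e = m) : comp 0 n n (zero_add n) (attachInl e f hf).1 (attachDesc (hf := hf) α β hm) =
      α := by
  refine hom_ext' fun W p q h x => ?_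
  rw [ap_comp _ _ _ W p p q h (add_zero p), ap_attachInl, ap_attachDesc, attachFst_ι, attachSnd_ι,
    map_zero, add_zero]

lemma attachInr_attachDesc {n m : ℤ} (α : (hom (k := k) N L).X n) (β : (hom (k := k) M L).X m)
    (hm : n + e = m) : comp e n m (by have := hf.1; omega) (attachInr e f hf) (attachDesc (hf := hf) α β hm) = β := by
  refine hom_ext' fun W p q h x => ?_
  obtain ⟨p', hp'⟩ : ∃ p', p' = p + e := ⟨_, rfl⟩
  obtain rfl : p = p' - e := by omega
  rw [ap_comp _ _ _ W _ p' q h (by have := hf.1; omega), ap_attachInr', ap_attachDesc, attachFst_κ, attachSnd_κ,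
    map_zero, zero_add]

variable (e f hf)

lemma d_attachInr (e' : ℤ) (h : e + 1 = e') :
    ((hom M (attachMod e f hf)).d e e').hom (attachInr e f hf) =
      comp r₀ 0 e' (by have := hf.1; omega) f (attachInl e f hf).1 := by
  refine hom_ext' fun W p q h z => ?_
  obtain ⟨m, hm⟩ : ∃ m, m = p + e := ⟨_, rfl⟩
  obtain rfl : p = m - e := by omega
  obtain rfl : q = m + 1 := by omega
  rw [ap_d (by assumption) _ W (m - e) (m + 1) m (m + 1 - e) (by omega) rfl (by omega), ap_attachInr',
    ap_attachInr', attach_d_κ _ _ _ _ _ _ rfl, ap_comp _ _ _ W _ (m + 1) _ _ (by have := hf.1; omega),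
    ap_attachInl]
  abel

/-- The projection of the extension to `N`; it is not closed. -/
def attachProjFst : (hom (k := k) (attachMod e f hf) N).X 0 :=
  attachDesc (hf := hf) (one N) (0 : (hom (k := k) M N).X e) (zero_add e)

/-- The projection of the extension to `M[-e]`. -/
def attachProjSnd : (hom (k := k) (attachMod e f hf) M).X (-e) :=
  attachDesc (hf := hf) (0 : (hom (k := k) N M).X (-e)) (one M) (neg_add_cancel e)

lemma ap_attachProjFst (W : A) (p : ℤ) (z : ((attachMod e f hf).obj W).X p) :
    ap (attachProjFst e f hf) W p p (add_zero p) z = attachFst e f hf W p z := by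
  rw [attachProjFst, ap_attachDesc, ap_one, castX_rfl]
  simp

lemma ap_attachProjSnd (W : A) (p : ℤ) (z : ((attachMod e f hf).obj W).X p) :
    ap (attachProjSnd e f hf) W p (p - e) (by omega) z = attachSnd e f hf W p z := by
  rw [attachProjSnd, ap_attachDesc, ap_one, castX_rfl]
  simp

lemma d_attachProjFst : ((hom (attachMod e f hf) N).d 0 1).hom (attachProjFst e f hf) =
    - comp (-e) r₀ 1 (by have := hf.1; omega) (attachProjSnd e f hf) f := by
  refine hom_ext' fun W p q h z => ?_
  subst h
  rw [ap_d (n := 0) (m := 1) rfl _ W p (p + 1) p (p + 1) rfl rfl rfl, ap_attachProjFst, ap_attachProjFst,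
    attachFst_d _ _ _ _ _ _ rfl, ap_neg, LinearMap.neg_apply,
    ap_comp _ _ _ W _ (p - e) _ _ (by omega), ap_attachProjSnd]
  simp

lemma d_attachProjSnd (e' : ℤ) (h : -e + 1 = e') :
    ((hom (attachMod e f hf) M).d (-e) e').hom (attachProjSnd e f hf) = 0 := by
  refine (closed_iff h _).2 fun W p q p' q' h hp hq z => ?_
  obtain rfl : q = p - e := by omega
  obtain rfl : q' = p' - e := by omega
  rw [ap_attachProjSnd, ap_attachProjSnd, attachSnd_d _ _ _ _ _ _ hp, smul_smul, ← Int.negOnePow_add]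
  simp

end Attach

end DGModule

end DG

namespace DG

open DGCategory

namespace DGModule

variable {k : Type v} [CommRing k] {A : Type v} [DGCategory k A] {M N L : DGModule k A}

section Yoneda

variable (k) in
/-- The representable dg-module `A(-, X)`. -/
abbrev yon (X : A) : DGModule k A := (yonedaDG k A).obj X

/-- The morphism `A(-, X) → M` given by an element of `M(X)`. -/
def elt {X : A} {n : ℤ} (x : (M.obj X).X n) : (hom (k := k) (yon k X) M).X n :=
  homMk n (fun W p q h => M.act n p q (by omega) x) (fun V W p q r p' r' h hp hr g f =>
    (M.act_act n p q p' r r' (by omega) (by omega) (by omega) (by omega) x g f).symm)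

lemma ap_elt {X : A} {n : ℤ} (x : (M.obj X).X n) (W : A) (p q : ℤ) (h : p + n = q)
    (f : (hom (k := k) W X).X p) : ap (elt x) W p q h f = M.act n p q (by omega) x f := rfl

lemma ap_elt_one {X : A} {n : ℤ} (x : (M.obj X).X n) :
    ap (elt x) X 0 n (zero_add n) (one X) = x := M.act_one n x

lemma elt_eta {X : A} {n : ℤ} (φ : (hom (k := k) (yon k X) M).X n) :
    elt (ap φ X 0 n (zero_add n) (one X)) = φ := by
  refine hom_ext' fun W p q h f => ?_
  refine (ap_elt _ W p q h f).trans ((ap_act φ 0 p p n q (zero_add p) (zero_add n) h _ _).symm.trans ?_)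
  exact congrArg (ap φ W p q h) (comp_one p f)

lemma elt_injective {X : A} {n : ℤ} {x y : (M.obj X).X n} (h : elt x = elt y) : x = y := by
  rw [← ap_elt_one x, h, ap_elt_one]

lemma d_elt {X : A} {n m : ℤ} (hnm : n + 1 = m) (x : (M.obj X).X n) :
    ((hom (yon k X) M).d n m).hom (elt x) = elt (((M.obj X).d n m).hom x) := by
  refine hom_ext' fun W p q h (f : (hom (k := k) W X).X p) => ?_
  refine (ap_d hnm (elt x) W p q (q - 1) (p + 1) h (by omega) rfl f).trans ?_
  have := M.leibniz n p (q - 1) m (p + 1) q (by omega) hnm rfl (by omega) x f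
  refine (congrArg (· - n.negOnePow • M.act n (p + 1) q (by omega) x (((hom W X).d p (p + 1)).hom f))
    this).trans (add_sub_cancel_right _ _)

lemma elt_comp {X : A} {n m l : ℤ} (h : n + m = l) (x : (M.obj X).X n) (φ : (hom (k := k) M N).X m) :
    comp n m l h (elt x) φ = elt (ap φ X n l h x) := by
  refine hom_ext' fun W p q hpq f => ?_
  refine (ap_comp h (elt x) φ W p (p + n) q hpq rfl f).trans ?_
  exact ap_act φ n p (p + n) l q (by omega) h (by omega) x f

lemma elt_add {X : A} {n : ℤ} (x y : (M.obj X).X n) : elt (x + y) = elt x + elt y := by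
  refine hom_ext' fun W p q h f => ?_
  exact LinearMap.map_add₂ (M.act n p q (by omega)) x y f

lemma elt_smul {X : A} {n : ℤ} (c : k) (x : (M.obj X).X n) : elt (c • x) = c • elt x := by
  refine hom_ext' fun W p q h f => ?_
  exact LinearMap.map_smul₂ (M.act n p q (by omega)) c x f

variable (M) in
/-- The Yoneda isomorphism. -/
def eltHom (X : A) : M.obj X ⟶ hom (k := k) (yon k X) M where
  f n := ModuleCat.ofHom { toFun := elt, map_add' := elt_add, map_smul' := elt_smul }
  comm' n m h := by
    ext x
    exact d_elt h x

lemma eltHom_bijective (X : A) (n : ℤ) : Function.Bijective ((eltHom M X).f n).hom :=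
  ⟨fun _ _ h => elt_injective h, fun φ => ⟨_, elt_eta φ⟩⟩

lemma quasiIso_eltHom (X : A) : QuasiIso (eltHom M X) := quasiIso_of_bijective _ (eltHom_bijective X)

/-- A closed element of degree `0` of `M(X)`, as a closed morphism. -/
def eltZ0 {X : A} (x : (M.obj X).X 0) (hx : ((M.obj X).d 0 1).hom x = 0) : Z0 k (yon k X) M :=
  ⟨elt x, by
    rw [LinearMap.mem_ker, d_elt (n := 0) (m := 1) rfl, hx]
    exact (((eltHom M X).f 1).hom).map_zero⟩

lemma elt_zero {X : A} (n : ℤ) : elt (0 : (M.obj X).X n) = 0 := (((eltHom M X).f n).hom).map_zero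

end Yoneda

section Quasi

/-- Morphisms on `M`, extended by zero to an extension of `M[-e]` by `N`. -/
def attachExt {e r : ℤ} {f : (hom (k := k) M N).X r} (hf : e + 1 = r ∧ ((hom M N).d r (r + 1)).hom f = 0)
    (L : DGModule k A) (n m : ℤ) (h : m = n + e) :
    (hom (k := k) M L).X m →ₗ[k] (hom (k := k) (attachMod e f hf) L).X n where
  toFun β := attachDesc (hf := hf) 0 β h.symm
  map_add' β β' := hom_ext' fun W p q hpq z => by
    rw [ap_attachDesc, ap_add, LinearMap.add_apply, ap_add, LinearMap.add_apply, ap_attachDesc,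
      ap_attachDesc, ap_zero, LinearMap.zero_apply, zero_add, zero_add, zero_add]
  map_smul' c β := hom_ext' fun W p q hpq z => by
    refine (ap_attachDesc _ _ _ _ _ _ _ _).trans ((zero_add _).trans ?_)
    exact congrArg (c • ·) ((zero_add _).symm.trans
      (ap_attachDesc (hf := hf) (0 : (hom (k := k) N L).X n) β h.symm W p q hpq z).symm)

section

variable {e r : ℤ} {f : (hom (k := k) M N).X r} (hf : e + 1 = r ∧ ((hom M N).d r (r + 1)).hom f = 0)

lemma attachExt_apply (n m : ℤ) (h : m = n + e) (β : (hom (k := k) M L).X m) :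
    attachExt hf L n m h β = attachDesc (hf := hf) 0 β h.symm := rfl

lemma d_attachExt (n m : ℤ) (h : m = n + e) (n' m' : ℤ) (h' : m' = n' + e)
    (β : (hom (k := k) M L).X m) : ((hom (attachMod e f hf) L).d n n').hom (attachExt hf L n m h β) =
        attachExt hf L n' m' h' (((hom M L).d m m').hom β) := by
  by_cases hn : n + 1 = n'
  · rw [attachExt_apply, attachExt_apply, d_attachDesc _ _ _ hn (show m + 1 = m' by omega), map_zero,
      map_zero, smul_zero, sub_zero]
  · rw [(hom (attachMod e f hf) L).shape n n' hn, (hom M L).shape m m' (fun h'' : m + 1 = m' =>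
      hn (by omega))]
    exact (map_zero (attachExt hf L n' m' h')).symm

lemma attachExt_injective (n m : ℤ) (h : m = n + e) (β : (hom (k := k) M L).X m)
    (h0 : attachExt hf L n m h β = 0) : β = 0 := by
  rw [← attachInr_attachDesc (hf := hf) 0 β h.symm, ← attachExt_apply hf n m h, h0, map_zero]

lemma exists_attachExt (n m : ℤ) (h : m = n + e) (φ : (hom (k := k) (attachMod e f hf) L).X n)
    (h0 : comp 0 n n (zero_add n) (attachInl e f hf).1 φ = 0) : ∃ β, attachExt hf L n m h β = φ :=
  ⟨_, by
    have := attachDesc_eta φ h.symm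
    rw [h0] at this
    exact this⟩

/-- The restriction to `N` of morphisms on an extension of `M[-e]` by `N`. -/
def attachRes (L : DGModule k A) (n m : ℤ) (h : m = n + 0) :
    (hom (k := k) (attachMod e f hf) L).X n →ₗ[k] (hom (k := k) N L).X m :=
  castX _ (by omega) ∘ₗ comp 0 n n (zero_add n) (attachInl e f hf).1

lemma attachRes_apply (n : ℤ) (h : n = n + 0) (φ : (hom (k := k) (attachMod e f hf) L).X n) :
    attachRes hf L n n h φ = comp 0 n n (zero_add n) (attachInl e f hf).1 φ := by
  rw [attachRes, LinearMap.comp_apply, castX_rfl]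

lemma d_attachRes (n m : ℤ) (h : m = n + 0) (n' m' : ℤ) (h' : m' = n' + 0)
    (φ : (hom (k := k) (attachMod e f hf) L).X n) :
    attachRes hf L n' m' h' (((hom (attachMod e f hf) L).d n n').hom φ) =
      ((hom N L).d m m').hom (attachRes hf L n m h φ) := by
  obtain rfl : m = n := h.trans (add_zero n)
  obtain rfl : m' = n' := h'.trans (add_zero n')
  rw [attachRes_apply, attachRes_apply, d_comp_closed_left]

lemma attachRes_surjective (n m : ℤ) (h : m = n + 0) (α : (hom (k := k) N L).X m) :
    ∃ φ, attachRes hf L n m h φ = α := by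
  obtain rfl : m = n := h.trans (add_zero n)
  exact ⟨attachDesc (hf := hf) α (0 : (hom (k := k) M L).X (m + e)) rfl, by
    rw [attachRes_apply, attachInl_attachDesc]⟩

end

lemma quasiIso_attach_hom {B : Type v} [DGCategory k B] {M' N' L' : DGModule k B} {e r r' : ℤ}
    {f : (hom (k := k) M N).X r} {hf : e + 1 = r ∧ ((hom M N).d r (r + 1)).hom f = 0}
    {f' : (hom (k := k) M' N').X r'} {hf' : e + 1 = r' ∧ ((hom M' N').d r' (r' + 1)).hom f' = 0}
    (Ω : hom (k := k) (attachMod e f hf) L ⟶ hom (attachMod e f' hf') L')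
    {φ₁ : hom (k := k) M L ⟶ hom M' L'} {φ₂ : hom (k := k) N L ⟶ hom N' L'}
    (h₁ : QuasiIso φ₁) (h₂ : QuasiIso φ₂)
    (hΩ₂ : ∀ (n : ℤ) (φ : (hom (k := k) (attachMod e f hf) L).X n),
      comp 0 n n (zero_add n) (attachInl e f' hf').1 ((Ω.f n).hom φ) =
        (φ₂.f n).hom (comp 0 n n (zero_add n) (attachInl e f hf).1 φ))
    (hΩ₁ : ∀ (n m : ℤ) (h : n + e = m) (β : (hom (k := k) M L).X m),
      (Ω.f n).hom (attachDesc (hf := hf) 0 β h) = attachDesc (hf := hf') 0 ((φ₁.f m).hom β) h) :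
    QuasiIso Ω := by
  refine quasiIso_of_extension (φ := Ω) h₁ h₂ e 0 1 (attachExt hf L) (attachExt hf' L')
    (attachRes hf L) (attachRes hf' L') (d_attachExt hf) (d_attachExt hf')
    (fun n m h n' m' h' φ => ?_) (fun n m h n' m' h' φ => ?_)
    (fun n m h l h' φ h0 => ?_) (fun n m h l h' φ h0 => ?_)
    (attachExt_injective hf) (attachExt_injective hf')
    (attachRes_surjective hf) (attachRes_surjective hf')
    (fun n l h' β => hΩ₁ n l h'.symm β) (fun n m h φ => ?_)
  · rw [one_smul, d_attachRes]
  · rw [one_smul, d_attachRes]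
  · obtain rfl : m = n := h.trans (add_zero n)
    exact exists_attachExt hf m l h' φ ((attachRes_apply hf m h φ).symm.trans h0)
  · obtain rfl : m = n := h.trans (add_zero n)
    exact exists_attachExt hf' m l h' φ ((attachRes_apply hf' m h φ).symm.trans h0)
  · obtain rfl : m = n := h.trans (add_zero n)
    rw [attachRes_apply, attachRes_apply, hΩ₂]

lemma castX_d (K : CochainComplex (ModuleCat.{v} k) ℤ) {p q p' q' : ℤ} (h : p = q) (h' : p' = q')
    (x : K.X p) : castX K h' ((K.d p p').hom x) = (K.d q q').hom (castX K h x) := by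
  subst h h'; simp

lemma castX_injective (K : CochainComplex (ModuleCat.{v} k) ℤ) {p q : ℤ} (h : p = q) :
    Function.Injective (castX K h) := by
  subst h; intro x y; simp

lemma castX_surjective (K : CochainComplex (ModuleCat.{v} k) ℤ) {p q : ℤ} (h : p = q) :
    Function.Surjective (castX K h) := by
  subst h; intro x; exact ⟨x, by simp⟩

lemma castX_map {K L : CochainComplex (ModuleCat.{v} k) ℤ} (φ : K ⟶ L) {p q : ℤ} (h : p = q)
    (x : K.X p) : castX L h ((φ.f p).hom x) = (φ.f q).hom (castX K h x) := by
  subst h; simp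

lemma d_castX (K : CochainComplex (ModuleCat.{v} k) ℤ) {p q : ℤ} (h : p = q) (r : ℤ)
    (x : K.X p) : (K.d q r).hom (castX K h x) = (K.d p r).hom x := by
  subst h; simp

lemma ap_castX {n : ℤ} (φ : (hom (k := k) M N).X n) (W : A) {p q : ℤ} (h : p = q) (r : ℤ)
    (hr : q + n = r) (x : (M.obj W).X p) :
    ap φ W q r hr (castX (M.obj W) h x) = ap φ W p r (by omega) x := by
  subst h; simp

lemma quasiIso_attach_app {B : Type v} [DGCategory k B] {M' N' : DGModule k B} {e r r' : ℤ}
    {f : (hom (k := k) M N).X r} {hf : e + 1 = r ∧ ((hom M N).d r (r + 1)).hom f = 0}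
    {f' : (hom (k := k) M' N').X r'} {hf' : e + 1 = r' ∧ ((hom M' N').d r' (r' + 1)).hom f' = 0}
    {W : A} {W' : B} (Ω : (attachMod e f hf).obj W ⟶ (attachMod e f' hf').obj W')
    {φ₁ : M.obj W ⟶ M'.obj W'} {φ₂ : N.obj W ⟶ N'.obj W'}
    (h₁ : QuasiIso φ₁) (h₂ : QuasiIso φ₂)
    (hΩ₂ : ∀ n y, (Ω.f n).hom (attachι e f hf W n y) = attachι e f' hf' W' n ((φ₂.f n).hom y))
    (hΩ₁ : ∀ n z, attachSnd e f' hf' W' n ((Ω.f n).hom z) =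
      (φ₁.f (n - e)).hom (attachSnd e f hf W n z)) : QuasiIso Ω := by
  have dkey : ∀ {B : Type v} [DGCategory k B] {M N : DGModule k B} {r : ℤ}
      {f : (hom (k := k) M N).X r} (hf : e + 1 = r ∧ ((hom M N).d r (r + 1)).hom f = 0) (W : B)
      (n n' : ℤ) (y : (N.obj W).X n), (((attachMod e f hf).obj W).d n n').hom (attachι e f hf W n y) =
        attachι e f hf W n' (((N.obj W).d n n').hom y) := by
    intro B _ M N r f hf W n n' y
    by_cases hn : n + 1 = n'
    · exact attach_d_ι e f hf W n n' hn y
    · rw [((attachMod e f hf).obj W).shape n n' hn, (N.obj W).shape n n' hn]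
      exact (map_zero (attachι e f hf W n')).symm
  have dkey' : ∀ {B : Type v} [DGCategory k B] {M N : DGModule k B} {r : ℤ}
      {f : (hom (k := k) M N).X r} (hf : e + 1 = r ∧ ((hom M N).d r (r + 1)).hom f = 0) (W : B)
      (n n' : ℤ) (z : ((attachMod e f hf).obj W).X n), attachSnd e f hf W n'
        ((((attachMod e f hf).obj W).d n n').hom z) =
        e.negOnePow • ((M.obj W).d (n - e) (n' - e)).hom (attachSnd e f hf W n z) := by
    intro B _ M N r f hf W n n' z
    by_cases hn : n + 1 = n'
    · exact attachSnd_d e f hf W n n' hn z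
    · rw [((attachMod e f hf).obj W).shape n n' hn, (M.obj W).shape (n - e) (n' - e)
        (fun h : n - e + 1 = n' - e => hn (by omega))]
      refine (map_zero (attachSnd e f hf W n')).trans (smul_zero _).symm
  refine quasiIso_of_extension (φ := Ω) h₂ h₁ 0 (-e) e.negOnePow
    (fun n m h => attachι e f hf W n ∘ₗ castX _ (show m = n by omega))
    (fun n m h => attachι e f' hf' W' n ∘ₗ castX _ (show m = n by omega))
    (fun n m h => castX _ (show n - e = m by omega) ∘ₗ attachSnd e f hf W n)
    (fun n m h => castX _ (show n - e = m by omega) ∘ₗ attachSnd e f' hf' W' n)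
    ?_ ?_ ?_ ?_ ?_ ?_ ?_ ?_ ?_ ?_ ?_ ?_
  · intro n m h n' m' h' x
    rw [LinearMap.comp_apply, LinearMap.comp_apply, dkey, castX_d]
  · intro n m h n' m' h' x
    rw [LinearMap.comp_apply, LinearMap.comp_apply, dkey, castX_d]
  · intro n m h n' m' h' x
    rw [LinearMap.comp_apply, LinearMap.comp_apply, dkey', ← castX_d _ (show n - e = m by omega)
      (show n' - e = m' by omega), Units.smul_def, Units.smul_def, map_zsmul]
  · intro n m h n' m' h' x
    rw [LinearMap.comp_apply, LinearMap.comp_apply, dkey', ← castX_d _ (show n - e = m by omega)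
      (show n' - e = m' by omega), Units.smul_def, Units.smul_def, map_zsmul]
  · intro n m h l h' x h0
    obtain rfl : l = n := by omega
    refine ⟨attachFst e f hf W l x, ?_⟩
    have h1 := castX_injective _ _ (h0.trans (map_zero _).symm)
    conv_rhs => rw [attach_decomp e f hf W l x, h1, map_zero, add_zero]
    rw [LinearMap.comp_apply, castX_rfl]
  · intro n m h l h' x h0
    obtain rfl : l = n := by omega
    refine ⟨attachFst e f' hf' W' l x, ?_⟩
    have h1 := castX_injective _ _ (h0.trans (map_zero _).symm)
    conv_rhs => rw [attach_decomp e f' hf' W' l x, h1, map_zero, add_zero]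
    rw [LinearMap.comp_apply, castX_rfl]
  · intro n l h' y h0
    obtain rfl : l = n := by omega
    rw [LinearMap.comp_apply, castX_rfl] at h0
    rw [← attachFst_ι e f hf W l y, h0, map_zero]
  · intro n l h' y h0
    obtain rfl : l = n := by omega
    rw [LinearMap.comp_apply, castX_rfl] at h0
    rw [← attachFst_ι e f' hf' W' l y, h0, map_zero]
  · intro n m h x
    obtain ⟨x, rfl⟩ := castX_surjective _ (show n - e = m by omega) x
    exact ⟨attachκ e f hf W n x, by rw [LinearMap.comp_apply, attachSnd_κ]⟩
  · intro n m h x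
    obtain ⟨x, rfl⟩ := castX_surjective _ (show n - e = m by omega) x
    exact ⟨attachκ e f' hf' W' n x, by rw [LinearMap.comp_apply, attachSnd_κ]⟩
  · intro n l h' y
    rw [LinearMap.comp_apply, LinearMap.comp_apply, hΩ₂, castX_map]
  · intro n m h z
    rw [LinearMap.comp_apply, LinearMap.comp_apply, hΩ₁, castX_map]

end Quasi

section HProjective

lemma isAcyclic_shiftMod (hN : N.IsAcyclic) (e : ℤ) : (shiftMod N e).IsAcyclic := by
  intro W i
  refine (exactAt_iff (j := i - 1) (l := i + 1) (by omega) rfl).2 fun x hx => ?_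
  obtain ⟨x, rfl⟩ := (shiftEquiv N e W (show i - e = i - e from rfl)).surjective x
  rw [shiftEquiv_d N e W rfl (p' := i + 1 - e) rfl] at hx
  obtain ⟨y, hy⟩ := (exactAt_iff (j := i - 1 - e) (l := i + 1 - e) (by omega) (by omega)).1
    (hN W (i - e)) x (by
      have := congrArg (e.negOnePow • ·) hx
      simp only [smul_smul, Int.units_mul_self, one_smul, smul_zero] at this
      exact (shiftEquiv N e W _).injective (this.trans (map_zero _).symm))
  refine ⟨e.negOnePow • shiftEquiv N e W rfl y, ?_⟩
  rw [Units.smul_def, map_zsmul, shiftEquiv_d N e W rfl (p' := i - e) rfl, hy, Units.smul_def,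
    smul_smul, ← Units.val_mul]
  simp

lemma IsHProjective.exists_boundary (hM : M.IsHProjective) (hN : N.IsAcyclic) {n m l : ℤ}
    (hm : m + 1 = n) (hl : n + 1 = l) (φ : (hom (k := k) M N).X n)
    (hφ : ((hom M N).d n l).hom φ = 0) : ∃ ψ, ((hom M N).d m n).hom ψ = φ := by
  have hc : ((hom M (shiftMod N (-n))).d 0 1).hom (comp n (-n) 0 (by omega) φ (toShift N (-n))) = 0 := by
    rw [d_comp_of_left_closed (q' := -n + 1) (by omega) rfl (by omega) φ _ hl hφ, d_toShift _ _ rfl, map_zero]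
  obtain ⟨s, hs⟩ := (cls_eq_zero_iff ⟨_, hc⟩).1 (hM _ (isAcyclic_shiftMod hN (-n))
    (H0.cls ⟨comp n (-n) 0 (by omega) φ (toShift N (-n)), hc⟩))
  refine ⟨n.negOnePow • comp (-1) (- -n) m (by omega) s (ofShift N (-n)), ?_⟩
  rw [Units.smul_def, map_zsmul, d_comp_of_right_closed (p' := 0) (by omega) rfl hm s
    (ofShift N (-n)) rfl (d_ofShift _ _ rfl), hs]
  change _ • _ • comp 0 (- -n) n _ (comp n (-n) 0 _ φ (toShift N (-n))) (ofShift N (-n)) = _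
  rw [DGCategory.assoc n (-n) (- -n) 0 0 n (by omega) (by omega) (by omega) (by omega), toShift_ofShift,
    comp_one, Units.smul_def, smul_smul, ← Units.val_mul, neg_neg]
  simp

lemma closed_cone (w : Z0 k M N) : (-1 : ℤ) + 1 = 0 ∧ ((hom (k := k) M N).d 0 (0 + 1)).hom w.1 = 0 :=
  ⟨rfl, w.2⟩

lemma isAcyclic_attachMod_of_quasiIso (w : Z0 k M N) (hw : ∀ W, QuasiIso (app w W)) :
    (attachMod (-1) w.1 (closed_cone w)).IsAcyclic := by
  intro W i
  obtain ⟨j, hj⟩ : ∃ j, j + 1 = i := ⟨i - 1, by omega⟩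
  refine (exactAt_iff hj (show i + 1 = i - -1 by omega)).2 fun z hz => ?_
  have h1 := attachSnd_d (-1) w.1 (closed_cone w) W i (i - -1) (by omega) z
  have h2 := attachFst_d (-1) w.1 (closed_cone w) W i (i - -1) (by omega) z
  rw [hz, map_zero] at h1 h2
  obtain ⟨x', y', h3, h4⟩ := (quasiIso_iff_coneExactAt _).1 (hw W) i j (i - -1) (i - -1 - -1)
    hj (by omega) (by omega) (attachSnd (-1) w.1 (closed_cone w) W i z)
    (-attachFst (-1) w.1 (closed_cone w) W i z) (by simpa using h1) (by
      rw [map_neg, app_apply, eq_neg_iff_add_eq_zero, add_comm]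
      exact h2.symm)
  have hij : i = j - -1 := by omega
  refine ⟨attachι (-1) w.1 (closed_cone w) W j (-y') +
    attachκ (-1) w.1 (closed_cone w) W j (-castX (M.obj W) hij x'), ?_⟩
  rw [map_add, attach_d_ι _ _ _ _ _ _ hj, attach_d_κ _ _ _ _ _ _ hj]
  refine attach_ext _ _ _ _ _ ?_ ?_
  · have h7 := neg_eq_iff_eq_neg.1 h4
    rw [app_apply] at h7
    simp only [map_add, attachFst_ι, map_neg, Units.smul_def, map_zsmul, attachFst_κ, ap_castX, h7]
    simp
  · simp only [map_add, attachSnd_ι, map_neg, Units.smul_def, map_zsmul, attachSnd_κ, d_castX, h3]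
    simp

/-- The standard cone of a closed morphism of degree `0`. -/
def coneData (w : Z0 k M N) : ConeData w (attachMod (-1) w.1 (closed_cone w)) where
  i := attachInr (-1) w.1 (closed_cone w)
  j := attachInl (-1) w.1 (closed_cone w)
  p := attachProjSnd (-1) w.1 (closed_cone w)
  s := attachProjFst (-1) w.1 (closed_cone w)
  d_i := d_attachInr (-1) w.1 (closed_cone w) 0 rfl
  d_p := d_attachProjSnd (-1) w.1 (closed_cone w) 2 rfl
  d_s := d_attachProjFst (-1) w.1 (closed_cone w)
  i_p := attachInr_attachDesc _ _ _
  j_s := attachInl_attachDesc _ _ _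
  j_p := attachInl_attachDesc _ _ _
  i_s := attachInr_attachDesc _ _ _
  p_i_add_s_j := by
    refine hom_ext' fun W p q h z => ?_
    obtain rfl : p = q := by omega
    rw [ap_add, LinearMap.add_apply, ap_one, castX_rfl,
      ap_comp _ _ _ W p p p h (add_zero p), ap_attachProjFst, ap_attachInl]
    refine Eq.trans (congrArg (· + _) ((ap_comp _ _ _ W p (p - -1) p h (by omega) z).trans
      ((congrArg _ (ap_attachProjSnd (-1) w.1 (closed_cone w) W p z)).trans
        (ap_attachInr' (-1) w.1 (closed_cone w) W p _)))) ?_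
    rw [add_comm]
    exact (attach_decomp _ _ _ _ _ z).symm

end HProjective

end DGModule

section Cones

variable {k : Type v} [CommRing k] {A : Type u} [DGCategory k A] {X Y C : A} {f : Z0 k X Y}

lemma ConeData.exactAt_iff_coneExactAt_postcomp (c : ConeData f C) (L : A) (n : ℤ) :
    (hom (k := k) L C).ExactAt n ↔ ConeExactAt (postcomp L f) n := by
  constructor
  · intro hC m n' n'' hm hn hn' α z hα hz
    have hz' : ((hom L Y).d n n').hom z = comp n' 0 n' (add_zero n') α f.1 := hz.symm
    have hcl : ((hom L C).d n n').hom (comp n' (-1) n (by omega) α c.i -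
        comp n 0 n (add_zero n) z c.j.1) = 0 := by
      rw [map_sub, d_comp_of_left_closed (q' := 0) (by omega) rfl hn α _ hn' hα, c.d_i,
        d_comp_closed_right, hz', DGCategory.assoc n' 0 0 n' 0 n' (by omega) (by omega) (by omega) (by omega),
        sub_self]
    obtain ⟨χ, hχ⟩ := (exactAt_iff hm hn).1 hC _ hcl
    have e1 : comp n 1 n' (by lia) (((hom L C).d m n).hom χ) c.p = α := by
      rw [hχ, map_sub, LinearMap.sub_apply,
        DGCategory.assoc n' (-1) 1 n 0 n' (by lia) (by lia) (by lia) (by lia),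
        DGCategory.assoc n 0 1 n 1 n' (by lia) (by lia) (by lia) (by lia), c.i_p, c.j_p, comp_one,
        map_zero, sub_zero]
    have e2 : comp n 0 n (by lia) (((hom L C).d m n).hom χ) c.s = - z := by
      rw [hχ, map_sub, LinearMap.sub_apply,
        DGCategory.assoc n' (-1) 0 n (-1) n (by lia) (by lia) (by lia) (by lia),
        DGCategory.assoc n 0 0 n 0 n (by lia) (by lia) (by lia) (by lia), c.i_s, c.j_s, comp_one,
        map_zero, zero_sub]
    have e3 := DGCategory.leibniz m 1 n n 2 n' (by lia) hm rfl hn χ c.p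
    rw [c.d_p, map_zero, zero_add, e1] at e3
    have e4 := DGCategory.leibniz m 0 m n 1 n (by lia) hm rfl hm χ c.s
    rw [c.d_s, e2, map_neg, ← DGCategory.assoc m 1 0 n 1 n (by lia) (by lia) (by lia) (by lia)] at e4
    refine ⟨-comp m 1 n (by lia) χ c.p, -comp m 0 m (by lia) χ c.s, ?_, ?_⟩
    · rw [map_neg, e3]
      simp
    · rw [map_neg, map_neg, e4, postcomp_apply]
      simp
  · intro hC
    refine (exactAt_iff (j := n - 1) (l := n + 1) (by lia) rfl).2 fun φ hφ => ?_
    have h1 := DGCategory.leibniz n 1 (n + 1) (n + 1) 2 (n + 2) rfl rfl rfl (by lia) φ c.p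
    rw [hφ, c.d_p, map_zero, map_zero, LinearMap.zero_apply, smul_zero, add_zero] at h1
    have h2 := DGCategory.leibniz n 0 n (n + 1) 1 (n + 1) (by lia) rfl rfl rfl φ c.s
    rw [hφ, c.d_s, map_zero, LinearMap.zero_apply, smul_zero, add_zero, map_neg,
      ← DGCategory.assoc n 1 0 (n + 1) 1 (n + 1) (by lia) (by lia) (by lia) (by lia)] at h2
    obtain ⟨x, z, hx, hz⟩ := hC (n - 1) (n + 1) (n + 2) (by lia) rfl (by lia) (comp n 1 (n + 1) rfl φ c.p)
      (-comp n 0 n (add_zero n) φ c.s) h1 (by rw [map_neg, h2, neg_neg]; rfl)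
    refine ⟨-comp n (-1) (n - 1) (by lia) x c.i - comp (n - 1) 0 (n - 1) (by lia) z c.j.1, ?_⟩
    have h3 := DGCategory.leibniz n (-1) (n - 1) (n + 1) 0 n (by lia) rfl rfl (by lia) x c.i
    rw [hx, c.d_i, ← DGCategory.assoc n 0 0 n 0 n (by lia) (by lia) (by lia) (by lia),
      DGCategory.assoc n 1 (-1) (n + 1) 0 n (by lia) (by lia) (by lia) (by lia)] at h3
    have h4 : comp n 0 n (add_zero n) φ c.s = -(comp n 0 n (add_zero n) x f.1 +
      ((hom L Y).d (n - 1) n).hom z) := by rw [← neg_eq_iff_eq_neg, hz]; rfl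
    have h5 := congrArg (comp n 0 n (add_zero n) φ) c.p_i_add_s_j
    rw [comp_one, map_add, ← DGCategory.assoc n 0 0 n 0 n (by lia) (by lia) (by lia) (by lia), h4,
      map_neg, map_add, LinearMap.neg_apply, LinearMap.add_apply] at h5
    refine Eq.trans ?_ h5
    rw [map_sub, map_neg, h3, d_comp_closed_right]
    simp
    abel

lemma ConeData.exactAt_iff_coneExactAt_precomp (c : ConeData f C) (L : A) (n l : ℤ) (hl : n + 1 = l) :
    (hom (k := k) C L).ExactAt l ↔ ConeExactAt (precomp f L) n := by
  have hs : n.negOnePow = -l.negOnePow := by rw [← hl, Int.negOnePow_succ, neg_neg]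
  constructor
  · intro hC m l' l'' hm hl' hl'' x z hx hz
    obtain rfl : l' = l := by lia
    have hz' : ((hom X L).d n l').hom z = comp 0 l' l' (zero_add l') f.1 x := hz.symm
    have h1 := DGCategory.leibniz 0 l' l' 1 l'' l'' (by lia) rfl hl'' hl'' c.s x
    rw [hx, c.d_s, map_zero, zero_add, map_neg, LinearMap.neg_apply,
      DGCategory.assoc 1 0 l' 1 l' l'' (by lia) (by lia) (by lia) (by lia)] at h1
    have h2 := DGCategory.leibniz 1 n l' 2 l' l'' (by lia) rfl hl hl'' c.p z
    rw [hz', c.d_p, map_zero, LinearMap.zero_apply, smul_zero, add_zero] at h2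
    obtain ⟨χ, hχ⟩ := (exactAt_iff hl hl'').1 hC (comp 0 l' l' (by lia) c.s x +
      l'.negOnePow • comp 1 n l' (by lia) c.p z) (by
        rw [map_add, Units.smul_def, map_zsmul, h1, h2, Units.smul_def, smul_neg, neg_add_cancel])
    have h3 := DGCategory.leibniz (-1) n m 0 l' n (by lia) rfl hl hm c.i χ
    rw [hχ, c.d_i, map_add, Units.smul_def, map_zsmul,
      ← DGCategory.assoc (-1) 1 n 0 l' n (by lia) (by lia) (by lia) (by lia), c.i_p, one_comp,
      ← DGCategory.assoc (-1) 0 l' (-1) l' n (by lia) (by lia) (by lia) (by lia), c.i_s,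
      map_zero, LinearMap.zero_apply, zero_add,
      DGCategory.assoc 0 0 n 0 n n (by lia) (by lia) (by lia) (by lia), hs] at h3
    have h4 := d_comp_closed_left c.j n l' χ
    rw [hχ, map_add, Units.smul_def, map_zsmul,
      ← DGCategory.assoc 0 1 n 1 l' l' (by lia) (by lia) (by lia) (by lia), c.j_p, map_zero,
      LinearMap.zero_apply, smul_zero, add_zero,
      ← DGCategory.assoc 0 0 l' 0 l' l' (by lia) (by lia) (by lia) (by lia), c.j_s, one_comp] at h4
    refine ⟨comp 0 n n (zero_add n) c.j.1 χ, l'.negOnePow • comp (-1) n m (by lia) c.i χ, h4, ?_⟩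
    rw [Units.smul_def, map_zsmul, h3, precomp_apply]
    rcases Int.units_eq_one_or l'.negOnePow with h | h <;> simp [h, Units.smul_def]
  · intro hC
    refine (exactAt_iff hl (l := l + 1) rfl).2 fun ψ hψ => ?_
    have h1 := d_comp_closed_left c.j l (l + 1) ψ
    rw [hψ, map_zero] at h1
    have h2 := DGCategory.leibniz (-1) l n 0 (l + 1) l (by lia) rfl rfl hl c.i ψ
    rw [hψ, map_zero, zero_add, c.d_i,
      DGCategory.assoc 0 0 l 0 l l (by lia) (by lia) (by lia) (by lia)] at h2
    obtain ⟨x, z, hx, hz⟩ := hC (n - 1) l (l + 1) (by omega) hl rfl (comp 0 l l (zero_add l) c.j.1 ψ)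
      (l.negOnePow • comp (-1) l n (by omega) c.i ψ) h1 (by
        rw [Units.smul_def, map_zsmul, h2, precomp_apply, Units.smul_def, smul_smul,
          ← Units.val_mul, Int.units_mul_self]
        simp)
    have h3 := DGCategory.leibniz 0 n n 1 l l (by omega) rfl hl hl c.s x
    rw [hx, c.d_s, hs, map_neg, LinearMap.neg_apply, ← DGCategory.assoc 0 0 l 0 l l (by omega) (by omega)
      (by omega) (by omega), DGCategory.assoc 1 0 n 1 n l (by omega) (by omega) (by omega) (by omega)] at h3
    have h4 := DGCategory.leibniz 1 (n - 1) n 2 n l (by omega) rfl (by omega) hl c.p z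
    rw [c.d_p, map_zero, LinearMap.zero_apply, smul_zero, add_zero] at h4
    have h5 := congrArg (fun t => comp 0 l l (zero_add l) t ψ) c.p_i_add_s_j
    simp only [one_comp, map_add, LinearMap.add_apply] at h5
    have h6 : comp (-1) l n (by omega) c.i ψ = l.negOnePow • (comp 0 n n (zero_add n) f.1 x +
        ((hom X L).d (n - 1) n).hom z) := by
      have := congrArg (l.negOnePow • ·) hz
      simp only [smul_smul, Int.units_mul_self, one_smul] at this
      exact this
    rw [DGCategory.assoc 1 (-1) l 0 n l (by omega) (by omega) (by omega) (by omega), h6] at h5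
    refine ⟨comp 0 n n (zero_add n) c.s x + l.negOnePow • comp 1 (n - 1) n (by omega) c.p z, ?_⟩
    refine Eq.trans ?_ h5
    rw [map_add, Units.smul_def, map_zsmul, h3, h4]
    rcases Int.units_eq_one_or l.negOnePow with h | h <;> simp [h, Units.smul_def] <;> abel

lemma ConeData.quasiIso_postcomp (c : ConeData f C) (L : A) (hC : (hom (k := k) L C).Acyclic) :
    QuasiIso (postcomp L f) :=
  (quasiIso_iff_coneExactAt _).2 fun n => (c.exactAt_iff_coneExactAt_postcomp L n).1 (hC n)

end Cones

namespace DGModule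

variable {k : Type v} [CommRing k] {A : Type v} [DGCategory k A] {M N L : DGModule k A}

lemma IsHProjective.quasiIso_postcomp (hL : L.IsHProjective) (w : Z0 k M N)
    (hw : ∀ W, QuasiIso (app w W)) : QuasiIso (postcomp L w) :=
  (coneData w).quasiIso_postcomp L fun n => (exactAt_iff (j := n - 1) (by omega) rfl).2 fun φ hφ =>
    hL.exists_boundary (isAcyclic_attachMod_of_quasiIso w hw) (by omega) rfl φ hφ

section Restriction

variable (P : A → Prop)

/-- The restriction of a dg-module to a full dg-subcategory. -/
def res (M : DGModule k A) : DGModule k (Subtype P) where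
  obj W := M.obj W.1
  act := M.act
  act_one := M.act_one
  act_act := M.act_act
  leibniz := M.leibniz

/-- The restriction of morphisms. -/
def resMap (M N : DGModule k A) : hom (k := k) M N ⟶ hom (res P M) (res P N) where
  f _ := ModuleCat.ofHom
    { toFun := fun φ => ⟨fun W => φ.1 W.1, fun V W => φ.2 V.1 W.1⟩
      map_add' := fun _ _ => rfl
      map_smul' := fun _ _ => rfl }
  comm' _ _ _ := rfl

end Restriction

end DGModule

end DG

namespace DG

open DGCategory DGModule

section Complexes

variable {k : Type v} [CommRing k] {K L K' L' : CochainComplex (ModuleCat.{v} k) ℤ}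

lemma coneExactAt_iff_homologyMap (φ : K ⟶ L) (n : ℤ) : ConeExactAt φ n ↔
    Function.Injective (HomologicalComplex.homologyMap φ (n + 1)).hom ∧
      Function.Surjective (HomologicalComplex.homologyMap φ n).hom := by
  rw [coneExactAt_iff, injective_homologyMap_iff φ rfl (show n + 1 + 1 = n + 2 by omega),
    surjective_homologyMap_iff φ (show n - 1 + 1 = n by omega) rfl]

lemma coneExactAt_iff_of_square {φ : K ⟶ L} {ψ : K' ⟶ L'} (a : K ⟶ K') (b : L ⟶ L')
    (ha : QuasiIso a) (hb : QuasiIso b) (h : φ ≫ b = a ≫ ψ) (n : ℤ) :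
    ConeExactAt φ n ↔ ConeExactAt ψ n := by
  have key : ∀ i, (HomologicalComplex.homologyMap b i).hom ∘ (HomologicalComplex.homologyMap φ i).hom =
      (HomologicalComplex.homologyMap ψ i).hom ∘ (HomologicalComplex.homologyMap a i).hom := by
    intro i
    have := congrArg (fun χ => HomologicalComplex.homologyMap χ i) h
    simp only [HomologicalComplex.homologyMap_comp] at this
    exact congrArg (fun χ : K.homology i ⟶ L'.homology i => (χ.hom : K.homology i → L'.homology i)) this
  have bij : ∀ {K L : CochainComplex (ModuleCat.{v} k) ℤ} (a : K ⟶ L) (_ : QuasiIso a) (i : ℤ),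
      Function.Bijective (HomologicalComplex.homologyMap a i).hom := by
    intro K L a ha i
    simp only [quasiIso_iff, quasiIsoAt_iff_injective_surjective] at ha
    exact ha i
  rw [coneExactAt_iff_homologyMap, coneExactAt_iff_homologyMap,
    ← (bij b hb (n + 1)).injective.of_comp_iff, ← Function.Surjective.of_comp_iff' (bij b hb n), key,
    key, Function.Injective.of_comp_iff' _ (bij a ha (n + 1)),
    (bij a ha n).surjective.of_comp_iff]

end Complexes

section

variable {k : Type v} [CommRing k] {A : Type u} [DGCategory k A]

lemma IsHoShift.trans_iso {n : ℤ} {X Y Y' : A} (h : IsHoShift k n X Y) (w : Z0 k Y Y')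
    (hw : IsIso (H0.cls w)) : IsHoShift k n X Y' := by
  obtain ⟨a, b, ha, hb, ⟨u, hu⟩, ⟨u', hu'⟩⟩ := h
  obtain ⟨w', ⟨s, hs⟩, ⟨t, ht⟩⟩ := exists_homotopyInverse w
  have hs' : comp 0 0 0 (add_zero 0) w.1 w'.1 = ((hom _ _).d (-1) 0).hom s + one _ := by
    rw [hs]; exact (sub_add_cancel _ _).symm
  have ht' : comp 0 0 0 (add_zero 0) w'.1 w.1 = ((hom _ _).d (-1) 0).hom t + one _ := by
    rw [ht]; exact (sub_add_cancel _ _).symm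
  refine ⟨comp (-n) 0 (-n) (by omega) a w.1, comp 0 n n (by omega) w'.1 b, ?_, ?_,
    ⟨u + n.negOnePow • comp (-n - 1) n (-1) (by omega) (comp (-n) (-1) (-n - 1) (by omega) a s) b, ?_⟩,
    ⟨t + comp (-1) 0 (-1) (by omega) (comp 0 (-1) (-1) (by omega) w'.1 u') w.1, ?_⟩⟩
  · rw [d_comp_closed_right, ha, map_zero, LinearMap.zero_apply]
  · rw [d_comp_closed_left, hb, map_zero]
  · rw [DGCategory.assoc (-n) 0 n (-n) n 0 (by omega) (by omega) (by omega) (by omega),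
      ← DGCategory.assoc 0 0 n 0 n n (by omega) (by omega) (by omega) (by omega), hs', map_add,
      LinearMap.add_apply, one_comp, map_add, add_sub_assoc, hu, map_add, add_comm, Units.smul_def,
      map_zsmul, d_comp_of_right_closed (p' := -n) (r' := 0) (by omega) (by omega) rfl _ b rfl hb,
      d_comp_of_left_closed (q' := 0) (by omega) rfl (by omega) a s rfl ha, Units.smul_def, smul_smul,
      ← Units.val_mul, Int.units_mul_self,
      DGCategory.assoc (-n) 0 n (-n) n 0 (by omega) (by omega) (by omega) (by omega)]
    simp
  · rw [DGCategory.assoc 0 n (-n) n 0 0 (by omega) (by omega) (by omega) (by omega),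
      ← DGCategory.assoc n (-n) 0 0 (-n) 0 (by omega) (by omega) (by omega) (by omega),
      eq_add_of_sub_eq hu', map_add, LinearMap.add_apply, one_comp, map_add, ht', map_add,
      d_comp_closed_right, d_comp_closed_left,
      DGCategory.assoc 0 0 0 0 0 0 (by omega) (by omega) (by omega) (by omega)]
    abel

/-- A closed morphism of degree `0`, from a proof that its differential vanishes. -/
def Z0.mk {X Y : A} (f : (hom (k := k) X Y).X 0) (hf : ((hom (k := k) X Y).d 0 1).hom f = 0) :
    Z0 k X Y := ⟨f, hf⟩

@[simp] lemma Z0.mk_val {X Y : A} (f : (hom (k := k) X Y).X 0)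
    (hf : ((hom (k := k) X Y).d 0 1).hom f = 0) : (Z0.mk f hf).1 = f := rfl

lemma exactAt_zero_iff (X Y : A) : (hom (k := k) X Y).ExactAt 0 ↔
    ∀ f : (H0.of X : H0 k A) ⟶ H0.of Y, f = 0 := by
  rw [exactAt_iff (i := 0) (j := -1) (l := 1) rfl rfl]
  constructor
  · intro H f
    obtain ⟨f, rfl⟩ := cls_surjective f
    exact (cls_eq_zero_iff f).2 (H f.1 f.2)
  · intro H f hf
    exact (cls_eq_zero_iff ⟨f, hf⟩).1 (H _)

lemma isZero_of_exactAt {X : A} (h : (hom (k := k) X X).ExactAt 0) : IsZero (H0.of X : H0 k A) :=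
  (IsZero.iff_id_eq_zero _).2 ((exactAt_zero_iff X X).1 h _)

lemma acyclic_of_isZero_left {X : A} (h : IsZero (H0.of X : H0 k A)) (Y : A) :
    (hom (k := k) X Y).Acyclic := by
  intro i
  obtain ⟨s, hs⟩ := (cls_eq_zero_iff (Z0.one X : Z0 k X X)).1 (h.eq_of_src _ _)
  refine (exactAt_iff (j := i - 1) (l := i + 1) (by omega) rfl).2 fun x hx => ?_
  refine ⟨i.negOnePow • comp (-1) i (i - 1) (by omega) s x, ?_⟩
  rw [Units.smul_def, map_zsmul, d_comp_of_right_closed (p' := 0) (by omega) rfl (by omega) s x rfl hx, hs,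
    Units.smul_def, smul_smul, ← Units.val_mul, Int.units_mul_self]
  simp [Z0.one, one_comp]

lemma acyclic_of_isZero_right {X : A} (h : IsZero (H0.of X : H0 k A)) (Y : A) :
    (hom (k := k) Y X).Acyclic := by
  intro i
  obtain ⟨s, hs⟩ := (cls_eq_zero_iff (Z0.one X : Z0 k X X)).1 (h.eq_of_src _ _)
  refine (exactAt_iff (j := i - 1) (l := i + 1) (by omega) rfl).2 fun x hx => ?_
  refine ⟨comp i (-1) (i - 1) (by omega) x s, ?_⟩
  rw [d_comp_of_left_closed (q' := 0) (by omega) rfl (by omega) x s rfl hx, hs]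
  simp [Z0.one, comp_one]

lemma IsHoShift.symm {n : ℤ} {X Y : A} (h : IsHoShift k n X Y) : IsHoShift k (-n) Y X := by
  obtain ⟨a, b, ha, hb, hab, hba⟩ := h
  obtain ⟨m, hm⟩ : ∃ m, m = -n := ⟨_, rfl⟩
  obtain rfl : n = -m := by omega
  rw [← hm]
  have key : ∀ (l : ℤ) (_ : l = m), ∃ a' : (hom (k := k) X Y).X l, ((hom X Y).d l (l + 1)).hom a' = 0 ∧
    (∃ s, comp l (-m) 0 (by omega) a' b - one X = ((hom X X).d (-1) 0).hom s) ∧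
    (∃ s, comp (-m) l 0 (by omega) b a' - one Y = ((hom Y Y).d (-1) 0).hom s) := by
    intro l hl
    obtain rfl : l = - -m := by omega
    exact ⟨a, ha, hab, hba⟩
  obtain ⟨a', h1, h2, h3⟩ := key m rfl
  exact ⟨b, a', hb, h1, h3, h2⟩

lemma IsHoShift.exactAt_right {n : ℤ} {X Y : A} (h : IsHoShift k n X Y) (W : A) (i j : ℤ)
    (hij : i + n = j) (hj : (hom (k := k) W X).ExactAt j) : (hom (k := k) W Y).ExactAt i := by
  obtain ⟨a, b, ha, hb, -, s, hs⟩ := h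
  refine (exactAt_iff (j := i - 1) (l := i + 1) (by omega) rfl).2 fun x hx => ?_
  have h1 := d_comp_of_right_closed (r := j) (r' := j + 1) hij rfl rfl x b rfl hb
  rw [hx, map_zero, LinearMap.zero_apply, smul_zero] at h1
  obtain ⟨y, hy⟩ := (exactAt_iff (j := j - 1) (l := j + 1) (by omega) rfl).1 hj _ h1
  have h2 := d_comp_of_right_closed (r := i - 1) (r' := i) (by omega) (show j - 1 + 1 = j by omega) (by omega) y a
    rfl ha
  rw [hy, DGCategory.assoc i n (-n) j 0 i (by omega) (by omega) (by omega) (by omega), eq_add_of_sub_eq hs,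
    map_add, comp_one] at h2
  refine ⟨(-n).negOnePow • comp (j - 1) (-n) (i - 1) (by omega) y a - comp i (-1) (i - 1) (by omega) x s, ?_⟩
  rw [map_sub, Units.smul_def, map_zsmul, h2,
    d_comp_of_left_closed (q' := 0) (by omega) rfl (by omega) x s rfl hx, Units.smul_def, smul_smul,
    ← Units.val_mul, Int.units_mul_self]
  simp

lemma IsHoShift.exactAt_right_iff {n : ℤ} {X Y : A} (h : IsHoShift k n X Y) (W : A) (i j : ℤ)
    (hij : i + n = j) : (hom (k := k) W X).ExactAt j ↔ (hom (k := k) W Y).ExactAt i :=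
  ⟨h.exactAt_right W i j hij, h.symm.exactAt_right W j i (by omega)⟩

lemma IsHoShift.exactAt_left {n : ℤ} {X Y : A} (h : IsHoShift k n X Y) (W : A) (i j : ℤ)
    (hij : i = j + n) (hj : (hom (k := k) X W).ExactAt j) : (hom (k := k) Y W).ExactAt i := by
  obtain ⟨a, b, ha, hb, -, s, hs⟩ := h
  refine (exactAt_iff (j := i - 1) (l := i + 1) (by omega) rfl).2 fun x hx => ?_
  have h1 := d_comp_of_left_closed (r := j) (r' := j + 1) (by omega) rfl rfl a x rfl ha
  rw [hx, map_zero] at h1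
  obtain ⟨y, hy⟩ := (exactAt_iff (j := j - 1) (l := j + 1) (by omega) rfl).1 hj _ h1
  have h2 := d_comp_of_left_closed (r := i - 1) (r' := i) (by omega) (show j - 1 + 1 = j by omega) (by omega) b y
    rfl hb
  rw [hy, ← DGCategory.assoc n (-n) i 0 j i (by omega) (by omega) (by omega) (by omega), eq_add_of_sub_eq hs,
    map_add, LinearMap.add_apply, one_comp] at h2
  refine ⟨comp n (j - 1) (i - 1) (by omega) b y - i.negOnePow • comp (-1) i (i - 1) (by omega) s x, ?_⟩
  rw [map_sub, Units.smul_def, map_zsmul, h2,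
    d_comp_of_right_closed (p' := 0) (by omega) rfl (by omega) s x rfl hx, Units.smul_def, smul_smul,
    ← Units.val_mul, Int.units_mul_self]
  simp

lemma IsHoShift.exactAt_left_iff {n : ℤ} {X Y : A} (h : IsHoShift k n X Y) (W : A) (i j : ℤ)
    (hij : i = j + n) : (hom (k := k) X W).ExactAt j ↔ (hom (k := k) Y W).ExactAt i :=
  ⟨h.exactAt_left W i j hij, h.symm.exactAt_left W j i (by omega)⟩

end

section WeakKernel

variable {k : Type v} [CommRing k] {A : Type u} [DGCategory k A] {X Y Y' C : A} (f : Z0 k X Y)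
  (a : (hom (k := k) Y Y').X 1)

lemma cls_comp_eq_zero_of_shift (b : (hom (k := k) Y' Y).X (-1))
    (hb : ((hom (k := k) Y' Y).d (-1) 0).hom b = 0) (s : (hom (k := k) Y Y).X (-1))
    (hs : comp 1 (-1) 0 rfl a b - one Y = ((hom Y Y).d (-1) 0).hom s)
    (p : Z0 k C X) (q : (hom (k := k) C Y').X 0)
    (hq : ((hom C Y').d 0 1).hom q = -comp 0 1 1 rfl p.1 (comp 0 1 1 rfl f.1 a)) :
    H0.cls p ≫ H0.cls f = 0 := by
  refine (cls_eq_zero_iff (Z0.comp p f)).2 ⟨comp 0 (-1) (-1) rfl q b -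
    comp 0 (-1) (-1) rfl (Z0.comp p f).1 s, ?_⟩
  rw [map_sub, d_comp_of_right_closed (p := 0) (q := -1) (r := -1) (p' := 1) (r' := 0) rfl rfl rfl q b
    (q' := 0) rfl hb, hq, d_comp_closed_left, ← hs, map_sub, comp_one, map_neg, LinearMap.neg_apply,
    ← DGCategory.assoc 0 0 1 0 1 1 rfl rfl rfl rfl,
    DGCategory.assoc 0 1 (-1) 1 0 0 rfl rfl rfl rfl]
  simp [Z0.comp]

lemma exists_lift_of_shift (ha : ((hom (k := k) Y Y').d 1 2).hom a = 0) (p : Z0 k C X) (j : Z0 k Y' C)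
    (i : (hom (k := k) X C).X 0)
    (hi : ((hom X C).d 0 1).hom i = comp 1 0 1 rfl (comp 0 1 1 rfl f.1 a) j.1)
    (hip : comp 0 0 0 rfl i p.1 = one X) (hjp : comp 0 0 0 rfl j.1 p.1 = 0)
    {W : A} (h : Z0 k W X) (hh : H0.cls h ≫ H0.cls f = 0) : ∃ l : Z0 k W C, Z0.comp l p = h := by
  obtain ⟨z, hz⟩ := (cls_eq_zero_iff (Z0.comp h f)).1 hh
  refine ⟨Z0.mk (comp 0 0 0 rfl (comp (-1) 1 0 rfl z a) j.1 + comp 0 0 0 rfl h.1 i) ?_, Subtype.ext ?_⟩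
  · rw [map_add, d_comp_closed_right, d_comp_closed_left, hi,
      d_comp_of_right_closed (p := -1) (q := 1) (r := 0) (p' := 0) (r' := 1) rfl rfl rfl z a (q' := 2) rfl
        ha, hz, ← DGCategory.assoc 0 1 0 1 1 1 rfl rfl rfl rfl, ← DGCategory.assoc 0 0 1 0 1 1 rfl rfl rfl rfl]
    simp [Z0.comp]
  · change comp 0 0 0 rfl (comp 0 0 0 rfl (comp (-1) 1 0 rfl z a) j.1 + comp 0 0 0 rfl h.1 i) p.1 = h.1
    rw [map_add, LinearMap.add_apply, DGCategory.assoc 0 0 0 0 0 0 rfl rfl rfl rfl, hjp, map_zero, zero_add,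
      DGCategory.assoc 0 0 0 0 0 0 rfl rfl rfl rfl, hip, comp_one]

end WeakKernel

section FullyFaithful

variable {k : Type v} [CommRing k] {A : Type u₁} [DGCategory k A] {B : Type u₂} [DGCategory k B]
  (F : DGFunctor k A B) (hF : ∀ X Y n, Function.Bijective ((F.map X Y).f n).hom)

lemma DGFunctor.mapZ0_comp {X Y Z : A} (f : Z0 k X Y) (g : Z0 k Y Z) :
    F.mapZ0 (Z0.comp f g) = Z0.comp (F.mapZ0 f) (F.mapZ0 g) :=
  Subtype.ext (F.map_comp 0 0 0 (add_zero 0) f.1 g.1)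

lemma DGFunctor.mapZ0_one (X : A) : F.mapZ0 (Z0.one X : Z0 k X X) = Z0.one _ :=
  Subtype.ext (F.map_one X)

lemma DGFunctor.mapZ0_add {X Y : A} (f g : Z0 k X Y) : F.mapZ0 (f + g) = F.mapZ0 f + F.mapZ0 g :=
  Subtype.ext (map_add _ _ _)

lemma DGFunctor.mapZ0_zero {X Y : A} : F.mapZ0 (0 : Z0 k X Y) = 0 :=
  Subtype.ext (map_zero _)

variable {F}

include hF

lemma DGFunctor.mapZ0_surjective {X Y : A} (g : Z0 k (F.obj X) (F.obj Y)) :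
    ∃ f : Z0 k X Y, F.mapZ0 f = g := by
  obtain ⟨f, hf⟩ := (hF X Y 0).2 g.1
  exact ⟨Z0.mk f ((hF X Y 1).1 (by rw [← hom_d_apply, hf, g.2, map_zero])), Subtype.ext hf⟩

lemma DGFunctor.cls_mapZ0_injective {X Y : A} {f g : Z0 k X Y}
    (h : H0.cls (F.mapZ0 f) = H0.cls (F.mapZ0 g)) : H0.cls f = H0.cls g := by
  obtain ⟨s, hs⟩ := (cls_eq_iff _ _).1 h
  obtain ⟨s, rfl⟩ := (hF X Y (-1)).2 s
  refine (cls_eq_iff _ _).2 ⟨s, (hF X Y 0).1 ?_⟩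
  rw [← hom_d_apply, hs, map_sub]
  rfl

lemma IsHoShift.of_map {n : ℤ} {X Y : A} (h : IsHoShift k n (F.obj X) (F.obj Y)) :
    IsHoShift k n X Y := by
  obtain ⟨a, b, ha, hb, ⟨s, hs⟩, ⟨t, ht⟩⟩ := h
  obtain ⟨a, rfl⟩ := (hF X Y (-n)).2 a
  obtain ⟨b, rfl⟩ := (hF Y X n).2 b
  obtain ⟨s, rfl⟩ := (hF X X (-1)).2 s
  obtain ⟨t, rfl⟩ := (hF Y Y (-1)).2 t
  refine ⟨a, b, (hF _ _ _).1 ?_, (hF _ _ _).1 ?_, ⟨s, (hF _ _ _).1 ?_⟩, ⟨t, (hF _ _ _).1 ?_⟩⟩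
  · rw [← hom_d_apply, ha, map_zero]
  · rw [← hom_d_apply, hb, map_zero]
  · rw [← hom_d_apply, ← hs, map_sub, F.map_comp, F.map_one]
  · rw [← hom_d_apply, ← ht, map_sub, F.map_comp, F.map_one]

end FullyFaithful

section Yoneda

variable {k : Type v} [CommRing k] {A : Type v} [DGCategory k A] {M N : DGModule k A}

lemma DGModule.quasiIso_app (w : Z0 k M N) [IsIso (H0.cls w)] (W : A) : QuasiIso (app w W) := by
  have h : app w W ≫ eltHom N W = eltHom M W ≫ postcomp (yon k W) w := by
    ext n x
    exact (elt_comp (add_zero n) x w.1).symm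
  have := quasiIso_eltHom (M := M) W
  have := quasiIso_eltHom (M := N) W
  have := quasiIso_postcomp (yon k W) w
  have : QuasiIso (app w W ≫ eltHom N W) := by rw [h]; infer_instance
  exact quasiIso_of_comp_right (app w W) (eltHom N W)

lemma yonedaDG_map_bijective (X Y : A) (n : ℤ) :
    Function.Bijective (((yonedaDG k A).map X Y).f n).hom :=
  eltHom_bijective (M := yon k Y) X n

lemma IsDistinguished.exactAt_right {X Y Z : A} {f : Z0 k X Y} {g : Z0 k Y Z}
    (h : IsDistinguished f g) (W : A) (n : ℤ) :
    (hom (k := k) W Z).ExactAt n ↔ ConeExactAt (postcomp W f) n := by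
  obtain ⟨C, c, w, hw, -⟩ := h
  have h1 := quasiIso_postcomp (yon k W) w
  have h2 : QuasiIso ((yonedaDG k A).map W Z) := quasiIso_eltHom (M := yon k Z) W
  rw [exactAt_iff_of_quasiIsoAt ((yonedaDG k A).map W Z) n,
    ← exactAt_iff_of_quasiIsoAt (postcomp (yon k W) w) n,
    c.exactAt_iff_coneExactAt_postcomp]
  refine (coneExactAt_iff_of_square ((yonedaDG k A).map W X) ((yonedaDG k A).map W Y)
    (quasiIso_eltHom (M := yon k X) W) (quasiIso_eltHom (M := yon k Y) W) ?_ n).symm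
  ext p x
  exact (yonedaDG k A).map_comp p 0 p (add_zero p) x f.1

lemma IsDistinguished.exactAt_left {X Y Z : A} {f : Z0 k X Y} {g : Z0 k Y Z}
    (h : IsDistinguished f g) (W : A) (n l : ℤ) (hl : n + 1 = l) :
    (hom (k := k) Z W).ExactAt l ↔ ConeExactAt (precomp f W) n := by
  obtain ⟨C, c, w, hw, -⟩ := h
  have h1 := quasiIso_precomp w (yon k W)
  have h2 : QuasiIso ((yonedaDG k A).map Z W) := quasiIso_eltHom (M := yon k W) Z
  rw [exactAt_iff_of_quasiIsoAt ((yonedaDG k A).map Z W) l,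
    exactAt_iff_of_quasiIsoAt (precomp w (yon k W)) l,
    c.exactAt_iff_coneExactAt_precomp _ n l hl]
  refine (coneExactAt_iff_of_square ((yonedaDG k A).map Y W) ((yonedaDG k A).map X W)
    (quasiIso_eltHom (M := yon k W) Y) (quasiIso_eltHom (M := yon k W) X) ?_ n).symm
  ext p x
  exact (yonedaDG k A).map_comp 0 p p (zero_add p) f.1 x

lemma isShift_shiftMod (M : DGModule k A) (n : ℤ) : IsShift k n M (shiftMod M (-n)) := by
  have key : ∀ (l : ℤ) (_ : l = - -n), ∃ b : (hom (k := k) (shiftMod M (-n)) M).X l,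
      ((hom (shiftMod M (-n)) M).d l (l + 1)).hom b = 0 ∧
      comp (-n) l 0 (by omega) (toShift M (-n)) b = one M ∧
      comp l (-n) 0 (by omega) b (toShift M (-n)) = one (shiftMod M (-n)) := by
    rintro _ rfl
    exact ⟨ofShift M (-n), d_ofShift _ _ rfl, toShift_ofShift _ _, ofShift_toShift _ _⟩
  obtain ⟨b, h1, h2, h3⟩ := key n (by omega)
  exact ⟨toShift M (-n), b, d_toShift _ _ rfl, h1, h2, h3⟩

lemma isPretr_shiftMod (hM : IsPretr k M) (e : ℤ) : IsPretr k (shiftMod M e) := by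
  obtain ⟨n, rfl⟩ : ∃ n, e = -n := ⟨-e, by omega⟩
  exact IsPretr.shift n M _ hM (isShift_shiftMod M n)

lemma attachProj_total {e r : ℤ} {f : (hom (k := k) M N).X r}
    (hf : e + 1 = r ∧ ((hom (k := k) M N).d r (r + 1)).hom f = 0) :
    comp (-e) e 0 (neg_add_cancel e) (attachProjSnd e f hf) (attachInr e f hf) +
      comp 0 0 0 (add_zero 0) (attachProjFst e f hf) (attachInl e f hf).1 = one _ := by
  refine hom_ext' fun W p q h z => ?_
  obtain rfl : p = q := by omega
  rw [ap_add, LinearMap.add_apply, ap_one, castX_rfl, ap_comp _ _ _ W p (p - e) p h (by omega),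
    ap_comp _ _ _ W p p p h (by omega), ap_attachProjFst, ap_attachInl, ap_attachProjSnd, ap_attachInr',
    add_comm]
  exact (attach_decomp _ _ _ _ _ z).symm

lemma isPretr_attachMod {e r : ℤ} {f : (hom (k := k) M N).X r}
    (hf : e + 1 = r ∧ ((hom (k := k) M N).d r (r + 1)).hom f = 0) (hM : IsPretr k M) (hN : IsPretr k N) :
    IsPretr k (attachMod e f hf) := by
  have hr := hf.1
  have hg : ((hom (k := k) (shiftMod M r) N).d 0 1).hom
      (comp (-r) r 0 (neg_add_cancel r) (ofShift M r) f) = 0 := by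
    rw [d_comp_of_left_closed (r := 0) (r' := 1) (q' := r + 1) (by omega) rfl rfl _ _ rfl (d_ofShift r _ rfl), hf.2, map_zero]
  refine IsPretr.cone (shiftMod M r) N _ (Z0.mk (comp (-r) r 0 (neg_add_cancel r) (ofShift M r) f) hg)
    (isPretr_shiftMod hM r) hN
    { i := comp (-r) e (-1) (by omega) (ofShift M r) (attachInr e f hf)
      j := attachInl e f hf
      p := comp (-e) r 1 (by omega) (attachProjSnd e f hf) (toShift M r)
      s := attachProjFst e f hf
      d_i := ?_
      d_p := ?_
      d_s := ?_
      i_p := ?_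
      j_s := attachInl_attachDesc _ _ _
      j_p := ?_
      i_s := ?_
      p_i_add_s_j := ?_ }
  · rw [d_comp_of_left_closed (r := -1) (r' := 0) (q' := r) (by omega) hr rfl _ _ rfl (d_ofShift r _ rfl), d_attachInr e f hf r hr,
      ← DGCategory.assoc (-r) r 0 0 r 0 (by omega) (by omega) (by omega) (by omega), Z0.mk_val]
  · rw [d_comp_of_left_closed (r := 1) (r' := 2) (q' := r + 1) (by omega) rfl rfl _ _ rfl (d_attachProjSnd e f hf _ rfl),
      d_toShift r _ rfl, map_zero]
  · rw [d_attachProjFst, Z0.mk_val, DGCategory.assoc (-e) r 0 1 r 1 (by omega) (by omega) (by omega) (by omega),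
      ← DGCategory.assoc r (-r) r 0 0 r (by omega) (by omega) (by omega) (by omega), toShift_ofShift, one_comp]
  · rw [DGCategory.assoc (-r) e 1 (-1) r 0 (by omega) (by omega) (by omega) (by omega),
      ← DGCategory.assoc e (-e) r 0 1 r (by omega) (by omega) (by omega) (by omega), attachProjSnd,
      attachInr_attachDesc, one_comp, ofShift_toShift]
  · rw [← DGCategory.assoc 0 (-e) r (-e) 1 1 (by omega) (by omega) (by omega) (by omega), attachProjSnd,
      attachInl_attachDesc, map_zero, LinearMap.zero_apply]
  · rw [DGCategory.assoc (-r) e 0 (-1) e (-1) (by omega) (by omega) (by omega) (by omega), attachProjFst,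
      attachInr_attachDesc, map_zero]
  · rw [DGCategory.assoc (-e) r (-1) 1 e 0 (by omega) (by omega) (by omega) (by omega),
      ← DGCategory.assoc r (-r) e 0 (-1) e (by omega) (by omega) (by omega) (by omega), toShift_ofShift, one_comp]
    exact attachProj_total hf

end Yoneda

section Pretriangulated

variable {k : Type v} [CommRing k] {A : Type v} [DGCategory k A]

lemma IsPretriangulated.exists_isIso (hA : IsPretriangulated k A) {M : DGModule k A} (hM : IsPretr k M) :
    ∃ (X : A) (w : Z0 k M (yon k X)), IsIso (H0.cls w) := by
  obtain ⟨X, ⟨i⟩⟩ := hA.quasiEquivalence.essSurj ⟨M, hM⟩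
  obtain ⟨w, hw⟩ := cls_surjective i.inv
  obtain ⟨w', hw'⟩ := cls_surjective i.hom
  refine ⟨X, w, ⟨H0.cls w', ?_, ?_⟩⟩
  · have := i.inv_hom_id
    rw [← hw, ← hw'] at this
    exact this
  · have := i.hom_inv_id
    rw [← hw, ← hw'] at this
    exact this

lemma IsPretriangulated.exists_attach (hA : IsPretriangulated k A) {X Y : A} {e r : ℤ} (f : (hom (k := k) (yon k X) (yon k Y)).X r)
    (hf : e + 1 = r ∧ ((hom (k := k) (yon k X) (yon k Y)).d r (r + 1)).hom f = 0) :
    ∃ (Z : A) (w : Z0 k (attachMod e f hf) (yon k Z)), IsIso (H0.cls w) :=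
  hA.exists_isIso (isPretr_attachMod hf (.yoneda X) (.yoneda Y))

lemma IsPretriangulated.exists_cone (hA : IsPretriangulated k A) {X Y : A} (f : Z0 k X Y) :
    ∃ (Z : A) (g : Z0 k Y Z), IsDistinguished f g := by
  obtain ⟨Z, w, hw⟩ := hA.exists_attach ((yonedaDG k A).mapZ0 f).1 (closed_cone _)
  obtain ⟨g, hg⟩ := DGFunctor.mapZ0_surjective yonedaDG_map_bijective (Z0.comp (coneData ((yonedaDG k A).mapZ0 f)).j w)
  exact ⟨Z, g, _, coneData _, w, hw, by rw [hg]⟩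

lemma IsPretriangulated.exists_isHoShift (hA : IsPretriangulated k A) (n : ℤ) (X : A) :
    ∃ Y : A, IsHoShift k n X Y := by
  obtain ⟨a, b, ha, hb, hab, hba⟩ := isShift_shiftMod (yon k X) n
  obtain ⟨Y, w, hw⟩ := hA.exists_isIso (isPretr_shiftMod (.yoneda X) (-n))
  have h : IsHoShift k n (yon k X) (shiftMod (yon k X) (-n)) :=
    ⟨a, b, ha, hb, ⟨0, by rw [hab, sub_self, map_zero]⟩, ⟨0, by rw [hba, sub_self, map_zero]⟩⟩
  exact ⟨Y, IsHoShift.of_map yonedaDG_map_bijective (h.trans_iso w hw)⟩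

lemma IsPretriangulated.hasBinaryBiproduct (hA : IsPretriangulated k A) (X Y : H0 k A) :
    HasBinaryBiproduct X Y := by
  have hz : (0 : ℤ) + 1 = 1 ∧ ((hom (k := k) (yon k X.obj) (yon k Y.obj)).d 1 (1 + 1)).hom 0 = 0 :=
    ⟨rfl, map_zero _⟩
  obtain ⟨Z, w, hw⟩ := hA.exists_attach (X := X.obj) (Y := Y.obj) (e := 0) (r := 1) 0 hz
  obtain ⟨w', hw'⟩ := cls_surjective (inv (H0.cls w))
  have hinr : ((hom (k := k) (yon k X.obj) (attachMod 0 0 hz)).d 0 1).hom (attachInr 0 0 hz) = 0 := by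
    rw [d_attachInr 0 0 hz 1 rfl, map_zero, LinearMap.zero_apply]
  have hfst : ((hom (k := k) (attachMod 0 0 hz) (yon k Y.obj)).d 0 1).hom (attachProjFst 0 0 hz) = 0 := by
    rw [d_attachProjFst 0 0 hz, map_zero, neg_zero]
  have hsnd : ((hom (k := k) (attachMod 0 0 hz) (yon k X.obj)).d 0 1).hom (attachProjSnd 0 0 hz) = 0 :=
    d_attachProjSnd 0 0 hz 1 rfl
  obtain ⟨ι₁, h₁⟩ := DGFunctor.mapZ0_surjective yonedaDG_map_bijective (Z0.comp (Z0.mk _ hinr) w)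
  obtain ⟨ι₂, h₂⟩ := DGFunctor.mapZ0_surjective yonedaDG_map_bijective (Z0.comp (attachInl 0 0 hz) w)
  obtain ⟨π₁, h₃⟩ := DGFunctor.mapZ0_surjective yonedaDG_map_bijective (Z0.comp w' (Z0.mk _ hsnd))
  obtain ⟨π₂, h₄⟩ := DGFunctor.mapZ0_surjective yonedaDG_map_bijective (Z0.comp w' (Z0.mk _ hfst))
  have e₁ : Z0.comp (Z0.mk _ hinr) (Z0.mk _ hsnd) = Z0.one _ :=
    Subtype.ext (attachInr_attachDesc (hf := hz) 0 (one _) rfl)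
  have e₂ : Z0.comp (Z0.mk _ hinr) (Z0.mk _ hfst) = 0 :=
    Subtype.ext (attachInr_attachDesc (hf := hz) (one _) 0 rfl)
  have e₃ : Z0.comp (attachInl 0 0 hz) (Z0.mk _ hsnd) = 0 :=
    Subtype.ext (attachInl_attachDesc (hf := hz) 0 (one _) rfl)
  have e₄ : Z0.comp (attachInl 0 0 hz) (Z0.mk _ hfst) = Z0.one _ :=
    Subtype.ext (attachInl_attachDesc (hf := hz) (one _) 0 rfl)
  have e₅ : Z0.comp (Z0.mk _ hsnd) (Z0.mk _ hinr) + Z0.comp (Z0.mk _ hfst) (attachInl 0 0 hz) =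
      Z0.one _ := Subtype.ext (attachProj_total hz)
  let b : BinaryBicone X Y :=
    { pt := H0.of Z
      fst := H0.cls π₁
      snd := H0.cls π₂
      inl := H0.cls ι₁
      inr := H0.cls ι₂
      inl_fst := DGFunctor.cls_mapZ0_injective (f := Z0.comp ι₁ π₁) (g := Z0.one _)
        yonedaDG_map_bijective (by
          rw [DGFunctor.mapZ0_comp, h₁, h₃, cls_comp, cls_comp, cls_comp, hw', Category.assoc,
            IsIso.hom_inv_id_assoc, ← cls_comp, e₁, DGFunctor.mapZ0_one])
      inl_snd := DGFunctor.cls_mapZ0_injective (f := Z0.comp ι₁ π₂) (g := 0)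
        yonedaDG_map_bijective (by
          rw [DGFunctor.mapZ0_comp, h₁, h₄, cls_comp, cls_comp, cls_comp, hw', Category.assoc,
            IsIso.hom_inv_id_assoc, ← cls_comp, e₂, DGFunctor.mapZ0_zero])
      inr_fst := DGFunctor.cls_mapZ0_injective (f := Z0.comp ι₂ π₁) (g := 0)
        yonedaDG_map_bijective (by
          rw [DGFunctor.mapZ0_comp, h₂, h₃, cls_comp, cls_comp, cls_comp, hw', Category.assoc,
            IsIso.hom_inv_id_assoc, ← cls_comp, e₃, DGFunctor.mapZ0_zero])
      inr_snd := DGFunctor.cls_mapZ0_injective (f := Z0.comp ι₂ π₂) (g := Z0.one _)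
        yonedaDG_map_bijective (by
          rw [DGFunctor.mapZ0_comp, h₂, h₄, cls_comp, cls_comp, cls_comp, hw', Category.assoc,
            IsIso.hom_inv_id_assoc, ← cls_comp, e₄, DGFunctor.mapZ0_one]) }
  refine hasBinaryBiproduct_of_total b (DGFunctor.cls_mapZ0_injective
    (f := Z0.comp π₁ ι₁ + Z0.comp π₂ ι₂) (g := Z0.one _) yonedaDG_map_bijective ?_)
  rw [DGFunctor.mapZ0_add, DGFunctor.mapZ0_comp, DGFunctor.mapZ0_comp, h₁, h₂, h₃, h₄, cls_add]
  simp only [cls_comp, hw', Category.assoc]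
  rw [← Preadditive.comp_add, ← Category.assoc, ← Category.assoc, ← Preadditive.add_comp, ← cls_comp,
    ← cls_comp, ← cls_add, e₅, cls_one, Category.id_comp, IsIso.inv_hom_id, DGFunctor.mapZ0_one]
  rfl

lemma IsPretriangulated.exists_isZero (hA : IsPretriangulated k A) : ∃ X : A, IsZero (H0.of X : H0 k A) := by
  obtain ⟨X⟩ := hA.nonempty
  obtain ⟨Z, g, h⟩ := hA.exists_cone (Z0.one X : Z0 k X X)
  refine ⟨Z, isZero_of_exactAt ((h.exactAt_right Z 0).2 ?_)⟩
  have : IsIso (H0.cls (Z0.one X : Z0 k X X)) := by rw [cls_one]; infer_instance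
  exact (quasiIso_iff_coneExactAt _).1 (quasiIso_postcomp Z _) 0

lemma IsPretriangulated.hasFiniteBiproducts (hA : IsPretriangulated k A) :
    HasFiniteBiproducts (H0 k A) := by
  obtain ⟨X, hX⟩ := hA.exists_isZero
  have : HasZeroObject (H0 k A) := ⟨_, hX⟩
  have : HasBinaryBiproducts (H0 k A) := ⟨hA.hasBinaryBiproduct⟩
  have : HasFiniteProducts (H0 k A) := hasFiniteProducts_of_has_binary_and_terminal
  exact HasFiniteBiproducts.of_hasFiniteProducts

/-- Weak kernels in the homotopy category. -/
lemma IsPretriangulated.exists_weakKernel (hA : IsPretriangulated k A) {X Y : A} (f : Z0 k X Y) :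
    ∃ (V : A) (g : Z0 k V X), H0.cls g ≫ H0.cls f = 0 ∧
      ∀ (W : A) (h : Z0 k W X), H0.cls h ≫ H0.cls f = 0 → ∃ l : Z0 k W V, H0.cls l ≫ H0.cls g = H0.cls h := by
  obtain ⟨Y', (a : (hom (k := k) Y Y').X 1), b, (ha : ((hom Y Y').d 1 2).hom a = 0),
    (hb : ((hom Y' Y).d (-1) 0).hom b = 0),
    ⟨s, (hs : comp 1 (-1) 0 rfl a b - one Y = ((hom Y Y).d (-1) 0).hom s)⟩, -⟩ :=
    hA.exists_isHoShift (-1) Y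
  have hv : (0 : ℤ) + 1 = 1 ∧ ((hom (k := k) (yon k X) (yon k Y')).d 1 (1 + 1)).hom
      ((((yonedaDG k A).map X Y').f 1).hom (comp 0 1 1 rfl f.1 a)) = 0 :=
    ⟨rfl, by
      refine (hom_d_apply ((yonedaDG k A).map X Y') 1 2 _).trans ?_
      rw [d_comp_closed_left, ha, map_zero, map_zero]⟩
  obtain ⟨V, w, hw⟩ := hA.exists_attach _ hv
  obtain ⟨w', hw'⟩ := cls_surjective (inv (H0.cls w))
  have hsnd : ((hom (k := k) (attachMod 0 _ hv) (yon k X)).d 0 1).hom (attachProjSnd 0 _ hv) = 0 :=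
    d_attachProjSnd 0 _ hv 1 rfl
  obtain ⟨g, hg⟩ := DGFunctor.mapZ0_surjective yonedaDG_map_bijective (Z0.comp w' (Z0.mk _ hsnd))
  have hv' := (yonedaDG k A).map_comp 0 1 1 rfl f.1 a
  refine ⟨V, g, ?_, fun W h hh => ?_⟩
  · refine DGFunctor.cls_mapZ0_injective (f := Z0.comp g f) (g := 0) yonedaDG_map_bijective ?_
    rw [DGFunctor.mapZ0_comp, hg, DGFunctor.mapZ0_zero, cls_comp, cls_comp, Category.assoc,
      cls_comp_eq_zero_of_shift ((yonedaDG k A).mapZ0 f) ((((yonedaDG k A).map Y Y').f 1).hom a)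
        ((((yonedaDG k A).map Y' Y).f (-1)).hom b) (by rw [hom_d_apply, hb, map_zero])
        ((((yonedaDG k A).map Y Y).f (-1)).hom s)
        (by rw [hom_d_apply, ← hs, map_sub, (yonedaDG k A).map_comp, (yonedaDG k A).map_one])
        (Z0.mk _ hsnd) (attachProjFst 0 _ hv)
        ((d_attachProjFst 0 _ hv).trans (congrArg (fun t => -comp 0 1 1 rfl (attachProjSnd 0 _ hv) t) hv')),
      Limits.comp_zero]
    rfl
  · obtain ⟨l, hl⟩ := exists_lift_of_shift ((yonedaDG k A).mapZ0 f)
      ((((yonedaDG k A).map Y Y').f 1).hom a) (by rw [hom_d_apply, ha, map_zero]) (Z0.mk _ hsnd)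
      (attachInl 0 _ hv) (attachInr 0 _ hv)
      ((d_attachInr 0 _ hv 1 rfl).trans (congrArg (fun t => comp 1 0 1 rfl t (attachInl 0 _ hv).1) hv'))
      (attachInr_attachDesc (hf := hv) 0 (one _) rfl) (attachInl_attachDesc (hf := hv) 0 (one _) rfl)
      ((yonedaDG k A).mapZ0 h) (by
        obtain ⟨z, hz⟩ := (cls_eq_zero_iff (Z0.comp h f)).1 hh
        rw [← cls_comp, ← DGFunctor.mapZ0_comp]
        refine (cls_eq_zero_iff _).2 ⟨(((yonedaDG k A).map W Y).f (-1)).hom z, ?_⟩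
        rw [hom_d_apply, hz]
        rfl)
    obtain ⟨l', hl'⟩ := DGFunctor.mapZ0_surjective yonedaDG_map_bijective (Z0.comp l w)
    refine ⟨l', DGFunctor.cls_mapZ0_injective (f := Z0.comp l' g) yonedaDG_map_bijective ?_⟩
    rw [DGFunctor.mapZ0_comp, hg, hl', cls_comp, cls_comp, cls_comp, hw', Category.assoc,
      IsIso.hom_inv_id_assoc, ← cls_comp, hl]

end Pretriangulated

end DG

namespace DG

open DGCategory DGModule

section Cones

variable {k : Type v} [CommRing k] {K L : CochainComplex (ModuleCat.{v} k) ℤ}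

lemma coneExactAt_of_exactAt (φ : K ⟶ L) {n m : ℤ} (h : n + 1 = m) (hK : K.ExactAt m)
    (hL : L.ExactAt n) : ConeExactAt φ n := by
  subst h
  rw [coneExactAt_iff]
  refine ⟨fun x hx z _ => (exactAt_iff rfl (by lia)).1 hK x hx, fun z hz => ?_⟩
  obtain ⟨y, hy⟩ := (exactAt_iff (j := n - 1) (by lia) rfl).1 hL z hz
  exact ⟨0, y, map_zero _, by rw [map_zero, zero_add, hy]⟩

lemma ConeExactAt.exactAt_left {φ : K ⟶ L} {n m : ℤ} (hφ : ConeExactAt φ n) (h : n + 1 = m)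
    (hL : L.ExactAt m) : K.ExactAt m := by
  subst h
  rw [exactAt_iff (j := n) (l := n + 2) rfl (by lia)]
  intro x hx
  obtain ⟨z, hz⟩ := (exactAt_iff (j := n) (l := n + 2) rfl (by lia)).1 hL ((φ.f _).hom x) (by
    rw [hom_d_apply, hx, map_zero])
  exact ((coneExactAt_iff φ n).1 hφ).1 x hx z hz.symm

lemma ConeExactAt.exactAt_right {φ : K ⟶ L} {n : ℤ} (hφ : ConeExactAt φ n)
    (hK : K.ExactAt n) : L.ExactAt n := by
  rw [exactAt_iff (j := n - 1) (l := n + 1) (by lia) rfl]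
  intro z hz
  obtain ⟨x, z', hx, h⟩ := ((coneExactAt_iff φ n).1 hφ).2 z hz
  obtain ⟨y, rfl⟩ := (exactAt_iff (j := n - 1) (l := n + 1) (by lia) rfl).1 hK x hx
  exact ⟨(φ.f _).hom y + z', by rw [map_add, hom_d_apply, h]⟩

variable {A : Type u} [DGCategory k A] {X Y C : A} {f : Z0 k X Y}

lemma ConeData.isIso_cls_j (c : ConeData f C) (hX : (hom (k := k) X X).ExactAt 0) :
    IsIso (H0.cls c.j) := by
  obtain ⟨h, hh⟩ := (exactAt_iff (i := 0) (j := -1) (l := 1) rfl rfl).1 hX (one X) (d_one X)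
  have dph : ((hom C X).d 0 1).hom (comp 1 (-1) 0 (by lia) c.p h) = c.p := by
    rw [DGCategory.leibniz 1 (-1) 0 2 0 1 (by lia) rfl rfl rfl, c.d_p, hh, comp_one]
    simp
  have hs : ((hom C Y).d 0 1).hom
      (c.s + comp 0 0 0 rfl (comp 1 (-1) 0 (by lia) c.p h) f.1) = 0 := by
    rw [map_add, c.d_s, DGCategory.leibniz 0 0 0 1 1 1 rfl rfl rfl rfl, dph, Z0_d]
    simp
  refine ⟨H0.cls (Z0.mk _ hs), ?_, ?_⟩
  · rw [← cls_comp, ← cls_one]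
    refine congrArg _ (Subtype.ext ?_)
    change comp 0 0 0 _ c.j.1 (c.s + _) = one Y
    rw [map_add, c.j_s, ← DGCategory.assoc 0 0 0 0 0 0 rfl rfl rfl rfl,
      ← DGCategory.assoc 0 1 (-1) 1 0 0 rfl rfl rfl rfl, c.j_p]
    simp
  · rw [← cls_comp, ← cls_one, cls_eq_iff]
    refine ⟨comp 0 (-1) (-1) rfl (comp 1 (-1) 0 (by lia) c.p h) c.i, ?_⟩
    rw [DGCategory.leibniz 0 (-1) (-1) 1 0 0 rfl rfl rfl rfl, c.d_i, dph]
    change _ = comp 0 0 0 _ (c.s + _) c.j.1 - one C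
    rw [← c.p_i_add_s_j, LinearMap.map_add₂, DGCategory.assoc 0 0 0 0 0 0 rfl rfl rfl rfl]
    simp
    abel

end Cones

section

variable {k : Type v} [CommRing k] {A : Type u₁} [DGCategory k A] {B : Type u₂} [DGCategory k B]

lemma DGFunctor.cls_mapZ0_eq_of_cls_eq {F : DGFunctor k A B} {X Y : A} {f g : Z0 k X Y}
    (h : H0.cls f = H0.cls g) : H0.cls (F.mapZ0 f) = H0.cls (F.mapZ0 g) := by
  rw [cls_eq_iff] at h ⊢
  obtain ⟨s, hs⟩ := h
  refine ⟨((F.map X Y).f (-1)).hom s, ?_⟩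
  rw [hom_d_apply, hs]
  exact map_sub _ _ _

lemma DGFunctor.isIso_cls_of_mapZ0 {F : DGFunctor k A B}
    (hF : ∀ (X Y : A) (n : ℤ), Function.Bijective ((F.map X Y).f n).hom) {X Y : A} (f : Z0 k X Y)
    [IsIso (H0.cls (F.mapZ0 f))] : IsIso (H0.cls f) := by
  obtain ⟨g, hg⟩ := cls_surjective (inv (H0.cls (F.mapZ0 f)))
  obtain ⟨g, rfl⟩ := DGFunctor.mapZ0_surjective hF g
  refine ⟨H0.cls g, ?_, ?_⟩
  · rw [← cls_comp, ← cls_one]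
    apply DGFunctor.cls_mapZ0_injective hF
    rw [DGFunctor.mapZ0_comp, cls_comp, hg, IsIso.hom_inv_id, DGFunctor.mapZ0_one, cls_one]
  · rw [← cls_comp, ← cls_one]
    apply DGFunctor.cls_mapZ0_injective hF
    rw [DGFunctor.mapZ0_comp, cls_comp, hg, IsIso.inv_hom_id, DGFunctor.mapZ0_one, cls_one]

end

namespace TStructure

variable {k : Type v} [CommRing k] {A : Type v} [DGCategory k A] (t : TStructure k A)

lemma le_of_iso {n : ℤ} {X Y : H0 k A} (e : X ≅ Y) (h : t.le n X) : t.le n Y :=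
  (t.le_isClosedUnderIsomorphisms n).of_iso e h

lemma ge_of_iso {n : ℤ} {X Y : H0 k A} (e : X ≅ Y) (h : t.ge n X) : t.ge n Y :=
  (t.ge_isClosedUnderIsomorphisms n).of_iso e h

variable {t}

lemma le_mono (hA : IsPretriangulated k A) {n m : ℤ} (hnm : n ≤ m) {X : A}
    (h : t.le n (H0.of X)) : t.le m (H0.of X) := by
  induction m, hnm using Int.leInduction with
  | base => exact h
  | succ m _ ih =>
    obtain ⟨Y, hY⟩ := hA.exists_isHoShift m X
    exact t.le_shift 1 (-m) (m + 1) (by lia) Y X hY.symm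
      (t.le_zero_le _ (t.le_shift m m 0 (by lia) X Y hY ih))

lemma ge_mono (hA : IsPretriangulated k A) {n m : ℤ} (hnm : n ≤ m) {X : A}
    (h : t.ge m (H0.of X)) : t.ge n (H0.of X) := by
  induction m, hnm using Int.leInduction with
  | base => exact h
  | succ m _ ih =>
    obtain ⟨Y, hY⟩ := hA.exists_isHoShift m X
    exact ih (t.ge_shift 0 (-m) m (by lia) Y X hY.symm
      (t.ge_one_le _ (t.ge_shift (m + 1) m 1 (by lia) X Y hY h)))

lemma exactAt_hom (hA : IsPretriangulated k A) {n m i : ℤ} {X Z : A} (hX : t.le n (H0.of X))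
    (hZ : t.ge m (H0.of Z)) (hi : i < m - n) : (hom (k := k) X Z).ExactAt i := by
  obtain ⟨X', hX'⟩ := hA.exists_isHoShift n X
  obtain ⟨Z', hZ'⟩ := hA.exists_isHoShift (n + i) Z
  rw [hZ'.exactAt_right_iff X (-n) i (by lia), hX'.exactAt_left_iff Z' 0 (-n) (by lia),
    exactAt_zero_iff]
  intro f
  refine t.zero f (t.le_shift n n 0 (by lia) X X' hX' hX)
    (ge_mono hA (show 1 ≤ m - n - i by lia) ?_)
  exact t.ge_shift m (n + i) (m - n - i) (by lia) Z Z' hZ' hZ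

lemma le_iff (hA : IsPretriangulated k A) (n : ℤ) (X : A) : t.le n (H0.of X) ↔
    ∀ Z, t.ge (n + 1) (H0.of Z) → (hom (k := k) X Z).ExactAt 0 := by
  refine ⟨fun h Z hZ => exactAt_hom hA h hZ (by lia), fun h => ?_⟩
  obtain ⟨X', hX'⟩ := hA.exists_isHoShift n X
  refine t.le_shift 0 (-n) n (by lia) X' X hX'.symm ?_
  have h' : ∀ Z, t.ge 1 (H0.of Z) → (hom (k := k) X' Z).ExactAt 0 := by
    intro Z hZ
    obtain ⟨Z', hZ'⟩ := hA.exists_isHoShift (-n) Z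
    rw [← hX'.exactAt_left_iff Z 0 (-n) (by lia), hZ'.exactAt_right_iff X 0 (-n) (by lia)]
    exact h Z' (t.ge_shift 1 (-n) (n + 1) (by lia) Z Z' hZ' hZ)
  obtain ⟨U, V, f, g, hU, hV, hfg⟩ := t.exists_triangle X'
  have hVz : IsZero (H0.of V : H0 k A) := by
    apply isZero_of_exactAt
    rw [hfg.exactAt_left V (-1) 0 rfl]
    exact coneExactAt_of_exactAt _ rfl (h' V hV) (exactAt_hom hA hU hV (by lia))
  have : IsIso (H0.cls f) := by
    refine isIso_cls_of_quasiIso_postcomp f fun W => ?_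
    rw [quasiIso_iff_coneExactAt]
    exact fun n => (hfg.exactAt_right W n).1 (acyclic_of_isZero_right hVz W n)
  exact t.le_of_iso (asIso (H0.cls f)) hU

lemma ge_iff (hA : IsPretriangulated k A) (n : ℤ) (X : A) : t.ge n (H0.of X) ↔
    ∀ Z, t.le (n - 1) (H0.of Z) → (hom (k := k) Z X).ExactAt 0 := by
  refine ⟨fun h Z hZ => exactAt_hom hA hZ h (by lia), fun h => ?_⟩
  obtain ⟨X', hX'⟩ := hA.exists_isHoShift (n - 1) X
  refine t.ge_shift 1 (-(n - 1)) n (by lia) X' X hX'.symm ?_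
  have h' : ∀ Z, t.le 0 (H0.of Z) → (hom (k := k) Z X').ExactAt 0 := by
    intro Z hZ
    obtain ⟨Z', hZ'⟩ := hA.exists_isHoShift (-(n - 1)) Z
    rw [← hX'.exactAt_right_iff Z 0 (n - 1) (by lia), hZ'.exactAt_left_iff X 0 (n - 1) (by lia)]
    exact h Z' (t.le_shift 0 (-(n - 1)) (n - 1) (by lia) Z Z' hZ' hZ)
  obtain ⟨U, V, f, g, hU, hV, C, c, w, hw, hcw⟩ := t.exists_triangle X'
  have hfg : IsDistinguished f g := ⟨C, c, w, hw, hcw⟩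
  have hUz : IsZero (H0.of U : H0 k A) := by
    apply isZero_of_exactAt
    exact ((hfg.exactAt_right U (-1)).1 (exactAt_hom hA hU hV (by lia))).exactAt_left rfl (h' U hU)
  have hj : IsIso (H0.cls c.j) := by
    refine c.isIso_cls_j ?_
    rw [exactAt_zero_iff]
    intro φ
    obtain ⟨φ, rfl⟩ := cls_surjective φ
    obtain ⟨φ, rfl⟩ := DGFunctor.mapZ0_surjective yonedaDG_map_bijective φ
    refine Eq.trans ((DGFunctor.cls_mapZ0_eq_of_cls_eq (g := 0) ?_)) ?_
    · exact hUz.eq_of_src _ _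
    · rw [DGFunctor.mapZ0_zero]; rfl
  have hg : IsIso (H0.cls ((yonedaDG k A).mapZ0 g)) := by
    rw [← hcw, cls_comp]; infer_instance
  have : IsIso (H0.cls g) := DGFunctor.isIso_cls_of_mapZ0 yonedaDG_map_bijective g
  exact t.ge_of_iso (asIso (H0.cls g)).symm hV

end TStructure

end DG

namespace DG

open DGCategory DGModule

namespace TStructure

variable {k : Type v} [CommRing k] {A : Type v} [DGCategory k A] {t : TStructure k A}

lemma exists_truncation (hA : IsPretriangulated k A) (hp : t.HasEnoughDerivedProjectives) :
    Nonempty t.Truncation := by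
  obtain ⟨Z, hZ⟩ := hA.exists_isZero
  have hle : t.le 0 (H0.of Z) :=
    (le_iff hA 0 Z).2 fun W _ => (exactAt_zero_iff _ _).2 fun f => hZ.eq_of_src _ _
  have hge : t.ge 0 (H0.of Z) :=
    (ge_iff hA 0 Z).2 fun W _ => (exactAt_zero_iff _ _).2 fun f => hZ.eq_of_tgt _ _
  obtain ⟨p⟩ := hp.enoughProjectives.presentation ⟨H0.of Z, hle, hge⟩
  obtain ⟨S, τ, -⟩ := hp.hasDerivedProjectives p.p p.projective
  exact ⟨τ⟩

namespace Truncation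

variable (τ : t.Truncation)

/-- The truncation `τ_{≥ 0}` as an endofunctor. -/
def G : H0 k A ⥤ H0 k A := τ.τge ⋙ (t.ge 0).ι

lemma ge_G (X : H0 k A) : t.ge 0 (τ.G.obj X) := (τ.τge.obj X).property

/-- The truncation morphism `X → τ_{≥ 0} X`. -/
def η (X : H0 k A) : X ⟶ τ.G.obj X := τ.adjGE.unit.app X

lemma η_naturality {X Y : H0 k A} (f : X ⟶ Y) : f ≫ τ.η Y = τ.η X ≫ τ.G.map f :=
  τ.adjGE.unit.naturality f

lemma exists_desc {X Y : H0 k A} (hY : t.ge 0 Y) (f : X ⟶ Y) : ∃ g : τ.G.obj X ⟶ Y, τ.η X ≫ g = f := by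
  let g := (τ.adjGE.homEquiv X ⟨Y, hY⟩).symm f
  refine ⟨g.hom, ?_⟩
  have := (τ.adjGE.homEquiv X ⟨Y, hY⟩).apply_symm_apply f
  rwa [Adjunction.homEquiv_unit] at this

lemma desc_ext {X Y : H0 k A} (hY : t.ge 0 Y) {g g' : τ.G.obj X ⟶ Y}
    (h : τ.η X ≫ g = τ.η X ≫ g') : g = g' := by
  have := (τ.adjGE.homEquiv X ⟨Y, hY⟩).injective
    (a₁ := ObjectProperty.homMk g) (a₂ := ObjectProperty.homMk g') (by
      rw [Adjunction.homEquiv_unit, Adjunction.homEquiv_unit]; exact h)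
  exact congrArg (fun f => f.hom) this

/-- The object `τ_{≤ 0} τ_{≥ 0} X`. -/
def H (X : H0 k A) : H0 k A := (τ.τle.obj (τ.G.obj X)).obj

lemma le_H (X : H0 k A) : t.le 0 (τ.H X) := (τ.τle.obj (τ.G.obj X)).property

/-- The morphism `τ_{≤ 0} τ_{≥ 0} X → τ_{≥ 0} X`. -/
def ε (X : H0 k A) : τ.H X ⟶ τ.G.obj X := τ.adjLE.counit.app (τ.G.obj X)

lemma exists_lift {P X : H0 k A} (hP : t.le 0 P) (f : P ⟶ τ.G.obj X) :
    ∃ g : P ⟶ τ.H X, g ≫ τ.ε X = f := by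
  let g := τ.adjLE.homEquiv ⟨P, hP⟩ (τ.G.obj X) f
  refine ⟨g.hom, ?_⟩
  have := (τ.adjLE.homEquiv ⟨P, hP⟩ (τ.G.obj X)).symm_apply_apply f
  rwa [Adjunction.homEquiv_counit] at this

lemma lift_ext {P X : H0 k A} (hP : t.le 0 P) {g g' : P ⟶ τ.H X}
    (h : g ≫ τ.ε X = g' ≫ τ.ε X) : g = g' := by
  have := (τ.adjLE.homEquiv ⟨P, hP⟩ (τ.G.obj X)).symm.injective
    (a₁ := ObjectProperty.homMk g) (a₂ := ObjectProperty.homMk g') (by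
      rw [Adjunction.homEquiv_counit, Adjunction.homEquiv_counit]; exact h)
  exact congrArg (fun f => f.hom) this

lemma heart_H (hA : IsPretriangulated k A) (X : H0 k A) : t.heart (τ.H X) := by
  refine ⟨τ.le_H X, (ge_iff hA 0 _).2 fun Z hZ => (exactAt_zero_iff _ _).2 fun f => ?_⟩
  refine τ.lift_ext (le_mono hA (show 0 - 1 ≤ 0 by lia) hZ) ?_
  refine Eq.trans ?_ zero_comp.symm
  exact (exactAt_zero_iff _ _).1 ((ge_iff hA 0 _).1 (τ.ge_G X) Z hZ) _

lemma G_map_zero (X Y : H0 k A) : τ.G.map (0 : X ⟶ Y) = 0 :=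
  τ.desc_ext (τ.ge_G Y) (by rw [← η_naturality, zero_comp, comp_zero])

/-- Derived projectives corepresent `X ↦ Hom(P, τ_{≥ 0} X)`, for `P` projective in the heart. -/
lemma exists_equiv {S : H0 k A} {P : t.heart.FullSubcategory} (hS : t.IsDerivedProjectiveOf S P) :
    ∃ β : ∀ X, (S ⟶ X) ≃ (P.obj ⟶ τ.G.obj X),
      ∀ (X Y : H0 k A) (f : S ⟶ X) (g : X ⟶ Y), β Y (f ≫ g) = β X f ≫ τ.G.map g := by
  obtain ⟨τ', ⟨α⟩⟩ := hS
  let e : τ'.G ≅ τ.G := Functor.isoWhiskerRight (τ'.adjGE.leftAdjointUniq τ.adjGE) _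
  let Hm : ∀ {X Y : H0 k A}, (X ⟶ Y) → (τ'.H X ⟶ τ'.H Y) := fun g => τ'.cohomology.map g
  have hε : ∀ {X Y : H0 k A} (g : X ⟶ Y), Hm g ≫ τ'.ε Y = τ'.ε X ≫ τ'.G.map g := fun g =>
    τ'.adjLE.counit.naturality (τ'.G.map g)
  let a : ∀ X, (S ⟶ X) ≃ (P.obj ⟶ τ'.H X) := fun X => (α.app X).toEquiv
  have ha : ∀ {X Y : H0 k A} (f : S ⟶ X) (g : X ⟶ Y), a Y (f ≫ g) = a X f ≫ Hm g := fun f g =>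
    ConcreteCategory.congr_hom (α.hom.naturality g) f
  clear_value a Hm e
  refine ⟨fun X => Equiv.ofBijective (fun f => a X f ≫ τ'.ε X ≫ e.hom.app X) ⟨?_, ?_⟩,
    fun X Y f g => ?_⟩
  · intro f f' hff
    refine (a X).injective (τ'.lift_ext P.property.1 ((cancel_mono (e.hom.app X)).1 ?_))
    simpa only [Category.assoc] using hff
  · intro h
    obtain ⟨g, hg⟩ := τ'.exists_lift P.property.1 (h ≫ e.inv.app X)
    refine ⟨(a X).symm g, ?_⟩
    dsimp only
    rw [Equiv.apply_symm_apply, ← Category.assoc, hg, Category.assoc, Iso.inv_hom_id_app,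
      Category.comp_id]
  · change a Y (f ≫ g) ≫ τ'.ε Y ≫ e.hom.app Y = (a X f ≫ τ'.ε X ≫ e.hom.app X) ≫ τ.G.map g
    rw [ha, Category.assoc, Category.assoc, ← Category.assoc (Hm g), hε, Category.assoc,
      e.hom.naturality]
    simp only [Category.assoc]

end Truncation

lemma dgProj.le_zero (hA : IsPretriangulated k A) (hp : t.HasEnoughDerivedProjectives) {W : A}
    (hW : t.dgProj W) : t.le 0 (H0.of W) := by
  obtain ⟨τ⟩ := exists_truncation hA hp
  obtain ⟨P, hP, hS⟩ := hW
  obtain ⟨β, hβ⟩ := τ.exists_equiv hS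
  refine (le_iff hA 0 W).2 fun Z hZ => (exactAt_zero_iff _ _).2 fun f => (β _).injective ?_
  have hZ' : t.ge 0 (H0.of Z) := ge_mono hA (by lia) hZ
  obtain ⟨r, hr⟩ := τ.exists_desc hZ' (𝟙 _)
  have h1 : r ≫ τ.η (H0.of Z) = 𝟙 _ := τ.desc_ext (τ.ge_G _) (by
    rw [← Category.assoc, hr, Category.id_comp, Category.comp_id])
  have h2 : ∀ u : P.obj ⟶ τ.G.obj (H0.of Z), u = 0 := fun u => by
    rw [← Category.comp_id u, ← h1, ← Category.assoc, t.zero (u ≫ r) P.property.1 hZ, zero_comp]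
  rw [h2 (β _ f), h2 (β _ 0)]

lemma dgProj.exactAt_of_le (hA : IsPretriangulated k A) (hp : t.HasEnoughDerivedProjectives) {W : A}
    (hW : t.dgProj W) {n i : ℤ} {X : A} (hX : t.le n (H0.of X)) (hi : n < i) :
    (hom (k := k) W X).ExactAt i := by
  obtain ⟨τ⟩ := exists_truncation hA hp
  obtain ⟨P, hP, hS⟩ := hW
  obtain ⟨β, hβ⟩ := τ.exists_equiv hS
  obtain ⟨X', hX'⟩ := hA.exists_isHoShift i X
  rw [hX'.exactAt_right_iff W 0 i (by lia), exactAt_zero_iff]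
  have hle := t.le_shift n i (n - i) (by lia) X X' hX' hX
  intro f
  refine (β _).injective ?_
  have h1 : 𝟙 (τ.G.obj (H0.of X')) = 0 := τ.desc_ext (τ.ge_G _) (by
    rw [comp_zero, Category.comp_id]
    refine (exactAt_zero_iff _ _).1 ?_ _
    exact exactAt_hom hA hle (τ.ge_G (H0.of X')) (by lia))
  rw [← Category.comp_id (β _ f), ← Category.comp_id (β _ 0), h1, comp_zero, comp_zero]

lemma dgProj.exactAt_of_ge (hA : IsPretriangulated k A) (hp : t.HasEnoughDerivedProjectives) {W : A}
    (hW : t.dgProj W) {n i : ℤ} {X : A} (hX : t.ge n (H0.of X)) (hi : i < n) :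
    (hom (k := k) W X).ExactAt i :=
  exactAt_hom hA (dgProj.le_zero hA hp hW) hX (by lia)

/-- The projective cover of `H⁰(X)` by a derived projective, lifted to `X`. -/
lemma Truncation.exists_cover (hA : IsPretriangulated k A) (hp : t.HasEnoughDerivedProjectives)
    (τ : t.Truncation) (X : H0 k A) :
    ∃ (S : A) (s : H0.of S ⟶ X), t.dgProj S ∧
      (∀ W, t.dgProj W → ∀ g : H0.of W ⟶ X, ∃ l : H0.of W ⟶ H0.of S, l ≫ s = g) ∧
      (s = 0 → IsZero (τ.H X)) := by
  obtain ⟨p⟩ := hp.enoughProjectives.presentation ⟨τ.H X, τ.heart_H hA X⟩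
  have hproj := p.projective
  have hepi := p.epi
  obtain ⟨S, hS⟩ := hp.hasDerivedProjectives p.p p.projective
  obtain ⟨β, hβ⟩ := τ.exists_equiv hS
  have hs : β X ((β X).symm (p.f.hom ≫ τ.ε X)) = p.f.hom ≫ τ.ε X := (β X).apply_symm_apply _
  refine ⟨S.obj, (β X).symm (p.f.hom ≫ τ.ε X), ⟨p.p, hproj, hS⟩, ?_, ?_⟩
  · rintro W ⟨P', hP', hW⟩ g
    obtain ⟨β', hβ'⟩ := τ.exists_equiv hW
    obtain ⟨r, hr⟩ := τ.exists_lift P'.property.1 (β' X g)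
    let r' : P' ⟶ ⟨τ.H X, τ.heart_H hA X⟩ := ObjectProperty.homMk r
    let l := Projective.factorThru r' p.f
    have hl : l.hom ≫ p.f.hom = r := congrArg (fun f => f.hom) (Projective.factorThru_comp r' p.f)
    refine ⟨(β' _).symm (l.hom ≫ β S (𝟙 S)), (β' X).injective ?_⟩
    have h1 : β S (𝟙 S) ≫ τ.G.map ((β X).symm (p.f.hom ≫ τ.ε X)) = p.f.hom ≫ τ.ε X := by
      rw [← hβ, Category.id_comp, hs]
    refine (hβ' _ _ _ _).trans ?_
    rw [Equiv.apply_symm_apply, Category.assoc]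
    refine Eq.trans (congrArg (fun z => l.hom ≫ z) h1) ?_
    rw [← Category.assoc, hl, hr]
  · intro h0
    have h1 : β X 0 = 0 := by
      have := hβ X X 0 0
      rwa [comp_zero, τ.G_map_zero, comp_zero] at this
    rw [h0, h1] at hs
    have h2 : p.f.hom = 0 := τ.lift_ext p.p.property.1 (by rw [zero_comp, ← hs])
    let z : (⟨τ.H X, τ.heart_H hA X⟩ : t.heart.FullSubcategory) ⟶ ⟨τ.H X, τ.heart_H hA X⟩ :=
      ObjectProperty.homMk 0
    have h3 : p.f ≫ 𝟙 _ = p.f ≫ z := by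
      apply ObjectProperty.hom_ext
      change p.f.hom ≫ 𝟙 _ = p.f.hom ≫ 0
      rw [h2, zero_comp, zero_comp]
    have h4 := (cancel_epi p.f).1 h3
    exact (IsZero.iff_id_eq_zero _).2 (congrArg (fun f => f.hom) h4)

lemma exists_dgProj_cover (hA : IsPretriangulated k A) (hp : t.HasEnoughDerivedProjectives) (X : A) :
    ∃ (S : A) (s : Z0 k S X), t.dgProj S ∧
      ∀ W, t.dgProj W → ∀ g : Z0 k W X, ∃ l : Z0 k W S, H0.cls l ≫ H0.cls s = H0.cls g := by
  obtain ⟨τ⟩ := exists_truncation hA hp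
  obtain ⟨S, s, hS, h, -⟩ := τ.exists_cover hA hp (H0.of X)
  obtain ⟨s, rfl⟩ := cls_surjective s
  refine ⟨S, s, hS, fun W hW g => ?_⟩
  obtain ⟨l, hl⟩ := h W hW (H0.cls g)
  obtain ⟨l, rfl⟩ := cls_surjective l
  exact ⟨l, hl⟩

lemma le_pred_of_exactAt (hA : IsPretriangulated k A) (hp : t.HasEnoughDerivedProjectives) {n : ℤ}
    {X : A} (hX : t.le n (H0.of X)) (h : ∀ W, t.dgProj W → (hom (k := k) W X).ExactAt n) :
    t.le (n - 1) (H0.of X) := by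
  obtain ⟨τ⟩ := exists_truncation hA hp
  obtain ⟨V, hV⟩ := hA.exists_isHoShift n X
  refine t.le_shift (-1) (-n) (n - 1) (by lia) V X hV.symm ?_
  have hV0 := t.le_shift n n 0 (by lia) X V hV hX
  have h0 : ∀ W, t.dgProj W → ∀ f : (H0.of W : H0 k A) ⟶ H0.of V, f = 0 := fun W hW => by
    rw [← exactAt_zero_iff, ← hV.exactAt_right_iff W 0 n (by lia)]
    exact h W hW
  obtain ⟨S, s, hS, -, hz⟩ := τ.exists_cover hA hp (H0.of V)
  have hHz := hz (h0 S hS s)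
  have hGle : t.le 0 (τ.G.obj (H0.of V)) := (le_iff hA 0 _).2 fun Z hZ =>
    (exactAt_zero_iff _ _).2 fun f => τ.desc_ext (ge_mono hA (show 0 ≤ 0 + 1 by lia) hZ) (by
      exact (t.zero _ hV0 hZ).trans comp_zero.symm)
  obtain ⟨r, hr⟩ := τ.exists_lift hGle (𝟙 _)
  refine (le_iff hA _ V).2 fun Z hZ => (exactAt_zero_iff _ _).2 fun f => ?_
  obtain ⟨g, hg⟩ := τ.exists_desc (show t.ge 0 (H0.of Z) from hZ) f
  rw [← hg, ← Category.id_comp g, ← hr, hHz.eq_of_tgt r 0]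
  simp

lemma le_of_forall_exactAt (hA : IsPretriangulated k A) (hp : t.HasEnoughDerivedProjectives)
    {X : A} (hX : t.minus X) {n : ℤ}
    (h : ∀ W, t.dgProj W → ∀ i, n < i → (hom (k := k) W X).ExactAt i) : t.le n (H0.of X) := by
  obtain ⟨m, hm⟩ := hX
  obtain hmn | hmn := le_total m n
  · exact le_mono hA hmn hm
  · induction m, hmn using Int.leInduction with
    | base => exact hm
    | succ m hmn ih =>
      have := le_pred_of_exactAt hA hp hm fun W hW => h W hW _ (by lia)
      rw [add_sub_cancel_right] at this
      exact ih this

lemma isZero_of_acyclic (hA : IsPretriangulated k A) (hp : t.HasEnoughDerivedProjectives)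
    (hnd : t.NonDegenerate) {X : A} (hX : t.minus X)
    (h : ∀ W, t.dgProj W → (hom (k := k) W X).Acyclic) : IsZero (H0.of X : H0 k A) :=
  hnd.left _ fun _ => le_of_forall_exactAt hA hp hX fun W hW i _ => h W hW i

lemma RightBounded.minus (h : t.RightBounded) (X : A) : t.minus X := by
  have : (ObjectProperty.ι (fun X : H0 k A => t.minus X.obj)).IsEquivalence := h
  obtain ⟨Y, ⟨e⟩⟩ :=
    Functor.EssSurj.mem_essImage (ObjectProperty.ι (fun X : H0 k A => t.minus X.obj)) (H0.of X)
  obtain ⟨n, hn⟩ := Y.property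
  exact ⟨n, t.le_of_iso e hn⟩

end TStructure

end DG

namespace DG

open DGCategory DGModule

namespace DGModule

variable {k : Type v} [CommRing k] {A : Type v} [DGCategory k A] {P : A → Prop}

lemma resMap_comp {L M N : DGModule k A} {a b c : ℤ} (h : a + b = c) (φ : (hom (k := k) L M).X a)
    (ψ : (hom (k := k) M N).X b) : ((resMap P L N).f c).hom (comp a b c h φ ψ) =
      comp a b c h (((resMap P L M).f a).hom φ) (((resMap P M N).f b).hom ψ) := rfl

/-- The restriction of a closed morphism of degree `0`. -/
def resZ0 {M N : DGModule k A} (w : Z0 k M N) : Z0 k (res P M) (res P N) :=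
  Z0.mk (((resMap P M N).f 0).hom w.1) (by rw [hom_d_apply, w.2, map_zero])

/-- The morphism `Hom(M, N) → Hom(T, res N)` given by restriction and `w : T → res M`. -/
def resComp {T : DGModule k (Subtype P)} {M : DGModule k A} (w : Z0 k T (res P M))
    (N : DGModule k A) : hom (k := k) M N ⟶ hom T (res P N) :=
  resMap P M N ≫ precomp w (res P N)

lemma resComp_apply {T : DGModule k (Subtype P)} {M : DGModule k A} (w : Z0 k T (res P M))
    (N : DGModule k A) (n : ℤ) (φ : (hom (k := k) M N).X n) :
    ((resComp w N).f n).hom φ = comp 0 n n (zero_add n) w.1 (((resMap P M N).f n).hom φ) := rfl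

/-- `w` exhibits `X` as the object of `A` that corepresents `Z ↦ Hom(T, A(-, Z))`. -/
def Corep (T : DGModule k (Subtype P)) (X : A) (w : Z0 k T (res P (yon k X))) : Prop :=
  ∀ Z, QuasiIso (resComp w (yon k Z))

variable {T T₁ T₂ : DGModule k (Subtype P)} {X X₁ X₂ : A}

section Cone

variable {M₁ M₂ : DGModule k A} {e r : ℤ} {ν : (hom (k := k) T₁ T₂).X r}
  {hν : e + 1 = r ∧ ((hom T₁ T₂).d r (r + 1)).hom ν = 0}
  {f : (hom (k := k) M₁ M₂).X r} {hf : e + 1 = r ∧ ((hom M₁ M₂).d r (r + 1)).hom f = 0}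

/-- The morphism of extensions given by a square that commutes up to the homotopy `s`. -/
def attachMap (w₁ : Z0 k T₁ (res P M₁)) (w₂ : Z0 k T₂ (res P M₂))
    (s : (hom (k := k) T₁ (res P M₂)).X e) :
    (hom (k := k) (attachMod e ν hν) (res P (attachMod e f hf))).X 0 :=
  attachDesc (comp 0 0 0 rfl w₂.1 (resZ0 (attachInl e f hf)).1)
    (comp 0 e e (zero_add e) w₁.1 (((resMap P _ _).f e).hom (attachInr e f hf)) +
      comp e 0 e (add_zero e) s (resZ0 (attachInl e f hf)).1) (zero_add e)

lemma d_attachMap (w₁ : Z0 k T₁ (res P M₁)) (w₂ : Z0 k T₂ (res P M₂))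
    (s : (hom (k := k) T₁ (res P M₂)).X e)
    (hs : comp r 0 r (add_zero r) ν w₂.1 =
      comp 0 r r (zero_add r) w₁.1 (((resMap P M₁ M₂).f r).hom f) + ((hom _ _).d e r).hom s) :
    ((hom _ _).d 0 1).hom (attachMap (hν := hν) (hf := hf) w₁ w₂ s) = 0 := by
  have her := hν.1
  subst her
  rw [attachMap, d_attachDesc _ _ _ (zero_add 1) rfl, map_add]
  have h1 : ((hom _ _).d 0 1).hom (comp 0 0 0 rfl w₂.1 (resZ0 (attachInl e f hf)).1) = 0 :=
    Z0_d (Z0.comp w₂ (resZ0 (attachInl e f hf)))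
  have h2 := d_comp_of_left_closed (p := 0) (q := e) (r := e) (q' := e + 1) (r' := e + 1)
    (zero_add e) rfl rfl w₁.1 (((resMap P _ _).f e).hom (attachInr e f hf)) (p' := 1) rfl w₁.2
  have h3 := d_comp_of_right_closed (p := e) (q := 0) (r := e) (p' := e + 1) (r' := e + 1)
    (add_zero e) rfl rfl s (resZ0 (P := P) (attachInl e f hf)).1 (q' := 1) rfl (Z0_d _)
  have h4 : ((hom _ _).d e (e + 1)).hom s = comp (e + 1) 0 (e + 1) (add_zero _) ν w₂.1 -
      comp 0 (e + 1) (e + 1) (zero_add _) w₁.1 (((resMap P M₁ M₂).f (e + 1)).hom f) := by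
    rw [hs, add_sub_cancel_left]
  rw [hom_d_apply, d_attachInr e f hf (e + 1) rfl, resMap_comp] at h2
  rw [h1, h2, h3, h4, Int.negOnePow_zero, one_smul, one_smul, map_sub, LinearMap.sub_apply,
    ← DGCategory.assoc 0 (e + 1) 0 (e + 1) (e + 1) (e + 1) (by omega) (by omega) (by omega) (by omega),
    ← DGCategory.assoc (e + 1) 0 0 (e + 1) 0 (e + 1) (by omega) (by omega) (by omega) (by omega)]
  have h5 : ∀ a b : (hom (k := k) T₁ (res P (attachMod e f hf))).X (e + 1), a + (b - a) - b = 0 :=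
    fun a b => by abel
  refine Eq.trans (congrArg (fun z => attachDesc (hf := hν) 0 z _) (h5 _ _)) ?_
  exact hom_ext' fun W p q h z => by rw [ap_attachDesc]; simp

lemma inl_attachMap (w₁ : Z0 k T₁ (res P M₁)) (w₂ : Z0 k T₂ (res P M₂))
    (s : (hom (k := k) T₁ (res P M₂)).X e) :
    comp 0 0 0 rfl (attachInl e ν hν).1 (attachMap (hν := hν) (hf := hf) w₁ w₂ s) =
      comp 0 0 0 rfl w₂.1 (resZ0 (attachInl e f hf)).1 :=
  attachInl_attachDesc _ _ _

lemma inr_attachMap (w₁ : Z0 k T₁ (res P M₁)) (w₂ : Z0 k T₂ (res P M₂))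
    (s : (hom (k := k) T₁ (res P M₂)).X e) :
    comp e 0 e (add_zero e) (attachInr e ν hν) (attachMap (hν := hν) (hf := hf) w₁ w₂ s) =
      comp 0 e e (zero_add e) w₁.1 (((resMap P _ _).f e).hom (attachInr e f hf)) +
      comp e 0 e (add_zero e) s (resZ0 (attachInl e f hf)).1 :=
  attachInr_attachDesc _ _ _

lemma quasiIso_resComp_attachMap (w₁ : Z0 k T₁ (res P M₁)) (w₂ : Z0 k T₂ (res P M₂))
    (s : (hom (k := k) T₁ (res P M₂)).X e)
    (hs : ((hom _ _).d 0 1).hom (attachMap (hν := hν) (hf := hf) w₁ w₂ s) = 0) (L : DGModule k A)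
    (h₁ : QuasiIso (resComp w₁ L)) (h₂ : QuasiIso (resComp w₂ L)) :
    QuasiIso (resComp (Z0.mk _ hs) L) := by
  refine quasiIso_attach_hom _ h₁ h₂ (fun n φ => ?_) (fun n m h β => ?_)
  · rw [resComp_apply, resComp_apply, Z0.mk_val,
      ← DGCategory.assoc 0 0 n 0 n n (by omega) (by omega) (by omega) (by omega), inl_attachMap,
      DGCategory.assoc 0 0 n 0 n n (by omega) (by omega) (by omega) (by omega), resMap_comp]
    rfl
  · rw [resComp_apply, resComp_apply, Z0.mk_val]
    refine (attachDesc_eta _ h).symm.trans ?_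
    have hz : comp 0 n n (zero_add n) (resZ0 (P := P) (attachInl e f hf)).1
        (((resMap P _ L).f n).hom (attachDesc (hf := hf) 0 β h)) = 0 := by
      refine (resMap_comp (P := P) (zero_add n) (attachInl e f hf).1 _).symm.trans ?_
      rw [attachInl_attachDesc, map_zero]
    congr 1
    · rw [← DGCategory.assoc 0 0 n 0 n n (by omega) (by omega) (by omega) (by omega), inl_attachMap,
        DGCategory.assoc 0 0 n 0 n n (by omega) (by omega) (by omega) (by omega), hz, map_zero]
    · rw [← DGCategory.assoc e 0 n e n m (by omega) (by omega) (by omega) (by omega), inr_attachMap,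
        LinearMap.map_add₂, DGCategory.assoc e 0 n e n m (by omega) (by omega) (by omega) (by omega), hz,
        map_zero, add_zero,
        DGCategory.assoc 0 e n e m m (by omega) (by omega) (by omega) (by omega), ← resMap_comp,
        attachInr_attachDesc]

lemma quasiIso_app_attachMap (w₁ : Z0 k T₁ (res P M₁)) (w₂ : Z0 k T₂ (res P M₂))
    (s : (hom (k := k) T₁ (res P M₂)).X e)
    (hs : ((hom _ _).d 0 1).hom (attachMap (hν := hν) (hf := hf) w₁ w₂ s) = 0) (W : Subtype P)
    (h₁ : QuasiIso (app w₁ W)) (h₂ : QuasiIso (app w₂ W)) :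
    QuasiIso (app (Z0.mk _ hs) W) := by
  have key : ∃ (u₁ : ∀ n, (T₁.obj W).X n →ₗ[k] (M₁.obj W.1).X n)
      (u₂ : ∀ n, (T₂.obj W).X n →ₗ[k] (M₂.obj W.1).X n)
      (σ : ∀ n, (T₁.obj W).X (n - e) →ₗ[k] (M₂.obj W.1).X n),
      (∀ n, u₁ n = ((app w₁ W).f n).hom) ∧ (∀ n, u₂ n = ((app w₂ W).f n).hom) ∧
      ∀ n z, ((app (Z0.mk _ hs) W).f n).hom z =
        attachι e f hf W.1 n (u₂ n (attachFst e ν hν W n z)) +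
        (attachκ e f hf W.1 n (u₁ (n - e) (attachSnd e ν hν W n z)) +
         attachι e f hf W.1 n (σ n (attachSnd e ν hν W n z))) := by
    refine ⟨fun n => ap w₁.1 W n n (add_zero n), fun n => ap w₂.1 W n n (add_zero n),
      fun n => ap s W (n - e) n (by omega), fun n => rfl, fun n => rfl, ?_⟩
    intro n z
    rw [app_apply, Z0.mk_val, attachMap, ap_attachDesc, ap_comp _ _ _ W n n n (by omega) (by omega),
      ap_add, LinearMap.add_apply, ap_comp _ _ _ W (n - e) (n - e) n (by omega) (by omega),
      ap_comp _ _ _ W (n - e) n n (by omega) (by omega)]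
    refine congrArg₂ (· + ·) ?_ (congrArg₂ (· + ·) ?_ ?_)
    · exact ap_attachInl e f hf W.1 n _
    · exact ap_attachInr' e f hf W.1 n _
    · exact ap_attachInl e f hf W.1 n _
  obtain ⟨u₁, u₂, σ, hu₁, hu₂, key⟩ := key
  refine quasiIso_attach_app (B := A) (M' := M₁) (N' := M₂) (f' := f) (hf' := hf) (W' := W.1) _
    (φ₁ := app w₁ W) (φ₂ := app w₂ W) h₁ h₂ (fun n y => ?_) (fun n z => ?_)
  · refine (key n _).trans ?_
    rw [attachFst_ι, attachSnd_ι, map_zero, map_zero, map_zero, map_zero, add_zero, add_zero, hu₂]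
    rfl
  · refine (congrArg _ (key n z)).trans ?_
    rw [map_add, map_add, attachSnd_ι, attachSnd_ι, attachSnd_κ, zero_add, add_zero, hu₁]
    rfl

end Cone

lemma Corep.exists_attach (hA : IsPretriangulated k A) {w₁ : Z0 k T₁ (res P (yon k X₁))}
    {w₂ : Z0 k T₂ (res P (yon k X₂))} (h₁ : Corep T₁ X₁ w₁) (h₂ : Corep T₂ X₂ w₂) {e r : ℤ}
    (ν : (hom (k := k) T₁ T₂).X r) (hν : e + 1 = r ∧ ((hom T₁ T₂).d r (r + 1)).hom ν = 0) :
    ∃ (X₃ : A) (w₃ : Z0 k (attachMod e ν hν) (res P (yon k X₃))), Corep _ X₃ w₃ ∧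
      ∀ W, QuasiIso (app w₁ W) → QuasiIso (app w₂ W) → QuasiIso (app w₃ W) := by
  have her := hν.1
  obtain ⟨f, s, hf, hs⟩ := exists_of_quasiIso _ (h₁ X₂) (i := r) (j := e) (l := r + 1) her rfl
    (comp r 0 r (add_zero r) ν w₂.1) (by
      rw [d_comp_of_right_closed (q := 0) (q' := 1) (p' := r + 1) (add_zero r) rfl rfl ν w₂.1 rfl
        w₂.2, hν.2]
      simp)
  have hfs := d_attachMap (hν := hν) (hf := ⟨her, hf⟩) w₁ w₂ s hs
  obtain ⟨X₃, ω, hω⟩ := hA.exists_attach f ⟨her, hf⟩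
  refine ⟨X₃, Z0.comp (Z0.mk _ hfs) (resZ0 ω), fun Z => ?_, fun W hW₁ hW₂ => ?_⟩
  · have e1 : resComp (Z0.comp (Z0.mk _ hfs) (resZ0 ω)) (yon k Z) =
        precomp ω (yon k Z) ≫ resComp (Z0.mk _ hfs) (yon k Z) := by
      ext n φ
      exact DGCategory.assoc 0 0 n 0 n n rfl (zero_add n) (zero_add n) (zero_add n)
        (Z0.mk _ hfs).1 (resZ0 ω).1 (((resMap P _ (yon k Z)).f n).hom φ)
    have := quasiIso_resComp_attachMap w₁ w₂ s hfs (yon k Z) (h₁ Z) (h₂ Z)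
    have := quasiIso_precomp ω (yon k Z)
    rw [e1]
    infer_instance
  · have := quasiIso_app_attachMap w₁ w₂ s hfs W hW₁ hW₂
    have : QuasiIso (app (resZ0 (P := P) ω) W) := quasiIso_app ω W.1
    rw [app_comp]
    infer_instance

end DGModule

end DG

namespace DG

open DGCategory DGModule

section Boundaries

variable {k : Type v} [CommRing k] {A : Type u} [DGCategory k A]

/-- Closed elements of the hom-complexes. -/
def IsCl {X Y : A} {n : ℤ} (x : (hom (k := k) X Y).X n) : Prop :=
  ((hom (k := k) X Y).d n (n + 1)).hom x = 0

/-- Boundaries in the hom-complexes. -/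
def IsBd {X Y : A} {n : ℤ} (x : (hom (k := k) X Y).X n) : Prop :=
  ∃ y, ((hom (k := k) X Y).d (n - 1) n).hom y = x

variable {X Y Z : A} {n m l : ℤ}

lemma IsBd.of_eq {x : (hom (k := k) X Y).X n} (y : (hom (k := k) X Y).X m) (h : m + 1 = n)
    (hy : ((hom (k := k) X Y).d m n).hom y = x) : IsBd x := by
  obtain rfl : m = n - 1 := by omega
  exact ⟨y, hy⟩

lemma IsBd.exists_eq {x : (hom (k := k) X Y).X n} (hx : IsBd x) (h : m + 1 = n) :
    ∃ y, ((hom (k := k) X Y).d m n).hom y = x := by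
  obtain rfl : m = n - 1 := by omega
  exact hx

lemma IsBd.add {x y : (hom (k := k) X Y).X n} (hx : IsBd x) (hy : IsBd y) : IsBd (x + y) := by
  obtain ⟨a, rfl⟩ := hx
  obtain ⟨b, rfl⟩ := hy
  exact ⟨a + b, map_add _ _ _⟩

lemma IsBd.sub {x y : (hom (k := k) X Y).X n} (hx : IsBd x) (hy : IsBd y) : IsBd (x - y) := by
  obtain ⟨a, rfl⟩ := hx
  obtain ⟨b, rfl⟩ := hy
  exact ⟨a - b, map_sub _ _ _⟩

lemma IsBd.zsmul {x : (hom (k := k) X Y).X n} (hx : IsBd x) (c : ℤˣ) : IsBd (c • x) := by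
  obtain ⟨a, rfl⟩ := hx
  exact ⟨c • a, by rw [Units.smul_def, map_zsmul]; rfl⟩

lemma IsCl.sub {x y : (hom (k := k) X Y).X n} (hx : IsCl x) (hy : IsCl y) : IsCl (x - y) := by
  rw [IsCl, map_sub, hx, hy, sub_zero]

lemma IsCl.comp {x : (hom (k := k) X Y).X n} {y : (hom (k := k) Y Z).X m} (hx : IsCl x)
    (hy : IsCl y) (h : n + m = l) : IsCl (comp n m l h x y) := by
  rw [IsCl, DGCategory.leibniz n m l (n + 1) (m + 1) (l + 1) h rfl rfl rfl, hx, hy]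
  simp

lemma IsBd.comp_left {x : (hom (k := k) X Y).X n} {y : (hom (k := k) Y Z).X m} (hx : IsCl x)
    (hy : IsBd y) (h : n + m = l) : IsBd (comp n m l h x y) := by
  obtain ⟨b, rfl⟩ := hy
  refine ⟨comp n (m - 1) (l - 1) (by omega) x b, ?_⟩
  rw [d_comp_of_left_closed (q' := m) (r' := l) (by omega) (by omega) (by omega) x b (p' := n + 1) rfl hx]

lemma IsBd.comp_right {x : (hom (k := k) X Y).X n} {y : (hom (k := k) Y Z).X m} (hx : IsBd x)
    (hy : IsCl y) (h : n + m = l) : IsBd (comp n m l h x y) := by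
  obtain ⟨b, rfl⟩ := hx
  have : IsBd (m.negOnePow • comp n m l h (((hom X Y).d (n - 1) n).hom b) y) := by
    refine ⟨comp (n - 1) m (l - 1) (by omega) b y, ?_⟩
    rw [d_comp_of_right_closed (p' := n) (r' := l) (by omega) (by omega) (by omega) b y (q' := m + 1) rfl
      hy]
  have := this.zsmul m.negOnePow
  rwa [smul_smul, Int.units_mul_self, one_smul] at this

/-- Left multiplication by an invertible element of the graded homotopy category detects boundaries. -/
lemma IsBd.of_comp_left {a : (hom (k := k) X Y).X n} {b : (hom (k := k) Y X).X m} (hb : IsCl b)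
    (h : m + n = 0) (hba : IsBd (comp m n 0 h b a - one Y)) {x : (hom (k := k) Y Z).X l}
    (hx : IsCl x) {r : ℤ} (hr : n + l = r) (hax : IsBd (comp n l r hr a x)) : IsBd x := by
  have h1 := IsBd.comp_left hb hax (show m + r = l by omega)
  have h2 := IsBd.comp_right hba hx (zero_add l)
  rw [map_sub, LinearMap.sub_apply, one_comp,
    DGCategory.assoc m n l 0 r l h hr (by omega) (by omega)] at h2
  have := h1.sub h2
  rwa [sub_sub_cancel] at this

lemma IsBd.of_comp_right {a : (hom (k := k) Y Z).X n} {b : (hom (k := k) Z Y).X m} (hb : IsCl b)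
    (h : n + m = 0) (hba : IsBd (comp n m 0 h a b - one Y)) {x : (hom (k := k) X Y).X l}
    (hx : IsCl x) {r : ℤ} (hr : l + n = r) (hax : IsBd (comp l n r hr x a)) : IsBd x := by
  have h1 := IsBd.comp_right hax hb (show r + m = l by omega)
  have h2 := IsBd.comp_left hx hba (add_zero l)
  rw [map_sub, comp_one, ← DGCategory.assoc l n m r 0 l hr h (by omega) (by omega)] at h2
  have := h1.sub h2
  rwa [sub_sub_cancel] at this

lemma IsHoShift.exists_isCl (hXY : IsHoShift k n X Y) {p q : ℤ} (hp : p = -n) (hq : q = n) :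
    ∃ (a : (hom (k := k) X Y).X p) (b : (hom (k := k) Y X).X q), IsCl a ∧ IsCl b ∧
      IsBd (comp p q 0 (by omega) a b - one X) ∧ IsBd (comp q p 0 (by omega) b a - one Y) := by
  subst hp hq
  obtain ⟨a, b, ha, hb, ⟨s, hs⟩, ⟨s', hs'⟩⟩ := hXY
  exact ⟨a, b, ha, hb, .of_eq s rfl hs.symm, .of_eq s' rfl hs'.symm⟩

end Boundaries

namespace TStructure

variable {k : Type v} [CommRing k] {A : Type v} [DGCategory k A] {t : TStructure k A}

lemma ClosedUnderCountableCoproducts.exists_coproduct_zero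
    (hc : t.ClosedUnderCountableCoproducts) (X : ℕ → A) (hX : ∀ l, t.le 0 (H0.of (X l))) :
    ∃ (C : A) (i : ∀ l, Z0 k (X l) C),
      (∀ (Z : A) (z : (hom (k := k) C Z).X 0), IsCl z →
        (∀ l, IsBd (comp 0 0 0 (zero_add 0) (i l).1 z)) → IsBd z) ∧
      (∀ (Z : A) (z : ∀ l, (hom (k := k) (X l) Z).X 0), (∀ l, IsCl (z l)) →
        ∃ z' : (hom (k := k) C Z).X 0, IsCl z' ∧
          ∀ l, IsBd (comp 0 0 0 (zero_add 0) (i l).1 z' - z l)) := by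
  obtain ⟨⟨⟨C⟩, c⟩, ⟨hcl⟩, -⟩ := hc (fun l => H0.of (X l)) hX
  choose ι hι using fun l => cls_surjective (Cofan.inj (Cofan.mk (H0.of C) fun l => c.app ⟨l⟩) l)
  refine ⟨C, ι, fun Z z hz h => ?_, fun Z z hz => ?_⟩
  · have h2 : H0.cls (Z0.mk z hz) = 0 := by
      refine Cofan.IsColimit.hom_ext hcl _ _ fun l => ?_
      rw [comp_zero]
      refine (congrArg (· ≫ _) (hι l).symm).trans ?_
      exact (cls_comp (ι l) _).symm.trans ((cls_eq_zero_iff _).2 ((h l).exists_eq rfl))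
    obtain ⟨y, hy⟩ := (cls_eq_zero_iff _).1 h2
    exact .of_eq (m := -1) y rfl hy
  · obtain ⟨ζ, hζ⟩ := cls_surjective (Cofan.IsColimit.desc hcl fun l => H0.cls (Z0.mk (z l) (hz l)))
    refine ⟨ζ.1, ζ.2, fun l => ?_⟩
    have : H0.cls (Z0.comp (ι l) ζ) = H0.cls (Z0.mk (z l) (hz l)) := by
      rw [cls_comp, hι, hζ]
      exact Cofan.IsColimit.fac hcl _ l
    obtain ⟨s, hs⟩ := (cls_eq_iff _ _).1 this
    exact .of_eq (m := -1) s rfl hs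

/-- Countable coproducts of uniformly bounded above objects, together with their shifts. -/
lemma ClosedUnderCountableCoproducts.exists_coproduct (hA : IsPretriangulated k A)
    (hc : t.ClosedUnderCountableCoproducts) (X : ℕ → A) (N : ℤ) (hX : ∀ l, t.le N (H0.of (X l))) :
    ∃ (C : A) (i : ∀ l, Z0 k (X l) C),
      (∀ (Z : A) (n : ℤ) (z : (hom (k := k) C Z).X n), IsCl z →
        (∀ l, IsBd (comp 0 n n (zero_add n) (i l).1 z)) → IsBd z) ∧
      (∀ (Z : A) (n : ℤ) (z : ∀ l, (hom (k := k) (X l) Z).X n), (∀ l, IsCl (z l)) →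
        ∃ z' : (hom (k := k) C Z).X n, IsCl z' ∧
          ∀ l, IsBd (z l - comp 0 n n (zero_add n) (i l).1 z')) := by
  choose X' hX' using fun l => hA.exists_isHoShift N (X l)
  obtain ⟨C₀, ι, hC₁, hC₂⟩ := hc.exists_coproduct_zero X' fun l =>
    t.le_shift N N 0 (by omega) _ _ (hX' l) (hX l)
  obtain ⟨C, hC⟩ := hA.exists_isHoShift (-N) C₀
  obtain ⟨a, b, ha, hb, hab, hba⟩ := hC.exists_isCl (p := N) (q := -N) (by omega) rfl
  choose al bl hal hbl habl hbal using fun l => (hX' l).exists_isCl (p := -N) (q := N) rfl rfl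
  have hιc : ∀ l, IsCl (ι l).1 := fun l => (ι l).2
  have hi : ∀ l, IsCl (comp (-N) N 0 (by omega) (al l) (comp 0 N N (by omega) (ι l).1 a)) := fun l =>
    (hal l).comp ((hιc l).comp ha _) _
  obtain ⟨i, hi⟩ : ∃ i : ∀ l, Z0 k (X l) C, ∀ l, (i l).1 =
      comp (-N) N 0 (by omega) (al l) (comp 0 N N (by omega) (ι l).1 a) :=
    ⟨fun l => Z0.mk _ (hi l), fun l => rfl⟩
  have hiz : ∀ {Z : A} {n : ℤ} (z : (hom (k := k) C Z).X n) (l : ℕ),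
      comp 0 n n (zero_add n) (i l).1 z = comp (-N) (N + n) n (by omega) (al l)
        (comp 0 (N + n) (N + n) (by omega) (ι l).1 (comp N n (N + n) rfl a z)) := fun {Z n} z l => by
    rw [hi, DGCategory.assoc (-N) N n 0 (N + n) n (by omega) (by omega) (by omega) (by omega),
      DGCategory.assoc 0 N n N (N + n) (N + n) (by omega) (by omega) (by omega) (by omega)]
  refine ⟨C, i, fun Z n z hz h => ?_, fun Z n z hz => ?_⟩
  · obtain ⟨Z', hZ'⟩ := hA.exists_isHoShift (N + n) Z
    obtain ⟨az, bz, haz, hbz, habz, hbaz⟩ := hZ'.exists_isCl rfl rfl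
    have haz' := (ha.comp hz rfl)
    have h1 : ∀ l, IsBd (comp 0 (N + n) (N + n) (by omega) (ι l).1 (comp N n (N + n) rfl a z)) :=
      fun l => .of_comp_left (hbl l) (by omega) (hbal l) ((hιc l).comp haz' _)
        (r := n) (by omega) (by have := h l; rwa [hiz] at this)
    have h2 := hC₁ Z' (comp (N + n) (-(N + n)) 0 (by omega) (comp N n (N + n) rfl a z) az)
      (haz'.comp haz _) fun l => by
        have := (h1 l).comp_right haz (show N + n + -(N + n) = 0 by omega)
        rwa [DGCategory.assoc 0 (N + n) (-(N + n)) (N + n) 0 0 (by omega) (by omega) (by omega)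
          (by omega)] at this
    exact .of_comp_left hb (by omega) hba hz (r := N + n) rfl
      (.of_comp_right hbz (by omega) habz haz' (r := 0) (by omega) h2)
  · obtain ⟨Z', hZ'⟩ := hA.exists_isHoShift (N + n) Z
    obtain ⟨az, bz, haz, hbz, habz, hbaz⟩ := hZ'.exists_isCl rfl rfl
    have hblz : ∀ l, IsCl (comp N n (N + n) rfl (bl l) (z l)) := fun l => (hbl l).comp (hz l) rfl
    obtain ⟨ζ, hζc, h1⟩ := hC₂ Z' (fun l => comp (N + n) (-(N + n)) 0 (by omega)
      (comp N n (N + n) rfl (bl l) (z l)) az) fun l => (hblz l).comp haz _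
    have hζb : IsCl (comp 0 (N + n) (N + n) (by omega) ζ bz) := hζc.comp hbz _
    obtain ⟨z', hz'e⟩ : ∃ z', z' = comp (-N) (N + n) n (by omega) b
      (comp 0 (N + n) (N + n) (by omega) ζ bz) := ⟨_, rfl⟩
    have hz' : IsCl z' := hz'e ▸ hb.comp hζb _
    refine ⟨z', hz', fun l => ?_⟩
    rw [hiz]
    obtain ⟨y, hye⟩ : ∃ y, y = comp 0 (N + n) (N + n) (by omega) (ι l).1
      (comp N n (N + n) rfl a z') := ⟨_, rfl⟩
    have hy : IsCl y := hye ▸ (hιc l).comp (ha.comp hz' rfl) (zero_add _)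
    rw [← hye]
    have hzy : IsCl (z l - comp (-N) (N + n) n (by omega) (al l) y) := (hz l).sub ((hal l).comp hy _)
    refine .of_comp_left (hal l) (show -N + N = 0 by omega) (habl l) hzy (r := N + n) rfl ?_
    refine .of_comp_right hbz (by omega) habz ((hbl l).comp hzy rfl) (r := 0) (by omega) ?_
    have h2 := (hbal l).comp_right hy (zero_add _)
    have h3 := IsBd.comp_left (hιc l) (hab.comp_right hζb (zero_add (N + n))) (zero_add (N + n))
    have h4 := IsBd.comp_left (l := 0) (hιc l) (IsBd.comp_left (l := 0) hζc hbaz rfl) rfl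
    rw [map_sub, LinearMap.sub_apply, one_comp, DGCategory.assoc N (-N) (N + n) 0 n (N + n)
      (by omega) (by omega) (by omega) (by omega)] at h2
    rw [map_sub, LinearMap.sub_apply, one_comp, map_sub, DGCategory.assoc N (-N) (N + n) 0 n (N + n)
      (by omega) (by omega) (by omega) (by omega), ← hz'e, ← hye] at h3
    rw [map_sub, comp_one, map_sub, ← DGCategory.assoc 0 (N + n) (-(N + n)) (N + n) 0 0 (by omega)
      (by omega) (by omega) (by omega), ← DGCategory.assoc 0 (N + n) (-(N + n)) (N + n) 0 0 (by omega)
      (by omega) (by omega) (by omega)] at h4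
    have h5 := (h2.add h3).comp_right haz (show N + n + -(N + n) = 0 by omega)
    rw [sub_add_sub_cancel, map_sub, LinearMap.sub_apply] at h5
    have h6 := ((h5.add h4).add (h1 l)).zsmul (-1)
    rw [sub_add_sub_cancel, sub_add_sub_cancel, Units.neg_smul, one_smul, neg_sub] at h6
    rwa [map_sub, map_sub, LinearMap.sub_apply]

end TStructure

end DG

namespace DG

open DGCategory DGModule

namespace DGModule

variable {k : Type v} [CommRing k] {A : Type v} [DGCategory k A]

/-- A closed morphism of degree `0`, from its values. -/
def ofMaps {M N : DGModule k A} (u : ∀ (W : A) (p : ℤ), (M.obj W).X p →ₗ[k] (N.obj W).X p)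
    (hd : ∀ (W : A) (p q : ℤ) (x : (M.obj W).X p),
      ((N.obj W).d p q).hom (u W p x) = u W q (((M.obj W).d p q).hom x))
    (hact : ∀ {V W : A} (p q r : ℤ) (h : p + q = r) (x : (M.obj W).X p)
      (f : (hom (k := k) V W).X q), u V r (M.act p q r h x f) = N.act p q r h (u W p x) f) :
    Z0 k M N :=
  Z0.mk (homMk 0 (fun W p q h => u W q ∘ₗ castX (M.obj W) (show p = q by omega))
    (fun V W p q r p' r' h hp hr x g => by
      obtain rfl : p = p' := by omega
      obtain rfl : r = r' := by omega
      rw [LinearMap.comp_apply, LinearMap.comp_apply, castX_rfl, castX_rfl, hact]))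
  ((closed_iff rfl _).2 fun W p q p' q' h hp hq x => by
    obtain rfl : p = q := by omega
    obtain rfl : p' = q' := by omega
    rw [ap_homMk, ap_homMk, LinearMap.comp_apply, LinearMap.comp_apply, castX_rfl, castX_rfl,
      hd, Int.negOnePow_zero, one_smul])

lemma ap_ofMaps {M N : DGModule k A} (u : ∀ (W : A) (p : ℤ), (M.obj W).X p →ₗ[k] (N.obj W).X p) (hd)
    (hact) (W : A) (p : ℤ) (x : (M.obj W).X p) :
    ap (ofMaps (M := M) (N := N) u hd hact).1 W p p (add_zero p) x = u W p x := by
  rw [ofMaps, Z0.mk_val, ap_homMk, LinearMap.comp_apply, castX_rfl]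

section Sum

variable (T : ℕ → DGModule k A)

/-- The elements of the direct sum of a sequence of dg-modules. -/
abbrev SumElt (W : A) (m : ℤ) : Type v := Π₀ l, ((T l).obj W).X m

/-- The values of the direct sum of a sequence of dg-modules. -/
def sumCplx (W : A) : CochainComplex (ModuleCat.{v} k) ℤ where
  X m := ModuleCat.of k (SumElt T W m)
  d m m' := ModuleCat.ofHom (DFinsupp.mapRange.linearMap fun l => (((T l).obj W).d m m').hom)
  shape m m' h := by
    refine ModuleCat.hom_ext (LinearMap.ext fun x => DFinsupp.ext fun l => ?_)
    have := ((T l).obj W).shape m m' h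
    simp [this]
  d_comp_d' m m' m'' h h' := by
    refine ModuleCat.hom_ext (LinearMap.ext fun x => DFinsupp.ext fun l => ?_)
    exact d_d_apply ((T l).obj W) m m' m'' (x l)

/-- The action on the direct sum. -/
def sumAct {V W : A} (p q r : ℤ) (h : p + q = r) :
    SumElt T W p →ₗ[k] (hom (k := k) V W).X q →ₗ[k] SumElt T V r :=
  LinearMap.mk₂ k
    (fun x f => DFinsupp.mapRange.linearMap (fun l => ((T l).act p q r h).flip f) x)
    (fun x x' f => map_add _ x x')
    (fun c x f => map_smul _ c x)
    (fun x f f' => DFinsupp.ext fun l => by simp)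
    (fun c x f => DFinsupp.ext fun l => by simp)

/-- The direct sum of a sequence of dg-modules. -/
def sumMod : DGModule k A where
  obj W := sumCplx T W
  act p q r h := sumAct T p q r h
  act_one p x := DFinsupp.ext fun l => (T l).act_one p _
  act_act p q r pq rq s hpq hrq hs hs' x g f := DFinsupp.ext fun l =>
    (T l).act_act p q r pq rq s hpq hrq hs hs' _ g f
  leibniz {V W} p q r p' q' r' h hp hq hr x f := DFinsupp.ext fun l => by
    refine ((T l).leibniz p q r p' q' r' h hp hq hr _ f).trans ?_
    exact congrArg₂ (· + ·) rfl (DFinsupp.smul_apply (p.negOnePow : ℤ)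
      (sumAct T p q' r' _ x _) l).symm

/-- The inclusions of the summands, on values. -/
def sumι (l : ℕ) (W : A) (m : ℤ) : ((T l).obj W).X m →ₗ[k] ((sumMod T).obj W).X m :=
  (DFinsupp.lsingle l : _ →ₗ[k] SumElt T W m)

lemma sumι_d (l : ℕ) (W : A) (m m' : ℤ) (x : ((T l).obj W).X m) :
    (((sumMod T).obj W).d m m').hom (sumι T l W m x) =
      sumι T l W m' ((((T l).obj W).d m m').hom x) :=
  DFinsupp.mapRange_single (f := fun l => (((T l).obj W).d m m').hom) (hf := fun _ => map_zero _)

lemma sumι_act (l : ℕ) {V W : A} (p q r : ℤ) (h : p + q = r) (x : ((T l).obj W).X p)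
    (f : (hom (k := k) V W).X q) :
    (sumMod T).act p q r h (sumι T l W p x) f = sumι T l V r ((T l).act p q r h x f) :=
  DFinsupp.mapRange_single (f := fun l => ((T l).act p q r h).flip f) (hf := fun _ => map_zero _)

/-- The inclusion of a summand. -/
def sumIn (l : ℕ) : Z0 k (T l) (sumMod T) :=
  ofMaps (sumι T l) (sumι_d T l) (fun p q r h x f => (sumι_act T l p q r h x f).symm)

lemma ap_sumIn (l : ℕ) (W : A) (p : ℤ) (x : ((T l).obj W).X p) :
    ap (sumIn T l).1 W p p (add_zero p) x = sumι T l W p x := ap_ofMaps _ _ _ _ _ _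

variable {T} {L : DGModule k A}

lemma sum_ext {W : A} {m : ℤ} {E : Type v} [AddCommGroup E] [Module k E]
    {F G : ((sumMod T).obj W).X m →ₗ[k] E}
    (h : ∀ l x, F (sumι T l W m x) = G (sumι T l W m x)) : F = G := by
  have := DFinsupp.lhom_ext (R := k) (φ := (F : SumElt T W m →ₗ[k] E)) (ψ := G) h
  exact this

lemma sumHom_ext {n : ℤ} {φ ψ : (hom (k := k) (sumMod T) L).X n}
    (h : ∀ l, comp 0 n n (zero_add n) (sumIn T l).1 φ = comp 0 n n (zero_add n) (sumIn T l).1 ψ) :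
    φ = ψ := by
  refine hom_ext' fun W p q hpq x => ?_
  refine LinearMap.congr_fun (sum_ext (T := T) fun l y => ?_) x
  have := congrArg (fun z => ap z W p q hpq y) (h l)
  rwa [ap_comp _ _ _ W p p q (by omega) (by omega), ap_comp _ _ _ W p p q (by omega) (by omega),
    ap_sumIn] at this

/-- The values of the morphism from the direct sum with the given components. -/
def sumDescMap {n : ℤ} (φ : ∀ l, (hom (k := k) (T l) L).X n) (W : A) (p q : ℤ) (h : p + n = q) :
    ((sumMod T).obj W).X p →ₗ[k] (L.obj W).X q :=
  (DFinsupp.lsum k (fun l => ap (φ l) W p q h) : SumElt T W p →ₗ[k] (L.obj W).X q)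

lemma sumDescMap_ι {n : ℤ} (φ : ∀ l, (hom (k := k) (T l) L).X n) (W : A) (p q : ℤ) (h : p + n = q)
    (l : ℕ) (x : ((T l).obj W).X p) :
    sumDescMap φ W p q h (sumι T l W p x) = ap (φ l) W p q h x :=
  DFinsupp.lsum_single (R := k) _ _ _ _

/-- The morphism from the direct sum with the given components. -/
def sumDesc {n : ℤ} (φ : ∀ l, (hom (k := k) (T l) L).X n) : (hom (k := k) (sumMod T) L).X n :=
  homMk n (sumDescMap φ)
    (fun V W p q r p' r' h hp hr x f => by
      refine LinearMap.congr_fun (sum_ext (T := T)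
        (F := sumDescMap φ V r r' hr ∘ₗ ((sumMod T).act p q r h).flip f)
        (G := ((L.act p' q r' (by omega)).flip f) ∘ₗ sumDescMap φ W p p' hp) fun l y => ?_) x
      rw [LinearMap.comp_apply, LinearMap.comp_apply, LinearMap.flip_apply, LinearMap.flip_apply,
        sumι_act, sumDescMap_ι, sumDescMap_ι, ap_act (φ l) p q r p' r' h hp hr y f])

lemma sumIn_sumDesc {n : ℤ} (φ : ∀ l, (hom (k := k) (T l) L).X n) (l : ℕ) :
    comp 0 n n (zero_add n) (sumIn T l).1 (sumDesc φ) = φ l := by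
  refine hom_ext' fun W p q hpq x => ?_
  rw [ap_comp _ _ _ W p p q (by omega) (by omega), ap_sumIn]
  exact sumDescMap_ι φ W p q hpq l x

lemma sumIn_d {n m : ℤ} (h : n + 1 = m) (φ : (hom (k := k) (sumMod T) L).X n) (l : ℕ) :
    comp 0 m m (zero_add m) (sumIn T l).1 (((hom (sumMod T) L).d n m).hom φ) =
      ((hom (T l) L).d n m).hom (comp 0 n n (zero_add n) (sumIn T l).1 φ) :=
  (d_comp_of_left_closed (zero_add n) h h (sumIn T l).1 φ (p' := 1) rfl (sumIn T l).2).symm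

end Sum

section Corep

variable {P : A → Prop} {T : ℕ → DGModule k (Subtype P)} {X : ℕ → A}

/-- The morphism `A(X, Z) → Hom(T, A(-, Z))`. -/
def corepHom {T : DGModule k (Subtype P)} {X : A} (w : Z0 k T (res P (yon k X))) (Z : A) :
    hom (k := k) X Z ⟶ hom T (res P (yon k Z)) :=
  (yonedaDG k A).map X Z ≫ resComp w (yon k Z)

lemma corepHom_apply {T : DGModule k (Subtype P)} {X : A} (w : Z0 k T (res P (yon k X))) (Z : A)
    (n : ℤ) (z : (hom (k := k) X Z).X n) : ((corepHom w Z).f n).hom z =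
      comp 0 n n (zero_add n) w.1 (((resMap P (yon k X) (yon k Z)).f n).hom
        ((((yonedaDG k A).map X Z).f n).hom z)) := rfl

lemma quasiIso_corepHom_iff {T : DGModule k (Subtype P)} {X : A} (w : Z0 k T (res P (yon k X)))
    (Z : A) : QuasiIso (corepHom w Z) ↔ QuasiIso (resComp w (yon k Z)) := by
  have : QuasiIso ((yonedaDG k A).map X Z) := quasiIso_of_bijective _ (yonedaDG_map_bijective X Z)
  exact quasiIso_iff_comp_left _ _

lemma Corep.exists_sum {w : ∀ l, Z0 k (T l) (res P (yon k (X l)))} (hw : ∀ l, Corep (T l) (X l) (w l))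
    {C : A} (i : ∀ l, Z0 k (X l) C)
    (h₁ : ∀ (Z : A) (n : ℤ) (z : (hom (k := k) C Z).X n), IsCl z →
      (∀ l, IsBd (comp 0 n n (zero_add n) (i l).1 z)) → IsBd z)
    (h₂ : ∀ (Z : A) (n : ℤ) (z : ∀ l, (hom (k := k) (X l) Z).X n), (∀ l, IsCl (z l)) →
      ∃ z' : (hom (k := k) C Z).X n, IsCl z' ∧
        ∀ l, IsBd (z l - comp 0 n n (zero_add n) (i l).1 z')) :
    ∃ w' : Z0 k (sumMod T) (res P (yon k C)), Corep (sumMod T) C w' := by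
  have hq : ∀ l Z, QuasiIso (corepHom (w l) Z) := fun l Z => (quasiIso_corepHom_iff _ _).2 (hw l Z)
  have hcl : ((hom (sumMod T) (res P (yon k C))).d 0 1).hom
      (sumDesc fun l => (Z0.comp (w l) (resZ0 ((yonedaDG k A).mapZ0 (i l)))).1) = 0 := by
    refine sumHom_ext fun l => ?_
    rw [sumIn_d (n := 0) (m := 1) rfl, sumIn_sumDesc, Z0_d, map_zero]
  have key : ∀ (Z : A) (n : ℤ) (z : (hom (k := k) C Z).X n) (l : ℕ),
      comp 0 n n (zero_add n) (sumIn T l).1 (((corepHom (Z0.mk _ hcl) Z).f n).hom z) =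
        ((corepHom (w l) Z).f n).hom (comp 0 n n (zero_add n) (i l).1 z) := by
    intro Z n z l
    rw [corepHom_apply, corepHom_apply, Z0.mk_val,
      ← DGCategory.assoc 0 0 n 0 n n (by omega) (by omega) (by omega) (by omega), sumIn_sumDesc,
      DGFunctor.map_comp, resMap_comp]
    exact DGCategory.assoc 0 0 n 0 n n rfl (zero_add n) (zero_add n) (zero_add n) _ _ _
  refine ⟨Z0.mk _ hcl, fun Z => (quasiIso_corepHom_iff _ _).1 ?_⟩
  refine quasiIso_of_injective_surjective _ (fun n m r hm hr z hz ψ hψ => ?_)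
    (fun n m r hm hr ψ hψ => ?_)
  · subst hr
    refine (h₁ Z n z hz fun l => ?_).exists_eq hm
    obtain ⟨y, hy⟩ := boundary_of_quasiIso _ (hq l Z) hm rfl (comp 0 n n (zero_add n) (i l).1 z)
      (IsCl.comp (i l).2 hz _) (comp 0 m m (zero_add m) (sumIn T l).1 ψ) (by
        rw [← key, hψ, sumIn_d hm])
    exact .of_eq y hm hy
  · subst hr
    have := fun l => exists_of_quasiIso _ (hq l Z) hm rfl
      (comp 0 n n (zero_add n) (sumIn T l).1 ψ) (by rw [← sumIn_d rfl, hψ, map_zero])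
    choose z y hz hy using this
    obtain ⟨z', hz', h⟩ := h₂ Z n z hz
    choose y' hy' using fun l => (h l).exists_eq hm
    refine ⟨z', sumDesc fun l => ((corepHom (w l) Z).f m).hom (y' l) + y l, hz', ?_⟩
    refine sumHom_ext fun l => ?_
    rw [map_add, key, sumIn_d hm, sumIn_sumDesc, map_add, hom_d_apply, hy', hy, map_sub]
    abel

end Corep

end DGModule

end DG

namespace DG

open DGCategory DGModule

/-- Construction of a family by descending recursion on a degree that is bounded above. -/
lemma exists_forall_of_local {I : Type} (deg : I → ℤ) (N : ℤ) (hN : ∀ a, deg a ≤ N)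
    {V : I → Type v} (y₀ : ∀ a, V a) (P : I → (∀ a, V a) → Prop)
    (hloc : ∀ a y y', y a = y' a → (∀ b, deg a < deg b → y b = y' b) → P a y → P a y')
    (hex : ∀ a y, (∀ b, deg a < deg b → P b y) → ∃ y', (∀ b, deg a < deg b → y b = y' b) ∧ P a y') :
    ∃ y, ∀ a, P a y := by
  classical
  have step : ∀ (l : ℕ) (y : ∀ a, V a), (∀ a, N - l < deg a → P a y) →
      ∃ y', (∀ a, N - l < deg a → y a = y' a) ∧ ∀ a, N - (l + 1 : ℕ) < deg a → P a y' := by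
    intro l y hy
    have h : ∀ a, ∃ y', deg a = N - l → (∀ b, deg a < deg b → y b = y' b) ∧ P a y' := by
      intro a
      by_cases ha : deg a = N - l
      · obtain ⟨y', hy'⟩ := hex a y fun b hb => hy b (by omega)
        exact ⟨y', fun _ => hy'⟩
      · exact ⟨y, fun h => absurd h ha⟩
    choose Y hY using h
    refine ⟨fun a => if deg a = N - l then Y a a else y a, fun a ha => (if_neg (by omega)).symm, fun a ha => ?_⟩
    by_cases hal : deg a = N - l
    · refine hloc a (Y a) _ (by rw [if_pos hal]) (fun b hb => ?_) (hY a hal).2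
      rw [if_neg (by omega)]
      exact ((hY a hal).1 b hb).symm
    · push_cast at ha
      refine hloc a y _ (by rw [if_neg hal]) (fun b hb => ?_) (hy a (by omega))
      rw [if_neg (by omega)]
  let Z : ℕ → {p : ℕ × (∀ a, V a) // ∀ a, N - p.1 < deg a → P a p.2} := fun l =>
    Nat.rec ⟨(0, y₀), fun a ha => by
      have := hN a
      push_cast at ha
      omega⟩ (fun _ p =>
        ⟨(p.1.1 + 1, (step p.1.1 p.1.2 p.2).choose), (step p.1.1 p.1.2 p.2).choose_spec.2⟩) l
  have hZ : ∀ l, (Z l).1.1 = l := fun l => by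
    induction l with
    | zero => rfl
    | succ l ih => exact congrArg (· + 1) ih
  have hZs : ∀ (l : ℕ) a, N - l < deg a → (Z l).1.2 a = (Z (l + 1)).1.2 a := fun l a ha =>
    (step (Z l).1.1 (Z l).1.2 (Z l).2).choose_spec.1 a (by rw [hZ]; exact ha)
  have hZm : ∀ (l l' : ℕ) (_ : l ≤ l') a, N - l < deg a → (Z l).1.2 a = (Z l').1.2 a := by
    intro l l' hl a ha
    induction l', hl using Nat.le_induction with
    | base => rfl
    | succ l' hl ih => exact ih.trans (hZs l' a (by omega))
  have hL : ∀ a, N - ((N - deg a).toNat + 1 : ℕ) < deg a := fun a => by push_cast; have := hN a; omega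
  refine ⟨fun a => (Z ((N - deg a).toNat + 1)).1.2 a, fun a => ?_⟩
  refine hloc a (Z ((N - deg a).toNat + 1)).1.2 _ rfl (fun b hb => ?_)
    ((Z ((N - deg a).toNat + 1)).2 a (by
      have := hZ ((N - deg a).toNat + 1)
      have := hL a
      omega))
  have := hN a
  have := hN b
  exact (hZm ((N - deg b).toNat + 1) ((N - deg a).toNat + 1) (by omega) b (hL b)).symm

lemma map_units_smul {k : Type v} [CommRing k] {E F : Type v} [AddCommGroup E] [Module k E]
    [AddCommGroup F] [Module k F] (f : E →ₗ[k] F) (c : ℤˣ) (x : E) : f (c • x) = c • f x := by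
  rw [Units.smul_def, Units.smul_def, map_zsmul]

namespace TwMinus

variable {k : Type v} [CommRing k] {Q : Type v} [DGCategory k Q] (Y : TwMinus k Q)

/-- The component of an element of the totalisation at a cell. -/
def coord (a : Y.gr.Idx) (W : Q) (m : ℤ) :
    (Y.tot.obj W).X m →ₗ[k] (hom (k := k) W (Y.gr.ob a)).X (m - a.1) :=
  (DFinsupp.lapply a : Y.gr.Elt k W m →ₗ[k] _)

/-- The inclusion of a cell in the totalisation. -/
def cellι (a : Y.gr.Idx) (W : Q) (m : ℤ) :
    (hom (k := k) W (Y.gr.ob a)).X (m - a.1) →ₗ[k] (Y.tot.obj W).X m :=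
  (DFinsupp.lsingle a : _ →ₗ[k] Y.gr.Elt k W m)

variable {Y}

lemma coord_ext {W : Q} {m : ℤ} {x y : (Y.tot.obj W).X m}
    (h : ∀ a, Y.coord a W m x = Y.coord a W m y) : x = y :=
  DFinsupp.ext (β := fun a : Y.gr.Idx => (hom (k := k) W (Y.gr.ob a)).X (m - a.1)) h

@[simp] lemma coord_cellι_self (a : Y.gr.Idx) (W : Q) (m : ℤ)
    (g : (hom (k := k) W (Y.gr.ob a)).X (m - a.1)) : Y.coord a W m (Y.cellι a W m g) = g :=
  DFinsupp.single_eq_same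

lemma coord_cellι_of_ne {a b : Y.gr.Idx} (h : b ≠ a) (W : Q) (m : ℤ)
    (g : (hom (k := k) W (Y.gr.ob a)).X (m - a.1)) : Y.coord b W m (Y.cellι a W m g) = 0 :=
  DFinsupp.single_eq_of_ne h

lemma exists_sum_cellι {W : Q} {m : ℤ} (x : (Y.tot.obj W).X m) :
    ∃ s : Finset Y.gr.Idx, x = ∑ a ∈ s, Y.cellι a W m (Y.coord a W m x) ∧
      ∀ a ∉ s, Y.coord a W m x = 0 := by
  classical
  let x' : Y.gr.Elt k W m := x
  refine ⟨x'.support, ?_, fun a ha => ?_⟩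
  · exact (DFinsupp.sum_single (f := x')).symm
  · exact DFinsupp.notMem_support_iff.1 ha

lemma linearMap_eq_of_cellι {W : Q} {m : ℤ} {E : Type v} [AddCommGroup E] [Module k E]
    {F G : (Y.tot.obj W).X m →ₗ[k] E} (x : (Y.tot.obj W).X m)
    (h : ∀ a, Y.coord a W m x ≠ 0 → ∀ g, F (Y.cellι a W m g) = G (Y.cellι a W m g)) : F x = G x := by
  obtain ⟨s, hs, -⟩ := exists_sum_cellι x
  rw [hs, map_sum, map_sum]
  refine Finset.sum_congr rfl fun a _ => ?_
  by_cases ha : Y.coord a W m x = 0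
  · rw [ha, map_zero, map_zero, map_zero]
  · exact h a ha _

lemma exists_lt_coord {W : Q} {m : ℤ} (x : (Y.tot.obj W).X m) :
    ∃ M : ℤ, ∀ a : Y.gr.Idx, a.1 < M → Y.coord a W m x = 0 := by
  obtain ⟨s, -, hs⟩ := exists_sum_cellι x
  obtain ⟨M, hM⟩ := (s.image fun a => a.1).bddBelow
  refine ⟨M, fun a ha => hs a fun has => ?_⟩
  have := hM (Finset.mem_coe.2 (Finset.mem_image_of_mem _ has))
  omega

lemma coord_act (a : Y.gr.Idx) {V W : Q} (p q r : ℤ) (h : p + q = r) (x : (Y.tot.obj W).X p)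
    (f : (hom (k := k) V W).X q) : Y.coord a V r (Y.tot.act p q r h x f) =
      comp q (p - a.1) (r - a.1) (by omega) f (Y.coord a W p x) := rfl

lemma cellι_act (a : Y.gr.Idx) {V W : Q} (p q r : ℤ) (h : p + q = r)
    (g : (hom (k := k) W (Y.gr.ob a)).X (p - a.1)) (f : (hom (k := k) V W).X q) :
    Y.tot.act p q r h (Y.cellι a W p g) f =
      Y.cellι a V r (comp q (p - a.1) (r - a.1) (by omega) f g) := by
  refine coord_ext fun b => ?_
  rw [coord_act]
  by_cases hb : b = a
  · subst hb
    rw [coord_cellι_self, coord_cellι_self]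
  · rw [coord_cellι_of_ne hb, coord_cellι_of_ne hb, map_zero]

lemma coord_d_cellι_of_ne {a b : Y.gr.Idx} (hba : b ≠ a) (hb : b.1 ≤ a.1) (W : Q) (m m' : ℤ)
    (g : (hom (k := k) W (Y.gr.ob a)).X (m - a.1)) :
    Y.coord b W m' (((Y.tot.obj W).d m m').hom (Y.cellι a W m g)) = 0 := by
  by_cases h : m + 1 = m'
  · have h1 := (Y.gr.toModule k).twistCplx_d_apply Y.q Y.mc W m m' h (Y.cellι a W m g)
    refine (congrArg (Y.coord b W m') h1).trans ?_
    have h2 := Y.oneSided a b (by omega) W m m' h g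
    refine (congrArg₂ (· + ·) ?_ h2).trans (add_zero 0)
    refine (GradedObj.cplx_d_apply (k := k) Y.gr W m m' (DFinsupp.single a g) b).trans ?_
    rw [DFinsupp.single_eq_of_ne hba, map_zero, smul_zero]
  · rw [(Y.tot.obj W).shape m m' h]
    exact map_zero _

lemma coord_d_cellι_self (a : Y.gr.Idx) (W : Q) (m m' : ℤ)
    (g : (hom (k := k) W (Y.gr.ob a)).X (m - a.1)) :
    Y.coord a W m' (((Y.tot.obj W).d m m').hom (Y.cellι a W m g)) =
      a.1.negOnePow • ((hom (k := k) W (Y.gr.ob a)).d (m - a.1) (m' - a.1)).hom g := by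
  by_cases h : m + 1 = m'
  · have h1 := (Y.gr.toModule k).twistCplx_d_apply Y.q Y.mc W m m' h (Y.cellι a W m g)
    refine (congrArg (Y.coord a W m') h1).trans ?_
    have h2 := Y.oneSided a a (by omega) W m m' h g
    refine (congrArg₂ (· + ·) ?_ h2).trans (add_zero _)
    refine (GradedObj.cplx_d_apply (k := k) Y.gr W m m' (DFinsupp.single a g) a).trans ?_
    rw [DFinsupp.single_eq_same]
  · rw [(Y.tot.obj W).shape m m' h, (hom (k := k) W (Y.gr.ob a)).shape _ _ (fun h' => h (by
      have h' : m - a.1 + 1 = m' - a.1 := h'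
      omega))]
    exact (map_zero _).trans (smul_zero _).symm

lemma coord_d (b : Y.gr.Idx) (W : Q) (m m' : ℤ) (x : (Y.tot.obj W).X m)
    (hx : ∀ a, a.1 < b.1 → Y.coord a W m x = 0) :
    Y.coord b W m' (((Y.tot.obj W).d m m').hom x) =
      b.1.negOnePow • ((hom (k := k) W (Y.gr.ob b)).d (m - b.1) (m' - b.1)).hom (Y.coord b W m x) := by
  refine linearMap_eq_of_cellι (F := Y.coord b W m' ∘ₗ ((Y.tot.obj W).d m m').hom)
    (G := b.1.negOnePow • ((hom (k := k) W (Y.gr.ob b)).d (m - b.1) (m' - b.1)).hom ∘ₗ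
      Y.coord b W m) x fun a ha g => ?_
  have hab : b.1 ≤ a.1 := not_lt.1 fun h => ha (hx a h)
  by_cases hba : b = a
  · subst hba
    exact (coord_d_cellι_self b W m m' g).trans (by
      rw [LinearMap.smul_apply, LinearMap.comp_apply, coord_cellι_self])
  · rw [LinearMap.smul_apply, LinearMap.comp_apply, LinearMap.comp_apply,
      coord_d_cellι_of_ne hba hab, coord_cellι_of_ne hba, map_zero, smul_zero]

lemma exists_coord_eq (c : ℤ) (W : Q) (m : ℤ)
    (y : ∀ i : Fin (Y.gr.n c), (hom (k := k) W (Y.gr.ob ⟨c, i⟩)).X (m - c)) :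
    ∃ x : (Y.tot.obj W).X m, (∀ a, a.1 ≠ c → Y.coord a W m x = 0) ∧
      ∀ i, Y.coord ⟨c, i⟩ W m x = y i := by
  classical
  refine ⟨∑ i, Y.cellι ⟨c, i⟩ W m (y i), fun a ha => ?_, fun i => ?_⟩
  · rw [map_sum]
    exact Finset.sum_eq_zero fun i _ => coord_cellι_of_ne (fun h => ha (by rw [h])) _ _ _
  · rw [map_sum, Finset.sum_eq_single i]
    · exact coord_cellι_self _ _ _ _
    · exact fun i' _ hi => coord_cellι_of_ne (fun h => hi (by
        have := (Sigma.mk.inj h).2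
        exact (eq_of_heq this).symm)) _ _ _
    · exact fun h => absurd (Finset.mem_univ i) h

/-- If the cohomology of `Q` vanishes in positive degrees, the components at cells of low degree
can be removed by a boundary. -/
lemma exists_coord_sub_d_eq_zero (hQ : ∀ (V W : Q) (i : ℤ), 0 < i → (hom (k := k) V W).ExactAt i)
    {W : Q} {m m' : ℤ} (hm : m' + 1 = m) {M : ℤ} (hM : M ≤ m) (u : (Y.tot.obj W).X m)
    (hu : ∀ b, b.1 < M → Y.coord b W (m + 1) (((Y.tot.obj W).d m (m + 1)).hom u) = 0) :
    ∃ x : (Y.tot.obj W).X m', ∀ b, b.1 < M →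
      Y.coord b W m (u - ((Y.tot.obj W).d m' m).hom x) = 0 := by
  obtain ⟨M₀, hM₀⟩ := exists_lt_coord u
  obtain ⟨j, hj⟩ : ∃ j : ℕ, ∀ b, b.1 < M - j → Y.coord b W m u = 0 :=
    ⟨(M - M₀).toNat, fun b hb => hM₀ b (by omega)⟩
  clear hM₀
  induction j generalizing u with
  | zero => exact ⟨0, fun b hb => by rw [map_zero, sub_zero]; exact hj b (by omega)⟩
  | succ j ih =>
    have h1 : ∀ i : Fin (Y.gr.n (M - (j + 1 : ℕ))), ∃ y,
        ((hom (k := k) W (Y.gr.ob ⟨_, i⟩)).d (m' - (M - (j + 1 : ℕ))) (m - (M - (j + 1 : ℕ)))).hom y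
          = Y.coord ⟨M - (j + 1 : ℕ), i⟩ W m u := fun i => by
      have h2 := hu ⟨M - (j + 1 : ℕ), i⟩ (by dsimp only; omega)
      rw [coord_d _ _ _ _ _ hj] at h2
      refine (exactAt_iff (l := m + 1 - (M - (j + 1 : ℕ))) (by omega) (by omega)).1
        (hQ W (Y.gr.ob ⟨M - (j + 1 : ℕ), i⟩) (m - (M - (j + 1 : ℕ))) (by omega)) _ ?_
      exact (smul_eq_zero_iff_eq _).1 h2
    choose y hy using h1
    obtain ⟨x₀, hx₁, hx₂⟩ := exists_coord_eq (M - (j + 1 : ℕ)) W m'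
      fun i => (M - (j + 1 : ℕ)).negOnePow • y i
    have hx₀ : ∀ b, b.1 < M - j → Y.coord b W m (u - ((Y.tot.obj W).d m' m).hom x₀) = 0 := by
      rintro ⟨b, i⟩ hb
      dsimp only at hb
      rw [map_sub, coord_d _ _ _ _ _ fun a ha => hx₁ a (by
        have ha : a.1 < b := ha
        push_cast; omega)]
      by_cases hbc : b = M - (j + 1 : ℕ)
      · subst hbc
        rw [hx₂, map_units_smul, smul_smul, Int.units_mul_self, one_smul, hy, sub_self]
      · rw [hx₁ _ hbc, map_zero, smul_zero, sub_zero]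
        exact hj _ (by push_cast at hbc ⊢; omega)
    obtain ⟨x, hx⟩ := ih (u - ((Y.tot.obj W).d m' m).hom x₀) (fun b hb => by
      rw [map_sub, d_d_apply, sub_zero]; exact hu b hb) hx₀
    refine ⟨x₀ + x, fun b hb => ?_⟩
    rw [map_add, ← sub_sub]
    exact hx b hb

end TwMinus

end DG

namespace DG

open DGCategory DGModule

lemma comp_castX_one {k : Type v} [CommRing k] {A : Type v} [DGCategory k A] {X Y : A} {p r : ℤ}
    (h : 0 = r) (hr : p + r = p) (f : (hom (k := k) X Y).X p) :
    comp p r p hr f (castX _ h (one Y)) = f := by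
  subst h
  exact comp_one p f

lemma act_castX_one {k : Type v} [CommRing k] {A : Type v} [DGCategory k A] (M : DGModule k A)
    {X : A} {p r : ℤ} (h : 0 = r) (hr : p + r = p) (x : (M.obj X).X p) :
    M.act p r p hr x (castX _ h (one X)) = x := by
  subst h
  exact M.act_one p x

namespace DGModule

section Sub

variable {k : Type v} [CommRing k] {A : Type v} [DGCategory k A] (M : DGModule k A)
  (S : ∀ (W : A) (m : ℤ), Submodule k ((M.obj W).X m))
  (hd : ∀ W m m', ∀ x ∈ S W m, ((M.obj W).d m m').hom x ∈ S W m')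
  (ha : ∀ {V W : A} (p q r : ℤ) (h : p + q = r), ∀ x ∈ S W p, ∀ f : (hom (k := k) V W).X q,
    M.act p q r h x f ∈ S V r)

/-- The dg-submodule given by a family of submodules. -/
def subMod : DGModule k A where
  obj W :=
    { X := fun m => ModuleCat.of k (S W m)
      d := fun m m' => ModuleCat.ofHom (((M.obj W).d m m').hom.restrict (hd W m m'))
      shape := fun m m' h => by
        refine ModuleCat.hom_ext (LinearMap.ext fun x => Subtype.ext ?_)
        exact congrArg (fun φ => φ.hom x.1) ((M.obj W).shape m m' h)
      d_comp_d' := fun m m' m'' _ _ => by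
        refine ModuleCat.hom_ext (LinearMap.ext fun x => Subtype.ext ?_)
        exact d_d_apply (M.obj W) m m' m'' x.1 }
  act {V W} p q r h := LinearMap.mk₂ k
    (fun (x : S W p) f => (⟨M.act p q r h x.1 f, ha p q r h x.1 x.2 f⟩ : S V r))
    (fun _ _ _ => Subtype.ext (LinearMap.map_add₂ _ _ _ _))
    (fun _ _ _ => Subtype.ext (LinearMap.map_smul₂ _ _ _ _))
    (fun _ _ _ => Subtype.ext (map_add _ _ _))
    (fun _ _ _ => Subtype.ext (map_smul _ _ _))
  act_one p x := Subtype.ext (M.act_one p x.1)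
  act_act p q r pq rq s hpq hrq hs hs' x g f := Subtype.ext
    (M.act_act p q r pq rq s hpq hrq hs hs' x.1 g f)
  leibniz p q r p' q' r' h hp hq hr x f := Subtype.ext
    (M.leibniz p q r p' q' r' h hp hq hr x.1 f)

variable {M S hd ha}

/-- An element of a dg-submodule. -/
def subElt {W : A} {m : ℤ} (x : (M.obj W).X m) (hx : x ∈ S W m) : ((subMod M S hd ha).obj W).X m :=
  (⟨x, hx⟩ : S W m)

variable (M S hd ha)

/-- The values of the inclusion of a dg-submodule. -/
def subVal (W : A) (m : ℤ) : ((subMod M S hd ha).obj W).X m →ₗ[k] (M.obj W).X m :=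
  (S W m).subtype

/-- The inclusion of a dg-submodule. -/
def subIncl : Z0 k (subMod M S hd ha) M :=
  ofMaps (subVal M S hd ha) (fun _ _ _ _ => rfl) (fun _ _ _ _ _ _ => rfl)

lemma ap_subIncl (W : A) (p : ℤ) (x : ((subMod M S hd ha).obj W).X p) :
    ap (subIncl M S hd ha).1 W p p (add_zero p) x = subVal M S hd ha W p x := ap_ofMaps _ _ _ _ _ _

variable {M S hd ha}

lemma subVal_injective (W : A) (m : ℤ) : Function.Injective (subVal M S hd ha W m) :=
  Subtype.val_injective

lemma subVal_mem {W : A} {m : ℤ} (x : ((subMod M S hd ha).obj W).X m) :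
    subVal M S hd ha W m x ∈ S W m := Subtype.property (p := fun y => y ∈ S W m) x

end Sub

end DGModule

namespace TwMinus

variable {k : Type v} [CommRing k] {Q : Type v} [DGCategory k Q] (Y : TwMinus k Q)

/-- The generator of the totalisation given by a cell. -/
def cell (a : Y.gr.Idx) : (Y.tot.obj (Y.gr.ob a)).X a.1 :=
  Y.cellι a (Y.gr.ob a) a.1 (castX _ (sub_self a.1).symm (one (Y.gr.ob a)))

variable {Y} {L : DGModule k Q}

lemma act_cell (a : Y.gr.Idx) (W : Q) (m : ℤ) (g : (hom (k := k) W (Y.gr.ob a)).X (m - a.1)) :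
    Y.tot.act a.1 (m - a.1) m (by omega) (Y.cell a) g = Y.cellι a W m g := by
  rw [cell, cellι_act]
  exact congrArg _ (comp_castX_one (sub_self a.1).symm (by omega) g)

/-- The values of the morphism out of the totalisation with given values at the cells. -/
def totDescMap {n : ℤ} (y : ∀ a : Y.gr.Idx, (L.obj (Y.gr.ob a)).X (a.1 + n)) (W : Q) (p q : ℤ)
    (h : p + n = q) : (Y.tot.obj W).X p →ₗ[k] (L.obj W).X q :=
  (DFinsupp.lsum k (fun a => L.act (a.1 + n) (p - a.1) q (by omega) (y a)) :
    Y.gr.Elt k W p →ₗ[k] (L.obj W).X q)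

lemma totDescMap_cellι {n : ℤ} (y : ∀ a : Y.gr.Idx, (L.obj (Y.gr.ob a)).X (a.1 + n)) (W : Q)
    (p q : ℤ) (h : p + n = q) (a : Y.gr.Idx) (g : (hom (k := k) W (Y.gr.ob a)).X (p - a.1)) :
    totDescMap y W p q h (Y.cellι a W p g) = L.act (a.1 + n) (p - a.1) q (by omega) (y a) g :=
  DFinsupp.lsum_single (R := k) _ _ _ _

/-- The morphism out of the totalisation with given values at the cells. -/
def totDesc (n : ℤ) (y : ∀ a : Y.gr.Idx, (L.obj (Y.gr.ob a)).X (a.1 + n)) :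
    (hom (k := k) Y.tot L).X n :=
  homMk n (totDescMap y) (fun V W p q r p' r' h hp hr x f => by
    refine linearMap_eq_of_cellι (F := totDescMap y V r r' hr ∘ₗ (Y.tot.act p q r h).flip f)
        (G := ((L.act p' q r' (by omega)).flip f) ∘ₗ totDescMap y W p p' hp) x fun a _ g => ?_
    rw [LinearMap.comp_apply, LinearMap.comp_apply, LinearMap.flip_apply, LinearMap.flip_apply,
      cellι_act, totDescMap_cellι, totDescMap_cellι]
    exact (L.act_act (a.1 + n) (p - a.1) q p' (r - a.1) r' (by omega) (by omega) (by omega)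
      (by omega) (y a) g f).symm)

lemma ap_totDesc_cell {n : ℤ} (y : ∀ a : Y.gr.Idx, (L.obj (Y.gr.ob a)).X (a.1 + n))
    (a : Y.gr.Idx) : ap (totDesc n y) _ a.1 (a.1 + n) rfl (Y.cell a) = y a := by
  refine Eq.trans (totDescMap_cellι y _ a.1 (a.1 + n) rfl a _) ?_
  exact act_castX_one L (sub_self a.1).symm (by omega) (y a)

lemma ap_cellι {n : ℤ} (φ : (hom (k := k) Y.tot L).X n) (a : Y.gr.Idx) (W : Q) (p q : ℤ)
    (h : p + n = q) (g : (hom (k := k) W (Y.gr.ob a)).X (p - a.1)) :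
    ap φ W p q h (Y.cellι a W p g) =
      L.act (a.1 + n) (p - a.1) q (by omega) (ap φ _ a.1 (a.1 + n) rfl (Y.cell a)) g := by
  rw [← act_cell]
  exact ap_act φ a.1 (p - a.1) p (a.1 + n) q (by omega) rfl h _ _

lemma totHom_ext {n : ℤ} {φ ψ : (hom (k := k) Y.tot L).X n}
    (h : ∀ a, ap φ _ a.1 (a.1 + n) rfl (Y.cell a) = ap ψ _ a.1 (a.1 + n) rfl (Y.cell a)) : φ = ψ :=
  hom_ext' fun W p q hpq x => linearMap_eq_of_cellι x fun a _ g => by rw [ap_cellι, ap_cellι, h]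

lemma coord_cell_of_ne {a b : Y.gr.Idx} (h : b ≠ a) : Y.coord b _ a.1 (Y.cell a) = 0 :=
  coord_cellι_of_ne h _ _ _

lemma castX_zero_d_one {A : Type v} [DGCategory k A] (X : A) {p q : ℤ} (h : 0 = p) :
    ((hom (k := k) X X).d p q).hom (castX _ h (one X)) = 0 := by
  subst h
  rw [castX_rfl]
  by_cases hq : (0 : ℤ) + 1 = q
  · obtain rfl : (1 : ℤ) = q := hq
    exact d_one X
  · rw [(hom (k := k) X X).shape _ _ hq]
    rfl

lemma coord_d_cell (a b : Y.gr.Idx) (hb : b.1 ≤ a.1) (m : ℤ) :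
    Y.coord b _ m (((Y.tot.obj _).d a.1 m).hom (Y.cell a)) = 0 := by
  by_cases h : b = a
  · subst h
    rw [cell, coord_d_cellι_self, castX_zero_d_one, smul_zero]
  · exact coord_d_cellι_of_ne h hb _ _ _ _

/-- The value of `dφ` at a cell. -/
lemma ap_d_cell {n m : ℤ} (hnm : n + 1 = m) (φ : (hom (k := k) Y.tot L).X n) (a : Y.gr.Idx) :
    ap (((hom (k := k) Y.tot L).d n m).hom φ) _ a.1 (a.1 + m) rfl (Y.cell a) =
      ((L.obj _).d (a.1 + n) (a.1 + m)).hom (ap φ _ a.1 (a.1 + n) rfl (Y.cell a)) -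
        n.negOnePow • ap φ _ (a.1 + 1) (a.1 + m) (by omega)
          (((Y.tot.obj _).d a.1 (a.1 + 1)).hom (Y.cell a)) :=
  ap_d hnm φ _ a.1 (a.1 + m) (a.1 + n) (a.1 + 1) rfl (by omega) rfl _

section Sub

/-- A set of cells is closed upwards if it contains all cells of degree larger than that of one of its
elements. -/
def UpClosed (F : Set Y.gr.Idx) : Prop := ∀ a ∈ F, ∀ b : Y.gr.Idx, a.1 < b.1 → b ∈ F

variable (Y) in
/-- The elements of the totalisation with support in a set of cells. -/
def subFam (F : Set Y.gr.Idx) (W : Q) (m : ℤ) : Submodule k ((Y.tot.obj W).X m) where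
  carrier := {x | ∀ a ∉ F, Y.coord a W m x = 0}
  add_mem' := fun {x y} hx hy a ha => by rw [map_add, hx a ha, hy a ha, add_zero]
  zero_mem' := fun a _ => map_zero _
  smul_mem' := fun c x hx a ha => by rw [map_smul, hx a ha, smul_zero]

lemma subFam_d {F : Set Y.gr.Idx} (hF : UpClosed F) (W : Q) (m m' : ℤ) (x : (Y.tot.obj W).X m)
    (hx : x ∈ Y.subFam F W m) : ((Y.tot.obj W).d m m').hom x ∈ Y.subFam F W m' := fun b hb => by
  refine linearMap_eq_of_cellι (F := Y.coord b W m' ∘ₗ ((Y.tot.obj W).d m m').hom) (G := 0) x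
    fun a ha g => ?_
  have haF : a ∈ F := by_contra fun h => ha (hx a h)
  refine coord_d_cellι_of_ne (fun h : b = a => hb (h ▸ haF)) ?_ W m m' g
  exact not_lt.1 fun h => hb (hF a haF b h)

lemma subFam_act {F : Set Y.gr.Idx} {V W : Q} (p q r : ℤ) (h : p + q = r) (x : (Y.tot.obj W).X p)
    (hx : x ∈ Y.subFam F W p) (f : (hom (k := k) V W).X q) :
    Y.tot.act p q r h x f ∈ Y.subFam F V r := fun a ha => by
  rw [coord_act, hx a ha, map_zero]

variable (Y) in
/-- The dg-submodule of the totalisation generated by a set of cells that is closed upwards. -/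
def sub (F : Set Y.gr.Idx) (hF : UpClosed F) : DGModule k Q :=
  subMod Y.tot (Y.subFam F) (subFam_d hF) subFam_act

variable {F : Set Y.gr.Idx} {hF : UpClosed F}

variable (hF) in
/-- The values of the inclusion of the dg-submodule generated by a set of cells. -/
def val (W : Q) (m : ℤ) : ((Y.sub F hF).obj W).X m →ₗ[k] (Y.tot.obj W).X m :=
  subVal Y.tot (Y.subFam F) (subFam_d hF) subFam_act W m

variable (hF) in
/-- The inclusion of the dg-submodule generated by a set of cells. -/
def incl : Z0 k (Y.sub F hF) Y.tot :=
  subIncl Y.tot (Y.subFam F) (subFam_d hF) subFam_act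

lemma ap_incl (W : Q) (m : ℤ) (x : ((Y.sub F hF).obj W).X m) :
    ap (incl hF).1 W m m (add_zero m) x = val hF W m x := ap_subIncl _ _ _ _ _ _ _

lemma val_injective (W : Q) (m : ℤ) : Function.Injective (val hF W m) := subVal_injective W m

lemma val_d (W : Q) (p q : ℤ) (x : ((Y.sub F hF).obj W).X p) :
    val hF W q ((((Y.sub F hF).obj W).d p q).hom x) = ((Y.tot.obj W).d p q).hom (val hF W p x) := rfl

lemma val_act {V W : Q} (p q r : ℤ) (h : p + q = r) (x : ((Y.sub F hF).obj W).X p)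
    (f : (hom (k := k) V W).X q) : val hF V r ((Y.sub F hF).act p q r h x f) =
      Y.tot.act p q r h (val hF W p x) f := rfl

lemma coord_val {a : Y.gr.Idx} (ha : a ∉ F) (W : Q) (m : ℤ) (x : ((Y.sub F hF).obj W).X m) :
    Y.coord a W m (val hF W m x) = 0 := subVal_mem x a ha

lemma exists_val_eq {W : Q} {m : ℤ} (x : (Y.tot.obj W).X m) (hx : ∀ a ∉ F, Y.coord a W m x = 0) :
    ∃ x', val hF W m x' = x := ⟨subElt (S := Y.subFam F) x hx, rfl⟩

variable (hF) in
/-- A cell as an element of a dg-submodule. -/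
def subCell (a : Y.gr.Idx) (ha : a ∈ F) : ((Y.sub F hF).obj (Y.gr.ob a)).X a.1 :=
  subElt (S := Y.subFam F) (Y.cell a) fun b hb => coord_cell_of_ne fun h : b = a => hb (h ▸ ha)

lemma val_subCell (a : Y.gr.Idx) (ha : a ∈ F) : val hF _ a.1 (subCell hF a ha) = Y.cell a := rfl

lemma exists_sum_subCell {W : Q} {m : ℤ} (x : ((Y.sub F hF).obj W).X m) :
    ∃ (s : Finset F) (g : ∀ a : F, (hom (k := k) W (Y.gr.ob a.1)).X (m - a.1.1)),
      x = ∑ a ∈ s, (Y.sub F hF).act a.1.1 (m - a.1.1) m (by omega) (subCell hF a.1 a.2) (g a) := by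
  classical
  obtain ⟨s, hs, hs'⟩ := exists_sum_cellι (val hF W m x)
  refine ⟨s.subtype (· ∈ F), fun a => Y.coord a.1 W m (val hF W m x), val_injective (hF := hF) W m ?_⟩
  rw [map_sum]
  conv_lhs => rw [hs]
  simp_rw [val_act, val_subCell, act_cell]
  rw [Finset.sum_subtype_eq_sum_filter (s := s) (p := (· ∈ F))
    (fun a => Y.cellι a W m (Y.coord a W m (val hF W m x)))]
  refine (Finset.sum_subset (Finset.filter_subset _ _) fun a has ha => ?_).symm
  rw [coord_val (fun h => ha (Finset.mem_filter.2 ⟨has, h⟩)), map_zero]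

lemma subHom_ext {n : ℤ} {φ ψ : (hom (k := k) (Y.sub F hF) L).X n}
    (h : ∀ a ha, ap φ _ a.1 (a.1 + n) rfl (subCell hF a ha) =
      ap ψ _ a.1 (a.1 + n) rfl (subCell hF a ha)) : φ = ψ := by
  refine hom_ext' fun W p q hpq x => ?_
  obtain ⟨s, g, rfl⟩ := exists_sum_subCell x
  rw [map_sum, map_sum]
  refine Finset.sum_congr rfl fun a _ => ?_
  rw [ap_act φ a.1.1 (p - a.1.1) p (a.1.1 + n) q (by omega) rfl hpq,
    ap_act ψ a.1.1 (p - a.1.1) p (a.1.1 + n) q (by omega) rfl hpq, h]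

variable (hF) in
/-- Restriction of a morphism to a dg-submodule. -/
def restr {n : ℤ} (φ : (hom (k := k) Y.tot L).X n) : (hom (k := k) (Y.sub F hF) L).X n :=
  comp 0 n n (zero_add n) (incl hF).1 φ

lemma ap_restr {n : ℤ} (φ : (hom (k := k) Y.tot L).X n) (W : Q) (p q : ℤ) (h : p + n = q)
    (x : ((Y.sub F hF).obj W).X p) : ap (restr hF φ) W p q h x = ap φ W p q h (val hF W p x) := by
  rw [restr, ap_comp _ _ _ W p p q h (by omega), ap_incl]

lemma ap_restr_subCell {n : ℤ} (φ : (hom (k := k) Y.tot L).X n) (a : Y.gr.Idx) (ha : a ∈ F) :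
    ap (restr hF φ) _ a.1 (a.1 + n) rfl (subCell hF a ha) = ap φ _ a.1 (a.1 + n) rfl (Y.cell a) :=
  ap_restr _ _ _ _ _ _

lemma d_restr {n m : ℤ} (h : n + 1 = m) (φ : (hom (k := k) Y.tot L).X n) :
    ((hom (k := k) (Y.sub F hF) L).d n m).hom (restr hF φ) =
      restr hF (((hom (k := k) Y.tot L).d n m).hom φ) :=
  d_comp_of_left_closed (zero_add n) h h (incl hF).1 φ (p' := 1) rfl (incl hF).2

variable (hF) in
lemma exists_restr_eq {n : ℤ} (φ : (hom (k := k) (Y.sub F hF) L).X n) :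
    ∃ ψ : (hom (k := k) Y.tot L).X n, restr hF ψ = φ := by
  classical
  refine ⟨totDesc n fun a => if ha : a ∈ F then ap φ _ a.1 (a.1 + n) rfl (subCell hF a ha) else 0,
    subHom_ext fun a ha => ?_⟩
  rw [ap_restr_subCell, ap_totDesc_cell, dif_pos ha]

end Sub

end TwMinus

end DG

namespace DG

open DGCategory DGModule

namespace TwMinus

variable {k : Type v} [CommRing k] {Q : Type v} [DGCategory k Q] {Y : TwMinus k Q}
  {L : DGModule k Q}

lemma ap_congr {n : ℤ} {φ ψ : (hom (k := k) Y.tot L).X n} {W : Q} {p q : ℤ} (h : p + n = q)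
    (x : (Y.tot.obj W).X p) (H : ∀ a, Y.coord a W p x ≠ 0 →
      ap φ _ a.1 (a.1 + n) rfl (Y.cell a) = ap ψ _ a.1 (a.1 + n) rfl (Y.cell a)) :
    ap φ W p q h x = ap ψ W p q h x :=
  linearMap_eq_of_cellι x fun a ha g => by rw [ap_cellι, ap_cellι, H a ha]

lemma lt_of_coord_d_cell_ne_zero {a b : Y.gr.Idx} {m : ℤ}
    (h : Y.coord b _ m (((Y.tot.obj _).d a.1 m).hom (Y.cell a)) ≠ 0) : a.1 < b.1 :=
  not_le.1 fun hb => h (coord_d_cell a b hb m)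

lemma ap_d_totDesc_congr {n m : ℤ} (hnm : n + 1 = m) {a : Y.gr.Idx}
    {v v' : ∀ a : Y.gr.Idx, (L.obj (Y.gr.ob a)).X (a.1 + n)} (ha : v a = v' a)
    (h : ∀ b, a.1 < b.1 → v b = v' b) :
    ap (((hom (k := k) Y.tot L).d n m).hom (totDesc n v)) _ a.1 (a.1 + m) rfl (Y.cell a) =
      ap (((hom (k := k) Y.tot L).d n m).hom (totDesc n v')) _ a.1 (a.1 + m) rfl (Y.cell a) := by
  rw [ap_d_cell hnm, ap_d_cell hnm, ap_totDesc_cell, ap_totDesc_cell, ha]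
  congr 2
  refine ap_congr _ _ fun b hb => ?_
  rw [ap_totDesc_cell, ap_totDesc_cell, h b (lt_of_coord_d_cell_ne_zero hb)]

/-- Families of values at the cells can be constructed by descending recursion on the degree. -/
lemma exists_forall_cells {V : Y.gr.Idx → Type v} (y₀ : ∀ a, V a)
    (P : Y.gr.Idx → (∀ a, V a) → Prop)
    (hloc : ∀ a y y', y a = y' a → (∀ b : Y.gr.Idx, a.1 < b.1 → y b = y' b) → P a y → P a y')
    (hex : ∀ a y, (∀ b : Y.gr.Idx, a.1 < b.1 → P b y) → ∃ x, ∀ y', y' a = x →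
      (∀ b : Y.gr.Idx, a.1 < b.1 → y b = y' b) → P a y') : ∃ y, ∀ a, P a y := by
  classical
  obtain ⟨N, hN⟩ := Y.gr.bounded
  refine exists_forall_of_local (fun a : Y.gr.Idx => a.1) N (fun a => ?_) y₀ P hloc fun a y hy => ?_
  · by_contra h
    have := hN a.1 (not_le.1 h)
    exact (Fin.cast this a.2).elim0
  · obtain ⟨x, hx⟩ := hex a y hy
    have hu : ∀ b : Y.gr.Idx, a.1 < b.1 → y b = Function.update y a x b := fun b hb =>
      (Function.update_of_ne (fun h => by subst h; omega) _ _).symm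
    exact ⟨Function.update y a x, hu, hx _ (Function.update_self _ _ _) hu⟩

/-- The differential of `z(e) ± φ(de)` for a cell `e`. -/
lemma d_ap_cell_add {n m m' : ℤ} (hnm : n + 1 = m) (hm : m + 1 = m') (z : (hom (k := k) Y.tot L).X m)
    (φ : (hom (k := k) Y.tot L).X n) (a : Y.gr.Idx) :
    ((L.obj _).d (a.1 + m) (a.1 + m')).hom (ap z _ a.1 (a.1 + m) rfl (Y.cell a) +
      n.negOnePow • ap φ _ (a.1 + 1) (a.1 + m) (by omega)
        (((Y.tot.obj _).d a.1 (a.1 + 1)).hom (Y.cell a))) =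
      ap (((hom (k := k) Y.tot L).d m m').hom z) _ a.1 (a.1 + m') rfl (Y.cell a) -
        n.negOnePow • ap (z - ((hom (k := k) Y.tot L).d n m).hom φ) _ (a.1 + 1) (a.1 + m') (by omega)
          (((Y.tot.obj _).d a.1 (a.1 + 1)).hom (Y.cell a)) := by
  have h1 := ap_d_cell hm z a
  have h2 := ap_d hnm φ _ (a.1 + 1) (a.1 + m') (a.1 + m) (a.1 + 1 + 1) (by omega) (by omega) rfl
    (((Y.tot.obj _).d a.1 (a.1 + 1)).hom (Y.cell a))
  rw [d_d_apply, map_zero, smul_zero, sub_zero] at h2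
  rw [map_add, map_units_smul, h1, ← h2, ap_sub, LinearMap.sub_apply, smul_sub,
    show m.negOnePow = - n.negOnePow by rw [← hnm, Int.negOnePow_succ], Units.neg_smul]
  abel

lemma exists_extension {F : Set Y.gr.Idx} (hF : UpClosed F) {n m m' : ℤ} (hnm : n + 1 = m)
    (hm : m + 1 = m') (z : (hom (k := k) Y.tot L).X m)
    (hz : ((hom (k := k) Y.tot L).d m m').hom z = 0) (y : (hom (k := k) (Y.sub F hF) L).X n)
    (hy : ((hom (k := k) (Y.sub F hF) L).d n m).hom y = restr hF z)
    (hL : ∀ a ∉ F, (L.obj (Y.gr.ob a)).ExactAt (a.1 + m)) :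
    ∃ y', restr hF y' = y ∧ ((hom (k := k) Y.tot L).d n m).hom y' = z := by
  obtain ⟨ψ, rfl⟩ := exists_restr_eq hF y
  rw [d_restr hnm] at hy
  have hψ : ∀ a ∈ F, ap (((hom (k := k) Y.tot L).d n m).hom ψ) _ a.1 (a.1 + m) rfl (Y.cell a) =
      ap z _ a.1 (a.1 + m) rfl (Y.cell a) := fun a ha => by
    rw [← ap_restr_subCell (hF := hF) _ a ha, hy, ap_restr_subCell]
  obtain ⟨v, hv⟩ := exists_forall_cells (Y := Y)
    (V := fun a : Y.gr.Idx => (L.obj (Y.gr.ob a)).X (a.1 + n)) (fun _ => 0)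
    (fun a v => (a ∈ F → v a = ap ψ _ a.1 (a.1 + n) rfl (Y.cell a)) ∧
      ap (((hom (k := k) Y.tot L).d n m).hom (totDesc n v)) _ a.1 (a.1 + m) rfl (Y.cell a) =
        ap z _ a.1 (a.1 + m) rfl (Y.cell a))
    (fun a v v' ha hb h => ⟨fun haF => ha.symm.trans (h.1 haF),
      (ap_d_totDesc_congr hnm ha hb).symm.trans h.2⟩) (fun a v hv => by
    by_cases ha : a ∈ F
    · refine ⟨ap ψ _ a.1 (a.1 + n) rfl (Y.cell a), fun v' h1 h2 => ⟨fun _ => h1, ?_⟩⟩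
      rw [← hψ a ha, ap_d_cell hnm, ap_d_cell hnm, ap_totDesc_cell, h1]
      congr 2
      refine ap_congr _ _ fun b hb => ?_
      have hab := lt_of_coord_d_cell_ne_zero hb
      rw [ap_totDesc_cell, ← h2 b hab, (hv b hab).1 (hF a ha b hab)]
    · obtain ⟨x, hx⟩ := (exactAt_iff (j := a.1 + n) (l := a.1 + m') (by omega) (by omega)).1 (hL a ha)
        (ap z _ a.1 (a.1 + m) rfl (Y.cell a) +
          n.negOnePow • ap (totDesc n v) _ (a.1 + 1) (a.1 + m) (by omega)
            (((Y.tot.obj _).d a.1 (a.1 + 1)).hom (Y.cell a))) (by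
          rw [d_ap_cell_add hnm hm, hz, ap_zero, LinearMap.zero_apply, zero_sub, neg_eq_zero]
          refine (congrArg _ (ap_congr (ψ := 0) _ _ fun b hb => ?_)).trans (smul_zero _)
          rw [ap_sub, LinearMap.sub_apply, (hv b (lt_of_coord_d_cell_ne_zero hb)).2, sub_self]
          rfl)
      refine ⟨x, fun v' h1 h2 => ⟨fun h => absurd h ha, ?_⟩⟩
      rw [ap_d_cell hnm, ap_totDesc_cell, h1, hx]
      refine sub_eq_of_eq_add (congrArg (_ + n.negOnePow • ·) (ap_congr _ _ fun b hb => ?_))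
      rw [ap_totDesc_cell, ap_totDesc_cell, h2 b (lt_of_coord_d_cell_ne_zero hb)])
  refine ⟨totDesc n v, subHom_ext fun a ha => ?_, totHom_ext fun a => (hv a).2⟩
  rw [ap_restr_subCell, ap_restr_subCell, ap_totDesc_cell, (hv a).1 ha]

lemma coneExactAt_precomp_incl {F : Set Y.gr.Idx} (hF : UpClosed F) (n : ℤ)
    (hL : ∀ a ∉ F, (L.obj (Y.gr.ob a)).ExactAt (a.1 + (n + 1))) :
    ConeExactAt (precomp (incl hF) L) n := by
  intro m n' n'' hm hn hn' z y hz hy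
  subst hn
  obtain ⟨y', h1, h2⟩ := exists_extension hF rfl hn' z hz y hy.symm hL
  exact ⟨y', 0, h2, by rw [map_zero, add_zero]; exact h1.symm⟩

lemma isHProjective_tot : Y.tot.IsHProjective := by
  intro N hN f
  obtain ⟨w, rfl⟩ := cls_surjective f
  rw [cls_eq_zero_iff]
  obtain ⟨y, -, hy⟩ := exists_extension (Y := Y) (F := ∅) (fun _ h => h.elim) (n := -1) (m := 0)
    (m' := 1) rfl rfl w.1 w.2 0 (subHom_ext fun a ha => ha.elim)
    fun a _ => hN _ _
  exact ⟨y, hy⟩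

/-- The cells of degree at least `M`. -/
def upSet (Y : TwMinus k Q) (M : ℤ) : Set Y.gr.Idx := {a | M ≤ a.1}

lemma upClosed_upSet (M : ℤ) : UpClosed (Y.upSet M) := fun _ ha _ hb => le_trans ha hb.le

section

variable (hQ : ∀ (V W : Q) (i : ℤ), 0 < i → (hom (k := k) V W).ExactAt i)
include hQ

lemma stdLE_tot {N : ℤ} (hN : ∀ i, N < i → Y.gr.n i = 0) : Y.tot.StdLE N := by
  refine fun i hi W => (exactAt_iff (j := i - 1) (l := i + 1) (by omega) rfl).2 fun u hu => ?_
  obtain ⟨x, hx⟩ := exists_coord_sub_d_eq_zero hQ (m' := i - 1) (by omega) (M := N + 1) (by omega) u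
    fun b _ => by rw [hu, map_zero]
  refine ⟨x, (sub_eq_zero.1 (coord_ext fun b => ?_)).symm⟩
  rw [map_zero]
  refine hx b (lt_of_not_ge fun h => ?_)
  exact (Fin.cast (hN b.1 (by omega)) b.2).elim0

lemma coneExactAt_app_incl_upSet {M n : ℤ} (h : M ≤ n) (W : Q) :
    ConeExactAt (app (incl (upClosed_upSet (Y := Y) M)) W) n := by
  intro m n' n'' hm hn hn' x z hx hz
  subst hn
  have hz' : val (upClosed_upSet M) W (n + 1) x = ((Y.tot.obj W).d n (n + 1)).hom z :=
    (ap_incl W _ x).symm.trans hz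
  obtain ⟨z', h1⟩ := exists_coord_sub_d_eq_zero hQ hm h z fun b hb => by
    rw [← hz', coord_val fun hb' => absurd hb (not_lt.2 hb')]
  obtain ⟨x', hx'⟩ := exists_val_eq (hF := upClosed_upSet M) (z - ((Y.tot.obj W).d m n).hom z')
    fun b hb => h1 b (not_le.1 hb)
  refine ⟨x', z', val_injective W _ ?_, ?_⟩
  · rw [val_d, hx', hz', map_sub, d_d_apply, sub_zero]
  · refine (sub_eq_iff_eq_add.1 (hx'.symm.trans (ap_incl W _ x').symm))

end

lemma isOneSided_iff {X Y : TwMinus k Q} {p : ℤ} (φ : (hom (k := k) X.tot Y.tot).X p) :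
    IsOneSided φ ↔ ∀ (a : X.gr.Idx) (b : Y.gr.Idx), b.1 < p + a.1 →
      Y.coord b _ (a.1 + p) (ap φ _ a.1 (a.1 + p) rfl (X.cell a)) = 0 := by
  constructor
  · exact fun h a b hab => h a b (by omega) _ a.1 (a.1 + p) rfl _
  · intro h a b hab W m m' hm x
    have := congrArg (Y.coord b W m') (ap_cellι φ a W m m' hm x)
    rw [coord_act, h a b (by omega), map_zero] at this
    exact this

lemma exists_isOneSided_sub (hQ : ∀ (V W : Q) (i : ℤ), 0 < i → (hom (k := k) V W).ExactAt i)
    {X Y : TwMinus k Q} {n m m' : ℤ} (hnm : n + 1 = m) (hm : m + 1 = m')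
    (z : (hom (k := k) X.tot Y.tot).X m)
    (hz : IsOneSided (X := X) (Y := Y) (((hom (k := k) X.tot Y.tot).d m m').hom z)) :
    ∃ y : (hom (k := k) X.tot Y.tot).X n,
      IsOneSided (X := X) (Y := Y) (z - ((hom (k := k) X.tot Y.tot).d n m).hom y) := by
  rw [isOneSided_iff] at hz
  obtain ⟨v, hv⟩ := exists_forall_cells (Y := X)
    (V := fun a : X.gr.Idx => (Y.tot.obj (X.gr.ob a)).X (a.1 + n)) (fun _ => 0)
    (fun a v => ∀ b : Y.gr.Idx, b.1 < m + a.1 → Y.coord b _ (a.1 + m)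
      (ap (z - ((hom (k := k) X.tot Y.tot).d n m).hom (totDesc n v)) _ a.1 (a.1 + m) rfl
        (X.cell a)) = 0)
    (fun a v v' ha hb h b hba => by
      rw [ap_sub, LinearMap.sub_apply, ← ap_d_totDesc_congr hnm ha hb]
      exact h b hba)
    (fun a v hv => by
      obtain ⟨x, hx⟩ := exists_coord_sub_d_eq_zero hQ (Y := Y) (W := X.gr.ob a) (m := a.1 + m)
        (m' := a.1 + n) (by omega) (M := m + a.1) (by omega)
        (ap z _ a.1 (a.1 + m) rfl (X.cell a) +
          n.negOnePow • ap (totDesc n v) _ (a.1 + 1) (a.1 + m) (by omega)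
            (((X.tot.obj _).d a.1 (a.1 + 1)).hom (X.cell a))) (fun b hb => by
          obtain rfl : m' = m + 1 := hm.symm
          rw [show a.1 + m + 1 = a.1 + (m + 1) by omega, d_ap_cell_add hnm rfl, map_sub,
            hz a b (by omega), zero_sub, neg_eq_zero, map_units_smul]
          refine (congrArg _ ?_).trans (smul_zero _)
          refine linearMap_eq_of_cellι (F := Y.coord b _ _ ∘ₗ
            ap (z - ((hom (k := k) X.tot Y.tot).d n m).hom (totDesc n v)) (X.gr.ob a) (a.1 + 1)
              (a.1 + (m + 1)) (by omega)) (G := 0) _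
            fun c hc g => ?_
          rw [LinearMap.comp_apply, ap_cellι, coord_act, hv c (lt_of_coord_d_cell_ne_zero hc) b (by
            have := lt_of_coord_d_cell_ne_zero hc
            omega), map_zero]
          rfl)
      refine ⟨x, fun v' h1 h2 b hb => ?_⟩
      rw [← hx b hb, ap_sub, LinearMap.sub_apply, ap_d_cell hnm, ap_totDesc_cell, h1, sub_sub_eq_add_sub]
      refine congrArg (fun y => Y.coord b _ (a.1 + m) (_ + n.negOnePow • y - _))
        (ap_congr _ _ fun b hb => ?_)
      rw [ap_totDesc_cell, ap_totDesc_cell, h2 b (lt_of_coord_d_cell_ne_zero hb)])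
  exact ⟨totDesc n v, (isOneSided_iff _).2 hv⟩

lemma quasiIso_tot_map (hQ : ∀ (V W : Q) (i : ℤ), 0 < i → (hom (k := k) V W).ExactAt i)
    (X Y : TwMinus k Q) : QuasiIso ((Tot k Q).map X Y) := by
  have h₁ : ∀ (n m r : ℤ), m + 1 = n → n + 1 = r → ∀ x : homSub X Y n,
      ∀ ψ : (hom (k := k) X.tot Y.tot).X m, x.1 = ((hom (k := k) X.tot Y.tot).d m n).hom ψ →
      ∃ x' : homSub X Y m, ((hom (k := k) X.tot Y.tot).d m n).hom x'.1 = x.1 := by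
    intro n m r hm hr x ψ hψ
    obtain ⟨y, hy⟩ := exists_isOneSided_sub hQ (n := m - 1) (by omega) hm ψ (hψ ▸ x.2.1)
    subst hm
    have hd : ((hom (k := k) X.tot Y.tot).d m (m + 1)).hom
        (ψ - ((hom (k := k) X.tot Y.tot).d (m - 1) m).hom y) = x.1 := by
      rw [map_sub, d_d_apply, sub_zero, hψ]
    exact ⟨⟨_, hy, by rw [hd]; exact x.2.1⟩, hd⟩
  have h₂ : ∀ (n m r : ℤ), m + 1 = n → n + 1 = r → ∀ ψ : (hom (k := k) X.tot Y.tot).X n,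
      ((hom (k := k) X.tot Y.tot).d n r).hom ψ = 0 → ∃ (x' : homSub X Y n)
        (z' : (hom (k := k) X.tot Y.tot).X m), ((hom (k := k) X.tot Y.tot).d n r).hom x'.1 = 0 ∧
        ψ = x'.1 + ((hom (k := k) X.tot Y.tot).d m n).hom z' := by
    intro n m r hm hr ψ hψ
    subst hr
    obtain ⟨y, hy⟩ := exists_isOneSided_sub hQ hm rfl ψ (by rw [hψ]; exact IsOneSided.zero)
    have hd : ((hom (k := k) X.tot Y.tot).d n (n + 1)).hom
        (ψ - ((hom (k := k) X.tot Y.tot).d m n).hom y) = 0 := by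
      rw [map_sub, d_d_apply, sub_zero, hψ]
    exact ⟨⟨_, hy, by rw [hd]; exact IsOneSided.zero⟩, y, hd, (sub_add_cancel _ _).symm⟩
  refine quasiIso_of_injective_surjective _ (fun n m r hm hr x _ ψ hψ => ?_)
    (fun n m r hm hr ψ hψ => ?_)
  · obtain ⟨x', hx'⟩ := h₁ n m r hm hr x ψ hψ
    exact ⟨x', Subtype.ext hx'⟩
  · obtain ⟨x', z', h, h'⟩ := h₂ n m r hm hr ψ hψ
    exact ⟨x', z', Subtype.ext h, h'⟩

end TwMinus

end DG

namespace DG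

open DGCategory DGModule

namespace DGModule

variable {k : Type v} [CommRing k] {A : Type v} [DGCategory k A]

lemma quasiIso_app_iff {M N : DGModule k A} (w : Z0 k M N) (W : A) :
    QuasiIso (app w W) ↔ QuasiIso (postcomp (yon k W) w) := by
  have h : app w W ≫ eltHom N W = eltHom M W ≫ postcomp (yon k W) w := by
    ext n x
    exact (elt_comp (add_zero n) x w.1).symm
  have := quasiIso_eltHom (M := M) W
  have := quasiIso_eltHom (M := N) W
  rw [← quasiIso_iff_comp_right (app w W) (eltHom N W), h, quasiIso_iff_comp_left]

lemma quasiIso_app_of_cls_eq {M N : DGModule k A} {w w' : Z0 k M N} (h : H0.cls w = H0.cls w') (W : A)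
    (hw : QuasiIso (app w W)) : QuasiIso (app w' W) :=
  (quasiIso_app_iff _ _).2 (quasiIso_postcomp_of_cls_eq h ((quasiIso_app_iff _ _).1 hw))

lemma isIso_cls_of_bijective {M N : DGModule k A} (w : Z0 k M N)
    (h : ∀ W p, Function.Bijective (ap w.1 W p p (add_zero p))) : IsIso (H0.cls w) := by
  let e : ∀ (W : A) (p : ℤ), (M.obj W).X p ≃ₗ[k] (N.obj W).X p := fun W p =>
    LinearEquiv.ofBijective _ (h W p)
  have he : ∀ W p y, ap w.1 W p p (add_zero p) ((e W p).symm y) = y := fun W p y =>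
    (e W p).apply_symm_apply y
  let v : Z0 k N M := ofMaps (fun W p => (e W p).symm.toLinearMap)
    (fun W p q y => (h W q).1 (by
      refine Eq.trans (hom_d_apply (app w W) p q ((e W p).symm y)).symm ?_
      exact (congrArg _ (he W p y)).trans (he W q _).symm))
    (fun {V W} p q r hr y f => (h V r).1 (by
      refine (he V r _).trans ?_
      refine Eq.trans ?_ (ap_act w.1 p q r p r hr (add_zero p) (add_zero r) _ f).symm
      exact (congrArg (fun x => N.act p q r hr x f) (he W p y)).symm))
  have hv : ∀ W p y, ap v.1 W p p (add_zero p) y = (e W p).symm y := fun W p y => ap_ofMaps _ _ _ W p y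
  refine ⟨H0.cls v, ?_, ?_⟩
  · rw [← cls_comp, ← cls_one]
    refine congrArg _ (Subtype.ext (hom_ext' fun W p q hpq x => ?_))
    obtain rfl : p = q := by omega
    refine (ap_comp rfl w.1 v.1 W p p p hpq hpq x).trans ?_
    refine Eq.trans (hv W p _) ?_
    refine Eq.trans ?_ (ap_one W p p hpq x).symm
    exact (e W p).symm_apply_apply x
  · rw [← cls_comp, ← cls_one]
    refine congrArg _ (Subtype.ext (hom_ext' fun W p q hpq x => ?_))
    obtain rfl : p = q := by omega
    refine (ap_comp rfl v.1 w.1 W p p p hpq hpq x).trans ?_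
    refine Eq.trans (congrArg _ (hv W p x)) ?_
    exact (he W p x).trans (ap_one W p p hpq x).symm

variable {P : A → Prop}

lemma coneExactAt_resComp_of_cls_eq {T : DGModule k (Subtype P)} {M : DGModule k A}
    {w w' : Z0 k T (res P M)} (h : H0.cls w = H0.cls w') {N : DGModule k A} {n : ℤ}
    (hw : ConeExactAt (resComp w N) n) : ConeExactAt (resComp w' N) n := by
  obtain ⟨s, hs⟩ := (cls_eq_iff w w').1 h
  refine hw.of_homotopic (fun p q hpq => p.negOnePow •
    (comp (-1) p q (by omega) s ∘ₗ ((resMap P M N).f p).hom)) ?_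
  intro p q r h h' x
  rw [resComp_apply, resComp_apply, ← LinearMap.sub_apply, ← map_sub, ← hs, LinearMap.smul_apply,
    LinearMap.smul_apply, LinearMap.comp_apply, LinearMap.comp_apply, DG.map_units_smul,
    DGCategory.leibniz (-1) p r 0 q p (by omega) rfl h h' s _, hom_d_apply,
    show q.negOnePow = -p.negOnePow by rw [← h, Int.negOnePow_succ], smul_add, smul_smul,
    Int.units_mul_self, one_smul, Units.neg_smul, add_neg_cancel_comm]

/-- Transport of corepresenting objects along a morphism that induces quasi-isomorphisms. -/
lemma Corep.of_precomp {T' T : DGModule k (Subtype P)} (π : Z0 k T' T)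
    (hπ : ∀ L, QuasiIso (precomp π L)) {X : A} {w' : Z0 k T' (res P (yon k X))} (h : Corep T' X w') :
    ∃ w, Corep T X w ∧ H0.cls (Z0.comp π w) = H0.cls w' := by
  obtain ⟨w, s, hw, hs⟩ := exists_of_quasiIso _ (hπ (res P (yon k X))) (i := 0) (j := -1) (l := 1)
    rfl rfl w'.1 w'.2
  have hcls : H0.cls (Z0.comp π (Z0.mk w hw)) = H0.cls w' := by
    refine ((cls_eq_iff _ _).2 ⟨s, ?_⟩).symm
    rw [hs]
    exact (add_sub_cancel_left _ _).symm
  refine ⟨Z0.mk w hw, fun Z => ?_, hcls⟩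
  have := hπ (res P (yon k Z))
  rw [← quasiIso_iff_comp_right _ (precomp π (res P (yon k Z)))]
  have e1 : resComp (Z0.mk w hw) (yon k Z) ≫ precomp π (res P (yon k Z)) =
      resComp (Z0.comp π (Z0.mk w hw)) (yon k Z) := by
    ext n φ
    exact (DGCategory.assoc 0 0 n 0 n n rfl (zero_add n) (zero_add n) (zero_add n) π.1 w
      (((resMap P _ (yon k Z)).f n).hom φ)).symm
  rw [e1]
  exact (quasiIso_iff_coneExactAt _).2 fun n =>
    coneExactAt_resComp_of_cls_eq hcls.symm ((quasiIso_iff_coneExactAt _).1 (h Z) n)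

/-- A dg-module is realizable if it is corepresented by an object `X` and quasi-isomorphic to the
restriction of `A(-, X)`. -/
def Realizable (T : DGModule k (Subtype P)) : Prop :=
  ∃ (X : A) (w : Z0 k T (res P (yon k X))), Corep T X w ∧ ∀ W, QuasiIso (app w W)

lemma Realizable.of_bijective {T' T : DGModule k (Subtype P)} (hT : Realizable T') (π : Z0 k T' T)
    (h : ∀ W p, Function.Bijective (ap π.1 W p p (add_zero p))) : Realizable T := by
  obtain ⟨X, w', hw', hq⟩ := hT
  have := isIso_cls_of_bijective π h
  obtain ⟨w, hw, hcls⟩ := hw'.of_precomp π (fun L => quasiIso_precomp π L)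
  refine ⟨X, w, hw, fun W => ?_⟩
  have h1 := quasiIso_app_of_cls_eq hcls.symm W (hq W)
  have := quasiIso_app π W
  rwa [app_comp, quasiIso_iff_comp_left] at h1

lemma Realizable.of_zero (hA : IsPretriangulated k A) {T : DGModule k (Subtype P)}
    (hT : ∀ W p (x : (T.obj W).X p), x = 0) : Realizable T := by
  obtain ⟨X, hX⟩ := hA.exists_isZero
  have h1 : ∀ W, (T.obj W).Acyclic := fun W i =>
    (exactAt_iff (j := i - 1) (l := i + 1) (by omega) rfl).2 fun x _ => ⟨0, by rw [map_zero, hT _ _ x]⟩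
  have h2 : ∀ L : DGModule k (Subtype P), (hom (k := k) T L).Acyclic := fun L i =>
    (exactAt_iff (j := i - 1) (l := i + 1) (by omega) rfl).2 fun φ _ => ⟨0, by
      rw [map_zero]
      exact hom_ext' fun W p q hpq x => by rw [hT _ _ x, map_zero, map_zero]⟩
  refine ⟨X, 0, fun Z => ?_, fun W => ?_⟩
  · rw [← quasiIso_corepHom_iff, quasiIso_iff_coneExactAt]
    exact fun n => coneExactAt_of_exactAt _ rfl (acyclic_of_isZero_left hX Z _) (h2 _ _)
  · rw [quasiIso_iff_coneExactAt]
    exact fun n => coneExactAt_of_exactAt _ rfl (h1 W _) (acyclic_of_isZero_right hX W.1 _)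

lemma Realizable.yon (W : Subtype P) : Realizable (DGModule.yon k W) := by
  refine ⟨W.1, eltZ0 (M := res P (DGModule.yon k W.1)) (X := W) (one W.1) (d_one W.1), fun Z => ?_,
    fun V => ?_⟩
  · have h1 := quasiIso_eltHom (M := DGModule.yon k Z) W.1
    have h2 := quasiIso_eltHom (M := res P (DGModule.yon k Z)) W
    rw [← quasiIso_iff_comp_left (eltHom (DGModule.yon k Z) W.1)]
    suffices h3 : eltHom (DGModule.yon k Z) W.1 ≫ resComp (eltZ0 (M := res P (DGModule.yon k W.1))
        (X := W) (one W.1) (d_one W.1)) (DGModule.yon k Z) =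
        eltHom (res P (DGModule.yon k Z)) W by
      exact (congrArg (fun φ : (DGModule.yon k Z).obj W.1 ⟶ _ => QuasiIso φ) h3).mpr h2
    ext n x
    refine (elt_comp (zero_add n) (M := res P (DGModule.yon k W.1)) (X := W) (one W.1)
      (((resMap P (DGModule.yon k W.1) (DGModule.yon k Z)).f n).hom (elt x))).trans ?_
    exact congrArg _ (ap_elt_one x)
  · refine quasiIso_of_bijective _ fun i => ?_
    have : ∀ x : (hom (k := k) V.1 W.1).X i, ((app (eltZ0 (M := res P (DGModule.yon k W.1)) (X := W)
        (one W.1) (d_one W.1)) V).f i).hom x = x := fun x => comp_one i x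
    exact ⟨fun x y hxy => (this x).symm.trans (hxy.trans (this y)), fun x => ⟨x, this x⟩⟩

lemma Realizable.attach (hA : IsPretriangulated k A) {T₁ T₂ : DGModule k (Subtype P)}
    (h₁ : Realizable T₁) (h₂ : Realizable T₂) {e r : ℤ} (ν : (hom (k := k) T₁ T₂).X r)
    (hν : e + 1 = r ∧ ((hom T₁ T₂).d r (r + 1)).hom ν = 0) : Realizable (attachMod e ν hν) := by
  obtain ⟨X₁, w₁, hw₁, hq₁⟩ := h₁
  obtain ⟨X₂, w₂, hw₂, hq₂⟩ := h₂
  obtain ⟨X₃, w₃, hw₃, hq₃⟩ := hw₁.exists_attach hA hw₂ ν hν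
  exact ⟨X₃, w₃, hw₃, fun W => hq₃ W (hq₁ W) (hq₂ W)⟩

end DGModule

namespace TwMinus

variable {k : Type v} [CommRing k]

section

variable {Q : Type v} [DGCategory k Q] {Y : TwMinus k Q} {F F' : Set Y.gr.Idx} {hF : UpClosed F}
  {hF' : UpClosed F'}

variable (hF hF') in
/-- The inclusion between the dg-submodules generated by two sets of cells. -/
def subLE (h : F' ⊆ F) : Z0 k (Y.sub F' hF') (Y.sub F hF) :=
  ofMaps (fun W p => (Submodule.inclusion (fun _ hx a ha => hx a fun h' => ha (h h')) :
      Y.subFam F' W p →ₗ[k] Y.subFam F W p))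
    (fun _ _ _ _ => rfl) (fun _ _ _ _ _ _ => rfl)

lemma val_subLE (h : F' ⊆ F) (W : Q) (p : ℤ) (x : ((Y.sub F' hF').obj W).X p) :
    val hF W p (ap (subLE hF hF' h).1 W p p (add_zero p) x) = val hF' W p x :=
  congrArg (val hF W p) (ap_ofMaps _ _ _ W p x)

lemma subLE_incl (h : F' ⊆ F) : Z0.comp (subLE hF hF' h) (incl hF) = incl hF' := by
  refine Subtype.ext (hom_ext' fun W p q hpq x => ?_)
  obtain rfl : p = q := by omega
  refine (ap_comp rfl _ _ W p p p hpq hpq x).trans ?_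
  exact ((ap_incl W p _).trans (val_subLE h W p x)).trans (ap_incl W p x).symm

end

variable {A : Type v} [DGCategory k A] {P : A → Prop} {Y : TwMinus k (Subtype P)}

lemma realizable_sub_insert (hA : IsPretriangulated k A) {F F' : Set Y.gr.Idx} (hF : UpClosed F)
    (hF' : UpClosed F') {a : Y.gr.Idx} (ha : a ∉ F') (h : F = insert a F')
    (hr : Realizable (Y.sub F' hF')) : Realizable (Y.sub F hF) := by
  have haF : a ∈ F := h ▸ Set.mem_insert a F'
  have hsub : F' ⊆ F := h ▸ Set.subset_insert a F'
  obtain ⟨c, hc⟩ := exists_val_eq (hF := hF') (((Y.tot.obj _).d a.1 (a.1 + 1)).hom (Y.cell a))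
    fun b hb => by
      by_contra hne
      have hab := lt_of_coord_d_cell_ne_zero hne
      have hbF := hF a haF b hab
      rw [h] at hbF
      obtain rfl | hb' := Set.mem_insert_iff.1 hbF
      · omega
      · exact hb hb'
  have hdc : (((Y.sub F' hF').obj (Y.gr.ob a)).d (a.1 + 1) (a.1 + 1 + 1)).hom c = 0 :=
    val_injective (hF := hF') _ _ (by rw [val_d, hc, d_d_apply, map_zero])
  have hν : a.1 + 1 = a.1 + 1 ∧ ((hom (k := k) (yon k (Y.gr.ob a)) (Y.sub F' hF')).d (a.1 + 1)
      (a.1 + 1 + 1)).hom (elt c) = 0 := ⟨rfl, by rw [d_elt rfl, hdc, elt_zero]⟩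
  have hcl : ((hom (k := k) (attachMod a.1 (elt c) hν) (Y.sub F hF)).d 0 1).hom
      (attachDesc (subLE hF hF' hsub).1 (elt (subCell hF a haF)) (zero_add a.1)) = 0 := by
    have h2 : ((hom (k := k) (yon k (Y.gr.ob a)) (Y.sub F hF)).d a.1 (a.1 + 1)).hom
        (elt (subCell hF a haF)) - (0 : ℤ).negOnePow • comp (a.1 + 1) 0 (a.1 + 1) (by omega) (elt c)
          (subLE hF hF' hsub).1 = 0 := by
      rw [d_elt rfl, Int.negOnePow_zero, one_smul, elt_comp, sub_eq_zero]
      refine congrArg elt (val_injective (hF := hF) _ _ ?_)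
      rw [val_d, val_subCell, val_subLE, hc]
    rw [d_attachDesc _ _ _ (zero_add 1) rfl, Z0_d, h2]
    exact hom_ext' fun W p q h z => by rw [ap_attachDesc]; simp
  obtain ⟨snd, κ, hval, h0, hsι, hsκ, hfκ⟩ : ∃ (snd : ∀ W p,
      ((attachMod a.1 (elt c) hν).obj W).X p →ₗ[k] (hom (k := k) W (Y.gr.ob a)).X (p - a.1))
      (κ : ∀ W p, (hom (k := k) W (Y.gr.ob a)).X (p - a.1) →ₗ[k]
        ((attachMod a.1 (elt c) hν).obj W).X p),
      (∀ W p z, val hF W p (ap (Z0.mk _ hcl).1 W p p (add_zero p) z) =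
        val hF' W p (attachFst a.1 (elt c) hν W p z) + Y.cellι a W p (snd W p z)) ∧
      (∀ W p z, attachFst a.1 (elt c) hν W p z = 0 → snd W p z = 0 → z = 0) ∧
      (∀ W p y, snd W p (attachι a.1 (elt c) hν W p y) = 0) ∧ (∀ W p g, snd W p (κ W p g) = g) ∧
      ∀ W p g, attachFst a.1 (elt c) hν W p (κ W p g) = 0 := by
    refine ⟨fun W p => attachSnd a.1 (elt c) hν W p, fun W p => attachκ a.1 (elt c) hν W p,
      fun W p z => ?_, fun W p z h1 h2 => attach_ext _ _ _ W p (h1.trans (map_zero _).symm)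
        (h2.trans (map_zero _).symm), fun W p y => attachSnd_ι _ _ _ W p y,
      fun W p g => attachSnd_κ a.1 (elt c) hν W p g, fun W p g => attachFst_κ a.1 (elt c) hν W p g⟩
    rw [Z0.mk_val, ap_attachDesc, map_add, val_subLE]
    congr 1
    refine Eq.trans ?_ (act_cell a W p _)
    exact congrArg (val hF W p) (ap_elt (subCell hF a haF) W (p - a.1) p (by omega) _)
  refine (Realizable.attach hA (Realizable.yon (Y.gr.ob a)) hr (elt c) hν).of_bijective (Z0.mk _ hcl)
    fun W p => ⟨(injective_iff_map_eq_zero _).2 fun z hz => ?_, fun x => ?_⟩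
  · have h1 := hval W p z
    rw [hz, map_zero] at h1
    have h2 : snd W p z = 0 := by
      have := congrArg (Y.coord a W p) h1
      rw [map_zero, map_add, coord_val ha, coord_cellι_self, zero_add] at this
      exact this.symm
    rw [h2, map_zero, add_zero] at h1
    exact h0 W p z (val_injective (hF := hF') _ _ (h1.symm.trans (map_zero _).symm)) h2
  · obtain ⟨y, hy⟩ := exists_val_eq (hF := hF')
      (val hF W p x - Y.cellι a W p (Y.coord a W p (val hF W p x))) fun b hb => by
        rw [map_sub]
        by_cases hba : b = a
        · subst hba
          rw [coord_cellι_self, sub_self]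
        · rw [coord_cellι_of_ne hba, sub_zero]
          exact coord_val (fun hbF => (Set.mem_insert_iff.1 (h ▸ hbF)).elim hba hb) _ _ _
    refine ⟨attachι a.1 (elt c) hν W p y + κ W p (Y.coord a W p (val hF W p x)),
      val_injective (hF := hF) _ _ ?_⟩
    rw [hval, map_add, map_add, map_add (snd W p), attachFst_ι, hfκ, hsι, hsκ, map_zero, add_zero, zero_add, hy,
      sub_add_cancel]

lemma realizable_sub_of_finite (hA : IsPretriangulated k A) {F : Set Y.gr.Idx} (hF : UpClosed F)
    (hfin : F.Finite) : Realizable (Y.sub F hF) := by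
  obtain ⟨n, hn⟩ : ∃ n, F.ncard = n := ⟨_, rfl⟩
  induction n generalizing F with
  | zero =>
    obtain rfl := (Set.ncard_eq_zero hfin).1 hn
    refine Realizable.of_zero hA fun W p x => val_injective (hF := hF) _ _ (coord_ext fun a => ?_)
    rw [coord_val (Set.notMem_empty a), map_zero, map_zero]
  | succ n ih =>
    have hne : F.Nonempty := Set.nonempty_of_ncard_ne_zero (by omega)
    obtain ⟨a, ha, hmin⟩ := Set.exists_min_image F (fun a => a.1) hfin hne
    have hF' : UpClosed (F \ {a}) := fun b hb c hc => ⟨hF b hb.1 c hc, fun hca => by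
      have := hmin b hb.1
      obtain rfl : c = a := hca
      omega⟩
    refine realizable_sub_insert hA hF hF' (a := a) (fun h => h.2 rfl)
      (Set.insert_sdiff_self_of_mem ha).symm (ih hF' hfin.sdiff ?_)
    rw [Set.ncard_sdiff_singleton_of_mem ha, hn, Nat.add_sub_cancel]

lemma finite_upSet {Q : Type v} [DGCategory k Q] (Y : TwMinus k Q) (M : ℤ) : (Y.upSet M).Finite := by
  obtain ⟨N, hN⟩ := Y.gr.bounded
  refine (Finset.finite_toSet ((Finset.Icc M N).sigma fun _ => Finset.univ)).subset fun a ha => ?_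
  refine Finset.mem_coe.2 (Finset.mem_sigma.2 ⟨Finset.mem_Icc.2 ⟨ha, ?_⟩, Finset.mem_univ _⟩)
  by_contra h
  exact (Fin.cast (hN a.1 (not_le.1 h)) a.2).elim0

end TwMinus

end DG

namespace DG

open DGCategory DGModule

section Complexes

variable {k : Type v} [CommRing k] {K L M : CochainComplex (ModuleCat.{v} k) ℤ}

lemma coneExactAt_comp_left_iff (f : K ⟶ L) (g : L ⟶ M) (hf : QuasiIso f) (n : ℤ) :
    ConeExactAt (f ≫ g) n ↔ ConeExactAt g n :=
  coneExactAt_iff_of_square f (𝟙 M) hf inferInstance (Category.comp_id _) n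

lemma coneExactAt_comp_right_iff (f : K ⟶ L) (g : L ⟶ M) (hg : QuasiIso g) (n : ℤ) :
    ConeExactAt (f ≫ g) n ↔ ConeExactAt f n :=
  (coneExactAt_iff_of_square (𝟙 K) g inferInstance hg (Category.id_comp _).symm n).symm

lemma ConeExactAt.of_comp {f : K ⟶ L} {g : L ⟶ M} {n : ℤ} (h : ConeExactAt (f ≫ g) n)
    (hf : ConeExactAt f (n + 1)) : ConeExactAt g n := by
  rw [coneExactAt_iff_homologyMap, HomologicalComplex.homologyMap_comp,
    HomologicalComplex.homologyMap_comp] at h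
  rw [coneExactAt_iff_homologyMap] at hf ⊢
  refine ⟨Function.Injective.of_comp_right (g := (HomologicalComplex.homologyMap f (n + 1)).hom)
    h.1 hf.2, Function.Surjective.of_comp (g := (HomologicalComplex.homologyMap f n).hom) h.2⟩

end Complexes

namespace DGModule

variable {k : Type v} [CommRing k] {A : Type v} [DGCategory k A]

lemma attachHom_ext {M N L : DGModule k A} {e r : ℤ} {f : (hom (k := k) M N).X r}
    {hf : e + 1 = r ∧ ((hom M N).d r (r + 1)).hom f = 0} {n m : ℤ} (hm : e + n = m)
    {φ ψ : (hom (k := k) (attachMod e f hf) L).X n}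
    (h₁ : comp 0 n n (zero_add n) (attachInl e f hf).1 φ =
      comp 0 n n (zero_add n) (attachInl e f hf).1 ψ)
    (h₂ : comp e n m hm (attachInr e f hf) φ = comp e n m hm (attachInr e f hf) ψ) : φ = ψ := by
  rw [← attachDesc_eta φ (by omega : n + e = m), ← attachDesc_eta ψ (by omega : n + e = m), h₁, h₂]

lemma coneExactAt_app_of_cls_eq {M N : DGModule k A} {w w' : Z0 k M N} (h : H0.cls w = H0.cls w')
    (W : A) {n : ℤ} (hw : ConeExactAt (app w W) n) : ConeExactAt (app w' W) n := by
  have sq : ∀ w : Z0 k M N, app w W ≫ eltHom N W = eltHom M W ≫ postcomp (yon k W) w := fun w => by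
    ext n x
    exact (elt_comp (add_zero n) x w.1).symm
  have hM := quasiIso_eltHom (M := M) W
  have hN := quasiIso_eltHom (M := N) W
  exact (coneExactAt_iff_of_square _ _ hM hN (sq w') n).2 (coneExactAt_postcomp_of_cls_eq h
    ((coneExactAt_iff_of_square _ _ hM hN (sq w) n).1 hw))

variable {P : A → Prop}

lemma coneExactAt_corepHom_of_cls_eq {T : DGModule k (Subtype P)} {X : A}
    {w w' : Z0 k T (res P (yon k X))} (h : H0.cls w = H0.cls w') {Z : A} {n : ℤ}
    (hw : ConeExactAt (corepHom w Z) n) : ConeExactAt (corepHom w' Z) n := by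
  have hy : QuasiIso ((yonedaDG k A).map X Z) := quasiIso_of_bijective _ (yonedaDG_map_bijective X Z)
  exact (coneExactAt_comp_left_iff _ _ hy n).2 (coneExactAt_resComp_of_cls_eq h
    ((coneExactAt_comp_left_iff _ _ hy n).1 hw))

end DGModule

namespace TwMinus

variable {k : Type v} [CommRing k]

section Telescope

variable {Q : Type v} [DGCategory k Q] (Y : TwMinus k Q) (N : ℤ) {L : DGModule k Q}

/-- The filtration of the totalisation by the degree of the cells. -/
def filt (l : ℕ) : DGModule k Q := Y.sub (Y.upSet (N - l)) (upClosed_upSet _)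

/-- The inclusion of a step of the filtration. -/
def filtIncl (l : ℕ) : Z0 k (Y.filt N l) Y.tot := incl (upClosed_upSet _)

lemma upSet_subset (l : ℕ) : Y.upSet (N - l) ⊆ Y.upSet (N - (l + 1 : ℕ)) := fun a ha =>
  le_trans (show N - ((l + 1 : ℕ) : ℤ) ≤ N - l by push_cast; omega) ha

/-- The inclusion of a step of the filtration in the next one. -/
def filtNext (l : ℕ) : Z0 k (Y.filt N l) (Y.filt N (l + 1)) :=
  subLE (upClosed_upSet _) (upClosed_upSet _) (Y.upSet_subset N l)

lemma filtNext_filtIncl (l : ℕ) : Z0.comp (Y.filtNext N l) (Y.filtIncl N (l + 1)) = Y.filtIncl N l :=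
  subLE_incl _

variable {Y N}

lemma exists_filtIncl_comp_eq {n : ℤ} (l : ℕ) (φ : (hom (k := k) (Y.filt N l) L).X n) :
    ∃ ψ : (hom (k := k) Y.tot L).X n, comp 0 n n (zero_add n) (Y.filtIncl N l).1 ψ = φ :=
  exists_restr_eq _ φ

lemma filtIncl_comp_eq_iff {n : ℤ} (l : ℕ) (φ ψ : (hom (k := k) Y.tot L).X n) :
    comp 0 n n (zero_add n) (Y.filtIncl N l).1 φ = comp 0 n n (zero_add n) (Y.filtIncl N l).1 ψ ↔
      ∀ a : Y.gr.Idx, N - l ≤ a.1 →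
        ap φ _ a.1 (a.1 + n) rfl (Y.cell a) = ap ψ _ a.1 (a.1 + n) rfl (Y.cell a) := by
  constructor
  · intro h a ha
    rw [← ap_restr_subCell (hF := upClosed_upSet (N - l)) φ a ha,
      ← ap_restr_subCell (hF := upClosed_upSet (N - l)) ψ a ha]
    exact congrArg (fun χ => ap χ _ a.1 (a.1 + n) rfl (subCell (upClosed_upSet (N - l)) a ha)) h
  · intro h
    refine subHom_ext (hF := upClosed_upSet (N - l)) fun a ha => ?_
    exact (ap_restr_subCell φ a ha).trans ((h a ha).trans (ap_restr_subCell ψ a ha).symm)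

lemma filtNext_comp {n : ℤ} (l : ℕ) (φ : (hom (k := k) Y.tot L).X n) :
    comp 0 n n (zero_add n) (Y.filtNext N l).1 (comp 0 n n (zero_add n) (Y.filtIncl N (l + 1)).1 φ) =
      comp 0 n n (zero_add n) (Y.filtIncl N l).1 φ := by
  have h : comp 0 0 0 (add_zero 0) (Y.filtNext N l).1 (Y.filtIncl N (l + 1)).1 = (Y.filtIncl N l).1 :=
    congrArg Subtype.val (Y.filtNext_filtIncl N l)
  rw [← DGCategory.assoc 0 0 n 0 n n (by omega) (by omega) (by omega) (by omega), h]

lemma totHom_ext_of_filt {n : ℤ} {φ ψ : (hom (k := k) Y.tot L).X n}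
    (h : ∀ l, comp 0 n n (zero_add n) (Y.filtIncl N l).1 φ =
      comp 0 n n (zero_add n) (Y.filtIncl N l).1 ψ) : φ = ψ :=
  totHom_ext fun a => (filtIncl_comp_eq_iff (N - a.1).toNat φ ψ).1 (h _) a (by omega)

lemma exists_glue {n : ℤ} (φ : ℕ → (hom (k := k) Y.tot L).X n)
    (h : ∀ l, comp 0 n n (zero_add n) (Y.filtIncl N l).1 (φ (l + 1)) =
      comp 0 n n (zero_add n) (Y.filtIncl N l).1 (φ l)) :
    ∃ ψ, ∀ l, comp 0 n n (zero_add n) (Y.filtIncl N l).1 ψ =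
      comp 0 n n (zero_add n) (Y.filtIncl N l).1 (φ l) := by
  refine ⟨totDesc n fun a => ap (φ (N - a.1).toNat) _ a.1 (a.1 + n) rfl (Y.cell a), fun l => ?_⟩
  refine (filtIncl_comp_eq_iff l _ _).2 fun a ha => ?_
  rw [ap_totDesc_cell]
  have key : ∀ l' : ℕ, (N - a.1).toNat ≤ l' → ap (φ (N - a.1).toNat) _ a.1 (a.1 + n) rfl (Y.cell a) =
      ap (φ l') _ a.1 (a.1 + n) rfl (Y.cell a) := by
    intro l' hl
    induction l', hl using Nat.le_induction with
    | base => rfl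
    | succ l' hl ih => exact ih.trans ((filtIncl_comp_eq_iff l' _ _).1 (h l') a (by omega)).symm
  exact key l (by omega)

variable (Y N)

/-- The endomorphism of the direct sum of the filtration steps whose cone is the telescope. -/
def teleMap : Z0 k (sumMod (Y.filt N)) (sumMod (Y.filt N)) :=
  Z0.mk (sumDesc fun l => (sumIn (Y.filt N) l).1 -
    (Z0.comp (Y.filtNext N l) (sumIn (Y.filt N) (l + 1))).1) (by
    refine sumHom_ext fun l => ?_
    rw [sumIn_d (n := 0) (m := 1) rfl, sumIn_sumDesc, map_sub, Z0_d, Z0_d, sub_zero, map_zero])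

variable {Y N}

lemma sumIn_teleMap_comp {n : ℤ} (φ : (hom (k := k) (sumMod (Y.filt N)) L).X n) (l : ℕ) :
    comp 0 n n (zero_add n) (sumIn (Y.filt N) l).1 (comp 0 n n (zero_add n) (Y.teleMap N).1 φ) =
      comp 0 n n (zero_add n) (sumIn (Y.filt N) l).1 φ - comp 0 n n (zero_add n) (Y.filtNext N l).1
        (comp 0 n n (zero_add n) (sumIn (Y.filt N) (l + 1)).1 φ) := by
  rw [← DGCategory.assoc 0 0 n 0 n n (by omega) (by omega) (by omega) (by omega), teleMap, Z0.mk_val,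
    sumIn_sumDesc, map_sub, LinearMap.sub_apply,
    ← DGCategory.assoc 0 0 n 0 n n (by omega) (by omega) (by omega) (by omega)]
  rfl

lemma teleMap_sumDesc_incl {n : ℤ} (φ : (hom (k := k) Y.tot L).X n) :
    comp 0 n n (zero_add n) (Y.teleMap N).1
      (sumDesc fun l => comp 0 n n (zero_add n) (Y.filtIncl N l).1 φ) = 0 := by
  refine sumHom_ext fun l => ?_
  rw [sumIn_teleMap_comp, sumIn_sumDesc, sumIn_sumDesc, filtNext_comp, sub_self, map_zero]

variable (Y N)

/-- The telescope of the filtration. -/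
abbrev tele : DGModule k Q := attachMod (-1) (Y.teleMap N).1 (closed_cone _)

/-- The morphism from the telescope of the filtration to the totalisation. -/
def telePr : Z0 k (Y.tele N) Y.tot :=
  Z0.mk (attachDesc (sumDesc fun l => (Y.filtIncl N l).1) 0 (zero_add (-1))) (by
    have h1 : ((hom (sumMod (Y.filt N)) Y.tot).d 0 1).hom (sumDesc fun l => (Y.filtIncl N l).1) = 0 := by
      refine sumHom_ext fun l => ?_
      rw [sumIn_d (n := 0) (m := 1) rfl, sumIn_sumDesc, Z0_d, map_zero]
    have h2 := teleMap_sumDesc_incl (Y := Y) (N := N) (one Y.tot)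
    simp only [comp_one] at h2
    rw [d_attachDesc _ _ _ (zero_add 1) (m' := 0) (by omega), h1, h2, map_zero, smul_zero, sub_zero]
    exact hom_ext' fun W p q h z => by rw [ap_attachDesc]; simp)

variable {Y N}

lemma inl_telePr_comp {n : ℤ} (φ : (hom (k := k) Y.tot L).X n) (l : ℕ) :
    comp 0 n n (zero_add n) (sumIn (Y.filt N) l).1 (comp 0 n n (zero_add n)
      (attachInl (-1) (Y.teleMap N).1 (closed_cone _)).1 (comp 0 n n (zero_add n) (Y.telePr N).1 φ)) =
      comp 0 n n (zero_add n) (Y.filtIncl N l).1 φ := by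
  rw [← DGCategory.assoc 0 0 n 0 n n (by omega) (by omega) (by omega) (by omega)
    (attachInl (-1) (Y.teleMap N).1 (closed_cone _)).1, telePr, Z0.mk_val,
    attachInl_attachDesc, ← DGCategory.assoc 0 0 n 0 n n (by omega) (by omega) (by omega) (by omega),
    sumIn_sumDesc]

lemma inr_telePr_comp {n m : ℤ} (hm : -1 + n = m) (φ : (hom (k := k) Y.tot L).X n) :
    comp (-1) n m hm (attachInr (-1) (Y.teleMap N).1 (closed_cone _))
      (comp 0 n n (zero_add n) (Y.telePr N).1 φ) = 0 := by
  rw [← DGCategory.assoc (-1) 0 n (-1) n m (by omega) (by omega) (by omega) (by omega), telePr,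
    Z0.mk_val, attachInr_attachDesc, map_zero, LinearMap.zero_apply]

lemma quasiIso_precomp_telePr (L : DGModule k Q) : QuasiIso (precomp (Y.telePr N) L) := by
  rw [quasiIso_iff_coneExactAt]
  intro n m n' n'' hm hn' hn'' x z hx hz
  have hnm : n + -1 = m := by omega
  obtain ⟨α, β, rfl⟩ : ∃ α β, attachDesc (hf := closed_cone (Y.teleMap N)) α β hnm = z :=
    ⟨_, _, attachDesc_eta z hnm⟩
  rw [precomp_apply, d_attachDesc α β _ hn' hm] at hz
  have hβ : ((hom (sumMod (Y.filt N)) L).d m n).hom β =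
      n.negOnePow • comp 0 n n (zero_add n) (Y.teleMap N).1 α := by
    have := congrArg (comp (-1) n' n (by omega) (attachInr (-1) (Y.teleMap N).1 (closed_cone _))) hz
    rw [inr_telePr_comp, attachInr_attachDesc] at this
    exact sub_eq_zero.1 this.symm
  have hα : ∀ l, comp 0 n' n' (zero_add n') (Y.filtIncl N l).1 x = ((hom _ _).d n n').hom
      (comp 0 n n (zero_add n) (sumIn (Y.filt N) l).1 α) := by
    intro l
    rw [← inl_telePr_comp, hz, attachInl_attachDesc, sumIn_d hn']
  choose a ha using fun l => exists_filtIncl_comp_eq l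
    (comp 0 n n (zero_add n) (sumIn (Y.filt N) l).1 α)
  choose b hb using fun l => exists_filtIncl_comp_eq l
    (comp 0 m m (zero_add m) (sumIn (Y.filt N) l).1 β)
  obtain ⟨γ, hγ⟩ : ∃ γ : ℕ → (hom (k := k) Y.tot L).X m, ∀ l,
      γ (l + 1) = γ l - n.negOnePow • b l :=
    ⟨fun l => -∑ j ∈ Finset.range l, n.negOnePow • b j, fun l => by
      dsimp only
      rw [Finset.sum_range_succ, neg_add, sub_eq_add_neg]⟩
  have hab : ∀ l, comp 0 n n (zero_add n) (Y.filtIncl N l).1 (a l - a (l + 1)) =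
      n.negOnePow • comp 0 n n (zero_add n) (Y.filtIncl N l).1 (((hom _ _).d m n).hom (b l)) := by
    intro l
    rw [← d_comp_closed_left, hb, ← sumIn_d hm, hβ, DG.map_units_smul, smul_smul, Int.units_mul_self,
      one_smul, sumIn_teleMap_comp, map_sub, ha, ← ha (l + 1), filtNext_comp]
  obtain ⟨φ, hφ⟩ := exists_glue (N := N) (fun l => a l - ((hom Y.tot L).d m n).hom (γ l)) fun l => by
    have h1 := hab l
    rw [map_sub, sub_eq_iff_eq_add] at h1
    rw [hγ, map_sub, map_sub, map_sub, map_sub, h1, DG.map_units_smul, DG.map_units_smul]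
    abel
  have hφ' : ∀ l, comp 0 n n (zero_add n) (sumIn (Y.filt N) l).1 α =
      comp 0 n n (zero_add n) (Y.filtIncl N l).1 φ +
        ((hom _ _).d m n).hom (comp 0 m m (zero_add m) (Y.filtIncl N l).1 (γ l)) := fun l => by
    rw [hφ, map_sub, ha, d_comp_closed_left, sub_add_cancel]
  refine ⟨φ, attachDesc (sumDesc fun l => comp 0 m m (zero_add m) (Y.filtIncl N l).1 (γ l)) 0
    (rfl : m + -1 = m + -1), totHom_ext_of_filt (N := N) fun l => ?_,
    attachHom_ext (by omega : -1 + n = m) ?_ ?_⟩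
  · rw [← d_comp_closed_left, hα, hφ', map_add, d_d_apply, add_zero]
  · refine sumHom_ext fun l => ?_
    rw [attachInl_attachDesc, map_add, map_add, precomp_apply, inl_telePr_comp,
      d_attachDesc _ _ _ hm (by omega : m + -1 + 1 = m), attachInl_attachDesc, sumIn_d hm,
      sumIn_sumDesc, hφ']
  · rw [attachInr_attachDesc, map_add, precomp_apply, inr_telePr_comp, zero_add,
      d_attachDesc _ _ _ hm (by omega : m + -1 + 1 = m), attachInr_attachDesc, map_zero, zero_sub]
    refine sumHom_ext fun l => ?_
    rw [map_neg, DG.map_units_smul, sumIn_teleMap_comp, sumIn_sumDesc, sumIn_sumDesc, filtNext_comp,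
      ← map_sub, hγ, sub_sub_cancel, DG.map_units_smul, hb, smul_smul,
      show n.negOnePow = - m.negOnePow by rw [← hm, Int.negOnePow_succ], mul_neg, Int.units_mul_self,
      Units.neg_smul, one_smul, neg_neg]

end Telescope

end TwMinus

namespace TStructure

variable {k : Type v} [CommRing k] {A : Type v} [DGCategory k A] {t : TStructure k A}

lemma exactAt_dgProj (hA : IsPretriangulated k A) (hp : t.HasEnoughDerivedProjectives)
    (V W : t.DGProj) (i : ℤ) (hi : 0 < i) : (hom (k := k) V W).ExactAt i :=
  dgProj.exactAt_of_le hA hp V.2 (dgProj.le_zero hA hp W.2) hi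

lemma realizable_tot (hA : IsPretriangulated k A) (hrb : t.RightBounded)
    (hp : t.HasEnoughDerivedProjectives) (hc : t.ClosedUnderCountableCoproducts)
    (Y : TwMinus k t.DGProj) : Realizable Y.tot := by
  have hQ := exactAt_dgProj hA hp
  obtain ⟨N, hN⟩ := Y.gr.bounded
  have hr : ∀ l : ℕ, Realizable (Y.filt N l) := fun l =>
    TwMinus.realizable_sub_of_finite hA _ (Y.finite_upSet _)
  choose X w hw hq using hr
  have hcone : ∀ (l : ℕ) (n : ℤ) (W : t.DGProj), N - l ≤ n → ConeExactAt (app (Y.filtIncl N l) W) n :=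
    fun l n W h => TwMinus.coneExactAt_app_incl_upSet hQ h W
  have hX : ∀ l, t.le N (H0.of (X l)) := fun l =>
    le_of_forall_exactAt hA hp (hrb.minus _) fun W hW i hi => by
      have h1 := (hcone l (i - 1) ⟨W, hW⟩ (by omega)).exactAt_left (by omega)
        (TwMinus.stdLE_tot hQ hN i hi ⟨W, hW⟩)
      exact ((quasiIso_iff_coneExactAt _).1 (hq l ⟨W, hW⟩) i).exactAt_right h1
  obtain ⟨C, i, h₁, h₂⟩ := hc.exists_coproduct hA X N hX
  obtain ⟨w₀, hw₀⟩ := Corep.exists_sum hw i h₁ h₂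
  obtain ⟨X', w', hw', -⟩ := hw₀.exists_attach hA hw₀ (Y.teleMap N).1 (closed_cone _)
  obtain ⟨ω, hω, -⟩ := hw'.of_precomp (Y.telePr N) TwMinus.quasiIso_precomp_telePr
  refine ⟨X', ω, hω, fun W => (quasiIso_iff_coneExactAt _).2 fun n => ?_⟩
  obtain ⟨l, hl⟩ : ∃ l : ℕ, N - l ≤ n := ⟨(N - n).toNat, by omega⟩
  obtain ⟨u, s, hu, hs⟩ := exists_of_quasiIso _ ((quasiIso_corepHom_iff _ _).2 (hw l X')) (i := 0)
    (j := -1) (l := 1) rfl rfl (Z0.comp (Y.filtIncl N l) ω).1 (Z0_d _)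
  obtain ⟨u, rfl⟩ : ∃ u' : Z0 k (X l) X', u'.1 = u := ⟨Z0.mk u hu, rfl⟩
  have hcls : H0.cls (Z0.comp (w l) (resZ0 ((yonedaDG k A).mapZ0 u))) =
      H0.cls (Z0.comp (Y.filtIncl N l) ω) := by
    refine ((cls_eq_iff _ _).2 ⟨s, ?_⟩).symm
    rw [hs]
    exact (add_sub_cancel_left _ _).symm
  obtain ⟨Z, g, hg⟩ := hA.exists_cone u
  have hZ : t.le (N - l - 1) (H0.of Z) := by
    refine (le_iff hA _ _).2 fun V hV => (hg.exactAt_left V (-1) 0 rfl).2 ?_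
    rw [← coneExactAt_comp_right_iff _ _ ((quasiIso_corepHom_iff _ _).2 (hw l V))]
    have e1 : precomp u V ≫ corepHom (w l) V =
        corepHom (Z0.comp (w l) (resZ0 ((yonedaDG k A).mapZ0 u))) V := by
      ext n z
      rw [HomologicalComplex.comp_f, ModuleCat.hom_comp, LinearMap.comp_apply, corepHom_apply,
        corepHom_apply, precomp_apply, DGFunctor.map_comp, resMap_comp]
      exact (DGCategory.assoc 0 0 n 0 n n rfl (zero_add n) (zero_add n) (zero_add n) _ _ _).symm
    have e2 : corepHom (Z0.comp (Y.filtIncl N l) ω) V =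
        corepHom ω V ≫ precomp (Y.filtIncl N l) (res t.dgProj (yon k V)) := by
      ext n z
      rw [HomologicalComplex.comp_f, ModuleCat.hom_comp, LinearMap.comp_apply, corepHom_apply,
        corepHom_apply, precomp_apply]
      exact DGCategory.assoc 0 0 n 0 n n rfl (zero_add n) (zero_add n) (zero_add n) _ _ _
    rw [e1]
    refine coneExactAt_corepHom_of_cls_eq hcls.symm ?_
    rw [e2, coneExactAt_comp_left_iff _ _ ((quasiIso_corepHom_iff _ _).2 (hω V))]
    refine TwMinus.coneExactAt_precomp_incl _ _ fun a ha => ?_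
    have ha' : a.1 < N - l := not_le.1 ha
    exact dgProj.exactAt_of_ge hA hp (Y.gr.ob a).2 hV (by omega)
  have h1 : ConeExactAt (postcomp W.1 u) n :=
    (hg.exactAt_right W.1 n).1 (dgProj.exactAt_of_le hA hp W.2 hZ (by omega))
  have h2 : ConeExactAt (app (Z0.comp (w l) (resZ0 ((yonedaDG k A).mapZ0 u))) W) n := by
    rw [app_comp, coneExactAt_comp_left_iff _ _ (hq l W)]
    exact h1
  have h3 := coneExactAt_app_of_cls_eq hcls W h2
  rw [app_comp] at h3
  exact h3.of_comp (hcone l (n + 1) W (by omega))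

end TStructure

end DG

namespace DG

section FinitelyPresented

variable {k : Type v} [CommRing k] {C : Type v} [Category.{v} C]

/-- The element `x` generates the right module `F`. -/
def Generates (F : Cᵒᵖ ⥤ ModuleCat.{v} k) {S : C} (x : F.obj (op S)) : Prop :=
  ∀ (W : C) (y : F.obj (op W)), ∃ g : W ⟶ S, (F.map g.op).hom x = y

/-- The right module `F` is generated by an element, whose annihilator is generated by a morphism. -/
def IsCyclicallyPresented [Preadditive C] (F : Cᵒᵖ ⥤ ModuleCat.{v} k) : Prop :=
  ∃ (S : C) (x : F.obj (op S)), Generates F x ∧ ∃ (S' : C) (f : S' ⟶ S),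
    (F.map f.op).hom x = 0 ∧ ∀ (W : C) (g : W ⟶ S), (F.map g.op).hom x = 0 → ∃ h : W ⟶ S', h ≫ f = g

lemma exact_of_evaluation (S : ShortComplex (Cᵒᵖ ⥤ ModuleCat.{v} k))
    (h : ∀ W, (S.map ((evaluation _ _).obj W)).Exact) : S.Exact := by
  rw [ShortComplex.exact_iff_isZero_homology, Functor.isZero_iff]
  intro W
  exact IsZero.of_iso ((ShortComplex.exact_iff_isZero_homology _).1 (h W))
    (S.mapHomologyIso ((evaluation _ _).obj W)).symm

variable [Preadditive C]

variable (C) in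
/-- Every finite family of objects consists of orthogonal retracts of an object. -/
def HasFiniteHulls : Prop :=
  ∀ (n : ℕ) (S : Fin n → C), ∃ (T : C) (l : ∀ i, S i ⟶ T) (p : ∀ i, T ⟶ S i),
    (∀ i, l i ≫ p i = 𝟙 _) ∧ ∀ i j, i ≠ j → l i ≫ p j = 0

lemma HasFiniteHulls.pair (hC : HasFiniteHulls C) (S₁ S₂ : C) : ∃ (T : C) (l₁ : S₁ ⟶ T) (l₂ : S₂ ⟶ T)
    (p₁ : T ⟶ S₁) (p₂ : T ⟶ S₂), l₁ ≫ p₁ = 𝟙 _ ∧ l₂ ≫ p₂ = 𝟙 _ ∧ l₁ ≫ p₂ = 0 ∧ l₂ ≫ p₁ = 0 := by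
  obtain ⟨T, l, p, h, h'⟩ := hC 2 ![S₁, S₂]
  exact ⟨T, l 0, l 1, p 0, p 1, h 0, h 1, h' 0 1 (by decide), h' 1 0 (by decide)⟩

lemma HasFiniteHulls.exists_generates (hC : HasFiniteHulls C) (F : Cᵒᵖ ⥤ ModuleCat.{v} k) [F.Additive]
    {S₁ S₂ : C} (x₁ : F.obj (op S₁)) (x₂ : F.obj (op S₂)) : ∃ (S : C) (x : F.obj (op S)),
      (∃ (p₁ : S ⟶ S₁) (p₂ : S ⟶ S₂), x = (F.map p₁.op).hom x₁ + (F.map p₂.op).hom x₂) ∧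
      ∀ (W : C) (g₁ : W ⟶ S₁) (g₂ : W ⟶ S₂), ∃ g : W ⟶ S,
        (F.map g.op).hom x = (F.map g₁.op).hom x₁ + (F.map g₂.op).hom x₂ := by
  obtain ⟨T, l₁, l₂, p₁, p₂, h₁, h₂, h₁₂, h₂₁⟩ := hC.pair S₁ S₂
  refine ⟨T, _, ⟨p₁, p₂, rfl⟩, fun W g₁ g₂ => ⟨g₁ ≫ l₁ + g₂ ≫ l₂, ?_⟩⟩
  rw [map_add]
  simp only [← ConcreteCategory.comp_apply, ← F.map_comp, ← op_comp,
    Preadditive.add_comp, Category.assoc, h₁, h₂, h₁₂, h₂₁, Category.comp_id, Limits.comp_zero, add_zero,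
    zero_add]

variable [Linear k C]

/-- The morphism from a representable module given by an element. -/
def yonedaElt (F : Cᵒᵖ ⥤ ModuleCat.{v} k) [F.Additive]
    (hF : ∀ {W V : C} (c : k) (g : W ⟶ V), F.map (c • g).op = c • F.map g.op) {S : C} (x : F.obj (op S)) :
    (linearYoneda k C).obj S ⟶ F where
  app W := ModuleCat.ofHom
    { toFun := fun (g : W.unop ⟶ S) => (F.map g.op).hom x
      map_add' := fun g g' => by
        rw [op_add, F.map_add]; rfl
      map_smul' := fun c g => by
        rw [hF]; rfl }
  naturality W V h := by
    ext (g : W.unop ⟶ S)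
    change (F.map (h.unop ≫ g).op).hom x = (F.map h).hom ((F.map g.op).hom x)
    rw [op_comp, F.map_comp]
    rfl

lemma IsCyclicallyPresented.isFinitelyPresented {F : Cᵒᵖ ⥤ ModuleCat.{v} k} [F.Additive]
    (hl : ∀ {W V : C} (c : k) (g : W ⟶ V), F.map (c • g).op = c • F.map g.op)
    (hF : IsCyclicallyPresented F) : IsFinitelyPresented F := by
  obtain ⟨S, x, hx, S', f, hf, hr⟩ := hF
  have w : (linearYoneda k C).map f ≫ yonedaElt F hl x = 0 := by
    ext W (g : W.unop ⟶ S')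
    change (F.map (g ≫ f).op).hom x = 0
    rw [op_comp, F.map_comp, ModuleCat.hom_comp, LinearMap.comp_apply, hf, map_zero]
  have hexact : (ShortComplex.mk _ _ w).Exact := by
    refine exact_of_evaluation _ fun W => ?_
    rw [ShortComplex.moduleCat_exact_iff]
    intro (g : W.unop ⟶ S) hg
    obtain ⟨h, hh⟩ := hr _ g hg
    exact ⟨h, hh⟩
  have hepi : Epi (yonedaElt F hl x) := by
    rw [NatTrans.epi_iff_epi_app]
    intro W
    rw [ModuleCat.epi_iff_surjective]
    intro y
    exact hx _ y
  let e := coproductUniqueIso fun _ : Fin 1 => (linearYoneda k C).obj S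
  let e' := coproductUniqueIso fun _ : Fin 1 => (linearYoneda k C).obj S'
  have w' : (e'.hom ≫ (linearYoneda k C).map f ≫ e.inv) ≫ e.hom ≫ yonedaElt F hl x = 0 := by simp [w]
  refine ⟨1, 1, fun _ => S', fun _ => S, e'.hom ≫ (linearYoneda k C).map f ≫ e.inv,
    e.hom ≫ yonedaElt F hl x, w', ?_, inferInstance⟩
  exact ShortComplex.exact_of_iso (ShortComplex.isoMk e'.symm e.symm (Iso.refl F) (by simp) (by simp))
    hexact

lemma HasFiniteHulls.exists_retract (hC : HasFiniteHulls C) {n : ℕ} (S : Fin n → C) :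
    ∃ (T : C) (a : (∐ fun i => (linearYoneda k C).obj (S i)) ⟶ (linearYoneda k C).obj T)
      (b : (linearYoneda k C).obj T ⟶ ∐ fun i => (linearYoneda k C).obj (S i)), a ≫ b = 𝟙 _ := by
  obtain ⟨T, l, p, h, h'⟩ := hC n S
  refine ⟨T, Sigma.desc fun i => (linearYoneda k C).map (l i),
    ∑ j, (linearYoneda k C).map (p j) ≫ Sigma.ι (fun i => (linearYoneda k C).obj (S i)) j,
    Sigma.hom_ext _ _ fun i => ?_⟩
  rw [Category.comp_id, Sigma.ι_desc_assoc, Preadditive.comp_sum, Finset.sum_eq_single i]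
  · rw [← Category.assoc, ← Functor.map_comp, h, CategoryTheory.Functor.map_id, Category.id_comp]
  · intro j _ hj
    rw [← Category.assoc, ← Functor.map_comp, h' i j hj.symm, Functor.map_zero, zero_comp]
  · simp

lemma HasFiniteHulls.isCyclicallyPresented (hC : HasFiniteHulls C) {F : Cᵒᵖ ⥤ ModuleCat.{v} k}
    (hF : IsFinitelyPresented F) : IsCyclicallyPresented F := by
  obtain ⟨m, n, C', C₀, f, g, w, hex, hepi⟩ := hF
  obtain ⟨S, a, b, hab⟩ := hC.exists_retract (k := k) C₀
  obtain ⟨S', a', b', hab'⟩ := hC.exists_retract (k := k) C'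
  have hab (W) (z) : (b.app W).hom ((a.app W).hom z) = z :=
    congrArg (fun φ : _ ⟶ _ => (φ.app W).hom z) hab
  have hab' (W) (z) : (b'.app W).hom ((a'.app W).hom z) = z :=
    congrArg (fun φ : _ ⟶ _ => (φ.app W).hom z) hab'
  have hw (W) (z) : (g.app W).hom ((f.app W).hom z) = 0 :=
    congrArg (fun φ : _ ⟶ _ => (φ.app W).hom z) w
  obtain ⟨x, hx⟩ : ∃ x : F.obj (op S), ∀ (W : C) (h : W ⟶ S),
      (F.map h.op).hom x = (g.app (op W)).hom ((b.app (op W)).hom h) := by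
    refine ⟨((b ≫ g).app (op S)).hom (𝟙 S), fun W h => ?_⟩
    have := ConcreteCategory.congr_hom ((b ≫ g).naturality h.op) (𝟙 S)
    refine this.symm.trans ?_
    change ((b ≫ g).app (op W)).hom (h ≫ 𝟙 S) = _
    rw [Category.comp_id]
    rfl
  have yon : ∀ {V V' : C} (φ : (linearYoneda k C).obj V ⟶ (linearYoneda k C).obj V'),
      ∃ r : V ⟶ V', ∀ (W : C) (h : W ⟶ V), (φ.app (op W)).hom h = h ≫ r := by
    intro V V' φ
    refine ⟨(φ.app (op V)).hom (𝟙 V), fun W h => ?_⟩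
    have := ConcreteCategory.congr_hom (φ.naturality h.op) (𝟙 V)
    refine Eq.trans ?_ this
    change _ = (φ.app (op W)).hom (h ≫ 𝟙 V)
    rw [Category.comp_id]
  obtain ⟨r, hr⟩ := yon (b' ≫ f ≫ a)
  obtain ⟨e, he⟩ := yon (b ≫ a)
  obtain ⟨T, l₁, l₂, p₁, p₂, h₁, h₂, h₁₂, h₂₁⟩ := hC.pair S' S
  have hgr : ∀ (W : C) (h : W ⟶ S'), (F.map (h ≫ r).op).hom x = 0 := by
    intro W h
    rw [hx, ← hr]
    exact (congrArg _ (hab _ _)).trans (hw _ _)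
  have hge : ∀ (W : C) (h : W ⟶ S), (F.map (h ≫ e).op).hom x = (F.map h.op).hom x := by
    intro W h
    rw [hx, hx, ← he]
    exact congrArg _ (hab _ _)
  refine ⟨S, x, fun W y => ?_, T, p₁ ≫ r + p₂ ≫ (𝟙 S - e), ?_, fun W h hh => ?_⟩
  · rw [NatTrans.epi_iff_epi_app] at hepi
    obtain ⟨z, rfl⟩ := (ModuleCat.epi_iff_surjective _).1 (hepi (op W)) y
    obtain ⟨u, rfl⟩ : ∃ u : W ⟶ S, (b.app (op W)).hom u = z := ⟨_, hab _ _⟩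
    exact ⟨u, hx W u⟩
  · rw [hx]
    have h1 := hgr T p₁
    have h2 := hge T p₂
    rw [hx] at h1
    rw [hx, hx] at h2
    refine (congrArg (g.app (op T)).hom ((b.app (op T)).hom.map_add (p₁ ≫ r) _)).trans ?_
    rw [map_add]
    refine (congrArg₂ (· + ·) h1 ?_).trans (add_zero 0)
    rw [Preadditive.comp_sub, Category.comp_id]
    refine (congrArg (g.app (op T)).hom ((b.app (op T)).hom.map_sub p₂ (p₂ ≫ e))).trans ?_
    rw [map_sub, h2]
    exact sub_self _
  · rw [hx] at hh
    have hex' := (ShortComplex.moduleCat_exact_iff _).1 (hex.map ((evaluation _ _).obj (op W)))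
    obtain ⟨u, hu⟩ := hex' _ hh
    have hu : (f.app (op W)).hom u = (b.app (op W)).hom h := hu
    obtain ⟨u', hu'⟩ : ∃ u' : W ⟶ S', (b'.app (op W)).hom u' = u := ⟨_, hab' _ _⟩
    have key : u' ≫ r = h ≫ e := by
      rw [← hr, ← he]
      change (a.app (op W)).hom ((f.app (op W)).hom ((b'.app (op W)).hom u')) = _
      rw [hu', hu]
      rfl
    refine ⟨u' ≫ l₁ + h ≫ l₂, ?_⟩
    simp only [Preadditive.add_comp, Preadditive.comp_add, Category.assoc, reassoc_of% h₁,
      reassoc_of% h₂, reassoc_of% h₁₂, reassoc_of% h₂₁, zero_comp, Limits.comp_zero, add_zero, zero_add,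
      Preadditive.comp_sub, Category.comp_id, key, h₂, h₁₂]
    exact add_sub_cancel (h ≫ e) h

end FinitelyPresented

end DG

namespace DG

open DGCategory DGModule

section FinitelyPresented

variable {k : Type v} [CommRing k] {C : Type v} [Category.{v} C] [Preadditive C]

lemma HasFiniteHulls.exists_kernel_generator (hC : HasFiniteHulls C) {F G : Cᵒᵖ ⥤ ModuleCat.{v} k}
    [F.Additive] (φ : F ⟶ G) (hφ : ∀ W, Function.Surjective (φ.app W).hom) {S₀ : C} {x₀ : F.obj (op S₀)}
    (hx₀ : Generates F x₀) (hG : IsCyclicallyPresented G) : ∃ (S : C) (v : F.obj (op S)),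
      (φ.app (op S)).hom v = 0 ∧ ∀ (W : C) (y : F.obj (op W)), (φ.app (op W)).hom y = 0 →
        ∃ g : W ⟶ S, (F.map g.op).hom v = y := by
  obtain ⟨S, x, hx, S', f, hf, hr⟩ := hG
  have nat : ∀ {W V : C} (g : W ⟶ V) (y : F.obj (op V)),
      (φ.app (op W)).hom ((F.map g.op).hom y) = (G.map g.op).hom ((φ.app (op V)).hom y) :=
    fun g y => ConcreteCategory.congr_hom (φ.naturality g.op) y
  have cmp : ∀ {E : Cᵒᵖ ⥤ ModuleCat.{v} k} {U W V : C} (h : U ⟶ W) (g : W ⟶ V) (y : E.obj (op V)),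
      (E.map (h ≫ g).op).hom y = (E.map h.op).hom ((E.map g.op).hom y) := fun h g y => by
    rw [op_comp, Functor.map_comp, ModuleCat.hom_comp, LinearMap.comp_apply]
  obtain ⟨u, rfl⟩ := hφ _ x
  obtain ⟨g₀, hg₀⟩ := hx _ ((φ.app (op S₀)).hom x₀)
  obtain ⟨T, v, ⟨p₁, p₂, hpv⟩, hv⟩ := hC.exists_generates F ((F.map f.op).hom u)
    (x₀ - (F.map g₀.op).hom u)
  refine ⟨T, v, ?_, fun W y hy => ?_⟩
  · rw [hpv, map_add, nat, nat, nat, map_sub, nat, hg₀, sub_self, map_zero, add_zero]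
    exact (congrArg _ hf).trans (map_zero _)
  · obtain ⟨h, rfl⟩ := hx₀ W y
    obtain ⟨h', hh'⟩ := hr W (h ≫ g₀) (by rw [cmp]; exact (congrArg _ hg₀).trans ((nat _ _).symm.trans hy))
    obtain ⟨g, hg⟩ := hv W h' h
    refine ⟨g, hg.trans ?_⟩
    rw [map_sub, ← cmp, ← cmp, hh', add_sub_cancel]

end FinitelyPresented

lemma cohClass_eq_iff {k : Type u} [CommRing k] {K : CochainComplex (ModuleCat.{v} k) ℤ} {i j : ℤ}
    (h : j + 1 = i) (x y : LinearMap.ker (K.d i (i + 1)).hom) :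
    cohClass K i x = cohClass K i y ↔ ∃ s, (K.d j i).hom s = x.1 - y.1 := by
  rw [← sub_eq_zero, ← map_sub, cohClass_eq_zero_iff h]
  rfl

namespace DGModule

variable {k : Type v} [CommRing k] {A : Type v} [DGCategory k A] {T M N : DGModule k A}

lemma act_mem_ker (M : DGModule k A) {V W : A} {i : ℤ} (g : Z0 k V W)
    (x : LinearMap.ker ((M.obj W).d i (i + 1)).hom) :
    M.act i 0 i (add_zero i) x.1 g.1 ∈ LinearMap.ker ((M.obj V).d i (i + 1)).hom := by
  rw [LinearMap.mem_ker, M.d_act_closed i 0 i (i + 1) 1 (i + 1) (add_zero i) rfl rfl rfl _ _ g.2, x.2,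
    map_zero, LinearMap.zero_apply]

lemma cohomology_map_cohClass (M : DGModule k A) (i : ℤ) {V W : A} (g : Z0 k V W)
    (x : LinearMap.ker ((M.obj W).d i (i + 1)).hom) :
    ((M.cohomology i).map (H0.cls g).op).hom (cohClass (M.obj W) i x) =
      cohClass (M.obj V) i ⟨M.act i 0 i (add_zero i) x.1 g.1, M.act_mem_ker g x⟩ :=
  homologyMap_cohClass (M.actHom g) i x

lemma cohomology_ext (M : DGModule k A) (i : ℤ) {V W : A}
    {φ ψ : (M.cohomology i).obj (op (H0.of W)) ⟶ (M.cohomology i).obj (op (H0.of V))}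
    (h : ∀ x, φ.hom (cohClass (M.obj W) i x) = ψ.hom (cohClass (M.obj W) i x)) : φ = ψ := by
  refine ModuleCat.hom_ext (LinearMap.ext fun y => ?_)
  obtain ⟨x, rfl⟩ := cohClass_surjective i y
  exact h x

instance (M : DGModule k A) (i : ℤ) : (M.cohomology i).Additive where
  map_add {W V} f g := by
    obtain ⟨f', hf⟩ := cls_surjective f.unop
    obtain ⟨g', hg⟩ := cls_surjective g.unop
    obtain rfl : f = (H0.cls f').op := Quiver.Hom.unop_inj hf.symm
    obtain rfl : g = (H0.cls g').op := Quiver.Hom.unop_inj hg.symm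
    refine cohomology_ext M i fun x => ?_
    refine (cohomology_map_cohClass M i (f' + g') x).trans ?_
    refine Eq.trans ?_ (congrArg₂ (· + ·) (cohomology_map_cohClass M i f' x)
      (cohomology_map_cohClass M i g' x)).symm
    refine Eq.trans (congrArg (cohClass (M.obj V.unop.obj) i) (Subtype.ext ?_)) (map_add _ _ _)
    exact map_add (M.act i 0 i (add_zero i) x.1) f'.1 g'.1

lemma cohomology_map_smul (M : DGModule k A) (i : ℤ) {W V : H0 k A} (c : k) (g : W ⟶ V) :
    (M.cohomology i).map (c • g).op = c • (M.cohomology i).map g.op := by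
  obtain ⟨g, rfl⟩ := cls_surjective g
  refine cohomology_ext M i fun x => ?_
  refine (cohomology_map_cohClass M i (c • g) x).trans ?_
  refine Eq.trans ?_ (congrArg (c • ·) (cohomology_map_cohClass M i g x)).symm
  refine Eq.trans (congrArg (cohClass (M.obj W.obj) i) (Subtype.ext ?_)) (map_smul _ _ _)
  exact map_smul (M.act i 0 i (add_zero i) x.1) c g.1

/-- The effect of a morphism of dg-modules on cohomology. -/
def cohomologyMap (w : Z0 k M N) (i : ℤ) : M.cohomology i ⟶ N.cohomology i where
  app W := HomologicalComplex.homologyMap (app w W.unop.obj) i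
  naturality W V f := by
    obtain ⟨f', hf⟩ := cls_surjective f.unop
    obtain rfl : f = (H0.cls f').op := Quiver.Hom.unop_inj hf.symm
    change HomologicalComplex.homologyMap (M.actHom f') i ≫ HomologicalComplex.homologyMap (app w _) i =
      HomologicalComplex.homologyMap (app w _) i ≫ HomologicalComplex.homologyMap (N.actHom f') i
    rw [← HomologicalComplex.homologyMap_comp, ← HomologicalComplex.homologyMap_comp]
    refine congrArg (fun φ => HomologicalComplex.homologyMap φ i) ?_
    ext p x
    exact ap_act w.1 p 0 p p p (add_zero p) (add_zero p) (add_zero p) x f'.1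

lemma cohomologyMap_cohClass (w : Z0 k M N) (i : ℤ) (W : A)
    (x : LinearMap.ker ((M.obj W).d i (i + 1)).hom) :
    ((cohomologyMap w i).app (op (H0.of W))).hom (cohClass (M.obj W) i x) =
      cohClass (N.obj W) i ⟨ap w.1 W i i (add_zero i) x.1, by
        have := hom_d_apply (app w W) i (i + 1) x.1
        rw [x.2, map_zero] at this
        exact this⟩ :=
  homologyMap_cohClass (app w W) i x

lemma isIso_cohomologyMap (w : Z0 k M N) (hw : ∀ W, QuasiIso (app w W)) (i : ℤ) :
    IsIso (cohomologyMap w i) := by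
  rw [NatTrans.isIso_iff_isIso_app]
  intro W
  have := hw W.unop.obj
  exact inferInstanceAs (IsIso (HomologicalComplex.homologyMap (app w W.unop.obj) i))

end DGModule

lemma IsFinitelyPresented.of_iso {k : Type v} [CommRing k] {C : Type v} [Category.{v} C] [Preadditive C]
    [Linear k C] {M N : Cᵒᵖ ⥤ ModuleCat.{v} k} (h : IsFinitelyPresented M) (e : M ≅ N) :
    IsFinitelyPresented N := by
  obtain ⟨m, n, C', C₀, f, g, w, hex, hepi⟩ := h
  refine ⟨m, n, C', C₀, f, g ≫ e.hom, by rw [reassoc_of% w, zero_comp], ?_, inferInstance⟩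
  exact ShortComplex.exact_of_iso (S₁ := ShortComplex.mk f g w)
    (ShortComplex.isoMk (Iso.refl _) (Iso.refl _) e) hex

lemma DGModule.isHfp_iff_of_quasiIso {k : Type v} [CommRing k] {A : Type v} [DGCategory k A]
    {M N : DGModule k A} (w : Z0 k M N) (hw : ∀ W, QuasiIso (app w W)) : M.IsHfp ↔ N.IsHfp := by
  have := isIso_cohomologyMap w hw
  exact ⟨fun h i => (h i).of_iso (asIso (cohomologyMap w i)),
    fun h i => (h i).of_iso (asIso (cohomologyMap w i)).symm⟩

namespace DGModule

variable {k : Type v} [CommRing k] {A : Type v} [DGCategory k A] {T M C : DGModule k A}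

section Cone

variable {w : Z0 k T M} (c : ConeData w C)

/-- The element of the cone with given components. -/
def coneElt (W : A) {p q : ℤ} (h : q + -1 = p) (t : (T.obj W).X q) (y : (M.obj W).X p) :
    (C.obj W).X p := ap c.i W q p h t - ap c.j.1 W p p (add_zero p) y

lemma d_coneElt (W : A) {p q r : ℤ} (h : q + -1 = p) (h' : q + 1 = r) (t : (T.obj W).X q)
    (y : (M.obj W).X p) : ((C.obj W).d p q).hom (coneElt c W h t y) =
      coneElt c W (by omega) (-((T.obj W).d q r).hom t) (((M.obj W).d p q).hom y -
        ap w.1 W q q (add_zero q) t) := by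
  have h1 := ap_d (n := -1) (m := 0) rfl c.i W q q p r (add_zero q) (by omega) h' t
  have h2 := hom_d_apply (app c.j W) p q y
  rw [c.d_i, ap_comp _ _ _ W q q q _ (add_zero q), eq_sub_iff_add_eq] at h1
  rw [coneElt, coneElt, map_sub, ← h1, map_sub, map_neg]
  refine (congrArg (_ - ·) h2).trans ?_
  rw [app_apply]
  simp only [Int.negOnePow_neg, Int.negOnePow_one, Units.neg_smul, one_smul]
  abel

lemma coneElt_act {V W : A} {p q p' q' n : ℤ} (h : q + -1 = p) (h' : q' + -1 = p') (hp : p + n = p')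
    (t : (T.obj W).X q) (y : (M.obj W).X p) (g : (hom (k := k) V W).X n) :
    C.act p n p' hp (coneElt c W h t y) g =
      coneElt c V h' (T.act q n q' (by omega) t g) (M.act p n p' hp y g) := by
  rw [coneElt, coneElt, map_sub, LinearMap.sub_apply, ← ap_act c.i q n q' p p' (by omega) h h',
    ← ap_act c.j.1 p n p' p p' hp (add_zero p) (add_zero p')]

lemma coneElt_sub (W : A) {p q : ℤ} (h : q + -1 = p) (t t' : (T.obj W).X q) (y y' : (M.obj W).X p) :
    coneElt c W h (t - t') (y - y') = coneElt c W h t y - coneElt c W h t' y' := by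
  rw [coneElt, coneElt, coneElt, map_sub, map_sub]
  abel

lemma coneElt_add (W : A) {p q : ℤ} (h : q + -1 = p) (t t' : (T.obj W).X q) (y y' : (M.obj W).X p) :
    coneElt c W h (t + t') (y + y') = coneElt c W h t y + coneElt c W h t' y' := by
  rw [coneElt, coneElt, coneElt, map_add, map_add]
  abel

lemma exists_coneElt (W : A) {p q : ℤ} (h : q + -1 = p) (z : (C.obj W).X p) :
    ∃ t y, coneElt c W h t y = z := by
  refine ⟨ap c.p W p q (by omega) z, -ap c.s W p p (add_zero p) z, ?_⟩
  have := congrArg (fun φ => ap φ W p p (add_zero p) z) c.p_i_add_s_j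
  rw [ap_add, LinearMap.add_apply, ap_comp _ _ _ W p q p _ (by omega), ap_comp _ _ _ W p p p _ (add_zero p),
    ap_one, castX_rfl] at this
  rw [coneElt, map_neg, sub_neg_eq_add]
  exact this

lemma coneElt_injective (W : A) {p q : ℤ} (h : q + -1 = p) {t t' : (T.obj W).X q} {y y' : (M.obj W).X p}
    (he : coneElt c W h t y = coneElt c W h t' y') : t = t' ∧ y = y' := by
  have hp : ∀ t y, ap c.p W p q (by omega) (coneElt c W h t y) = t := fun t y => by
    have h1 := congrArg (fun φ => ap φ W q q (add_zero q) t) c.i_p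
    have h2 := congrArg (fun φ => ap φ W p q (by omega) y) c.j_p
    rw [ap_comp _ _ _ W q p q _ h, ap_one, castX_rfl] at h1
    rw [ap_comp _ _ _ W p p q _ (add_zero p)] at h2
    rw [coneElt, map_sub, h1, h2]
    simp
  have hs : ∀ t y, ap c.s W p p (add_zero p) (coneElt c W h t y) = -y := fun t y => by
    have h1 := congrArg (fun φ => ap φ W q p h t) c.i_s
    have h2 := congrArg (fun φ => ap φ W p p (add_zero p) y) c.j_s
    rw [ap_comp _ _ _ W q p p _ h] at h1
    rw [ap_comp _ _ _ W p p p _ (add_zero p), ap_one, castX_rfl] at h2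
    rw [coneElt, map_sub, h1, h2]
    simp
  exact ⟨by rw [← hp t y, he, hp], neg_injective (by rw [← hs t y, he, hs])⟩

end Cone

/-- A pair consisting of a cocycle `x` of `T` and an element `z` of `M` whose boundary is the image of
`x` that generates the cohomology in degree `e` of the cone of `w`. -/
structure ConeGenerator (w : Z0 k T M) (e : ℤ) where
  S : A
  x : (T.obj S).X (e + 1)
  z : (M.obj S).X e
  d_x : ((T.obj S).d (e + 1) (e + 2)).hom x = 0
  d_z : ((M.obj S).d e (e + 1)).hom z = ap w.1 S (e + 1) (e + 1) (add_zero _) x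
  exists_eq (W : A) (t : (T.obj W).X (e + 1)) (y : (M.obj W).X e)
    (ht : ((T.obj W).d (e + 1) (e + 2)).hom t = 0)
    (hy : ((M.obj W).d e (e + 1)).hom y = ap w.1 W (e + 1) (e + 1) (add_zero _) t) :
    ∃ (h : Z0 k W S) (s : (T.obj W).X e) (r : (M.obj W).X (e - 1)),
      t = T.act (e + 1) 0 (e + 1) (add_zero _) x h.1 + ((T.obj W).d e (e + 1)).hom s ∧
      y = M.act e 0 e (add_zero _) z h.1 + ap w.1 W e e (add_zero e) s + ((M.obj W).d (e - 1) e).hom r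

lemma nonempty_coneGenerator (hA : HasFiniteHulls (H0 k A)) (w : Z0 k T M) (e : ℤ)
    (hs : ∀ W, Function.Surjective (HomologicalComplex.homologyMap (app w W) (e + 1)).hom)
    (hT : IsCyclicallyPresented (T.cohomology (e + 1)))
    (hM : IsCyclicallyPresented (M.cohomology (e + 1)))
    (hM' : IsCyclicallyPresented (M.cohomology e)) : Nonempty (ConeGenerator w e) := by
  obtain ⟨S₀, x₀, hx₀, -⟩ := hT
  obtain ⟨S₁, v, hv, hker⟩ := hA.exists_kernel_generator (cohomologyMap w (e + 1))
    (fun W => hs W.unop.obj) hx₀ hM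
  obtain ⟨S₂, z₂, hz₂, -⟩ := hM'
  obtain ⟨⟨x₁, hx₁⟩, rfl⟩ := cohClass_surjective (K := T.obj S₁.obj) (e + 1) v
  obtain ⟨⟨z₂, hz₂'⟩, rfl⟩ := cohClass_surjective (K := M.obj S₂.obj) e z₂
  obtain ⟨z₁, hz₁⟩ := (cohClass_eq_zero_iff (j := e) rfl _).1
    ((cohomologyMap_cohClass w (e + 1) S₁.obj ⟨x₁, hx₁⟩).symm.trans hv)
  dsimp only at hz₁
  have hx₁' : ((T.obj S₁.obj).d (e + 1) (e + 2)).hom x₁ = 0 := by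
    rw [show e + 2 = e + 1 + 1 by omega]; exact hx₁
  have hz₂'' : ((M.obj S₂.obj).d e (e + 1)).hom z₂ = 0 := hz₂'
  let c := coneData w
  have hcl : ∀ {W : A} {t : (T.obj W).X (e + 1)} {y : (M.obj W).X e}
      (_ : ((T.obj W).d (e + 1) (e + 2)).hom t = 0)
      (_ : ((M.obj W).d e (e + 1)).hom y = ap w.1 W (e + 1) (e + 1) (add_zero _) t),
      coneElt c W (by omega) t y ∈ LinearMap.ker (((attachMod (-1) w.1 (closed_cone w)).obj W).d e (e + 1)).hom := by
    intro W t y ht hy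
    rw [LinearMap.mem_ker, d_coneElt c W (by omega) (show e + 1 + 1 = e + 2 by omega), ht, hy, sub_self,
      coneElt]
    simp
  obtain ⟨⟨S⟩, ζ, -, hζ⟩ := hA.exists_generates ((attachMod (-1) w.1 (closed_cone w)).cohomology e)
    (S₁ := S₁) (S₂ := S₂) (cohClass _ e ⟨_, hcl hx₁' hz₁⟩)
    (cohClass _ e ⟨coneElt c S₂.obj (by omega) 0 z₂, hcl (map_zero _) (by rw [hz₂'', map_zero])⟩)
  obtain ⟨⟨ζ, hζ'⟩, rfl⟩ := cohClass_surjective (K := (attachMod (-1) w.1 (closed_cone w)).obj S) e ζ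
  obtain ⟨x, z, rfl⟩ := exists_coneElt c S (p := e) (q := e + 1) (by omega) ζ
  have hxz : ((T.obj S).d (e + 1) (e + 2)).hom x = 0 ∧
      ((M.obj S).d e (e + 1)).hom z = ap w.1 S (e + 1) (e + 1) (add_zero _) x := by
    have h0 : coneElt c S (p := e + 1) (q := e + 2) (by omega) 0 0 = 0 := by simp [coneElt]
    rw [LinearMap.mem_ker, d_coneElt c S (by omega) (show e + 1 + 1 = e + 2 by omega), ← h0] at hζ'
    obtain ⟨h1, h2⟩ := coneElt_injective c S (by omega) hζ'
    exact ⟨neg_eq_zero.1 h1, sub_eq_zero.1 h2⟩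
  refine ⟨⟨S, x, z, hxz.1, hxz.2, fun W t y ht hy => ?_⟩⟩
  have ht' : ((T.obj W).d (e + 1) (e + 1 + 1)).hom t = 0 := by
    rw [show e + 1 + 1 = e + 2 by omega]; exact ht
  obtain ⟨g₁, hg₁⟩ := hker (H0.of W) (cohClass (T.obj W) (e + 1) ⟨t, ht'⟩) (by
    refine (cohomologyMap_cohClass w (e + 1) W ⟨t, ht'⟩).trans ?_
    exact (cohClass_eq_zero_iff (j := e) rfl _).2 ⟨y, hy⟩)
  obtain ⟨g₁, rfl⟩ := cls_surjective (X := W) (Y := S₁.obj) g₁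
  obtain ⟨s, hs⟩ := (cohClass_eq_iff (j := e) rfl _ _).1
    (hg₁.symm.trans (cohomology_map_cohClass T (e + 1) g₁ ⟨x₁, hx₁⟩))
  dsimp only at hs
  have hwx : ap w.1 W (e + 1) (e + 1) (add_zero _) (T.act (e + 1) 0 (e + 1) (add_zero _) x₁ g₁.1) =
      ((M.obj W).d e (e + 1)).hom (M.act e 0 e (add_zero e) z₁ g₁.1) := by
    rw [M.d_act_closed e 0 e (e + 1) 1 (e + 1) (add_zero e) rfl rfl rfl _ _ g₁.2, hz₁]
    exact ap_act w.1 _ _ _ _ _ _ _ _ _ _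
  have hws : ap w.1 W (e + 1) (e + 1) (add_zero _) (((T.obj W).d e (e + 1)).hom s) =
      ((M.obj W).d e (e + 1)).hom (ap w.1 W e e (add_zero e) s) :=
    (hom_d_apply (app w W) e (e + 1) s).symm
  have hy₂ : ((M.obj W).d e (e + 1)).hom (y - M.act e 0 e (add_zero e) z₁ g₁.1 -
      ap w.1 W e e (add_zero e) s) = 0 := by
    rw [map_sub, map_sub, hy, ← hws, ← hwx, hs, map_sub, sub_self]
  obtain ⟨g₂, hg₂⟩ := hz₂ (H0.of W) (cohClass (M.obj W) e ⟨_, hy₂⟩)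
  obtain ⟨g₂, rfl⟩ := cls_surjective (X := W) (Y := S₂.obj) g₂
  obtain ⟨r, hr⟩ := (cohClass_eq_iff (j := e - 1) (by omega) _ _).1
    (hg₂.symm.trans (cohomology_map_cohClass M e g₂ ⟨z₂, hz₂'⟩))
  dsimp only at hr
  obtain ⟨g, hg⟩ := hζ (H0.of W) (H0.cls g₁) (H0.cls g₂)
  obtain ⟨g, rfl⟩ := cls_surjective (X := W) (Y := S) g
  have e1 := cohomology_map_cohClass (attachMod (-1) w.1 (closed_cone w)) e g ⟨_, hζ'⟩
  have e2 := cohomology_map_cohClass (attachMod (-1) w.1 (closed_cone w)) e g₁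
    (W := S₁.obj) ⟨_, hcl hx₁' hz₁⟩
  have e3 := cohomology_map_cohClass (attachMod (-1) w.1 (closed_cone w)) e g₂ (W := S₂.obj)
    ⟨coneElt c S₂.obj (by omega) 0 z₂, hcl (map_zero _) (by rw [hz₂'', map_zero])⟩
  obtain ⟨η, hη⟩ := (cohClass_eq_iff (j := e - 1) (by omega) _ _).1
    ((e1.symm.trans (hg.trans (congrArg₂ (· + ·) e2 e3))).trans
      (map_add (cohClass ((attachMod (-1) w.1 (closed_cone w)).obj W) e) _ _).symm)
  obtain ⟨a, b, rfl⟩ := exists_coneElt c W (p := e - 1) (q := e) (by omega) η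
  change _ = _ - (_ + _) at hη
  dsimp only at hη
  rw [coneElt_act c (q' := e + 1) (by omega) (by omega), coneElt_act c (q' := e + 1) (by omega) (by omega),
    coneElt_act c (q' := e + 1) (by omega) (by omega), d_coneElt c W (by omega) (show e + 1 = e + 1 from rfl),
    ← coneElt_add, ← coneElt_sub] at hη
  obtain ⟨h1, h2⟩ := coneElt_injective c W (by omega) hη
  refine ⟨g, s + a, r - b, ?_, ?_⟩
  · have h0 : T.act (e + 1) 0 (e + 1) (add_zero _) (0 : (T.obj S₂.obj).X (e + 1)) g₂.1 = 0 := by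
      rw [map_zero, LinearMap.zero_apply]
    rw [eq_sub_iff_add_eq] at h1
    rw [map_add, hs, ← h1]
    refine Eq.trans ?_ (congrArg (fun u => -((T.obj W).d e (e + 1)).hom a +
      (T.act (e + 1) 0 (e + 1) (add_zero _) x₁ g₁.1 + u) + (t - T.act (e + 1) 0 (e + 1) (add_zero _) x₁ g₁.1 +
        ((T.obj W).d e (e + 1)).hom a)) h0).symm
    abel
  · rw [eq_sub_iff_add_eq] at h2
    rw [map_add, map_sub, hr, ← h2]
    abel

end DGModule

end DG

namespace DG

open DGCategory DGModule

namespace DGModule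

variable {k : Type v} [CommRing k] {A : Type v} [DGCategory k A] {T T' M L : DGModule k A}

lemma isCyclicallyPresented_cohomology (M : DGModule k A) (i : ℤ) {S S' : A} (x : (M.obj S).X i)
    (hx : ((M.obj S).d i (i + 1)).hom x = 0) (f : Z0 k S' S)
    (hgen : ∀ (W : A) (y : (M.obj W).X i), ((M.obj W).d i (i + 1)).hom y = 0 → ∃ (g : Z0 k W S) (s : _),
      ((M.obj W).d (i - 1) i).hom s = M.act i 0 i (add_zero i) x g.1 - y)
    (hf : ∃ s, ((M.obj S').d (i - 1) i).hom s = M.act i 0 i (add_zero i) x f.1)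
    (hr : ∀ (W : A) (g : Z0 k W S), (∃ s, ((M.obj W).d (i - 1) i).hom s = M.act i 0 i (add_zero i) x g.1) →
      ∃ h : Z0 k W S', H0.cls h ≫ H0.cls f = H0.cls g) :
    IsCyclicallyPresented (M.cohomology i) := by
  refine ⟨H0.of S, cohClass (M.obj S) i ⟨x, hx⟩, fun W y => ?_, H0.of S', H0.cls f, ?_, fun W g hg => ?_⟩
  · obtain ⟨⟨y, hy⟩, rfl⟩ := cohClass_surjective (K := M.obj W.obj) i y
    obtain ⟨g, hg⟩ := hgen W.obj y hy
    refine ⟨H0.cls g, (cohomology_map_cohClass M i g ⟨x, hx⟩).trans ?_⟩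
    exact (cohClass_eq_iff (j := i - 1) (by omega) _ _).2 hg
  · refine (cohomology_map_cohClass M i f ⟨x, hx⟩).trans ?_
    exact (cohClass_eq_zero_iff (j := i - 1) (by omega) _).2 hf
  · obtain ⟨g, rfl⟩ := cls_surjective g
    obtain ⟨h, hh⟩ := hr W.obj g ((cohClass_eq_zero_iff (j := i - 1) (by omega) _).1
      ((cohomology_map_cohClass M i g ⟨x, hx⟩).symm.trans hg))
    exact ⟨H0.cls h, hh⟩

/-- `T'` is obtained from `T` by attaching a cell of degree `e` along the cocycle `x`. -/
structure CellExt (T T' : DGModule k A) (e : ℤ) {S : A} (x : (T.obj S).X (e + 1)) where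
  inl : Z0 k T T'
  ε : (T'.obj S).X e
  d_ε : ((T'.obj S).d e (e + 1)).hom ε = ap inl.1 S (e + 1) (e + 1) (add_zero _) x
  exists_eq (W : A) (p q : ℤ) (h : e + q = p) (u : (T'.obj W).X p) :
    ∃ (t : (T.obj W).X p) (b : (hom (k := k) W S).X q),
      u = ap inl.1 W p p (add_zero p) t + T'.act e q p h ε b
  eq_zero (W : A) (p q : ℤ) (h : e + q = p) (t : (T.obj W).X p) (b : (hom (k := k) W S).X q)
    (h0 : ap inl.1 W p p (add_zero p) t + T'.act e q p h ε b = 0) : t = 0 ∧ b = 0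
  desc {L : DGModule k A} {n m : ℤ} (h : e + n = m) (α : (hom (k := k) T L).X n) (y : (L.obj S).X m) :
    ∃ φ : (hom (k := k) T' L).X n, comp 0 n n (zero_add n) inl.1 φ = α ∧ ap φ S e m h ε = y

/-- Attaching a cell. -/
def cellExt (T : DGModule k A) (e : ℤ) {S : A} (x : (T.obj S).X (e + 1))
    (hx : e + 1 = e + 1 ∧ ((hom (yon k S) T).d (e + 1) (e + 1 + 1)).hom (elt x) = 0) :
    CellExt T (attachMod e (elt x) hx) e x := by
  have hε : elt (ap (attachInr e (elt x) hx) S 0 e (zero_add e) (one S)) = attachInr e (elt x) hx :=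
    elt_eta _
  have hκ : ∀ (W : A) (p : ℤ) (b : (hom (k := k) W S).X (p - e)), (attachMod e (elt x) hx).act e (p - e) p
      (by omega) (ap (attachInr e (elt x) hx) S 0 e (zero_add e) (one S)) b =
        attachκ e (elt x) hx W p b := fun W p b => by
    refine (ap_elt (ap (attachInr e (elt x) hx) S 0 e (zero_add e) (one S)) W (p - e) p (by omega)
      b).symm.trans ?_
    rw [hε]
    exact ap_attachInr' e (elt x) hx W p b
  refine ⟨attachInl e (elt x) hx, ap (attachInr e (elt x) hx) S 0 e (zero_add e) (one S),
    elt_injective ?_, fun W p q h u => ?_, fun W p q h t b h0 => ?_, fun {L n m} h α y => ?_⟩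
  · rw [← d_elt rfl, hε, d_attachInr _ _ _ _ rfl, elt_comp]
  · obtain rfl : q = p - e := by omega
    refine ⟨attachFst e (elt x) hx W p u, attachSnd e (elt x) hx W p u, ?_⟩
    rw [ap_attachInl]
    exact (attach_decomp e (elt x) hx W p u).trans (congrArg _ (hκ W p _).symm)
  · obtain rfl : q = p - e := by omega
    rw [ap_attachInl, hκ] at h0
    constructor
    · have := congrArg (attachFst e (elt x) hx W p) h0
      rw [map_add, attachFst_ι, map_zero] at this
      exact (add_zero t).symm.trans this
    · have := congrArg (attachSnd e (elt x) hx W p) h0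
      rw [map_add, attachSnd_ι, zero_add, map_zero] at this
      exact this
  · refine ⟨attachDesc (hf := hx) α (elt y) (by omega), attachInl_attachDesc _ _ _, elt_injective ?_⟩
    rw [← elt_comp, hε]
    exact attachInr_attachDesc _ _ _

namespace CellExt

variable {e : ℤ} {S : A} {x : (T.obj S).X (e + 1)} (c : CellExt T T' e x)

lemma hom_ext {n : ℤ} {φ ψ : (hom (k := k) T' L).X n}
    (h₁ : comp 0 n n (zero_add n) c.inl.1 φ = comp 0 n n (zero_add n) c.inl.1 ψ)
    (h₂ : ap φ S e (e + n) rfl c.ε = ap ψ S e (e + n) rfl c.ε) : φ = ψ := by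
  refine hom_ext' fun W p q hpq u => ?_
  obtain ⟨t, b, rfl⟩ := c.exists_eq W p (p - e) (by omega) u
  rw [map_add, map_add, ap_act φ e (p - e) p (e + n) q (by omega) rfl hpq,
    ap_act ψ e (p - e) p (e + n) q (by omega) rfl hpq, h₂,
    ← ap_comp (zero_add n) c.inl.1 φ W p p q hpq (add_zero p),
    ← ap_comp (zero_add n) c.inl.1 ψ W p p q hpq (add_zero p), h₁]

lemma d_act_ε (W : A) {p q p' q' : ℤ} (h : e + q = p) (hp : p + 1 = p') (hq : q + 1 = q')
    (b : (hom (k := k) W S).X q) : ((T'.obj W).d p p').hom (T'.act e q p h c.ε b) =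
      ap c.inl.1 W p' p' (add_zero p') (T.act (e + 1) q p' (by omega) x b) +
        e.negOnePow • T'.act e q' p' (by omega) c.ε (((hom W S).d q q').hom b) := by
  rw [T'.leibniz e q p (e + 1) q' p' h rfl hq hp, c.d_ε,
    ap_act c.inl.1 (e + 1) q p' (e + 1) p' (by omega) (add_zero _) (add_zero _)]

lemma inl_injective (W : A) (p : ℤ) : Function.Injective (ap c.inl.1 W p p (add_zero p)) :=
  (injective_iff_map_eq_zero _).2 fun t ht => (c.eq_zero W p (p - e) (by omega) t 0 (by
    rw [ht, map_zero, add_zero])).1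

lemma d_inl (W : A) (p p' : ℤ) (t : (T.obj W).X p) :
    ((T'.obj W).d p p').hom (ap c.inl.1 W p p (add_zero p) t) =
      ap c.inl.1 W p' p' (add_zero p') (((T.obj W).d p p').hom t) := hom_d_apply (app c.inl W) p p' t

end CellExt

/-- Attaching a generator of the cohomology of the cone in degree `e` kills it, and does not change the
cohomology of the cone in higher degrees. -/
lemma ConeGenerator.coneExactAt (hA : ∀ (V W : A) (i : ℤ), 0 < i → (hom (k := k) V W).ExactAt i)
    {w : Z0 k T M} {e : ℤ} (g : ConeGenerator w e) (c : CellExt T T' e g.x) (w' : Z0 k T' M)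
    (h₁ : Z0.comp c.inl w' = w) (h₂ : ap w'.1 g.S e e (add_zero e) c.ε = g.z)
    (hw : ∀ n, e < n → ∀ W, ConeExactAt (app w W) n) (n : ℤ) (hn : e ≤ n) (W : A) :
    ConeExactAt (app w' W) n := by
  intro m n' n'' hm hn' hn'' u z hu hz
  have hw' : ∀ p (t : (T.obj W).X p), ap w'.1 W p p (add_zero p) (ap c.inl.1 W p p (add_zero p) t) =
      ap w.1 W p p (add_zero p) t := fun p t =>
    (ap_comp (add_zero 0) c.inl.1 w'.1 W p p p (add_zero p) (add_zero p) t).symm.trans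
      (congrArg (fun v : Z0 k T M => ap v.1 W p p (add_zero p) t) h₁)
  have hwd : ∀ p p' (t : (T'.obj W).X p), ((M.obj W).d p p').hom (ap w'.1 W p p (add_zero p) t) =
      ap w'.1 W p' p' (add_zero p') (((T'.obj W).d p p').hom t) := fun p p' t =>
    hom_d_apply (app w' W) p p' t
  have key : ∀ (t : (T.obj W).X n') (z : (M.obj W).X n), ((T.obj W).d n' n'').hom t = 0 →
      ap w.1 W n' n' (add_zero n') t = ((M.obj W).d n n').hom z →
      ∃ (u' : (T'.obj W).X n) (z' : (M.obj W).X m), ((T'.obj W).d n n').hom u' =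
        ap c.inl.1 W n' n' (add_zero n') t ∧
        z = ap w'.1 W n n (add_zero n) u' + ((M.obj W).d m n).hom z' := by
    intro t z ht hz
    rcases hn.lt_or_eq with hn | rfl
    · obtain ⟨t', z', ht', hz'⟩ := hw n hn W m n' n'' hm hn' hn'' t z ht hz
      refine ⟨ap c.inl.1 W n n (add_zero n) t', z', ?_, ?_⟩
      · rw [c.d_inl, ht']
      · rw [hw']
        exact hz'
    · obtain rfl : n' = e + 1 := by omega
      obtain rfl : n'' = e + 2 := by omega
      obtain rfl : m = e - 1 := by omega
      obtain ⟨h, s, r, rfl, rfl⟩ := g.exists_eq W t z ht hz.symm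
      refine ⟨T'.act e 0 e (add_zero e) c.ε h.1 + ap c.inl.1 W e e (add_zero e) s, r, ?_, ?_⟩
      · rw [map_add, c.d_act_ε W (q' := 1) (add_zero e) rfl rfl, Z0_d, map_zero, smul_zero, add_zero, c.d_inl, map_add]
      · rw [map_add, hw', ap_act w'.1 e 0 e e e (add_zero e) (add_zero e) (add_zero e), h₂]
  obtain ⟨t, b, rfl⟩ := c.exists_eq W n' (n' - e) (by omega) u
  have hu₀ := hu
  rw [map_add, c.d_inl, c.d_act_ε W (by omega) hn'' (show n' - e + 1 = n' - e + 1 from rfl), ← add_assoc,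
    ← map_add, ← DG.map_units_smul] at hu
  have hb := (smul_eq_zero_iff_eq _).1 (c.eq_zero W n'' _ _ _ _ hu).2
  obtain ⟨b', rfl⟩ := (exactAt_iff (j := n - e) (by omega) (by omega)).1 (hA W g.S (n' - e) (by omega)) b hb
  have hd := c.d_act_ε W (show e + (n - e) = n by omega) hn' (show n - e + 1 = n' - e by omega) b'
  have hu' : ap c.inl.1 W n' n' (add_zero n') t + T'.act e (n' - e) n' (by omega) c.ε
      (((hom (k := k) W g.S).d (n - e) (n' - e)).hom b') = ap c.inl.1 W n' n' (add_zero n')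
        (t - e.negOnePow • T.act (e + 1) (n - e) n' (by omega) g.x b') +
        ((T'.obj W).d n n').hom (e.negOnePow • T'.act e (n - e) n (by omega) c.ε b') := by
    rw [map_sub, DG.map_units_smul, DG.map_units_smul, hd, smul_add, smul_smul, Int.units_mul_self, one_smul]
    abel
  rw [hu', map_add, d_d_apply, add_zero, c.d_inl] at hu₀
  rw [hu'] at hz ⊢
  obtain ⟨u', z', h3, h4⟩ := key (t - e.negOnePow • T.act (e + 1) (n - e) n' (by omega) g.x b')
    (z - ap w'.1 W n n (add_zero n) (e.negOnePow • T'.act e (n - e) n (by omega) c.ε b')) (c.inl_injective W n'' (hu₀.trans (map_zero _).symm)) (by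
      rw [map_sub ((M.obj W).d n n').hom, hwd, ← hz, app_apply, map_add, hw', add_sub_cancel_right])
  refine ⟨u' + e.negOnePow • T'.act e (n - e) n (by omega) c.ε b', z', ?_, ?_⟩
  · rw [map_add, h3]
  · rw [app_apply, map_add, add_right_comm, ← h4, sub_add_cancel]

end DGModule

namespace TStructure

variable {k : Type v} [CommRing k] {A : Type v} [DGCategory k A] {t : TStructure k A}

lemma hasFiniteHulls_dgProj (hA : IsPretriangulated k A) (hp : t.HasEnoughDerivedProjectives) :
    HasFiniteHulls (H0 k t.DGProj) := by
  intro n S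
  have := hA.hasFiniteBiproducts
  let B : H0 k A := ⨁ fun i => H0.of (S i).obj.1
  obtain ⟨V, s, hV, hs⟩ := exists_dgProj_cover hA hp B.obj
  have hι : ∀ i, ∃ g : Z0 k (S i).obj.1 B.obj, H0.cls g = biproduct.ι (fun i => H0.of (S i).obj.1) i :=
    fun i => cls_surjective _
  have hπ : ∀ i, ∃ g : Z0 k B.obj (S i).obj.1, H0.cls g = biproduct.π (fun i => H0.of (S i).obj.1) i :=
    fun i => cls_surjective _
  choose a ha using hι
  choose b hb using hπ
  choose l hl using fun i => hs (S i).obj.1 (S i).obj.2 (a i)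
  have key : ∀ i j, H0.cls (l i) ≫ H0.cls (Z0.comp s (b j)) =
      biproduct.ι (fun i => H0.of (S i).obj.1) i ≫ biproduct.π (fun i => H0.of (S i).obj.1) j := by
    intro i j
    rw [cls_comp, ← Category.assoc, hl, ha, hb]
  let V' : t.DGProj := ⟨V, hV⟩
  let l' : ∀ i, Z0 k (S i).obj V' := l
  let p' : ∀ i, Z0 k V' (S i).obj := fun i => (Z0.comp s (b i) : Z0 k V (S i).obj.1)
  refine ⟨H0.of V', fun i => H0.cls (l' i), fun i => H0.cls (p' i), fun i => ?_, fun i j hij => ?_⟩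
  · exact (key i i).trans (biproduct.ι_π_self _ _)
  · exact (key i j).trans (biproduct.ι_π_ne _ hij)

lemma isCyclicallyPresented_cohomology_res (hA : IsPretriangulated k A)
    (hp : t.HasEnoughDerivedProjectives) (X : A) (i : ℤ) :
    IsCyclicallyPresented ((res t.dgProj (yon k X)).cohomology i) := by
  obtain ⟨X', h⟩ := hA.exists_isHoShift i X
  obtain ⟨a, b, ha, hb, hab, hba⟩ := h.exists_isCl (p := -i) (q := i) rfl rfl
  obtain ⟨S, s, hS, hs⟩ := exists_dgProj_cover hA hp X'
  obtain ⟨V, v, hv, hv'⟩ := hA.exists_weakKernel s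
  obtain ⟨S', r, hS', hr⟩ := exists_dgProj_cover hA hp V
  have hcl : ∀ {X Y : A} (f : Z0 k X Y), IsCl f.1 := fun f => f.2
  have hbd : ∀ {X Y : A} (f : Z0 k X Y), H0.cls f = 0 → IsBd f.1 := fun f hf => by
    obtain ⟨s, hs⟩ := (cls_eq_zero_iff f).1 hf
    exact .of_eq s rfl hs
  have hbd' : ∀ {X Y : A} (f : Z0 k X Y), IsBd f.1 → H0.cls f = 0 := fun f hf =>
    (cls_eq_zero_iff f).2 (hf.exists_eq rfl)
  have hx : IsCl (comp 0 i i (zero_add i) s.1 b) := (hcl s).comp hb _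
  refine isCyclicallyPresented_cohomology (A := t.DGProj) (res t.dgProj (yon k X)) i
    (S := ⟨S, hS⟩) (S' := ⟨S', hS'⟩) (comp 0 i i (zero_add i) s.1 b) hx
    (show Z0 k S' S from Z0.comp r v) ?_ ?_ ?_
  · intro W (y : (hom (k := k) W.1 X).X i) (hy : IsCl y)
    obtain ⟨g, hg⟩ : ∃ g : Z0 k W.1 X', g.1 = comp i (-i) 0 (by omega) y a :=
      ⟨Z0.mk _ (hy.comp ha _), rfl⟩
    obtain ⟨l, hl⟩ := hs W.1 W.2 g
    refine ⟨l, ?_⟩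
    obtain ⟨σ, hσ⟩ := (cls_eq_iff (Z0.comp l s) _).1 hl
    have h1 := IsBd.comp_right (IsBd.of_eq (n := 0) σ rfl hσ) hb (zero_add i)
    have h2 := IsBd.comp_left hy hab (add_zero i)
    rw [map_sub, comp_one, ← DGCategory.assoc i (-i) i 0 0 i (by omega) (by omega) (by omega) (by omega)] at h2
    rw [map_sub, LinearMap.sub_apply] at h1
    have h3 := h1.add h2
    rw [hg, sub_add_sub_cancel] at h3
    have h4 : comp 0 i i (zero_add i) (Z0.comp l s).1 b =
        comp 0 i i (zero_add i) l.1 (comp 0 i i (zero_add i) s.1 b) :=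
      DGCategory.assoc 0 0 i 0 i i (by omega) (by omega) (by omega) (by omega) _ _ _
    rw [h4] at h3
    exact h3
  · have h1 := IsBd.comp_right (hbd (Z0.comp (Z0.comp r v) s) (by
      rw [cls_comp, cls_comp, Category.assoc, hv, Limits.comp_zero])) hb (zero_add i)
    have h4 : comp 0 i i (zero_add i) (Z0.comp (Z0.comp r v) s).1 b =
        comp 0 i i (zero_add i) (Z0.comp r v).1 (comp 0 i i (zero_add i) s.1 b) :=
      DGCategory.assoc 0 0 i 0 i i (by omega) (by omega) (by omega) (by omega) _ _ _
    rw [h4] at h1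
    exact h1
  · intro W (g : Z0 k W.1 S) (hg : IsBd (comp 0 i i (zero_add i) g.1 (comp 0 i i (zero_add i) s.1 b)))
    rw [← DGCategory.assoc 0 0 i 0 i i (by omega) (by omega) (by omega) (by omega)] at hg
    have h1 := IsBd.of_comp_right (x := (Z0.comp g s).1) ha (by omega) hba (hcl _) (zero_add i) hg
    obtain ⟨l, hl⟩ := hv' W.1 g (hbd' _ h1)
    obtain ⟨l', hl'⟩ := hr W.1 W.2 l
    refine ⟨l', ?_⟩
    change H0.cls l' ≫ H0.cls (Z0.comp r v) = H0.cls g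
    rw [cls_comp, ← Category.assoc, hl', hl]

lemma isHfp_res (hA : IsPretriangulated k A) (hp : t.HasEnoughDerivedProjectives) (X : A) :
    (res t.dgProj (yon k X)).IsHfp := fun i =>
  (isCyclicallyPresented_cohomology_res hA hp X i).isFinitelyPresented (cohomology_map_smul _ i)

lemma isHfp_of_realizable (hA : IsPretriangulated k A) (hp : t.HasEnoughDerivedProjectives)
    {T : DGModule k t.DGProj} (hT : Realizable T) : T.IsHfp := by
  obtain ⟨X, w, -, hw⟩ := hT
  exact (isHfp_iff_of_quasiIso w hw).2 (isHfp_res hA hp X)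

end TStructure

end DG

namespace DG

open DGCategory DGModule

namespace GradedObj

variable {k : Type v} [CommRing k] {Q : Type v} [DGCategory k Q]

variable (k) in
/-- A graded object as a twisted complex with vanishing twist. -/
abbrev toTw (G : GradedObj Q) : TwMinus k Q :=
  ⟨G, 0, by rw [map_zero, map_zero, add_zero], fun _ _ _ _ _ _ _ _ => rfl⟩

lemma toTw_d (G : GradedObj Q) (W : Q) (i j : ℤ) :
    ((G.toTw k).tot.obj W).d i j = ((G.toModule k).obj W).d i j := by
  refine Eq.trans (congrArg (((G.toModule k).obj W).d i j + ·) ?_) (add_zero _)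
  split_ifs <;> rfl

lemma coord_toTw_d (G : GradedObj Q) (b : G.Idx) (W : Q) (m m' : ℤ) (u : ((G.toTw k).tot.obj W).X m) :
    (G.toTw k).coord b W m' ((((G.toTw k).tot.obj W).d m m').hom u) =
      b.1.negOnePow • ((hom (k := k) W (G.ob b)).d (m - b.1) (m' - b.1)).hom ((G.toTw k).coord b W m u) := by
  rw [toTw_d]
  rfl

lemma toTw_d_cell (G : GradedObj Q) (a : G.Idx) (m : ℤ) :
    (((G.toTw k).tot.obj (G.ob a)).d a.1 m).hom ((G.toTw k).cell a) = 0 := by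
  refine TwMinus.coord_ext fun b => ?_
  rw [coord_toTw_d]
  by_cases h : b = a
  · subst h
    rw [TwMinus.cell, TwMinus.coord_cellι_self]
    refine (congrArg _ (TwMinus.castX_zero_d_one _ _)).trans ((smul_zero _).trans (map_zero _).symm)
  · rw [TwMinus.coord_cell_of_ne h, map_zero, smul_zero, map_zero]

lemma ap_toTw_d {G : GradedObj Q} (p : (hom (k := k) (G.toTw k).tot (G.toTw k).tot).X 1)
    (hp : ((hom _ _).d 1 2).hom p + comp 1 1 2 rfl p p = 0) (W : Q) {i j l : ℤ} (hij : i + 1 = j)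
    (hjl : j + 1 = l) (u : ((G.toTw k).tot.obj W).X i) :
    (((G.toTw k).tot.obj W).d j l).hom (ap p W i j hij u) +
      ap p W j l hjl ((((G.toTw k).tot.obj W).d i j).hom u) + ap p W j l hjl (ap p W i j hij u) = 0 := by
  have h := congrArg (fun f => ap f W i l (by omega) u) hp
  rw [ap_add, LinearMap.add_apply, ap_d (n := 1) (m := 2) rfl p W i l j j (by omega) hjl hij,
    ap_comp _ p p W i j l _ hij] at h
  simpa using h

/-- The identity of the underlying graded modules. -/
def tw (G : GradedObj Q) (W : Q) (m : ℤ) : ((G.toModule k).obj W).X m →ₗ[k] ((G.toTw k).tot.obj W).X m :=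
  (LinearMap.id : G.Elt k W m →ₗ[k] G.Elt k W m)

/-- The identity of the underlying graded modules. -/
def untw (G : GradedObj Q) (W : Q) (m : ℤ) : ((G.toTw k).tot.obj W).X m →ₗ[k] ((G.toModule k).obj W).X m :=
  (LinearMap.id : G.Elt k W m →ₗ[k] G.Elt k W m)

lemma tw_untw (G : GradedObj Q) (W : Q) (m : ℤ) (u : ((G.toTw k).tot.obj W).X m) :
    G.tw W m (G.untw W m u) = u := rfl

lemma tw_act (G : GradedObj Q) {V W : Q} (i j l : ℤ) (h : i + j = l) (u : ((G.toModule k).obj W).X i)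
    (f : (hom (k := k) V W).X j) :
    G.tw V l ((G.toModule k).act i j l h u f) = (G.toTw k).tot.act i j l h (G.tw W i u) f := rfl

lemma untw_act (G : GradedObj Q) {V W : Q} (i j l : ℤ) (h : i + j = l) (u : ((G.toTw k).tot.obj W).X i)
    (f : (hom (k := k) V W).X j) :
    G.untw V l ((G.toTw k).tot.act i j l h u f) = (G.toModule k).act i j l h (G.untw W i u) f := rfl

lemma tw_d (G : GradedObj Q) (W : Q) (i j : ℤ) (u : ((G.toModule k).obj W).X i) :
    G.tw W j ((((G.toModule k).obj W).d i j).hom u) = (((G.toTw k).tot.obj W).d i j).hom (G.tw W i u) := by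
  rw [toTw_d]
  rfl

lemma d_untw (G : GradedObj Q) (W : Q) (i j : ℤ) (u : ((G.toTw k).tot.obj W).X i) :
    (((G.toModule k).obj W).d i j).hom (G.untw W i u) = G.untw W j ((((G.toTw k).tot.obj W).d i j).hom u) := by
  rw [toTw_d]
  rfl

/-- A morphism between totalisations, as a morphism of the underlying graded modules. -/
def untwHom (G : GradedObj Q) (p : (hom (k := k) (G.toTw k).tot (G.toTw k).tot).X 1) :
    (hom (k := k) (G.toModule k) (G.toModule k)).X 1 :=
  homMk 1 (fun W m m' h => G.untw W m' ∘ₗ ap p W m m' h ∘ₗ G.tw W m)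
    (fun V W i j l i' l' h hi hl u f => by
      simp only [LinearMap.comp_apply]
      rw [tw_act, ap_act p i j l i' l' h hi hl, untw_act])

lemma ap_untwHom (G : GradedObj Q) (p : (hom (k := k) (G.toTw k).tot (G.toTw k).tot).X 1) (W : Q) (m m' : ℤ)
    (h : m + 1 = m') (u : ((G.toModule k).obj W).X m) :
    ap (G.untwHom p) W m m' h u = G.untw W m' (ap p W m m' h (G.tw W m u)) := by
  rw [untwHom, ap_homMk]
  rfl

lemma untwHom_mc (G : GradedObj Q) (p : (hom (k := k) (G.toTw k).tot (G.toTw k).tot).X 1)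
    (hp : ((hom _ _).d 1 2).hom p + comp 1 1 2 rfl p p = 0) :
    ((hom (k := k) (G.toModule k) (G.toModule k)).d 1 2).hom (G.untwHom p) +
      comp 1 1 2 rfl (G.untwHom p) (G.untwHom p) = 0 := by
  refine hom_ext' fun W i l h u => ?_
  have h2 := congrArg (G.untw W l)
    (ap_toTw_d p hp W (rfl : i + 1 = i + 1) (by omega : i + 1 + 1 = l) (G.tw W i u))
  rw [map_add, map_add, ← d_untw, ← tw_d, ← ap_untwHom, ← ap_untwHom, map_zero,
    ← G.tw_untw W (i + 1) (ap p W i (i + 1) rfl (G.tw W i u)), ← ap_untwHom, ← ap_untwHom] at h2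
  rw [ap_add, LinearMap.add_apply, ap_d (n := 1) (m := 2) rfl _ W i l (i + 1) (i + 1) h (by omega) rfl,
    ap_comp _ _ _ W i (i + 1) l h rfl, Int.negOnePow_one, Units.neg_smul, one_smul, sub_neg_eq_add, ap_zero]
  exact h2

lemma untwHom_oneSided (G : GradedObj Q) (p : (hom (k := k) (G.toTw k).tot (G.toTw k).tot).X 1)
    (h1 : ∀ a b : G.Idx, b.1 ≤ a.1 → (G.toTw k).coord b _ (a.1 + 1)
      (ap p _ a.1 (a.1 + 1) rfl ((G.toTw k).cell a)) = 0) :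
    OneSided (k := k) G G 1 fun W m m' h => ap (G.untwHom p) W m m' h := by
  intro a b hab W m m' h x
  have e : ap (G.untwHom p) W m m' h (DFinsupp.single a x) =
      G.untw W m' (ap p W m m' h ((G.toTw k).cellι a W m x)) := ap_untwHom G p W m m' h _
  refine (congrArg (fun z : G.Elt k W m' => z b) e).trans ?_
  change (G.toTw k).coord b W m' (ap p W m m' h ((G.toTw k).cellι a W m x)) = 0
  rw [TwMinus.ap_cellι, TwMinus.coord_act, h1 a b (by omega), map_zero]

/-- The twisted complex given by a strictly one-sided Maurer-Cartan element. -/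
abbrev twistBy (G : GradedObj Q) (p : (hom (k := k) (G.toTw k).tot (G.toTw k).tot).X 1)
    (hp : ((hom _ _).d 1 2).hom p + comp 1 1 2 rfl p p = 0)
    (h1 : ∀ a b : G.Idx, b.1 ≤ a.1 → (G.toTw k).coord b _ (a.1 + 1)
      (ap p _ a.1 (a.1 + 1) rfl ((G.toTw k).cell a)) = 0) : TwMinus k Q where
  gr := G
  q := G.untwHom p
  mc := G.untwHom_mc p hp
  oneSided := G.untwHom_oneSided p h1

/-- The identity of the underlying graded modules. -/
def toTwist (G : GradedObj Q) (p : (hom (k := k) (G.toTw k).tot (G.toTw k).tot).X 1) (hp) (h1) (W : Q) (m : ℤ) :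
    ((G.toTw k).tot.obj W).X m →ₗ[k] ((G.twistBy p hp h1).tot.obj W).X m :=
  (LinearMap.id : G.Elt k W m →ₗ[k] G.Elt k W m)

section

variable (G : GradedObj Q) (p : (hom (k := k) (G.toTw k).tot (G.toTw k).tot).X 1) (hp) (h1)

lemma toTwist_d (W : Q) (i j : ℤ) (h : i + 1 = j) (u : ((G.toTw k).tot.obj W).X i) :
    (((G.twistBy p hp h1).tot.obj W).d i j).hom (G.toTwist p hp h1 W i u) =
      G.toTwist p hp h1 W j ((((G.toTw k).tot.obj W).d i j).hom u + ap p W i j h u) := by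
  have h2 := (G.toModule k).twistCplx_d_apply (G.untwHom p) (G.untwHom_mc p hp) W i j h (G.untw W i u)
  refine h2.trans ?_
  have h3 := ap_untwHom G p W i j h (G.untw W i u)
  refine (congrArg₂ (fun a b : ((G.toModule k).obj W).X j => a + b) (G.d_untw W i j u) h3).trans ?_
  rw [tw_untw, ← map_add]
  rfl

lemma toTwist_act {V W : Q} (i j l : ℤ) (h : i + j = l) (u : ((G.toTw k).tot.obj W).X i)
    (f : (hom (k := k) V W).X j) : G.toTwist p hp h1 V l ((G.toTw k).tot.act i j l h u f) =
      (G.twistBy p hp h1).tot.act i j l h (G.toTwist p hp h1 W i u) f := rfl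

lemma toTwist_cell (a : G.Idx) : G.toTwist p hp h1 (G.ob a) a.1 ((G.toTw k).cell a) =
    (G.twistBy p hp h1).cell a := rfl

end

end GradedObj

namespace DGModule

variable {k : Type v} [CommRing k] {Q : Type v} [DGCategory k Q]

section Tower

variable {Y : TwMinus k Q} {N : ℤ} (ι : ℕ ≃ Y.gr.Idx) (hι : ∀ l, (ι l).1 = N - l)
  {T : ℕ → DGModule k Q} {x : ∀ l, ((T l).obj (Y.gr.ob (ι l))).X ((ι l).1 + 1)}
  (c : ∀ l, CellExt (T l) (T (l + 1)) (ι l).1 (x l))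
  (hT : ∀ W p (u : ((T 0).obj W).X p), u = 0)

/-- A compatible family of morphisms of degree `0`, not closed in general, from the steps of a tower of
cell attachments to the direct sum of the cells. -/
def IsTowerMap (θ : ∀ l, (hom (k := k) (T l) Y.tot).X 0) : Prop :=
  ∀ l, comp 0 0 0 (add_zero 0) (c l).inl.1 (θ (l + 1)) = θ l ∧
    ap (θ (l + 1)) _ (ι l).1 (ι l).1 (add_zero _) (c l).ε = Y.cell (ι l)

lemma exists_isTowerMap : ∃ θ, IsTowerMap ι c θ := by
  choose D hD₁ hD₂ using fun l => (c l).desc (L := Y.tot) (n := 0) (add_zero _)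
  exact ⟨fun l => Nat.rec 0 (fun l θ => D l θ (Y.cell (ι l))) l,
    fun l => ⟨hD₁ l _ _, hD₂ l _ _⟩⟩

variable {ι c} {θ : ∀ l, (hom (k := k) (T l) Y.tot).X 0} (hθ : IsTowerMap ι c θ)
include hθ

lemma IsTowerMap.ap_inl (l : ℕ) (W : Q) (p : ℤ) (u : ((T l).obj W).X p) :
    ap (θ (l + 1)) W p p (add_zero p) (ap (c l).inl.1 W p p (add_zero p) u) = ap (θ l) W p p (add_zero p) u := by
  rw [← ap_comp (add_zero 0) (c l).inl.1 (θ (l + 1)) W p p p (add_zero p) (add_zero p), (hθ l).1]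

lemma IsTowerMap.ap_act_ε (l : ℕ) (W : Q) {p : ℤ} (b : (hom (k := k) W (Y.gr.ob (ι l))).X (p - (ι l).1)) :
    ap (θ (l + 1)) W p p (add_zero p) ((T (l + 1)).act _ _ p (by omega) (c l).ε b) =
      Y.cellι (ι l) W p b := by
  rw [ap_act (θ (l + 1)) _ _ p (ι l).1 p (by omega) (add_zero _) (add_zero p), (hθ l).2]
  exact TwMinus.act_cell (ι l) W p b

include hι

lemma IsTowerMap.exists_eq (l : ℕ) (W : Q) (p : ℤ) (u : (Y.tot.obj W).X p)
    (hu : ∀ b : Y.gr.Idx, b.1 ≤ N - l → Y.coord b W p u = 0) :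
    ∃ z, ap (θ l) W p p (add_zero p) z = u := by
  induction l generalizing u with
  | zero =>
    refine ⟨0, (map_zero _).trans (TwMinus.coord_ext fun b => ?_)⟩
    obtain ⟨j, rfl⟩ := ι.surjective b
    rw [map_zero, hu _ (by rw [hι]; push_cast; omega)]
  | succ l ih =>
    obtain ⟨z, hz⟩ := ih (u - Y.cellι (ι l) W p (Y.coord (ι l) W p u)) fun b hb => by
      rw [map_sub]
      by_cases h : b = ι l
      · subst h
        exact (congrArg (_ - ·) (TwMinus.coord_cellι_self (ι l) W p _)).trans (sub_self _)
      · refine (congrArg (_ - ·) (TwMinus.coord_cellι_of_ne h W p _)).trans ?_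
        rw [sub_zero]
        refine hu b ?_
        obtain ⟨j, rfl⟩ := ι.surjective b
        have hj : j ≠ l := fun e => h (e ▸ rfl)
        rw [hι] at hb ⊢
        push_cast
        omega
    refine ⟨ap (c l).inl.1 W p p (add_zero p) z + (T (l + 1)).act _ _ p (by omega) (c l).ε
      (Y.coord (ι l) W p u), ?_⟩
    rw [map_add, hθ.ap_inl, hθ.ap_act_ε, hz, sub_add_cancel]

include hT

lemma IsTowerMap.coord_eq_zero (l : ℕ) (W : Q) (p : ℤ) (u : ((T l).obj W).X p) (b : Y.gr.Idx)
    (hb : b.1 ≤ N - l) : Y.coord b W p (ap (θ l) W p p (add_zero p) u) = 0 := by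
  induction l with
  | zero => rw [hT W p u, map_zero, map_zero]
  | succ l ih =>
    push_cast at hb
    obtain ⟨t, g, rfl⟩ := (c l).exists_eq W p (p - (ι l).1) (by omega) u
    rw [map_add, map_add, hθ.ap_inl, hθ.ap_act_ε, ih t (by omega), zero_add]
    refine TwMinus.coord_cellι_of_ne (fun h => ?_) W p g
    rw [h, hι] at hb
    omega

lemma IsTowerMap.injective (l : ℕ) (W : Q) (p : ℤ) : Function.Injective (ap (θ l) W p p (add_zero p)) := by
  induction l with
  | zero => exact fun u u' _ => (hT W p u).trans (hT W p u').symm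
  | succ l ih =>
    refine (injective_iff_map_eq_zero _).2 fun u hu => ?_
    obtain ⟨t, g, rfl⟩ := (c l).exists_eq W p (p - (ι l).1) (by omega) u
    rw [map_add, hθ.ap_inl, hθ.ap_act_ε] at hu
    have h1 := congrArg (Y.coord (ι l) W p) hu
    rw [map_add, hθ.coord_eq_zero hι hT l W p t _ (hι l).le, zero_add, map_zero] at h1
    obtain rfl : g = 0 := (TwMinus.coord_cellι_self (ι l) W p g).symm.trans h1
    rw [map_zero, add_zero] at hu
    rw [ih (hu.trans (map_zero _).symm), map_zero, map_zero, add_zero]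

end Tower

section ClosedTower

variable {Y : TwMinus k Q} {N : ℤ} {ι : ℕ ≃ Y.gr.Idx} (hι : ∀ l, (ι l).1 = N - l)
  {T : ℕ → DGModule k Q} {x : ∀ l, ((T l).obj (Y.gr.ob (ι l))).X ((ι l).1 + 1)}
  {c : ∀ l, CellExt (T l) (T (l + 1)) (ι l).1 (x l)}
  (hT : ∀ W p (u : ((T 0).obj W).X p), u = 0)
include hι hT

lemma IsTowerMap.coneExactAt {θ : ∀ l, Z0 k (T l) Y.tot} (hθ : IsTowerMap ι c fun l => (θ l).1)
    (hQ : ∀ (V W : Q) (i : ℤ), 0 < i → (hom (k := k) V W).ExactAt i) (l : ℕ) (n : ℤ) (hn : N - l < n)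
    (W : Q) : ConeExactAt (app (θ l) W) n := by
  intro m n' n'' hm hn' hn'' u z hu hz
  subst hn'
  have hd : ∀ p p' (t : ((T l).obj W).X p), ((Y.tot.obj W).d p p').hom (ap (θ l).1 W p p (add_zero p) t) =
      ap (θ l).1 W p' p' (add_zero p') ((((T l).obj W).d p p').hom t) := fun p p' t =>
    hom_d_apply (app (θ l) W) p p' t
  obtain ⟨y, hy⟩ := TwMinus.exists_coord_sub_d_eq_zero hQ hm (M := N - l + 1) (by omega) z fun b hb => by
    rw [← hz]
    exact hθ.coord_eq_zero hι hT l W (n + 1) u b (by omega)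
  obtain ⟨v, hv⟩ := hθ.exists_eq hι l W n _ fun b hb => hy b (by omega)
  refine ⟨v, y, hθ.injective hι hT l W (n + 1) ?_, ?_⟩
  · rw [← hd, hv, map_sub, d_d_apply, sub_zero, ← hz]
    rfl
  · exact sub_eq_iff_eq_add.1 hv.symm

lemma IsTowerMap.exists_quasiIso {θ : ∀ l, Z0 k (T l) Y.tot} (hθ : IsTowerMap ι c fun l => (θ l).1)
    (hQ : ∀ (V W : Q) (i : ℤ), 0 < i → (hom (k := k) V W).ExactAt i) {M : DGModule k Q}
    (w : ∀ l, Z0 k (T l) M) (hw : ∀ l, Z0.comp (c l).inl (w (l + 1)) = w l)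
    (hM : ∀ (l : ℕ) (n : ℤ) (W : Q), N - l < n → ConeExactAt (app (w l) W) n) :
    ∃ φ : Z0 k Y.tot M, ∀ W, QuasiIso (app φ W) := by
  obtain ⟨y, hy⟩ : ∃ y : ∀ a : Y.gr.Idx, (M.obj (Y.gr.ob a)).X (a.1 + 0), ∀ l, y (ι l) =
      ap (w (l + 1)).1 _ (ι l).1 ((ι l).1 + 0) rfl (c l).ε :=
    ⟨Equiv.piCongrLeft _ ι fun l => ap (w (l + 1)).1 _ (ι l).1 ((ι l).1 + 0) rfl (c l).ε,
      Equiv.piCongrLeft_apply_apply _ ι _⟩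
  obtain ⟨φ, hφ⟩ : ∃ φ : (hom (k := k) Y.tot M).X 0, ∀ l (q : ℤ) (h : (ι l).1 + 0 = q),
      ap φ _ (ι l).1 q h (Y.cell (ι l)) = ap (w (l + 1)).1 _ (ι l).1 q h (c l).ε :=
    ⟨TwMinus.totDesc 0 y, fun l q h => by subst h; rw [TwMinus.ap_totDesc_cell, hy]⟩
  have hwi : ∀ l W p (t : ((T l).obj W).X p), ap (w (l + 1)).1 W p p (add_zero p)
      (ap (c l).inl.1 W p p (add_zero p) t) = ap (w l).1 W p p (add_zero p) t := fun l W p t =>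
    (ap_comp (add_zero 0) (c l).inl.1 (w (l + 1)).1 W p p p (add_zero p) (add_zero p) t).symm.trans
      (congrArg (fun v : Z0 k (T l) M => ap v.1 W p p (add_zero p) t) (hw l))
  have hφθ : ∀ l W p (t : ((T l).obj W).X p), ap φ W p p (add_zero p)
      (ap (θ l).1 W p p (add_zero p) t) = ap (w l).1 W p p (add_zero p) t := by
    intro l
    induction l with
    | zero => intro W p t; rw [hT W p t, map_zero, map_zero, map_zero]
    | succ l ih =>
      intro W p u
      obtain ⟨t, g, rfl⟩ := (c l).exists_eq W p (p - (ι l).1) (by omega) u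
      rw [map_add, map_add, map_add, hθ.ap_inl, ih, hwi,
        ap_act (θ (l + 1)).1 _ _ p (ι l).1 p (by omega) (add_zero _) (add_zero p), (hθ l).2,
        ap_act φ _ _ p (ι l).1 p (by omega) (add_zero _) (add_zero p), hφ,
        ap_act (w (l + 1)).1 _ _ p (ι l).1 p (by omega) (add_zero _) (add_zero p)]
  have hcl : ((hom (k := k) Y.tot M).d 0 1).hom φ = 0 := by
    refine TwMinus.totHom_ext fun a => ?_
    obtain ⟨l, rfl⟩ := ι.surjective a
    have h1 : ((Y.tot.obj _).d (ι l).1 ((ι l).1 + 1)).hom (Y.cell (ι l)) =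
        ap (θ l).1 _ _ _ (add_zero _) (x l) := by
      rw [← (hθ l).2]
      refine (hom_d_apply (app (θ (l + 1)) _) _ _ _).trans ?_
      rw [(c l).d_ε]
      exact hθ.ap_inl l _ _ _
    have h2 : ((M.obj _).d (ι l).1 ((ι l).1 + 1)).hom (ap (w (l + 1)).1 _ _ _ (add_zero _) (c l).ε) =
        ap (w l).1 _ _ _ (add_zero _) (x l) := by
      refine (hom_d_apply (app (w (l + 1)) _) _ _ _).trans ?_
      rw [(c l).d_ε]
      exact hwi l _ _ _
    rw [ap_d (n := 0) (m := 1) rfl φ _ _ _ (ι l).1 ((ι l).1 + 1) rfl rfl rfl, hφ, h1, hφθ, h2]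
    simp
  refine ⟨⟨φ, hcl⟩, fun W => (quasiIso_iff_coneExactAt _).2 fun n => ?_⟩
  obtain ⟨l, hl⟩ : ∃ l : ℕ, N - l < n := ⟨(N - n + 1).toNat, by omega⟩
  have h1 : Z0.comp (θ l) ⟨φ, hcl⟩ = w l := Subtype.ext <| hom_ext' fun V p q h u => by
    obtain rfl : p = q := by omega
    exact (ap_comp (add_zero 0) (θ l).1 φ V p p p (add_zero p) (add_zero p) u).trans (hφθ l V p u)
  have h2 := hM l n W hl
  rw [← h1, app_comp] at h2
  exact h2.of_comp (hθ.coneExactAt hι hT hQ l (n + 1) (by omega) W)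

end ClosedTower

/-- The union of a tower of cell attachments is a twisted complex. -/
lemma exists_twistBy_isTowerMap {G : GradedObj Q} {N : ℤ} (ι : ℕ ≃ G.Idx) (hι : ∀ l, (ι l).1 = N - l)
    {T : ℕ → DGModule k Q} {x : ∀ l, ((T l).obj (G.ob (ι l))).X ((ι l).1 + 1)}
    (c : ∀ l, CellExt (T l) (T (l + 1)) (ι l).1 (x l)) (hT : ∀ W p (u : ((T 0).obj W).X p), u = 0)
    (hx : ∀ l, (((T l).obj _).d ((ι l).1 + 1) ((ι l).1 + 2)).hom (x l) = 0) :
    ∃ p hp h1, ∃ θ : ∀ l, Z0 k (T l) (G.twistBy p hp h1).tot,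
      IsTowerMap (Y := G.twistBy p hp h1) ι c fun l => (θ l).1 := by
  obtain ⟨θ, hθ⟩ := exists_isTowerMap (Y := G.toTw k) ι c
  obtain ⟨y, hy⟩ : ∃ y : ∀ a : G.Idx, ((G.toTw k).tot.obj (G.ob a)).X (a.1 + 1), ∀ l, y (ι l) =
      ap (θ l) _ ((ι l).1 + 1) ((ι l).1 + 1) (add_zero _) (x l) :=
    ⟨Equiv.piCongrLeft _ ι fun l => ap (θ l) _ ((ι l).1 + 1) ((ι l).1 + 1) (add_zero _) (x l),
      Equiv.piCongrLeft_apply_apply _ ι _⟩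
  obtain ⟨p, hp⟩ : ∃ p : (hom (k := k) (G.toTw k).tot (G.toTw k).tot).X 1, ∀ l,
      ap p _ (ι l).1 ((ι l).1 + 1) rfl ((G.toTw k).cell (ι l)) =
        ap (θ l) _ ((ι l).1 + 1) ((ι l).1 + 1) (add_zero _) (x l) :=
    ⟨TwMinus.totDesc (Y := G.toTw k) 1 y, fun l => (TwMinus.ap_totDesc_cell (Y := G.toTw k) y (ι l)).trans (hy l)⟩
  have key : ∀ l W m m' (h : m + 1 = m') (u : ((T l).obj W).X m),
      (((G.toTw k).tot.obj W).d m m').hom (ap (θ l) W m m (add_zero m) u) +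
        ap p W m m' h (ap (θ l) W m m (add_zero m) u) =
      ap (θ l) W m' m' (add_zero m') ((((T l).obj W).d m m').hom u) := by
    intro l
    induction l with
    | zero => intro W m m' h u; rw [hT W m u]; simp only [map_zero, add_zero]
    | succ l ih =>
      intro W m m' h u
      obtain ⟨t, g, rfl⟩ := (c l).exists_eq W m (m - (ι l).1) (by omega) u
      rw [map_add (((T (l + 1)).obj W).d m m').hom, (c l).d_inl,
        (c l).d_act_ε W (by omega) h (show m - (ι l).1 + 1 = m' - (ι l).1 by omega), map_add, map_add,
        map_add, hθ.ap_inl, ← add_assoc, map_add, map_add, hθ.ap_inl, ← ih W m m' h t, hθ.ap_inl,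
        DG.map_units_smul, ap_act (θ (l + 1)) _ _ m (ι l).1 m (by omega) (add_zero _) (add_zero m),
        (hθ l).2, ap_act (θ (l + 1)) _ _ m' (ι l).1 m' (by omega) (add_zero _) (add_zero m'),
        (hθ l).2, ap_act (θ l) _ _ m' ((ι l).1 + 1) m' (by omega) (add_zero _) (add_zero m'), ← hp,
        ap_act p _ _ m ((ι l).1 + 1) m' (by omega) rfl h,
        (G.toTw k).tot.leibniz _ _ m ((ι l).1 + 1) (m' - (ι l).1) m' (by omega) rfl (by omega) h,
        G.toTw_d_cell, map_zero, LinearMap.zero_apply, zero_add]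
      abel
  have hmc : ((hom (k := k) (G.toTw k).tot (G.toTw k).tot).d 1 2).hom p + comp 1 1 2 rfl p p = 0 := by
    refine TwMinus.totHom_ext (Y := G.toTw k) fun a => ?_
    obtain ⟨l, rfl⟩ := ι.surjective a
    have h1 := key l _ ((ι l).1 + 1) ((ι l).1 + 2) (by omega) (x l)
    rw [hx, map_zero, ← hp] at h1
    rw [ap_add, LinearMap.add_apply, TwMinus.ap_d_cell (n := 1) (m := 2) rfl, G.toTw_d_cell, map_zero, smul_zero,
      sub_zero, ap_comp _ p p _ _ ((ι l).1 + 1) _ _ rfl, h1]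
    simp
  have h1 : ∀ a b : G.Idx, b.1 ≤ a.1 → (G.toTw k).coord b _ (a.1 + 1)
      (ap p _ a.1 (a.1 + 1) rfl ((G.toTw k).cell a)) = 0 := by
    intro a b hab
    obtain ⟨l, rfl⟩ := ι.surjective a
    rw [hp]
    exact hθ.coord_eq_zero hι hT l _ _ _ b (hab.trans (hι l).le)
  obtain ⟨θ', hθ'⟩ : ∃ θ' : ∀ l, Z0 k (T l) (G.twistBy p hmc h1).tot, ∀ l W m (u : ((T l).obj W).X m),
      ap (θ' l).1 W m m (add_zero m) u = G.toTwist p hmc h1 W m (ap (θ l) W m m (add_zero m) u) := by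
    refine ⟨fun l => ofMaps (fun W m => G.toTwist p hmc h1 W m ∘ₗ ap (θ l) W m m (add_zero m))
      (fun W m m' u => ?_) (fun i j r h u f => ?_), fun l W m u => ap_ofMaps _ _ _ _ _ _⟩
    · by_cases h : m + 1 = m'
      · rw [LinearMap.comp_apply, G.toTwist_d p hmc h1 W m m' h, key l W m m' h]
        rfl
      · rw [HomologicalComplex.shape _ _ _ h, HomologicalComplex.shape _ _ _ h]
        exact (map_zero _).symm
    · rw [LinearMap.comp_apply, LinearMap.comp_apply, ← G.toTwist_act,
        ap_act (θ l) i j r i r h (add_zero i) (add_zero r)]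
  refine ⟨p, hmc, h1, θ', fun l => ⟨hom_ext' fun W m m' h u => ?_, ?_⟩⟩
  · obtain rfl : m = m' := by omega
    rw [ap_comp (add_zero 0) (c l).inl.1 (θ' (l + 1)).1 W m m m (add_zero m) (add_zero m), hθ', hθ',
      hθ.ap_inl]
  · rw [hθ', (hθ l).2]
    exact G.toTwist_cell p hmc h1 (ι l)

end DGModule

end DG

namespace DG

open DGCategory DGModule

namespace TStructure

variable {k : Type v} [CommRing k] {A : Type v} [DGCategory k A] {t : TStructure k A}
  {M : DGModule k t.DGProj}

lemma exists_cellExt (hA : IsPretriangulated k A) (hp : t.HasEnoughDerivedProjectives) (hM : M.IsHfp)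
    {T : DGModule k t.DGProj} (hT : Realizable T) (w : Z0 k T M) (e : ℤ)
    (hw : ∀ n, e < n → ∀ W, ConeExactAt (app w W) n) :
    ∃ (T' : DGModule k t.DGProj) (w' : Z0 k T' M) (S : t.DGProj) (x : (T.obj S).X (e + 1))
      (c : CellExt T T' e x), Realizable T' ∧ ((T.obj S).d (e + 1) (e + 2)).hom x = 0 ∧
        Z0.comp c.inl w' = w ∧ ∀ n, e ≤ n → ∀ W, ConeExactAt (app w' W) n := by
  have hQ := hasFiniteHulls_dgProj hA hp
  obtain ⟨g⟩ := nonempty_coneGenerator hQ w e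
    (fun W => ((coneExactAt_iff_homologyMap _ _).1 (hw (e + 1) (by omega) W)).2)
    (hQ.isCyclicallyPresented (isHfp_of_realizable hA hp hT _)) (hQ.isCyclicallyPresented (hM _))
    (hQ.isCyclicallyPresented (hM _))
  have hx : e + 1 = e + 1 ∧ ((hom (yon k g.S) T).d (e + 1) (e + 1 + 1)).hom (elt g.x) = 0 := by
    refine ⟨rfl, ?_⟩
    rw [d_elt rfl, show e + 1 + 1 = e + 2 by omega, g.d_x]
    exact elt_zero _
  have c := cellExt T e g.x hx
  obtain ⟨φ, h₁, h₂⟩ := c.desc (add_zero e) w.1 g.z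
  have hφ : ((hom (k := k) _ M).d 0 1).hom φ = 0 := by
    refine c.hom_ext ?_ ?_
    · have h3 := congrArg ((hom (k := k) T M).d 0 1).hom h₁
      rw [Z0_d, d_comp_of_left_closed (q := 0) (q' := 1) (r' := 1) (add_zero 0) rfl rfl c.inl.1 φ rfl c.inl.2] at h3
      rw [h3, map_zero]
    · have h3 : ap φ g.S (e + 1) (e + 1) (add_zero _) (ap c.inl.1 g.S (e + 1) (e + 1) (add_zero _) g.x) =
          ap w.1 g.S (e + 1) (e + 1) (add_zero _) g.x := by
        rw [← ap_comp (add_zero 0) c.inl.1 φ g.S _ _ _ (add_zero _) (add_zero _), h₁]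
      rw [ap_d (n := 0) (m := 1) rfl φ g.S e (e + 1) e (e + 1) rfl rfl rfl, h₂, c.d_ε, h3, g.d_z]
      simp
  have h₁' : Z0.comp c.inl (⟨φ, hφ⟩ : Z0 k _ M) = w := Subtype.ext h₁
  exact ⟨_, ⟨φ, hφ⟩, g.S, g.x, c, Realizable.attach hA (Realizable.yon g.S) hT (elt g.x) hx, g.d_x, h₁',
    g.coneExactAt (exactAt_dgProj hA hp) c ⟨φ, hφ⟩ h₁' h₂ hw⟩

lemma exists_zero (M : DGModule k t.DGProj) : ∃ (T : DGModule k t.DGProj) (_ : Z0 k T M),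
    ∀ W p (x : (T.obj W).X p), x = 0 :=
  ⟨subMod M (fun _ _ => ⊥) (fun W m m' x hx => by
      rw [(Submodule.mem_bot k).1 hx, map_zero]; exact Submodule.zero_mem _)
    (fun p q r h x hx f => by
      rw [(Submodule.mem_bot k).1 hx, map_zero]; exact Submodule.zero_mem _), 0, fun W p x =>
    Subtype.ext ((Submodule.mem_bot k).1 (Subtype.property x))⟩

/-- A dg-module with finitely presented bounded above cohomology has a resolution by a twisted complex. -/
lemma exists_resolution (hA : IsPretriangulated k A) (hp : t.HasEnoughDerivedProjectives) (hM : M.IsHfp)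
    {N : ℤ} (hN : M.StdLE N) :
    ∃ (Y : TwMinus k t.DGProj) (φ : Z0 k Y.tot M), ∀ W, QuasiIso (app φ W) := by
  obtain ⟨T₀, w₀, h₀⟩ := exists_zero M
  let St (l : ℕ) : Type _ := {σ : Σ T : DGModule k t.DGProj, Z0 k T M //
    Realizable σ.1 ∧ ∀ n, N - l < n → ∀ W, ConeExactAt (app σ.2 W) n}
  have step : ∀ l (σ : St l), ∃ (σ' : St (l + 1)) (S : t.DGProj) (x : (σ.1.1.obj S).X (N - l + 1))
      (c : CellExt σ.1.1 σ'.1.1 (N - l) x), ((σ.1.1.obj S).d (N - l + 1) (N - l + 2)).hom x = 0 ∧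
        Z0.comp c.inl σ'.1.2 = σ.1.2 := by
    rintro l ⟨⟨T, w⟩, hT, hw⟩
    obtain ⟨T', w', S, x, c, hT', hx, hc, hw'⟩ := exists_cellExt hA hp hM hT w (N - l) hw
    exact ⟨⟨⟨T', w'⟩, hT', fun n hn => hw' n (by push_cast at hn; omega)⟩, S, x, c, hx, hc⟩
  choose next S x c hx hc using step
  have hz : ∀ n W, (T₀.obj W).ExactAt n := fun n W =>
    (exactAt_iff (j := n - 1) (l := n + 1) (by omega) rfl).2 fun x _ => ⟨0, by rw [map_zero, h₀ _ _ x]⟩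
  let σ : ∀ l, St l := fun l => Nat.rec ⟨⟨T₀, w₀⟩, Realizable.of_zero hA h₀, fun n hn W =>
    coneExactAt_of_exactAt _ rfl (hz _ _) (hN n (by push_cast at hn; omega) W)⟩ (fun l s => next l s) l
  obtain ⟨O, hO⟩ : ∃ O : ℤ → t.DGProj, (fun l => S l (σ l)) = fun l : ℕ => O (N - l) :=
    ⟨fun i => S (N - i).toNat (σ (N - i).toNat), funext fun l => by
      have h : (N - (N - (l : ℤ))).toNat = l := by omega
      exact congrArg (fun m => S m (σ m)) h.symm⟩
  obtain ⟨x', c', hx', hc'⟩ : ∃ (x' : ∀ l : ℕ, ((σ l).1.1.obj (O (N - l))).X (N - l + 1))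
      (c' : ∀ l, CellExt (σ l).1.1 (σ (l + 1)).1.1 (N - l) (x' l)),
      (∀ l, (((σ l).1.1.obj (O (N - l))).d (N - l + 1) (N - l + 2)).hom (x' l) = 0) ∧
        ∀ l, Z0.comp (c' l).inl (σ (l + 1)).1.2 = (σ l).1.2 := by
    have : ∀ S' : ℕ → t.DGProj, (fun l => S l (σ l)) = S' →
      ∃ (x' : ∀ l : ℕ, ((σ l).1.1.obj (S' l)).X (N - l + 1))
        (c' : ∀ l, CellExt (σ l).1.1 (σ (l + 1)).1.1 (N - l) (x' l)),
        (∀ l, (((σ l).1.1.obj (S' l)).d (N - l + 1) (N - l + 2)).hom (x' l) = 0) ∧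
          ∀ l, Z0.comp (c' l).inl (σ (l + 1)).1.2 = (σ l).1.2 := by
      rintro _ rfl
      exact ⟨fun l => x l (σ l), fun l => c l (σ l), fun l => hx l (σ l), fun l => hc l (σ l)⟩
    exact this _ hO
  let G : GradedObj t.DGProj := ⟨fun i => if i ≤ N then 1 else 0, fun i _ => O i, N, fun i hi =>
    if_neg (not_le.2 hi)⟩
  have hG : ∀ l : ℕ, 0 < G.n (N - l) := fun l => by
    change 0 < if N - (l : ℤ) ≤ N then 1 else 0
    rw [if_pos (by omega)]
    exact one_pos
  let ι : ℕ ≃ G.Idx := Equiv.ofBijective (fun l => ⟨N - l, 0, hG l⟩) (by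
    refine ⟨fun l l' h => ?_, fun ⟨i, j⟩ => ?_⟩
    · have := congrArg Sigma.fst h
      dsimp only at this
      omega
    · have hi : i ≤ N := by
        by_contra h
        have : G.n i = 0 := if_neg h
        exact absurd j.2 (by omega)
      obtain ⟨l, rfl⟩ : ∃ l : ℕ, i = N - l := ⟨(N - i).toNat, by omega⟩
      have h1 : G.n (N - l) = 1 := if_pos hi
      exact ⟨l, Sigma.ext rfl (heq_of_eq (Fin.ext (by have := j.2; dsimp only; omega)))⟩)
  obtain ⟨p, hp', h1, θ, hθ⟩ := exists_twistBy_isTowerMap (G := G) (N := N) ι (fun _ => rfl)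
    (T := fun l => (σ l).1.1) (x := x') c' h₀ hx'
  exact ⟨_, hθ.exists_quasiIso (fun _ => rfl) h₀ (exactAt_dgProj hA hp) (fun l => (σ l).1.2) hc'
    fun l n W h => (σ l).2.2 n h W⟩

end TStructure

end DG

namespace DG

open DGCategory DGModule

namespace DGModule

variable {k : Type v} [CommRing k] {A : Type v} [DGCategory k A]

lemma IsHProjective.isIso_cls {M N : DGModule k A} (hM : M.IsHProjective) (hN : N.IsHProjective)
    (w : Z0 k M N) (hw : ∀ W, QuasiIso (app w W)) : IsIso (H0.cls w) := by
  obtain ⟨g, h₁, h₂⟩ := isIso_cls_of_quasiIso_postcomp (A := {M : DGModule k A // M.IsHProjective})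
    (X := ⟨M, hM⟩) (Y := ⟨N, hN⟩) w fun V => V.2.quasiIso_postcomp w hw
  exact ⟨g, h₁, h₂⟩

lemma quasiIso_postcomp_of_precomp {T T' M N : DGModule k A} (φ : Z0 k T T')
    (hφ : ∀ L, QuasiIso (precomp φ L)) (x : Z0 k M N) (hx : QuasiIso (postcomp T x)) :
    QuasiIso (postcomp T' x) := by
  have h1 := hφ M
  have h2 := hφ N
  have h : postcomp T' x ≫ precomp φ N = precomp φ M ≫ postcomp T x := by
    ext n f
    exact (DGCategory.assoc 0 n 0 n n n (zero_add n) (add_zero n) (add_zero n) (zero_add n) φ.1 f x.1).symm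
  have : QuasiIso (postcomp T' x ≫ precomp φ N) := h ▸ inferInstance
  exact quasiIso_of_comp_right (postcomp T' x) (precomp φ N)

lemma isHProjective_yon (X : A) : (yon k X).IsHProjective := by
  intro N hN f
  obtain ⟨w, rfl⟩ := cls_surjective f
  have := quasiIso_eltHom (M := N) X
  exact (cls_eq_zero_iff _).2 ((exactAt_iff (i := 0) (j := -1) (l := 1) rfl rfl).1
    ((exactAt_iff_of_quasiIsoAt (eltHom N X) 0).1 (hN X 0)) w.1 w.2)

variable {P : A → Prop}

lemma Realizable.of_quasiIso {T' T : DGModule k (Subtype P)} (hT : Realizable T') (π : Z0 k T' T)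
    [IsIso (H0.cls π)] (h : ∀ W, QuasiIso (app π W)) : Realizable T := by
  obtain ⟨X, w', hw', hq⟩ := hT
  obtain ⟨w, hw, hcls⟩ := hw'.of_precomp π (fun L => quasiIso_precomp π L)
  refine ⟨X, w, hw, fun W => ?_⟩
  have h1 := quasiIso_app_of_cls_eq hcls.symm W (hq W)
  have h2 := h W
  rw [app_comp] at h1
  exact quasiIso_of_comp_left (app π W) (app w W)

end DGModule

namespace TStructure

variable {k : Type v} [CommRing k] {A : Type v} [DGCategory k A] {t : TStructure k A}

/-- A morphism of `A` that restricts to a quasi-isomorphism on the derived projectives is an isomorphism in `H⁰(A)`. -/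
lemma isIso_cls_of_quasiIso_dgProj (hA : IsPretriangulated k A) (hnd : t.NonDegenerate)
    (hrb : t.RightBounded) (hp : t.HasEnoughDerivedProjectives) {X Y : A} (v : Z0 k X Y)
    (hv : ∀ W, t.dgProj W → QuasiIso (postcomp W v)) : IsIso (H0.cls v) := by
  obtain ⟨Z, g, hg⟩ := hA.exists_cone v
  have hZ := isZero_of_acyclic hA hp hnd (hrb.minus Z) fun W hW n =>
    (hg.exactAt_right W n).2 ((quasiIso_iff_coneExactAt _).1 (hv W hW) n)
  exact isIso_cls_of_quasiIso_postcomp v fun W => (quasiIso_iff_coneExactAt _).2 fun n =>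
    (hg.exactAt_right W n).1 (acyclic_of_isZero_right hZ W n)

lemma corep_of_quasiIso (hA : IsPretriangulated k A) (hnd : t.NonDegenerate)
    (hrb : t.RightBounded) (hp : t.HasEnoughDerivedProjectives) {T : DGModule k t.DGProj}
    (hT : Realizable T) {X : A} (φ : Z0 k T (res t.dgProj (yon k X))) (hφ : ∀ W, QuasiIso (app φ W))
    (Z : A) : QuasiIso (corepHom φ Z) := by
  obtain ⟨X', w, hw, hq⟩ := hT
  obtain ⟨v, s, hv, hs⟩ := exists_of_quasiIso _ ((quasiIso_corepHom_iff w X).2 (hw X)) (i := 0) (j := -1)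
    (l := 1) rfl rfl φ.1 φ.2
  obtain ⟨v, rfl⟩ : ∃ v' : Z0 k X' X, v = v'.1 := ⟨⟨v, hv⟩, rfl⟩
  have hcls : H0.cls φ = H0.cls (Z0.comp w (resZ0 ((yonedaDG k A).mapZ0 v))) := by
    refine (cls_eq_iff _ _).2 ⟨s, ?_⟩
    rw [hs]
    exact (add_sub_cancel_left _ _).symm
  have hiso : IsIso (H0.cls v) := isIso_cls_of_quasiIso_dgProj hA hnd hrb hp v fun W hW => by
    have h1 := quasiIso_app_of_cls_eq hcls ⟨W, hW⟩ (hφ _)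
    rw [app_comp] at h1
    have h2 := hq ⟨W, hW⟩
    exact quasiIso_of_comp_left (app w ⟨W, hW⟩) (app (resZ0 (P := t.dgProj) ((yonedaDG k A).mapZ0 v)) ⟨W, hW⟩)
  have h1 : corepHom (Z0.comp w (resZ0 ((yonedaDG k A).mapZ0 v))) Z = precomp v Z ≫ corepHom w Z := by
    ext n z
    rw [corepHom_apply, HomologicalComplex.comp_f, ModuleCat.hom_comp, LinearMap.comp_apply, corepHom_apply,
      precomp_apply, (yonedaDG k A).map_comp, resMap_comp]
    exact DGCategory.assoc 0 0 n 0 n n (by omega) (by omega) (by omega) (by omega) _ _ _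
  have h2 := quasiIso_precomp v Z
  have h3 := (quasiIso_corepHom_iff w Z).2 (hw Z)
  have h4 : QuasiIso (precomp v Z ≫ corepHom w Z) := inferInstance
  rw [← h1, quasiIso_iff_coneExactAt] at h4
  exact (quasiIso_iff_coneExactAt _).2 fun n => coneExactAt_corepHom_of_cls_eq hcls.symm (h4 n)

lemma exists_resolution_res (hA : IsPretriangulated k A) (hrb : t.RightBounded)
    (hp : t.HasEnoughDerivedProjectives) (X : A) :
    ∃ (Y : TwMinus k t.DGProj) (φ : Z0 k Y.tot (res t.dgProj (yon k X))), ∀ W, QuasiIso (app φ W) := by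
  obtain ⟨N, hN⟩ := hrb.minus X
  exact exists_resolution hA hp (isHfp_res hA hp X) (N := N) fun i hi W =>
    dgProj.exactAt_of_le hA hp W.2 hN hi

lemma isHProjMinusHfp_tot (hA : IsPretriangulated k A) (hrb : t.RightBounded)
    (hp : t.HasEnoughDerivedProjectives) (hc : t.ClosedUnderCountableCoproducts)
    (Y : TwMinus k t.DGProj) : IsHProjMinusHfp Y.tot where
  hproj := TwMinus.isHProjective_tot
  hfp := isHfp_of_realizable hA hp (realizable_tot hA hrb hp hc Y)
  bounded := by
    obtain ⟨N, hN⟩ := Y.gr.bounded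
    exact ⟨N, TwMinus.stdLE_tot (exactAt_dgProj hA hp) hN⟩

lemma realizable_of_isHProjMinusHfp (hA : IsPretriangulated k A) (hrb : t.RightBounded)
    (hp : t.HasEnoughDerivedProjectives) (hc : t.ClosedUnderCountableCoproducts)
    {M : DGModule k t.DGProj} (hM : IsHProjMinusHfp M) : Realizable M := by
  obtain ⟨N, hN⟩ := hM.bounded
  obtain ⟨Y, φ, hφ⟩ := exists_resolution hA hp hM.hfp hN
  have := TwMinus.isHProjective_tot.isIso_cls hM.hproj φ hφ
  exact (realizable_tot hA hrb hp hc Y).of_quasiIso φ hφ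

/-- Quasi-isomorphisms are detected by the totalisations of twisted complexes. -/
lemma quasiIso_app_of_tot (hA : IsPretriangulated k A) (hp : t.HasEnoughDerivedProjectives)
    {M N : DGModule k t.DGProj} (x : Z0 k M N)
    (hx : ∀ Y : TwMinus k t.DGProj, QuasiIso (postcomp Y.tot x)) (W : t.DGProj) : QuasiIso (app x W) := by
  obtain ⟨Y, φ, hφ⟩ := exists_resolution hA hp (isHfp_of_realizable hA hp (Realizable.yon W)) (N := 0)
    fun i hi V => exactAt_dgProj hA hp V W i hi
  have := TwMinus.isHProjective_tot.isIso_cls (isHProjective_yon W) φ hφ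
  exact (quasiIso_app_iff x W).2 (quasiIso_postcomp_of_precomp φ (fun L => quasiIso_precomp φ L) x (hx Y))

section Bimodule

variable {B : Type u₁} [DGCategory k B] (F : DGFunctor k B (DGModule k t.DGProj))

lemma isQuasiFunctor_ofFunctors (hA : IsPretriangulated k A) (hrb : t.RightBounded)
    (hp : t.HasEnoughDerivedProjectives) (hF : ∀ b b', QuasiIso (F.map b b'))
    (hF' : ∀ b, (F.obj b).IsHProjective) (hY : ∀ Y : TwMinus k t.DGProj, ∃ b, F.obj b = Y.tot) :
    (DGBimodule.ofFunctors t.comparison F).IsQuasiFunctor := by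
  intro X
  obtain ⟨Y, φ, hφ⟩ := exists_resolution_res hA hrb hp X.1
  obtain ⟨b, hb⟩ := hY Y
  obtain ⟨φ, hφ⟩ : ∃ φ : Z0 k (F.obj b) (res t.dgProj (yon k X.1)), ∀ W, QuasiIso (app φ W) := by
    rw [hb]
    exact ⟨φ, hφ⟩
  refine ⟨b, ⟨φ.1, φ.2, fun b' => ?_⟩⟩
  have h1 := hF b' b
  have h2 := (hF' b').quasiIso_postcomp φ hφ
  exact (inferInstance : QuasiIso (F.map b' b ≫ postcomp (F.obj b') φ))

lemma quasiIso_app_of_representation (hA : IsPretriangulated k A) (hp : t.HasEnoughDerivedProjectives)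
    (hF : ∀ b b', QuasiIso (F.map b b')) (hY : ∀ Y : TwMinus k t.DGProj, ∃ b, F.obj b = Y.tot)
    {b : B} {X : t.Minus} (ρ : (DGBimodule.ofFunctors t.comparison F).Representation b X)
    (φ : Z0 k (F.obj b) (res t.dgProj (yon k X.1))) (hφ : φ.1 = ρ.x) (W : t.DGProj) :
    QuasiIso (app φ W) := by
  refine quasiIso_app_of_tot hA hp φ (fun Y => ?_) W
  obtain ⟨b', hb'⟩ := hY Y
  rw [← hb']
  have h1 := hF b' b
  have h2 := ρ.quasiIso b'
  obtain ⟨φ, hcl⟩ := φ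
  obtain rfl : φ = ρ.x := hφ
  exact (quasiIso_iff_comp_left (F.map b' b) (postcomp (F.obj b') ⟨ρ.x, hcl⟩)).1 h2

lemma inducesIsoInHqe_ofFunctors (hA : IsPretriangulated k A) (hnd : t.NonDegenerate) (hrb : t.RightBounded)
    (hp : t.HasEnoughDerivedProjectives) (hF : ∀ b b', QuasiIso (F.map b b'))
    (hF' : ∀ b, (F.obj b).IsHProjective) (hr : ∀ b, Realizable (F.obj b))
    (hY : ∀ Y : TwMinus k t.DGProj, ∃ b, F.obj b = Y.tot) :
    (DGBimodule.ofFunctors t.comparison F).InducesIsoInHqe := by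
  refine DGBimodule.inducesIsoInHqe _ (DGBimodule.Graph.fst_isQuasiEquivalence _
    (isQuasiFunctor_ofFunctors F hA hrb hp hF hF' hY)) (DGBimodule.Graph.snd_isQuasiEquivalence _
      (fun E X => ?_) fun b => ?_)
  · obtain ⟨φ, hφ⟩ : ∃ φ : Z0 k (F.obj E.b) (res t.dgProj (yon k E.a.1)), φ.1 = E.rep.x :=
      ⟨⟨E.rep.x, E.rep.closed⟩, rfl⟩
    have h := corep_of_quasiIso hA hnd hrb hp (hr E.b) φ
      (quasiIso_app_of_representation F hA hp hF hY E.rep φ hφ) X.1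
    obtain ⟨φ, hcl⟩ := φ
    obtain rfl : φ = E.rep.x := hφ
    exact h
  · obtain ⟨X, w, -, hw⟩ := hr b
    refine ⟨⟨⟨X, hrb.minus X⟩, b, w.1, w.2, fun b' => ?_⟩, ⟨Iso.refl _⟩⟩
    have h1 := hF b' b
    have h2 := (hF' b').quasiIso_postcomp w hw
    exact (inferInstance : QuasiIso (F.map b' b ≫ postcomp (F.obj b') w))

end Bimodule

lemma quasiIso_incl_map {B : Type u₁} [DGCategory k B] (P : B → Prop) (M N : Subtype P) :
    QuasiIso ((incl k P).map M N) :=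
  (inferInstance : QuasiIso (𝟙 (hom (k := k) M.1 N.1)))

lemma isTExact_comparisonBimodule (hA : IsPretriangulated k A) (hp : t.HasEnoughDerivedProjectives) :
    t.IsTExact (t.comparisonBimodule IsHProjective) := by
  intro n X M ⟨ρ⟩
  obtain ⟨φ, hφ⟩ : ∃ φ : Z0 k M.1 (res t.dgProj (yon k X.1)), φ.1 = ρ.x := ⟨⟨ρ.x, ρ.closed⟩, rfl⟩
  have hq : ∀ W, QuasiIso (app φ W) := quasiIso_app_of_representation (incl k IsHProjective) hA hp
    (quasiIso_incl_map _) (fun Y => ⟨⟨Y.tot, TwMinus.isHProjective_tot⟩, rfl⟩) ρ φ hφ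
  refine ⟨fun hX i hi W => ?_, fun hX i hi W => ?_⟩
  · have := hq W
    exact (exactAt_iff_of_quasiIsoAt (app φ W) i).2 (dgProj.exactAt_of_le hA hp W.2 hX hi)
  · have := hq W
    exact (exactAt_iff_of_quasiIsoAt (app φ W) i).2 (dgProj.exactAt_of_ge hA hp W.2 hX hi)

lemma isQuasiEquivalence_tot (hA : IsPretriangulated k A) (hp : t.HasEnoughDerivedProjectives)
    (h : ∀ Y : TwMinus k t.DGProj, IsHProjMinusHfp ((TwMinus.Tot k t.DGProj).obj Y)) :
    ((TwMinus.Tot k t.DGProj).codRestrict IsHProjMinusHfp h).IsQuasiEquivalence where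
  quasiIso := TwMinus.quasiIso_tot_map (exactAt_dgProj hA hp)
  essSurj M := by
    obtain ⟨N, hN⟩ := M.2.bounded
    obtain ⟨Y, φ, hφ⟩ := exists_resolution hA hp M.2.hfp hN
    have := isIso_cls_of_quasiIso_postcomp (A := Subtype (IsHProjMinusHfp (k := k) (Q := t.DGProj)))
      (X := ⟨Y.tot, h Y⟩) (Y := M) φ fun V => V.2.hproj.quasiIso_postcomp φ hφ
    exact ⟨Y, ⟨@asIso _ _ _ _ _ this⟩⟩

lemma isQuasiFunctor_comparisonBimoduleTw (hA : IsPretriangulated k A) (hrb : t.RightBounded)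
    (hp : t.HasEnoughDerivedProjectives) : t.comparisonBimoduleTw.IsQuasiFunctor :=
  isQuasiFunctor_ofFunctors (TwMinus.Tot k t.DGProj) hA hrb hp
    (TwMinus.quasiIso_tot_map (exactAt_dgProj hA hp)) (fun Y => TwMinus.isHProjective_tot (Y := Y))
    fun Y => ⟨Y, rfl⟩

lemma inducesIsoInHqe_comparisonBimoduleTw (hA : IsPretriangulated k A) (hnd : t.NonDegenerate)
    (hrb : t.RightBounded) (hp : t.HasEnoughDerivedProjectives) (hc : t.ClosedUnderCountableCoproducts) :
    t.comparisonBimoduleTw.InducesIsoInHqe :=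
  inducesIsoInHqe_ofFunctors (TwMinus.Tot k t.DGProj) hA hnd hrb hp
    (TwMinus.quasiIso_tot_map (exactAt_dgProj hA hp)) (fun Y => TwMinus.isHProjective_tot (Y := Y))
    (realizable_tot hA hrb hp hc) fun Y => ⟨Y, rfl⟩

end TStructure

end DG

end

theorem mainTheorem2 {k : Type u} [Field k] {A : Type u} [DG.DGCategory k A]
    (hA : DG.IsPretriangulated k A) (t : DG.TStructure k A) (hnd : t.NonDegenerate)
    (hrb : t.RightBounded) (hproj : t.HasEnoughDerivedProjectives)
    (hcop : t.ClosedUnderCountableCoproducts) :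
    (t.comparisonBimodule DG.DGModule.IsHProjective).IsQuasiFunctor ∧
    t.IsTExact (t.comparisonBimodule DG.DGModule.IsHProjective) ∧
    (t.comparisonBimodule DG.DGModule.IsHProjMinusHfp).IsQuasiFunctor ∧
    (t.comparisonBimodule DG.DGModule.IsHProjMinusHfp).InducesIsoInHqe ∧
    (∃ h : ∀ Y : DG.TwMinus k t.DGProj,
        DG.DGModule.IsHProjMinusHfp ((DG.TwMinus.Tot k t.DGProj).obj Y),
      ((DG.TwMinus.Tot k t.DGProj).codRestrict DG.DGModule.IsHProjMinusHfp h).IsQuasiEquivalence) ∧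
    t.comparisonBimoduleTw.IsQuasiFunctor ∧
    t.comparisonBimoduleTw.InducesIsoInHqe := by
  have htot := DG.TStructure.isHProjMinusHfp_tot hA hrb hproj hcop
  refine ⟨?_, DG.TStructure.isTExact_comparisonBimodule hA hproj, ?_, ?_,
    ⟨htot, DG.TStructure.isQuasiEquivalence_tot hA hproj htot⟩,
    DG.TStructure.isQuasiFunctor_comparisonBimoduleTw hA hrb hproj,
    DG.TStructure.inducesIsoInHqe_comparisonBimoduleTw hA hnd hrb hproj hcop⟩
  · exact DG.TStructure.isQuasiFunctor_ofFunctors _ hA hrb hproj (DG.TStructure.quasiIso_incl_map _)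
      (fun M => M.2) fun Y => ⟨⟨Y.tot, (htot Y).hproj⟩, rfl⟩
  · exact DG.TStructure.isQuasiFunctor_ofFunctors _ hA hrb hproj (DG.TStructure.quasiIso_incl_map _)
      (fun M => M.2.hproj) fun Y => ⟨⟨Y.tot, htot Y⟩, rfl⟩
  · exact DG.TStructure.inducesIsoInHqe_ofFunctors _ hA hnd hrb hproj (DG.TStructure.quasiIso_incl_map _)
      (fun M => M.2.hproj)
      (fun M => DG.TStructure.realizable_of_isHProjMinusHfp hA hrb hproj hcop M.2)
      fun Y => ⟨⟨Y.tot, htot Y⟩, rfl⟩
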